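/- Let $\Lambda=(\mathbb R/\mathbb Z)^2$ with Lebesgue measure $dx$, identified with $[-1/2,1/2)^2$, let $\kappa>0$, and for $k\in\mathbb Z^2$ put $\lambda_k=\kappa+2\pi^2|k|^2$, $u_k(x)=e^{2\pi i k\cdot x}$. Let $(X_k)_{k\in\mathbb Z^2}$ be independent standard complex Gaussian random variables (law $\pi^{-1}e^{-|z|^2}dz$ on $\mathbb C$) on a probability space $(\Omega,\mathbb P)$, with expectation $\mathbb E$. A cutoff is a function $\vartheta:\mathbb R^2\to[0,\infty)$ of rapid decay ($\sup_\xi|\xi|^n\vartheta(\xi)<\infty$ for all $n\in\mathbb N$), with $\vartheta(0)=1$ and continuous at $0$. For a cutoff $\vartheta$ and $0<N<\infty$ let $$\phi_N(x)=\sum_{k\in\mathbb Z^2}\frac{X_k}{\sqrt{\lambda_k}}\sqrt{\vartheta(k/N)}\,u_k(x),$$ $$:|\phi_N(x)|^2:\;=|\phi_N(x)|^2-\mathbb E|\phi_N(x)|^2,\qquad :|\phi_N(x)|^4:\;=|\phi_N(x)|^4-4\,\mathbb E[|\phi_N(x)|^2]\,|\phi_N(x)|^2+2\,\mathbb E[|\phi_N(x)|^2]^2,$$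 and, for a centred complex Gaussian vector $(\xi_i)_{i\in I}$, let $:\prod_{i\in I}\xi_i:\;=\sum_{\Pi}\prod_{i\notin\bigcup\Pi}\xi_i\prod_{\{i,j\}\in\Pi}(-\mathbb E[\xi_i\xi_j])$, the sum being over all sets $\Pi$ of disjoint unordered pairs of elements of $I$. Let $v:\mathbb R^2\to\mathbb R$ be even, smooth, compactly supported, with nonnegative Fourier transform and $\int v=1$. For $\epsilon>0$ let $v^\epsilon(x)=\sum_{n\in\mathbb Z^2}\epsilon^{-2}v((x-n)/\epsilon)$ on $\Lambda$. Let $G=\sum_{k}\lambda_k^{-1}u_k\in L^2(\Lambda)$ be the Green function of $\kappa-\Delta/2$ on $\Lambda$, and let $\tau^\epsilon=\int_\Lambda v^\epsilon G\,dx$ and $E^\epsilon=\frac12\int_\Lambda v^\epsilon G^2\,dx$. Define $$V_N=\frac12\int_\Lambda:|\phi_N(x)|^4:\,dx,$$ $$W^\epsilon_N=\frac12\int_\Lambda\int_\Lambda:|\phi_N(x)|^2:\,v^\epsilon(x-\tilde x)\,:|\phi_N(\tilde x)|^2:\,dx\,d\tilde x-\tau^\epsilon\int_\Lambda:|\phi_N(x)|^2:\,dx-E^\epsilon.$$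 Then the following holds. (a) There are real random variables $V$ and $W^\epsilon$ ($\epsilon>0$) in $L^2(\mathbb P)$ such that, for every cutoff, $V_N\to V$ and $W_N^\epsilon\to W^\epsilon$ in $L^2(\mathbb P)$ as $N\to\infty$. The random variables $e^{-V}$ and $e^{-W^\epsilon}$, $\epsilon>0$, are integrable. Write $\zeta^U=\mathbb E[e^{-U}]$ for $U=V$ and $U=W^\epsilon$. (b) $\zeta^{W^\epsilon}\to\zeta^V$ as $\epsilon\to0$. (c) Let $p\ge1$ be an integer. For $U=V$ and for $U=W^\epsilon$ with any $\epsilon>0$, and for every cutoff, the regularized Wick-ordered correlation functions $$(\widehat\gamma^U_{N,p})_{\mathbf x,\tilde{\mathbf x}}=\frac1{\zeta^U}\,\mathbb E\Big[e^{-U}:\bar\phi_N(\tilde x_1)\cdots\bar\phi_N(\tilde x_p)\,\phi_N(x_1)\cdots\phi_N(x_p):\Big],\qquad\mathbf x,\tilde{\mathbf x}\in\Lambda^p,$$ are well defined (the random variable in the expectation is integrable), and as $N\to\infty$ they converge uniformly on $\Lambda^p\times\Lambda^p$ to a continuous function $\widehat\gamma^U_p$, which does not depend on the cutoff. Moreover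 $$\sup_{\mathbf x,\tilde{\mathbf x}\in\Lambda^p}\big|(\widehat\gamma_p^{W^\epsilon})_{\mathbf x,\tilde{\mathbf x}}-(\widehat\gamma_p^{V})_{\mathbf x,\tilde{\mathbf x}}\big|\to0\qquad\text{as }\epsilon\to0.$$ -/

import Mathlib

open MeasureTheory ProbabilityTheory Filter Topology
open scoped ENNReal FourierTransform

noncomputable section

namespace Phi42

/-! ### The torus and the free field -/

/-- The two-dimensional unit torus. -/
abbrev Torus : Type := UnitAddTorus (Fin 2)

/-- Lebesgue measure on the unit torus (total mass one). -/
abbrev torusMeasure : Measure Torus :=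
  Measure.pi fun _ : Fin 2 => (AddCircle.haarAddCircle : Measure UnitAddCircle)

/-- The representative in `[-1/2, 1/2)^2` of a point of the torus. -/
def rep (x : Torus) : EuclideanSpace ℝ (Fin 2) :=
  WithLp.toLp 2 fun i => (AddCircle.equivIco (1 : ℝ) (-1 / 2) (x i) : ℝ)

/-- An integer vector regarded as an element of the Euclidean plane. -/
def latticePoint (k : Fin 2 → ℤ) : EuclideanSpace ℝ (Fin 2) :=
  WithLp.toLp 2 fun i => (k i : ℝ)

/-- The eigenvalue of `κ - Δ/2` on the torus with eigenfunction `exp (2 π i k · x)`, which is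
`UnitAddTorus.mFourier k`. -/
def eigenvalue (κ : ℝ) (k : Fin 2 → ℤ) : ℝ :=
  κ + 2 * Real.pi ^ 2 * ∑ i, (k i : ℝ) ^ 2

/-- The law of a standard complex Gaussian random variable. -/
def stdComplexGaussian : Measure ℂ :=
  volume.withDensity fun z => ENNReal.ofReal (Real.pi⁻¹ * Real.exp (-‖z‖ ^ 2))

/-- The admissible Fourier cutoff functions: nonnegative, of rapid decay, equal to one at the
origin and continuous there. -/
structure IsCutoff (ϑ : EuclideanSpace ℝ (Fin 2) → ℝ) : Prop where
  nonneg : ∀ ξ, 0 ≤ ϑ ξ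
  map_zero : ϑ 0 = 1
  continuousAt_zero : ContinuousAt ϑ 0
  rapid_decay : ∀ n : ℕ, ∃ C : ℝ, ∀ ξ, ‖ξ‖ ^ n * ϑ ξ ≤ C

/-- The regularized free field `φ_N`. -/
def field {Ω : Type*} (κ : ℝ) (X : (Fin 2 → ℤ) → Ω → ℂ) (ϑ : EuclideanSpace ℝ (Fin 2) → ℝ)
    (N : ℝ) (x : Torus) (ω : Ω) : ℂ :=
  ∑' k : Fin 2 → ℤ, X k ω / (√(eigenvalue κ k) : ℂ) * (√(ϑ (N⁻¹ • latticePoint k)) : ℂ) *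
    UnitAddTorus.mFourier k x

/-! ### The Green function -/

/-- The Green function of `κ - Δ/2` on the torus (the convolution kernel of the inverse operator),
given by its Fourier series, which converges in `L²`. -/
def green (κ : ℝ) : Lp ℂ 2 torusMeasure :=
  ∑' k : Fin 2 → ℤ, (((eigenvalue κ k)⁻¹ : ℝ) : ℂ) • UnitAddTorus.mFourierLp 2 k

theorem summable_eigenvalue_inv_sq {κ : ℝ} (hκ : 0 < κ) :
    Summable fun k : Fin 2 → ℤ => (eigenvalue κ k)⁻¹ ^ 2 := by
  have h4 : Summable fun k : Fin 2 → ℤ => ‖k‖ ^ (-4 : ℝ) :=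
    EisensteinSeries.summable_one_div_norm_rpow (by norm_num)
  refine Summable.of_norm_bounded_eventually h4 ?_
  rw [Filter.eventually_cofinite]
  refine (Set.finite_singleton (0 : Fin 2 → ℤ)).subset ?_
  intro k hk
  by_contra hk0
  apply hk
  have hpos : 0 < ‖k‖ := norm_pos_iff.mpr hk0
  have hle : ‖k‖ ^ 2 ≤ ∑ i, (k i : ℝ) ^ 2 := by
    obtain ⟨i, hi⟩ : ∃ i, ‖k‖ = ‖k i‖ := by
      obtain ⟨i, -, hi⟩ := Finset.exists_mem_eq_sup' (s := Finset.univ)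
        Finset.univ_nonempty (fun i => ‖k i‖)
      refine ⟨i, le_antisymm ?_ (norm_le_pi_norm k i)⟩
      refine (pi_norm_le_iff_of_nonneg (norm_nonneg _)).mpr fun j => ?_
      rw [← hi]
      exact Finset.le_sup' (fun i => ‖k i‖) (Finset.mem_univ j)
    rw [hi, Int.norm_eq_abs, sq_abs]
    exact Finset.single_le_sum (f := fun i => (k i : ℝ) ^ 2) (fun j _ => sq_nonneg _)
      (Finset.mem_univ i)
  have hev : ‖k‖ ^ 2 ≤ eigenvalue κ k := by
    unfold eigenvalue
    have hpi : (1 : ℝ) ≤ 2 * Real.pi ^ 2 := by nlinarith [Real.pi_gt_three]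
    have hs : (0 : ℝ) ≤ ∑ i, (k i : ℝ) ^ 2 := Finset.sum_nonneg fun i _ => sq_nonneg _
    nlinarith
  have h2 : (0 : ℝ) < ‖k‖ ^ 2 := by positivity
  have h3 : (eigenvalue κ k)⁻¹ ≤ (‖k‖ ^ 2)⁻¹ := inv_anti₀ h2 hev
  have h5 : 0 ≤ (eigenvalue κ k)⁻¹ := inv_nonneg.mpr (h2.le.trans hev)
  have h6 : ‖k‖ ^ (-4 : ℝ) = (‖k‖ ^ 2)⁻¹ ^ 2 := by
    rw [Real.rpow_neg hpos.le, inv_pow, ← pow_mul]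
    norm_num
  rw [h6, Real.norm_of_nonneg (by positivity)]
  gcongr

/-- The Fourier series of the Green function converges in `L²`. -/
theorem hasSum_green {κ : ℝ} (hκ : 0 < κ) :
    HasSum (fun k : Fin 2 → ℤ =>
      (((eigenvalue κ k)⁻¹ : ℝ) : ℂ) • UnitAddTorus.mFourierLp 2 k) (green κ) := by
  have hmem : Memℓp (fun k : Fin 2 → ℤ => (((eigenvalue κ k)⁻¹ : ℝ) : ℂ)) 2 := by
    rw [memℓp_gen_iff (by norm_num)]
    refine (summable_eigenvalue_inv_sq hκ).congr fun k => ?_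
    simp [Complex.norm_real]
  have := (UnitAddTorus.mFourierBasis (d := Fin 2)).hasSum_repr_symm ⟨_, hmem⟩
  rw [UnitAddTorus.coe_mFourierBasis] at this
  exact this.summable.hasSum

/-- The Fourier coefficients of the Green function are the inverse eigenvalues. -/
theorem mFourierCoeff_green {κ : ℝ} (hκ : 0 < κ) (k : Fin 2 → ℤ) :
    UnitAddTorus.mFourierCoeff (green κ) k = ((eigenvalue κ k)⁻¹ : ℝ) := by
  have hmem : Memℓp (fun k : Fin 2 → ℤ => (((eigenvalue κ k)⁻¹ : ℝ) : ℂ)) 2 := by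
    rw [memℓp_gen_iff (by norm_num)]
    refine (summable_eigenvalue_inv_sq hκ).congr fun k => ?_
    simp [Complex.norm_real]
  have h := (UnitAddTorus.mFourierBasis (d := Fin 2)).hasSum_repr_symm ⟨_, hmem⟩
  rw [UnitAddTorus.coe_mFourierBasis] at h
  have heq := h.unique (hasSum_green hκ)
  have := UnitAddTorus.mFourierBasis_repr (green κ) k
  rw [← this, ← heq, LinearIsometryEquiv.apply_symm_apply]

/-! ### The interaction potential -/

/-- The two-body potentials: even, smooth, compactly supported, of positive type, of integral one.
They need not be pointwise nonnegative. -/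
structure IsPotential (v : EuclideanSpace ℝ (Fin 2) → ℝ) : Prop where
  even : ∀ x, v (-x) = v x
  smooth : ContDiff ℝ ((⊤ : ℕ∞) : WithTop ℕ∞) v
  compact_support : HasCompactSupport v
  positive_type : ∀ ξ, 0 ≤ (𝓕 (fun x => (v x : ℂ)) ξ).re ∧ (𝓕 (fun x => (v x : ℂ)) ξ).im = 0
  integral_eq_one : ∫ x, v x = 1

/-- The rescaled periodized potential `v^ε(x) = ∑_{n ∈ ℤ²} ε⁻² v((x - n)/ε)` on the torus. -/
def potential (v : EuclideanSpace ℝ (Fin 2) → ℝ) (ε : ℝ) (x : Torus) : ℝ :=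
  ∑' n : Fin 2 → ℤ, (ε ^ 2)⁻¹ * v (ε⁻¹ • (rep x - latticePoint n))

/-- The mass renormalization `τ^ε = ∫ v^ε G`. -/
def massCounterterm (κ : ℝ) (v : EuclideanSpace ℝ (Fin 2) → ℝ) (ε : ℝ) : ℝ :=
  ∫ x, potential v ε x * (green κ x).re ∂torusMeasure

/-- The energy renormalization `E^ε = (1/2) ∫ v^ε G²`. -/
def energyCounterterm (κ : ℝ) (v : EuclideanSpace ℝ (Fin 2) → ℝ) (ε : ℝ) : ℝ :=
  (1 / 2) * ∫ x, potential v ε x * (green κ x).re ^ 2 ∂torusMeasure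

/-! ### Wick ordering -/

/-- The partial pairings of a finite set: the sets of disjoint unordered pairs of elements. -/
def partialPairings (ι : Type*) [Fintype ι] [DecidableEq ι] : Finset (Finset (Finset ι)) :=
  (Finset.univ.powersetCard 2).powerset.filter fun Q =>
    ∀ a ∈ Q, ∀ b ∈ Q, a ≠ b → Disjoint a b

/-- The Wick-ordered monomial `:∏ i, ξ i:` of a centred complex Gaussian vector `ξ`. -/
def wick {Ω ι : Type*} [MeasurableSpace Ω] [Fintype ι] [DecidableEq ι] (P : Measure Ω)
    (ξ : ι → Ω → ℂ) (ω : Ω) : ℂ :=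
  ∑ Q ∈ partialPairings ι, (∏ i ∈ Finset.univ \ Q.sup id, ξ i ω) *
    ∏ e ∈ Q, (-∫ ω', ∏ i ∈ e, ξ i ω' ∂P)

section Interactions

variable {Ω : Type*} [MeasurableSpace Ω]

/-- The variance `𝔼 |φ_N(x)|²`. -/
def fieldVariance (κ : ℝ) (P : Measure Ω) (X : (Fin 2 → ℤ) → Ω → ℂ)
    (ϑ : EuclideanSpace ℝ (Fin 2) → ℝ) (N : ℝ) (x : Torus) : ℝ :=
  ∫ ω, ‖field κ X ϑ N x ω‖ ^ 2 ∂P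

/-- The Wick-ordered square `:|φ_N(x)|²:`. -/
def wickSquare (κ : ℝ) (P : Measure Ω) (X : (Fin 2 → ℤ) → Ω → ℂ)
    (ϑ : EuclideanSpace ℝ (Fin 2) → ℝ) (N : ℝ) (x : Torus) (ω : Ω) : ℝ :=
  ‖field κ X ϑ N x ω‖ ^ 2 - fieldVariance κ P X ϑ N x

/-- The Wick-ordered fourth power `:|φ_N(x)|⁴:`. -/
def wickFourth (κ : ℝ) (P : Measure Ω) (X : (Fin 2 → ℤ) → Ω → ℂ)
    (ϑ : EuclideanSpace ℝ (Fin 2) → ℝ) (N : ℝ) (x : Torus) (ω : Ω) : ℝ :=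
  ‖field κ X ϑ N x ω‖ ^ 4
    - 4 * fieldVariance κ P X ϑ N x * ‖field κ X ϑ N x ω‖ ^ 2
    + 2 * fieldVariance κ P X ϑ N x ^ 2

/-- The regularized local interaction `V_N`. -/
def localInteraction (κ : ℝ) (P : Measure Ω) (X : (Fin 2 → ℤ) → Ω → ℂ)
    (ϑ : EuclideanSpace ℝ (Fin 2) → ℝ) (N : ℝ) (ω : Ω) : ℝ :=
  (1 / 2) * ∫ x, wickFourth κ P X ϑ N x ω ∂torusMeasure

/-- The regularized nonlocal, mass- and energy-renormalized interaction `W^ε_N`. -/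
def nonlocalInteraction (κ : ℝ) (v : EuclideanSpace ℝ (Fin 2) → ℝ) (P : Measure Ω)
    (X : (Fin 2 → ℤ) → Ω → ℂ) (ε : ℝ) (ϑ : EuclideanSpace ℝ (Fin 2) → ℝ) (N : ℝ) (ω : Ω) : ℝ :=
  (1 / 2) * (∫ x, ∫ y, wickSquare κ P X ϑ N x ω * potential v ε (x - y) *
      wickSquare κ P X ϑ N y ω ∂torusMeasure ∂torusMeasure)
    - massCounterterm κ v ε * (∫ x, wickSquare κ P X ϑ N x ω ∂torusMeasure)
    - energyCounterterm κ v ε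

/-- `U` is the limit in `L²(P)` as `N → ∞` of the regularized interactions `U_N ϑ N`, for every
cutoff function `ϑ`. It determines `U` almost surely. -/
def IsInteractionLimit (P : Measure Ω) (U_N : (EuclideanSpace ℝ (Fin 2) → ℝ) → ℝ → Ω → ℝ)
    (U : Ω → ℝ) : Prop :=
  MemLp U 2 P ∧ ∀ ϑ, IsCutoff ϑ →
    Tendsto (fun N : ℝ => eLpNorm (U_N ϑ N - U) 2 P) atTop (𝓝 0)

/-- The partition function `ζ^U = 𝔼 [exp (-U)]`. -/
def partitionFunction (P : Measure Ω) (U : Ω → ℝ) : ℝ := ∫ ω, Real.exp (-U ω) ∂P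

/-- The Wick-ordered monomial `:φ̄_N(y₁) ⋯ φ̄_N(y_p) φ_N(x₁) ⋯ φ_N(x_p):`. -/
def wickMonomial (κ : ℝ) (P : Measure Ω) (X : (Fin 2 → ℤ) → Ω → ℂ)
    (ϑ : EuclideanSpace ℝ (Fin 2) → ℝ) (N : ℝ) {p : ℕ} (x y : Fin p → Torus) (ω : Ω) : ℂ :=
  wick P (Sum.elim (fun i ω => starRingEnd ℂ (field κ X ϑ N (y i) ω))
    (fun i => field κ X ϑ N (x i))) ω

/-- The regularized Wick-ordered `p`-point correlation function for the interaction `U`. -/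
def regCorrelation (κ : ℝ) (P : Measure Ω) (X : (Fin 2 → ℤ) → Ω → ℂ) (U : Ω → ℝ)
    (ϑ : EuclideanSpace ℝ (Fin 2) → ℝ) (N : ℝ) {p : ℕ}
    (z : (Fin p → Torus) × (Fin p → Torus)) : ℂ :=
  ((partitionFunction P U)⁻¹ : ℂ) *
    ∫ ω, (Real.exp (-U ω) : ℂ) * wickMonomial κ P X ϑ N z.1 z.2 ω ∂P

/-- `γ` is the Wick-ordered `p`-point correlation function for the interaction `U`: the regularized
correlation functions are well defined and, for every cutoff function, converge to `γ` in the
supremum norm as the regularization is removed. -/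
def IsCorrelation (κ : ℝ) (P : Measure Ω) (X : (Fin 2 → ℤ) → Ω → ℂ) (U : Ω → ℝ) {p : ℕ}
    (γ : C((Fin p → Torus) × (Fin p → Torus), ℂ)) : Prop :=
  ∀ ϑ, IsCutoff ϑ →
    (∀ N > 0, ∀ x y : Fin p → Torus,
      Integrable (fun ω => (Real.exp (-U ω) : ℂ) * wickMonomial κ P X ϑ N x y ω) P) ∧
    TendstoUniformly (fun (N : ℝ) z => regCorrelation κ P X U ϑ N z) γ atTop

end Interactions

end Phi42

end

noncomputable section

namespace Phi42

/-! ### Moments of the standard complex Gaussian -/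

/-! In Fourier variables both interactions have the form (1/2) ∑_q w(q) |ρ_q|² − τ ∑_k a_k² (|X_k|²
− 1) − E, where ρ_q is the Fourier coefficient of the Wick square and w is even and nonnegative with
w(0) = 1. The local interaction has w = 1, the nonlocal one w(m) = v̂(εm). Every estimate uses only
the conditions in `IsWeight`, whose constant does not depend on ε (`IsPotential.isWeight`); the
limit ε → 0 thus becomes continuity under pointwise convergence w → 1.

Sharp cutoffs to dyadic boxes of modes, with matching counterterms, give a sequence U_j. Its chaos
decomposition (`cutoffInteraction_eq`) is a quartic part, whose coefficients are square summable on
the momentum-conserving hyperplane, and a quadratic part with coefficients λ_l⁻¹ ∑_k (w(l−k) − w(k))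
λ_k⁻¹: the mass counterterm has removed the logarithmic divergence and the energy counterterm has
removed the constant. The Hölder condition in `IsWeight` makes the quadratic part square summable.
Hence U_M − U_j has coefficients of size O(r^j) in squared ℓ² norm with r < 1. Hypercontractivity
(`GaussianFamily.moment_le`) converts this into bounds on all moments; it is proved here by
induction on the chaos degree from a moment Poincaré inequality, which is Gaussian integration by
parts for the number operator.

Nelson's argument follows. Completing the square in the zero mode gives U_j ≥ −A (j+1)², since the
counterterms diverge only logarithmically in the momentum cutoff. If U_M is very negative, it must
differ from some early U_j by more than 1, which the high moments make extremely unlikely; so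
E[e^{−qU_M}] is bounded uniformly in M and in w. Consequently e^{−U_j} converges to e^{−U} in L² at
a geometric rate that is uniform in w (`exists_boltzmann_bounds`). Smooth cutoffs are handled by
comparing chaos coefficients with those of the sharp cutoff, through dominated convergence for the
lattice sums and Fatou's lemma for the truncation.

For the correlations the decisive fact is orthogonality: a Wick monomial one of whose factors
contains only high modes has zero expectation against any square integrable function of the low
modes. So E[e^{−U_j} :φ̄⋯φ:] does not change when the field is extended beyond the j-th box, and
between j and j+1 only the Boltzmann factor changes. The change is at most ‖e^{−U_{j+1}} −
e^{−U_j}‖₂ times the L² norm of the Wick monomial of the truncated field, that is, geometrically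
small times polynomial in j. This gives convergence uniform in the points, in bounded Fourier
multipliers and in w (`exists_dist_truncCorrelation_le`), although the Wick monomials themselves
diverge. At fixed j everything is a finite sum, jointly continuous in multipliers and points;
independence of the cutoff, continuity of the limit and convergence as ε → 0 are all obtained by
interchanging uniform limits. -/

theorem measurable_gaussianDensity :
    Measurable fun z : ℂ => ENNReal.ofReal (Real.pi⁻¹ * Real.exp (-‖z‖ ^ 2)) := by
  fun_prop

theorem integral_stdComplexGaussian {E : Type*} [NormedAddCommGroup E] [NormedSpace ℝ E]
    (f : ℂ → E) :
    ∫ z, f z ∂stdComplexGaussian = ∫ z, (Real.pi⁻¹ * Real.exp (-‖z‖ ^ 2)) • f z := by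
  rw [stdComplexGaussian, integral_withDensity_eq_integral_toReal_smul measurable_gaussianDensity
    (by simp)]
  refine integral_congr_ae (.of_forall fun z => ?_)
  simp only
  rw [ENNReal.toReal_ofReal (by positivity)]

theorem integral_norm_pow_mul_exp (n : ℕ) :
    ∫ z : ℂ, ‖z‖ ^ n * Real.exp (-‖z‖ ^ 2) = Real.pi * Real.Gamma ((n + 2) / 2) := by
  have := Complex.integral_rpow_mul_exp_neg_rpow (p := 2) (q := n) (by norm_num)
    (by have : (0 : ℝ) ≤ n := by positivity
        linarith)
  rw [show 2 * Real.pi / 2 = Real.pi by ring] at this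
  rw [← this]
  simp

/-- The integral of a non-integrable function is zero by convention, so the strictly positive Gamma
value already forces integrability. -/
theorem integrable_norm_pow_mul_exp (n : ℕ) :
    Integrable fun z : ℂ => ‖z‖ ^ n * Real.exp (-‖z‖ ^ 2) := by
  by_contra h
  have h1 := integral_undef h
  rw [integral_norm_pow_mul_exp] at h1
  have : 0 < Real.pi * Real.Gamma ((n + 2) / 2) :=
    mul_pos Real.pi_pos (Real.Gamma_pos_of_pos (by positivity))
  linarith

theorem integrable_norm_pow_stdComplexGaussian (n : ℕ) :
    Integrable (fun z : ℂ => ‖z‖ ^ n) stdComplexGaussian := by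
  rw [stdComplexGaussian, integrable_withDensity_iff measurable_gaussianDensity (by simp)]
  refine ((integrable_norm_pow_mul_exp n).const_mul Real.pi⁻¹).congr (.of_forall fun z => ?_)
  simp only
  rw [ENNReal.toReal_ofReal (by positivity)]
  ring

theorem integral_norm_pow_stdComplexGaussian (n : ℕ) :
    ∫ z, ‖z‖ ^ (2 * n) ∂stdComplexGaussian = n.factorial := by
  rw [integral_stdComplexGaussian]
  have : ∀ z : ℂ, (Real.pi⁻¹ * Real.exp (-‖z‖ ^ 2)) • ‖z‖ ^ (2 * n) =
      Real.pi⁻¹ * (‖z‖ ^ (2 * n) * Real.exp (-‖z‖ ^ 2)) := fun z => by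
    rw [smul_eq_mul]; ring
  simp_rw [this]
  rw [integral_const_mul, integral_norm_pow_mul_exp,
    show ((2 * n : ℕ) + 2 : ℝ) / 2 = n + 1 by push_cast; ring, Real.Gamma_nat_eq_factorial]
  field_simp

instance : IsProbabilityMeasure stdComplexGaussian := by
  refine ⟨?_⟩
  have h0 := integral_norm_pow_stdComplexGaussian 0
  have hi := integrable_norm_pow_stdComplexGaussian 0
  simp only [mul_zero, pow_zero, Nat.factorial_zero, Nat.cast_one] at h0 hi
  have hf : IsFiniteMeasure stdComplexGaussian := by
    simpa using (integrable_const_iff (μ := stdComplexGaussian) (c := (1 : ℝ))).1 hi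
  simp only [integral_const, smul_eq_mul, mul_one] at h0
  rw [measureReal_def, ENNReal.toReal_eq_one_iff] at h0
  exact h0

theorem integral_rotate_stdComplexGaussian (c : Circle) (f : ℂ → ℂ) :
    ∫ z, f (c * z) ∂stdComplexGaussian = ∫ z, f z ∂stdComplexGaussian := by
  rw [integral_stdComplexGaussian, integral_stdComplexGaussian]
  have := (rotation c).measurePreserving.integral_comp'
    (f := (rotation c).toHomeomorph.toMeasurableEquiv)
    (fun z : ℂ => (Real.pi⁻¹ * Real.exp (-‖z‖ ^ 2)) • f z)
  rw [← this]
  refine integral_congr_ae (.of_forall fun z => ?_)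
  simp [rotation_apply, Circle.norm_coe]

/-- The mixed moments of the standard complex Gaussian. -/
theorem integral_pow_mul_conj_pow (a b : ℕ) :
    ∫ z : ℂ, z ^ a * (starRingEnd ℂ z) ^ b ∂stdComplexGaussian =
      if a = b then (a.factorial : ℂ) else 0 := by
  split_ifs with h
  · subst h
    rw [← Complex.ofReal_natCast, ← integral_norm_pow_stdComplexGaussian, ← integral_complex_ofReal]
    refine integral_congr_ae (.of_forall fun z => ?_)
    simp only
    rw [← mul_pow, Complex.mul_conj, Complex.normSq_eq_norm_sq, pow_mul]
    push_cast; rfl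
  -- Rotation invariance multiplies the moment by c^a c̄^b. If the moment were nonzero, c^a = c^b
  -- would hold for every c on the circle.
  · have key : ∀ c : Circle, (c : ℂ) ^ a * (starRingEnd ℂ (c : ℂ)) ^ b *
        ∫ z : ℂ, z ^ a * (starRingEnd ℂ z) ^ b ∂stdComplexGaussian =
        ∫ z : ℂ, z ^ a * (starRingEnd ℂ z) ^ b ∂stdComplexGaussian := by
      intro c
      rw [← integral_const_mul]
      rw [← integral_rotate_stdComplexGaussian c (fun z => z ^ a * (starRingEnd ℂ z) ^ b)]
      refine integral_congr_ae (.of_forall fun z => ?_)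
      simp only [map_mul]
      ring
    by_contra hne
    have hc : ∀ c : Circle, (c : ℂ) ^ a = (c : ℂ) ^ b := by
      intro c
      have h1 : (c : ℂ) ^ a * (starRingEnd ℂ (c : ℂ)) ^ b = 1 :=
        mul_right_cancel₀ hne ((key c).trans (one_mul _).symm)
      have h2 : (c : ℂ) * starRingEnd ℂ (c : ℂ) = 1 := by
        rw [Complex.mul_conj, Complex.normSq_eq_norm_sq]; simp [Circle.norm_coe]
      calc (c : ℂ) ^ a = (c : ℂ) ^ a * ((c : ℂ) * starRingEnd ℂ (c : ℂ)) ^ b := by rw [h2]; simp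
        _ = ((c : ℂ) ^ a * (starRingEnd ℂ (c : ℂ)) ^ b) * (c : ℂ) ^ b := by ring
        _ = _ := by rw [h1, one_mul]
    -- Testing with c = e^i gives a − b = 2πm for an integer m, which contradicts either a ≠ b or
    -- the irrationality of π.
    have h1 := hc (Circle.exp 1)
    rw [← Circle.coe_pow, ← Circle.coe_pow, Circle.coe_inj, ← Circle.exp_nsmul,
      ← Circle.exp_nsmul, Circle.exp_eq_exp] at h1
    obtain ⟨m, hm⟩ := h1
    simp only [nsmul_eq_mul, mul_one] at hm
    by_cases hm0 : m = 0
    · subst hm0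
      simp at hm
      exact h hm
    · have hm' : (m : ℝ) ≠ 0 := by exact_mod_cast hm0
      have hpi : Real.pi = (((a : ℤ) - b : ℤ) : ℚ) / ((2 * m : ℤ) : ℚ) := by
        push_cast
        field_simp
        linarith
      exact irrational_pi ⟨((((a : ℤ) - b : ℤ) : ℚ) / ((2 * m : ℤ) : ℚ)), by rw [hpi]; push_cast; rfl⟩

/-- The Gaussian integration by parts formula for monomials in `z` and its conjugate. -/
theorem integral_mul_pow_mul_conj_pow (a b : ℕ) :
    ∫ z : ℂ, z ^ (a + 1) * (starRingEnd ℂ z) ^ b ∂stdComplexGaussian =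
      b * ∫ z : ℂ, z ^ a * (starRingEnd ℂ z) ^ (b - 1) ∂stdComplexGaussian := by
  rw [integral_pow_mul_conj_pow, integral_pow_mul_conj_pow]
  -- For b = 0 the truncated exponent b − 1 is harmless because the prefactor b vanishes.
  rcases b with _ | b
  · simp
  · simp only [add_left_inj, add_tsub_cancel_right]
    split_ifs with h
    · subst h; push_cast [Nat.factorial_succ]; ring
    · simp

theorem integral_conj_mul_pow_mul_pow (a b : ℕ) :
    ∫ z : ℂ, (starRingEnd ℂ z) ^ (b + 1) * z ^ a ∂stdComplexGaussian =
      a * ∫ z : ℂ, (starRingEnd ℂ z) ^ b * z ^ (a - 1) ∂stdComplexGaussian := by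
  simp_rw [fun z : ℂ => mul_comm ((starRingEnd ℂ z) ^ (b + 1)) (z ^ a),
    fun z : ℂ => mul_comm ((starRingEnd ℂ z) ^ b) (z ^ (a - 1))]
  rw [integral_pow_mul_conj_pow, integral_pow_mul_conj_pow]
  rcases a with _ | a
  · simp
  · simp only [add_left_inj, add_tsub_cancel_right]
    split_ifs with h
    · push_cast [Nat.factorial_succ]; ring
    · simp

end Phi42

end

noncomputable section

namespace Phi42

/-! ### Creation operators on polynomials in complex Gaussian variables -/

section Chaos

variable {ι : Type*}

/-- The conjugate of a letter: the letter `(k, true)` stands for `X k`, the letter `(k, false)` for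
its complex conjugate. -/
def bar (l : ι × Bool) : ι × Bool := (l.1, !l.2)

@[simp] theorem bar_bar (l : ι × Bool) : bar (bar l) = l := by simp [bar]

@[simp] theorem bar_fst (l : ι × Bool) : (bar l).1 = l.1 := rfl

@[simp] theorem bar_mk (k : ι) (b : Bool) : bar (k, b) = (k, !b) := rfl

theorem bar_injective : Function.Injective (bar : ι × Bool → ι × Bool) :=
  Function.LeftInverse.injective bar_bar

/-- The creation operator `p ↦ X_l p - ∂_{bar l} p`. -/
def creation (l : ι × Bool) : MvPolynomial (ι × Bool) ℂ →ₗ[ℂ] MvPolynomial (ι × Bool) ℂ :=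
  LinearMap.mulLeft ℂ (MvPolynomial.X l) - (MvPolynomial.pderiv (bar l)).toLinearMap

theorem creation_apply (l : ι × Bool) (p : MvPolynomial (ι × Bool) ℂ) :
    creation l p = MvPolynomial.X l * p - MvPolynomial.pderiv (bar l) p := rfl

/-- The commutator of two derivations is a derivation, and this one kills every variable. -/
theorem pderiv_comm {σ : Type*} (i j : σ) (p : MvPolynomial σ ℂ) :
    MvPolynomial.pderiv i (MvPolynomial.pderiv j p) =
      MvPolynomial.pderiv j (MvPolynomial.pderiv i p) := by
  classical
  have h : ⁅(MvPolynomial.pderiv i : Derivation ℂ (MvPolynomial σ ℂ) (MvPolynomial σ ℂ)),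
      (MvPolynomial.pderiv j : Derivation ℂ (MvPolynomial σ ℂ) (MvPolynomial σ ℂ))⁆ = 0 := by
    refine MvPolynomial.derivation_ext (R := ℂ) fun k => ?_
    rw [Derivation.commutator_apply]
    simp only [MvPolynomial.pderiv_X, Derivation.coe_zero, Pi.zero_apply]
    simp only [Pi.single_apply]
    split_ifs <;> simp
  have := DFunLike.congr_fun h p
  rw [Derivation.commutator_apply] at this
  exact sub_eq_zero.1 this

/-- Canonical commutation relation: only the multiplication by X_l in the creation operator fails to
commute with the derivative. -/
theorem pderiv_creation [DecidableEq ι] (l m : ι × Bool) (p : MvPolynomial (ι × Bool) ℂ) :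
    MvPolynomial.pderiv m (creation l p) =
      (if m = l then p else 0) + creation l (MvPolynomial.pderiv m p) := by
  rw [creation_apply, creation_apply, map_sub, MvPolynomial.pderiv_mul, MvPolynomial.pderiv_X,
    pderiv_comm m (bar l)]
  simp only [Pi.single_apply, eq_comm (a := l)]
  split_ifs <;> ring

/-- The delta terms from the commutation relation are symmetric because conjugation of letters is an
involution: bar l = m exactly when bar m = l. -/
theorem creation_comm [DecidableEq ι] (l m : ι × Bool) (p : MvPolynomial (ι × Bool) ℂ) :
    creation l (creation m p) = creation m (creation l p) := by
  rw [creation_apply l (creation m p), pderiv_creation, creation_apply m (creation l p),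
    pderiv_creation, creation_apply l, creation_apply m p, creation_apply l, creation_apply m,
    pderiv_comm]
  have : (bar l = m) ↔ (bar m = l) := by
    constructor <;> rintro rfl <;> simp
  simp only [this]
  ring

/-- The letters attached to a finite set of modes. -/
abbrev letters (B : Finset ι) : Finset (ι × Bool) := B ×ˢ Finset.univ

/-- The number operator. -/
def numberOp (B : Finset ι) (p : MvPolynomial (ι × Bool) ℂ) : MvPolynomial (ι × Bool) ℂ :=
  ∑ l ∈ letters B, creation l (MvPolynomial.pderiv l p)

/-- `p` lies in the homogeneous Wiener chaos of degree `n` over the modes `B`, and its top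
coefficients have squared `ℓ²` norm at most `σ`. -/
def IsChaos (B : Finset ι) : ℕ → MvPolynomial (ι × Bool) ℂ → ℝ → Prop
  | 0, p, σ => ∃ c : ℂ, p = MvPolynomial.C c ∧ ‖c‖ ^ 2 ≤ σ
  | n + 1, p, σ => numberOp B p = ((n + 1 : ℕ) : ℂ) • p ∧
      ∃ τ : ι × Bool → ℝ, (∀ l ∈ letters B, IsChaos B n (MvPolynomial.pderiv l p) (τ l)) ∧
        ∑ l ∈ letters B, τ l ≤ σ

theorem numberOp_add (B : Finset ι) (p q : MvPolynomial (ι × Bool) ℂ) :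
    numberOp B (p + q) = numberOp B p + numberOp B q := by
  simp [numberOp, Finset.sum_add_distrib]

theorem IsChaos.numberOp_eq {B : Finset ι} {n : ℕ} {p : MvPolynomial (ι × Bool) ℂ} {σ : ℝ}
    (h : IsChaos B n p σ) : numberOp B p = (n : ℂ) • p := by
  cases n with
  | zero => obtain ⟨c, rfl, -⟩ := h; simp [numberOp]
  | succ n => exact h.1

theorem IsChaos.nonneg {B : Finset ι} {n : ℕ} {p : MvPolynomial (ι × Bool) ℂ} {σ : ℝ}
    (h : IsChaos B n p σ) : 0 ≤ σ := by
  induction n generalizing p σ with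
  | zero => obtain ⟨c, -, hc⟩ := h; exact (by positivity : (0 : ℝ) ≤ ‖c‖ ^ 2).trans hc
  | succ n ih =>
    obtain ⟨-, τ, hτ, hs⟩ := h
    exact (Finset.sum_nonneg fun l hl => ih (hτ l hl)).trans hs

theorem IsChaos.mono {B : Finset ι} {n : ℕ} {p : MvPolynomial (ι × Bool) ℂ} {σ σ' : ℝ}
    (h : IsChaos B n p σ) (hσ : σ ≤ σ') : IsChaos B n p σ' := by
  cases n with
  | zero => obtain ⟨c, hp, hc⟩ := h; exact ⟨c, hp, hc.trans hσ⟩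
  | succ n => obtain ⟨h1, τ, hτ, hs⟩ := h; exact ⟨h1, τ, hτ, hs.trans hσ⟩

/-- The factor 2 is that of |c + d|² ≤ 2 (|c|² + |d|²) in degree zero; the recursion over
derivatives carries it upward unchanged. -/
theorem IsChaos.add {B : Finset ι} {n : ℕ} {p q : MvPolynomial (ι × Bool) ℂ} {σ τ : ℝ}
    (hp : IsChaos B n p σ) (hq : IsChaos B n q τ) : IsChaos B n (p + q) (2 * (σ + τ)) := by
  induction n generalizing p q σ τ with
  | zero =>
    obtain ⟨c, rfl, hc⟩ := hp
    obtain ⟨d, rfl, hd⟩ := hq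
    refine ⟨c + d, by simp, ?_⟩
    have := norm_add_le c d
    have h2 : ‖c + d‖ ^ 2 ≤ (‖c‖ + ‖d‖) ^ 2 := by gcongr
    nlinarith [sq_nonneg (‖c‖ - ‖d‖)]
  | succ n ih =>
    obtain ⟨h1, f, hf, hs⟩ := hp
    obtain ⟨h1', g, hg, hs'⟩ := hq
    refine ⟨by rw [numberOp_add, h1, h1', smul_add], fun l => 2 * (f l + g l), fun l hl => ?_, ?_⟩
    · rw [map_add]; exact ih (hf l hl) (hg l hl)
    · rw [← Finset.mul_sum, Finset.sum_add_distrib]; linarith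

theorem IsChaos.zero {B : Finset ι} (n : ℕ) : IsChaos B n 0 0 := by
  induction n with
  | zero => exact ⟨0, by simp, by simp⟩
  | succ n ih => exact ⟨by simp [numberOp], fun _ => 0, fun l _ => by rw [map_zero]; exact ih, by simp⟩

/-- The constant in the bound for the top coefficients of a sum of created chaoses. -/
def chaosConst : ℕ → ℝ
  | 0 => 1
  | n + 1 => 2 * (1 + chaosConst n)

theorem pderiv_sum_creation [DecidableEq ι] {B : Finset ι} (g : ι × Bool → MvPolynomial (ι × Bool) ℂ)
    {m : ι × Bool} (hm : m ∈ letters B) :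
    MvPolynomial.pderiv m (∑ l ∈ letters B, creation l (g l)) =
      g m + ∑ l ∈ letters B, creation l (MvPolynomial.pderiv m (g l)) := by
  rw [map_sum]
  simp_rw [pderiv_creation]
  rw [Finset.sum_add_distrib, Finset.sum_ite_eq, if_pos hm]

/-- Each creation operator raises the number by one. The commutation relation produces the extra
sum, and the remaining double sum is reordered because creation operators commute. -/
theorem numberOp_sum_creation [DecidableEq ι] (B : Finset ι) (g : ι × Bool → MvPolynomial (ι × Bool) ℂ) :
    numberOp B (∑ l ∈ letters B, creation l (g l)) =
      ∑ l ∈ letters B, creation l (numberOp B (g l)) + ∑ l ∈ letters B, creation l (g l) := by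
  rw [numberOp, Finset.sum_congr rfl fun m hm => by rw [pderiv_sum_creation g hm]]
  simp_rw [map_add, map_sum, Finset.sum_add_distrib, numberOp, map_sum]
  rw [add_comm, Finset.sum_comm]
  simp_rw [creation_comm]

/-- The derivative along m is g_m plus a sum of the same type one degree lower, to which the
induction hypothesis applies. Adding the two costs a factor 2, whence the recursion for
`chaosConst`. -/
theorem IsChaos.sum_creation [DecidableEq ι] {B : Finset ι} {n : ℕ} {g : ι × Bool → MvPolynomial (ι × Bool) ℂ}
    {τ : ι × Bool → ℝ} (h : ∀ l ∈ letters B, IsChaos B n (g l) (τ l)) :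
    IsChaos B (n + 1) (∑ l ∈ letters B, creation l (g l))
      (chaosConst n * ∑ l ∈ letters B, τ l) := by
  induction n generalizing g τ with
  | zero =>
    refine ⟨?_, τ, fun m hm => ?_, by simp [chaosConst]⟩
    · rw [numberOp_sum_creation, Finset.sum_eq_zero, zero_add]
      · simp
      · intro l hl; rw [(h l hl).numberOp_eq]; simp
    · rw [pderiv_sum_creation g hm, Finset.sum_eq_zero, add_zero]
      · exact h m hm
      · intro l hl; obtain ⟨c, hc, -⟩ := h l hl; simp [hc]
  | succ n ih =>
    choose! f hf hs using fun l hl => (h l hl).2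
    refine ⟨?_, fun m => 2 * (τ m + chaosConst n * ∑ l ∈ letters B, f l m), fun m hm => ?_, ?_⟩
    · rw [numberOp_sum_creation, Finset.sum_congr rfl fun l hl => by rw [(h l hl).numberOp_eq]]
      simp only [map_smul, ← Finset.smul_sum]
      push_cast
      module
    · rw [pderiv_sum_creation g hm]
      exact (h m hm).add (ih fun l hl => hf l hl m hm)
    · rw [← Finset.mul_sum, Finset.sum_add_distrib, ← Finset.mul_sum, Finset.sum_comm, chaosConst]
      have h1 : ∑ l ∈ letters B, ∑ m ∈ letters B, f l m ≤ ∑ l ∈ letters B, τ l :=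
        Finset.sum_le_sum fun l hl => hs l hl
      have h2 : 0 ≤ chaosConst n := by
        clear * -
        induction n with
        | zero => simp [chaosConst]
        | succ n ih => rw [chaosConst]; positivity
      nlinarith [mul_le_mul_of_nonneg_left h1 h2]

/-- The version of `IsChaos.sum_creation` for letters of one sign. -/
theorem IsChaos.sum_creation_mode [DecidableEq ι] {B : Finset ι} {n : ℕ} (b : Bool)
    {g : ι → MvPolynomial (ι × Bool) ℂ} {τ : ι → ℝ} (h : ∀ k ∈ B, IsChaos B n (g k) (τ k)) :
    IsChaos B (n + 1) (∑ k ∈ B, creation (k, b) (g k)) (chaosConst n * ∑ k ∈ B, τ k) := by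
  have := IsChaos.sum_creation (B := B) (n := n) (g := fun l => if l.2 = b then g l.1 else 0)
    (τ := fun l => if l.2 = b then τ l.1 else 0) (by
      rintro ⟨k, c⟩ hl
      simp only [Finset.mem_product, Finset.mem_univ, and_true] at hl
      simp only
      split_ifs
      · exact h k hl
      · exact IsChaos.zero n)
  rw [Finset.sum_product, Finset.sum_product] at this
  convert! this using 3 with k hk
  · rw [Finset.sum_eq_single b] <;> simp +contextual
  · rw [Finset.sum_eq_single b] <;> simp +contextual

end Chaos

end Phi42

end

noncomputable section

namespace Phi42

/-! ### Random variables with all moments -/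

/-- `f` has moments of all orders. -/
def HasMoments {Ω E : Type*} [MeasurableSpace Ω] [NormedAddCommGroup E] (P : Measure Ω)
    (f : Ω → E) : Prop :=
  ∀ n : ℕ, MemLp f n P

namespace HasMoments

variable {Ω : Type*} [MeasurableSpace Ω] {P : Measure Ω} {E : Type*}

theorem add [NormedAddCommGroup E] {f g : Ω → E} (hf : HasMoments P f) (hg : HasMoments P g) :
    HasMoments P fun ω => f ω + g ω :=
  fun n => (hf n).add (hg n)

theorem sub [NormedAddCommGroup E] {f g : Ω → E} (hf : HasMoments P f) (hg : HasMoments P g) :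
    HasMoments P fun ω => f ω - g ω :=
  fun n => (hf n).sub (hg n)

theorem const [NormedAddCommGroup E] [IsFiniteMeasure P] (c : E) :
    HasMoments P fun _ : Ω => c :=
  fun _ => memLp_const c

theorem mul [NormedRing E] {f g : Ω → E} (hf : HasMoments P f) (hg : HasMoments P g) :
    HasMoments P fun ω => f ω * g ω := by
  intro n
  have : ENNReal.HolderTriple ((2 * n : ℕ) : ℝ≥0∞) ((2 * n : ℕ) : ℝ≥0∞) (n : ℝ≥0∞) := by
    refine ⟨?_⟩
    push_cast
    rw [← two_mul, ENNReal.mul_inv (by simp) (by simp), ← mul_assoc,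
      ENNReal.mul_inv_cancel (by simp) (by simp), one_mul]
  exact (hg (2 * n)).mul (hf (2 * n))

theorem sum [NormedAddCommGroup E] {α : Type*} (s : Finset α) {f : α → Ω → E}
    (hf : ∀ i ∈ s, HasMoments P (f i)) : HasMoments P fun ω => ∑ i ∈ s, f i ω :=
  fun n => memLp_finsetSum s fun i hi => hf i hi n

theorem prod [NormedCommRing E] [IsFiniteMeasure P] {α : Type*} (s : Finset α) {f : α → Ω → E}
    (hf : ∀ i ∈ s, HasMoments P (f i)) : HasMoments P fun ω => ∏ i ∈ s, f i ω := by
  classical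
  induction s using Finset.induction_on with
  | empty => simpa using const 1
  | insert a s ha ih =>
    simp_rw [Finset.prod_insert ha]
    exact (hf a (by simp)).mul (ih fun i hi => hf i (by simp [hi]))

theorem pow [NormedCommRing E] [IsFiniteMeasure P] {f : Ω → E} (hf : HasMoments P f) (n : ℕ) :
    HasMoments P fun ω => f ω ^ n := by
  simpa using prod (Finset.range n) (f := fun _ => f) fun _ _ => hf

theorem norm [NormedAddCommGroup E] {f : Ω → E} (hf : HasMoments P f) :
    HasMoments P fun ω => ‖f ω‖ := fun n => (hf n).norm

theorem memLp_two [NormedAddCommGroup E] {f : Ω → E} (hf : HasMoments P f) : MemLp f 2 P := by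
  simpa using hf 2

theorem integrable [NormedAddCommGroup E] {f : Ω → E} (hf : HasMoments P f) : Integrable f P := by
  rw [← memLp_one_iff_integrable]
  simpa using hf 1

theorem aestronglyMeasurable [NormedAddCommGroup E] {f : Ω → E} (hf : HasMoments P f) :
    AEStronglyMeasurable f P := (hf 0).1

theorem congr [NormedAddCommGroup E] {f g : Ω → E} (hf : HasMoments P f) (h : ∀ ω, f ω = g ω) :
    HasMoments P g := (funext h : f = g) ▸ hf

theorem of_le [NormedAddCommGroup E] {f : Ω → E} {g : Ω → ℝ} (hg : HasMoments P g)
    (hf : AEStronglyMeasurable f P) (h : ∀ᵐ ω ∂P, ‖f ω‖ ≤ g ω) : HasMoments P f :=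
  fun n => (hg n).mono' hf h

end HasMoments

/-! ### Families of independent standard complex Gaussians -/

/-- A family of independent (everywhere measurable) standard complex Gaussians. -/
structure GaussianFamily {Ω ι : Type*} [MeasurableSpace Ω] (P : Measure Ω) (X : ι → Ω → ℂ) :
    Prop where
  measurable : ∀ k, Measurable (X k)
  hasLaw : ∀ k, HasLaw (X k) stdComplexGaussian P
  indep : iIndepFun X P

section Family

variable {Ω ι : Type*} {X : ι → Ω → ℂ}

/-- The random variable attached to a letter. -/
def letterVal (X : ι → Ω → ℂ) (l : ι × Bool) (ω : Ω) : ℂ :=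
  if l.2 then X l.1 ω else starRingEnd ℂ (X l.1 ω)

@[simp] theorem letterVal_true (k : ι) (ω : Ω) : letterVal X (k, true) ω = X k ω := rfl

@[simp] theorem letterVal_false (k : ι) (ω : Ω) :
    letterVal X (k, false) ω = starRingEnd ℂ (X k ω) := by simp [letterVal]

theorem letterVal_bar (l : ι × Bool) (ω : Ω) :
    letterVal X (bar l) ω = starRingEnd ℂ (letterVal X l ω) := by
  obtain ⟨k, b⟩ := l
  cases b <;> simp

/-- The random variable given by a polynomial in the letters. -/
def polyVal (X : ι → Ω → ℂ) (p : MvPolynomial (ι × Bool) ℂ) (ω : Ω) : ℂ :=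
  MvPolynomial.eval (fun l => letterVal X l ω) p

/-- The σ-algebra generated by a set of modes. -/
@[reducible] def modeAlgebra (X : ι → Ω → ℂ) (S : Set ι) : MeasurableSpace Ω :=
  ⨆ k ∈ S, MeasurableSpace.comap (X k) inferInstance

theorem measurable_mode {S : Set ι} {k : ι} (hk : k ∈ S) : Measurable[modeAlgebra X S] (X k) := by
  rw [measurable_iff_comap_le]
  exact le_iSup₂_of_le k hk le_rfl

theorem measurable_letterVal {S : Set ι} {l : ι × Bool} (hl : l.1 ∈ S) :
    Measurable[modeAlgebra X S] (letterVal X l) := by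
  obtain ⟨k, b⟩ := l
  cases b
  · exact (Complex.continuous_conj.measurable).comp (measurable_mode hl)
  · exact measurable_mode hl

theorem modeAlgebra_mono {S T : Set ι} (h : S ⊆ T) : modeAlgebra X S ≤ modeAlgebra X T :=
  iSup₂_le fun k hk => le_iSup₂_of_le k (h hk) le_rfl

theorem polyVal_add (p q : MvPolynomial (ι × Bool) ℂ) (ω : Ω) :
    polyVal X (p + q) ω = polyVal X p ω + polyVal X q ω := map_add _ _ _

theorem polyVal_sub (p q : MvPolynomial (ι × Bool) ℂ) (ω : Ω) :
    polyVal X (p - q) ω = polyVal X p ω - polyVal X q ω := map_sub _ _ _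

theorem polyVal_mul (p q : MvPolynomial (ι × Bool) ℂ) (ω : Ω) :
    polyVal X (p * q) ω = polyVal X p ω * polyVal X q ω := map_mul _ _ _

theorem polyVal_pow (p : MvPolynomial (ι × Bool) ℂ) (n : ℕ) (ω : Ω) :
    polyVal X (p ^ n) ω = polyVal X p ω ^ n := map_pow _ _ _

theorem polyVal_smul (c : ℂ) (p : MvPolynomial (ι × Bool) ℂ) (ω : Ω) :
    polyVal X (c • p) ω = c * polyVal X p ω := by simp [polyVal]

theorem polyVal_C (c : ℂ) (ω : Ω) : polyVal X (MvPolynomial.C c) ω = c := by simp [polyVal]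

theorem polyVal_X (l : ι × Bool) (ω : Ω) :
    polyVal X (MvPolynomial.X l) ω = letterVal X l ω := by simp [polyVal]

theorem polyVal_sum {α : Type*} (s : Finset α) (f : α → MvPolynomial (ι × Bool) ℂ) (ω : Ω) :
    polyVal X (∑ i ∈ s, f i) ω = ∑ i ∈ s, polyVal X (f i) ω := map_sum _ _ _

theorem polyVal_prod {α : Type*} (s : Finset α) (f : α → MvPolynomial (ι × Bool) ℂ) (ω : Ω) :
    polyVal X (∏ i ∈ s, f i) ω = ∏ i ∈ s, polyVal X (f i) ω := map_prod _ _ _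

namespace GaussianFamily

variable [MeasurableSpace Ω] {P : Measure Ω} (hX : GaussianFamily P X)
include hX

theorem modeAlgebra_le (S : Set ι) : modeAlgebra X S ≤ ‹MeasurableSpace Ω› :=
  iSup₂_le fun k _ => (hX.measurable k).comap_le

theorem integral_comp (k : ι) {f : ℂ → ℂ} (hf : Measurable f) :
    ∫ ω, f (X k ω) ∂P = ∫ z, f z ∂stdComplexGaussian :=
  (hX.hasLaw k).integral_comp hf.aestronglyMeasurable

theorem hasMoments (k : ι) : HasMoments P (X k) := by
  intro n
  -- The exponent 0 records measurability only.
  rcases Nat.eq_zero_or_pos n with rfl | hn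
  · simpa using (hX.measurable k).aestronglyMeasurable
  have h := integrable_norm_pow_stdComplexGaussian n
  rw [← (hX.hasLaw k).map_eq, integrable_map_measure (by fun_prop) (hX.measurable k).aemeasurable]
    at h
  rw [← integrable_norm_rpow_iff (hX.measurable k).aestronglyMeasurable (by simp [hn.ne'])
    (by simp)]
  simpa [Function.comp_def] using h

theorem hasMoments_letterVal (l : ι × Bool) : HasMoments P (letterVal X l) := by
  obtain ⟨k, b⟩ := l
  cases b
  · intro n
    refine (hX.hasMoments k n).of_le ?_ (.of_forall fun ω => by simp)
    exact (Complex.continuous_conj.measurable.comp (hX.measurable k)).aestronglyMeasurable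
  · exact hX.hasMoments k

theorem hasMoments_polyVal [IsProbabilityMeasure P] (p : MvPolynomial (ι × Bool) ℂ) :
    HasMoments P (polyVal X p) := by
  induction p using MvPolynomial.induction_on with
  | C a => exact (HasMoments.const (P := P) a).congr fun ω => (polyVal_C a ω).symm
  | add p q hp hq => exact (hp.add hq).congr fun ω => (polyVal_add p q ω).symm
  | mul_X p l hp =>
    exact (hp.mul (hX.hasMoments_letterVal l)).congr fun ω => by rw [polyVal_mul, polyVal_X]

theorem integral_indep_mul (k : ι) {S : Set ι} (hk : k ∉ S) {f : ℂ → ℂ} (hf : Measurable f)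
    {G : Ω → ℂ} (hG : Measurable[modeAlgebra X S] G) :
    ∫ ω, f (X k ω) * G ω ∂P = (∫ z, f z ∂stdComplexGaussian) * ∫ ω, G ω ∂P := by
  have hind : Indep (modeAlgebra X {k}) (modeAlgebra X S) P :=
    indep_iSup_of_disjoint (fun i => (hX.measurable i).comap_le) hX.indep
      (Set.disjoint_singleton_left.2 hk)
  have h1 : IndepFun (fun ω => f (X k ω)) G P := by
    rw [IndepFun_iff_Indep]
    refine indep_of_indep_of_le_left (indep_of_indep_of_le_right hind hG.comap_le) ?_
    exact Measurable.comap_le (hf.comp (measurable_mode (Set.mem_singleton k)))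
  rw [h1.integral_fun_mul_eq_mul_integral, hX.integral_comp k hf]
  · exact (hf.comp (hX.measurable k)).aestronglyMeasurable
  · exact (hG.mono (hX.modeAlgebra_le S) le_rfl).aestronglyMeasurable

/-- Gaussian integration by parts. -/
theorem integral_mul_letterVal_mul_polyVal [IsProbabilityMeasure P] {S : Set ι} {G : Ω → ℂ}
    (hG : Measurable[modeAlgebra X S] G) (hG2 : MemLp G 2 P) {l : ι × Bool} (hl : l.1 ∉ S)
    (p : MvPolynomial (ι × Bool) ℂ) :
    ∫ ω, G ω * (letterVal X l ω * polyVal X p ω) ∂P =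
      ∫ ω, G ω * polyVal X (MvPolynomial.pderiv (bar l) p) ω ∂P := by
  classical
  obtain ⟨k, b⟩ := l
  have hint : ∀ {f : Ω → ℂ}, HasMoments P f → Integrable (fun ω => G ω * f ω) P := fun hf =>
    hG2.integrable_mul hf.memLp_two
  induction p using MvPolynomial.induction_on' with
  | add p q hp hq =>
    have h1 : ∀ ω, G ω * (letterVal X (k, b) ω * polyVal X (p + q) ω) =
        G ω * (letterVal X (k, b) ω * polyVal X p ω) +
        G ω * (letterVal X (k, b) ω * polyVal X q ω) := fun ω => by simp [polyVal]; ring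
    have h2 : ∀ ω, G ω * polyVal X (MvPolynomial.pderiv (bar (k, b)) (p + q)) ω =
        G ω * polyVal X (MvPolynomial.pderiv (bar (k, b)) p) ω +
        G ω * polyVal X (MvPolynomial.pderiv (bar (k, b)) q) ω := fun ω => by
      simp [polyVal]; ring
    simp_rw [h1, h2]
    rw [integral_add, integral_add, hp, hq]
    · exact hint (hX.hasMoments_polyVal _)
    · exact hint (hX.hasMoments_polyVal _)
    · exact hint ((hX.hasMoments_letterVal _).mul (hX.hasMoments_polyVal _))
    · exact hint ((hX.hasMoments_letterVal _).mul (hX.hasMoments_polyVal _))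
  | monomial u c =>
    -- The monomial is split into a power of X_k, a power of its conjugate, and R, which collects
    -- the other modes. Then G c R depends only on modes different from k, so by independence the
    -- expectation factorizes and the formula reduces to the moments of a single Gaussian. No
    -- derivative falls on G because G does not involve the mode k.
    set R : Ω → ℂ := fun ω => ∏ l ∈ (u.support.erase (k, true)).erase (k, false),
      letterVal X l ω ^ u l with hR
    have hRm : Measurable[modeAlgebra X {k}ᶜ] R := by
      refine @Finset.measurable_fun_prod _ _ _ _ _ _ (modeAlgebra X {k}ᶜ) _ _ fun l hl => ?_
      refine Measurable.pow_const (measurable_letterVal ?_) _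
      obtain ⟨j, b⟩ := l
      simp only [Finset.mem_erase] at hl
      simp only [Set.mem_compl_iff, Set.mem_singleton_iff]
      rintro rfl
      cases b <;> simp at hl
    have hGm : Measurable[modeAlgebra X {k}ᶜ] G :=
      hG.mono (modeAlgebra_mono (Set.subset_compl_singleton_iff.2 hl)) le_rfl
    have hH : Measurable[modeAlgebra X {k}ᶜ] fun ω => G ω * (c * R ω) :=
      hGm.mul (hRm.const_mul c)
    have hsplit : ∀ (v : ι × Bool →₀ ℕ), (∀ l, l.1 ≠ k → v l = u l) → ∀ ω,
        v.prod (fun l n => letterVal X l ω ^ n) =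
        X k ω ^ v (k, true) * starRingEnd ℂ (X k ω) ^ v (k, false) * R ω := by
      intro v hv ω
      rw [Finsupp.prod_of_support_subset (s := insert (k, true) (insert (k, false)
        ((u.support.erase (k, true)).erase (k, false))))]
      · rw [Finset.prod_insert (by simp), Finset.prod_insert (by simp), letterVal_true,
          letterVal_false, ← mul_assoc, hR]
        congr 1
        refine Finset.prod_congr rfl fun l hl => ?_
        obtain ⟨j, b⟩ := l
        rw [hv]
        rintro rfl
        cases b <;> simp at hl
      · intro l hl
        obtain ⟨j, b⟩ := l
        by_cases hj : j = k
        · subst hj; cases b <;> simp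
        · simp only [Finset.mem_insert, Finset.mem_erase, Prod.mk.injEq, hj, false_and, ne_eq,
            not_false_eq_true, true_and, false_or]
          rw [Finsupp.mem_support_iff, ← hv _ hj]
          exact Finsupp.mem_support_iff.1 hl
      · simp
    have hkS : k ∉ ({k}ᶜ : Set ι) := by simp
    cases b
    · have h1 : ∀ ω, G ω * (letterVal X (k, false) ω * polyVal X (MvPolynomial.monomial u c) ω) =
          (starRingEnd ℂ (X k ω) ^ (u (k, false) + 1) * X k ω ^ u (k, true)) *
            (G ω * (c * R ω)) := fun ω => by
        rw [polyVal, MvPolynomial.eval_monomial, hsplit u (fun _ _ => rfl), letterVal_false]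
        ring
      have h2 : ∀ ω, G ω * polyVal X (MvPolynomial.pderiv (bar (k, false))
          (MvPolynomial.monomial u c)) ω = u (k, true) *
          ((starRingEnd ℂ (X k ω) ^ u (k, false) * X k ω ^ (u (k, true) - 1)) *
            (G ω * (c * R ω))) := fun ω => by
        rw [polyVal, MvPolynomial.pderiv_monomial, MvPolynomial.eval_monomial, hsplit]
        · simp
          ring
        · rintro ⟨j, b⟩ hj
          have : ¬ k = j := fun h => hj h.symm
          simp [this]
      simp_rw [h1, h2]
      rw [integral_const_mul, hX.integral_indep_mul k hkS
          (f := fun z => starRingEnd ℂ z ^ (u (k, false) + 1) * z ^ u (k, true)) (by fun_prop) hH,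
        hX.integral_indep_mul k hkS
          (f := fun z => starRingEnd ℂ z ^ u (k, false) * z ^ (u (k, true) - 1)) (by fun_prop) hH,
        integral_conj_mul_pow_mul_pow]
      ring
    · have h1 : ∀ ω, G ω * (letterVal X (k, true) ω * polyVal X (MvPolynomial.monomial u c) ω) =
          (X k ω ^ (u (k, true) + 1) * starRingEnd ℂ (X k ω) ^ u (k, false)) *
            (G ω * (c * R ω)) := fun ω => by
        rw [polyVal, MvPolynomial.eval_monomial, hsplit u (fun _ _ => rfl), letterVal_true]
        ring
      have h2 : ∀ ω, G ω * polyVal X (MvPolynomial.pderiv (bar (k, true))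
          (MvPolynomial.monomial u c)) ω = u (k, false) *
          ((X k ω ^ u (k, true) * starRingEnd ℂ (X k ω) ^ (u (k, false) - 1)) *
            (G ω * (c * R ω))) := fun ω => by
        rw [polyVal, MvPolynomial.pderiv_monomial, MvPolynomial.eval_monomial, hsplit]
        · simp
          ring
        · rintro ⟨j, b⟩ hj
          have : ¬ k = j := fun h => hj h.symm
          simp [this]
      simp_rw [h1, h2]
      rw [integral_const_mul, hX.integral_indep_mul k hkS
          (f := fun z => z ^ (u (k, true) + 1) * starRingEnd ℂ z ^ u (k, false)) (by fun_prop) hH,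
        hX.integral_indep_mul k hkS
          (f := fun z => z ^ u (k, true) * starRingEnd ℂ z ^ (u (k, false) - 1)) (by fun_prop) hH,
        integral_mul_pow_mul_conj_pow]
      ring

theorem integral_letterVal_mul_polyVal [IsProbabilityMeasure P] (l : ι × Bool)
    (p : MvPolynomial (ι × Bool) ℂ) :
    ∫ ω, letterVal X l ω * polyVal X p ω ∂P =
      ∫ ω, polyVal X (MvPolynomial.pderiv (bar l) p) ω ∂P := by
  have := hX.integral_mul_letterVal_mul_polyVal (S := ∅) (G := fun _ => 1) measurable_const
    (memLp_const _) (l := l) (by simp) p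
  simpa using this

theorem integral_letterVal_mul_letterVal [IsProbabilityMeasure P] [DecidableEq ι]
    (l m : ι × Bool) :
    ∫ ω, letterVal X l ω * letterVal X m ω ∂P = if m = bar l then 1 else 0 := by
  have := hX.integral_letterVal_mul_polyVal l (MvPolynomial.X m)
  simp only [polyVal, MvPolynomial.eval_X, MvPolynomial.pderiv_X] at this
  rw [this]
  simp only [Pi.single_apply]
  split_ifs <;> simp

end GaussianFamily

end Family

end Phi42

end

noncomputable section

namespace Phi42

/-! ### Hypercontractivity -/

section Hyper

variable {Ω ι : Type*} {X : ι → Ω → ℂ}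

/-- The polynomial whose value is the complex conjugate. -/
def conjPoly (p : MvPolynomial (ι × Bool) ℂ) : MvPolynomial (ι × Bool) ℂ :=
  MvPolynomial.rename bar (MvPolynomial.map (starRingEnd ℂ) p)

theorem polyVal_conjPoly (p : MvPolynomial (ι × Bool) ℂ) (ω : Ω) :
    polyVal X (conjPoly p) ω = starRingEnd ℂ (polyVal X p ω) := by
  rw [polyVal, conjPoly, MvPolynomial.eval_rename, MvPolynomial.eval_map, polyVal,
    MvPolynomial.eval, MvPolynomial.coe_eval₂Hom, MvPolynomial.eval₂_comp_left]
  congr 1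
  funext l
  simp [letterVal_bar]

theorem pderiv_bar_conjPoly (l : ι × Bool) (p : MvPolynomial (ι × Bool) ℂ) :
    MvPolynomial.pderiv (bar l) (conjPoly p) = conjPoly (MvPolynomial.pderiv l p) := by
  rw [conjPoly, MvPolynomial.pderiv_rename bar_injective, MvPolynomial.pderiv_map, conjPoly]

theorem sum_letters_bar {M : Type*} [AddCommMonoid M] (B : Finset ι) (f : ι × Bool → M) :
    ∑ l ∈ letters B, f (bar l) = ∑ l ∈ letters B, f l :=
  Finset.sum_bij' (fun l _ => bar l) (fun l _ => bar l) (by simp) (by simp) (by simp) (by simp)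
    (by simp)

variable [MeasurableSpace Ω] {P : Measure Ω} [IsProbabilityMeasure P]

/-- Under the expectation, creation by l is transposed to the derivative along bar l: integrating
X_l by parts yields one term in which the derivative hits the first factor, and this is exactly what
the creation operator subtracts. -/
theorem GaussianFamily.integral_numberOp_mul (hX : GaussianFamily P X) (B : Finset ι)
    (f g : MvPolynomial (ι × Bool) ℂ) :
    ∫ ω, polyVal X (numberOp B f) ω * polyVal X g ω ∂P =
      ∑ l ∈ letters B, ∫ ω, polyVal X (MvPolynomial.pderiv l f) ω *
        polyVal X (MvPolynomial.pderiv (bar l) g) ω ∂P := by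
  simp_rw [numberOp, polyVal_sum, Finset.sum_mul]
  rw [integral_finsetSum]
  · refine Finset.sum_congr rfl fun l _ => ?_
    have h := hX.integral_letterVal_mul_polyVal l (MvPolynomial.pderiv l f * g)
    have h1 : ∀ ω, polyVal X (creation l (MvPolynomial.pderiv l f)) ω * polyVal X g ω =
        letterVal X l ω * polyVal X (MvPolynomial.pderiv l f * g) ω -
        polyVal X (MvPolynomial.pderiv (bar l) (MvPolynomial.pderiv l f)) ω * polyVal X g ω := by
      intro ω
      rw [creation_apply, polyVal_sub, polyVal_mul, polyVal_mul, polyVal_X]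
      ring
    simp_rw [h1]
    rw [integral_sub, h, ← integral_sub]
    · refine integral_congr_ae (.of_forall fun ω => ?_)
      simp only [MvPolynomial.pderiv_mul, polyVal_add, polyVal_mul]
      ring
    · exact (hX.hasMoments_polyVal _).integrable
    · exact ((hX.hasMoments_polyVal _).mul (hX.hasMoments_polyVal _)).integrable
    · exact ((hX.hasMoments_letterVal l).mul (hX.hasMoments_polyVal _)).integrable
    · exact ((hX.hasMoments_polyVal _).mul (hX.hasMoments_polyVal _)).integrable
  · exact fun l _ => ((hX.hasMoments_polyVal _).mul (hX.hasMoments_polyVal _)).integrable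

/-- The Gaussian moment Poincaré inequality for an eigenfunction of the number operator. -/
theorem GaussianFamily.moment_poincare (hX : GaussianFamily P X) {B : Finset ι}
    {f : MvPolynomial (ι × Bool) ℂ} {n : ℕ} (hf : numberOp B f = (n : ℂ) • f) (m : ℕ) :
    n * ∫ ω, ‖polyVal X f ω‖ ^ (2 * (m + 1)) ∂P ≤
      (2 * m + 1) * ∑ l ∈ letters B,
        ∫ ω, ‖polyVal X f ω‖ ^ (2 * m) * ‖polyVal X (MvPolynomial.pderiv l f) ω‖ ^ 2 ∂P := by
  -- This test function turns the left side into n E|f|^{2m+2}.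
  have key := hX.integral_numberOp_mul B f (f ^ m * conjPoly f ^ (m + 1))
  have h1 : ∀ ω, polyVal X (numberOp B f) ω * polyVal X (f ^ m * conjPoly f ^ (m + 1)) ω =
      n * ((‖polyVal X f ω‖ ^ (2 * (m + 1)) : ℝ) : ℂ) := by
    intro ω
    rw [hf, polyVal_smul, polyVal_mul, polyVal_pow, polyVal_pow, polyVal_conjPoly, pow_mul,
      ← Complex.normSq_eq_norm_sq, Complex.ofReal_pow, ← Complex.mul_conj]
    ring
  simp_rw [h1] at key
  rw [integral_const_mul, integral_complex_ofReal] at key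
  have h2 := congrArg norm key
  rw [norm_mul, Complex.norm_natCast, Complex.norm_real, Real.norm_of_nonneg
    (integral_nonneg fun ω => by positivity)] at h2
  rw [h2]
  set D : ι × Bool → Ω → ℝ := fun l ω => ‖polyVal X f ω‖ ^ (2 * m) *
    ‖polyVal X (MvPolynomial.pderiv l f) ω‖ ^ 2 with hD
  have hDint : ∀ l, Integrable (D l) P := fun l =>
    (((hX.hasMoments_polyVal f).norm.pow _).mul
      ((hX.hasMoments_polyVal (MvPolynomial.pderiv l f)).norm.pow _)).integrable
  -- The product rule gives m |∂_l f| |∂_{bar l} f| + (m+1) |∂_l f|², times |f|^{2m}. The mixed term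
  -- is split by the arithmetic-geometric mean inequality into halves, giving the coefficients m/2
  -- and m/2 + m + 1. After summation over all letters the bars disappear and the total is 2m + 1.
  have h3 : ∀ l, ‖∫ ω, polyVal X (MvPolynomial.pderiv l f) ω *
      polyVal X (MvPolynomial.pderiv (bar l) (f ^ m * conjPoly f ^ (m + 1))) ω ∂P‖ ≤
      m / 2 * (∫ ω, D (bar l) ω ∂P) + (3 * m / 2 + 1) * ∫ ω, D l ω ∂P := by
    intro l
    rw [← integral_const_mul, ← integral_const_mul, ← integral_add]
    · refine norm_integral_le_of_norm_le ?_ (.of_forall fun ω => ?_)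
      · exact ((hDint _).const_mul _).add ((hDint _).const_mul _)
      · rw [MvPolynomial.pderiv_mul, MvPolynomial.pderiv_pow, MvPolynomial.pderiv_pow,
          pderiv_bar_conjPoly, polyVal_add]
        have e1 : polyVal X (↑m * f ^ (m - 1) * MvPolynomial.pderiv (bar l) f *
            conjPoly f ^ (m + 1)) ω = m * polyVal X f ω ^ (m - 1) *
            polyVal X (MvPolynomial.pderiv (bar l) f) ω *
            starRingEnd ℂ (polyVal X f ω) ^ (m + 1) := by
          rw [polyVal_mul, polyVal_mul, polyVal_mul, polyVal_pow, polyVal_pow, polyVal_conjPoly]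
          simp [polyVal]
        have e2 : polyVal X (f ^ m * (↑(m + 1) * conjPoly f ^ (m + 1 - 1) *
            conjPoly (MvPolynomial.pderiv l f))) ω = polyVal X f ω ^ m * ((m + 1) *
            starRingEnd ℂ (polyVal X f ω) ^ m *
            starRingEnd ℂ (polyVal X (MvPolynomial.pderiv l f) ω)) := by
          rw [polyVal_mul, polyVal_mul, polyVal_mul, polyVal_pow, polyVal_pow, polyVal_conjPoly,
            polyVal_conjPoly]
          simp [polyVal]
        rw [e1, e2]
        have e3 : ‖(m : ℂ) * polyVal X f ω ^ (m - 1) *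
            polyVal X (MvPolynomial.pderiv (bar l) f) ω *
            starRingEnd ℂ (polyVal X f ω) ^ (m + 1)‖ = m * ‖polyVal X f ω‖ ^ (2 * m) *
            ‖polyVal X (MvPolynomial.pderiv (bar l) f) ω‖ := by
          rcases m with _ | m
          · simp
          · simp only [norm_mul, norm_pow, RCLike.norm_conj, Complex.norm_natCast,
              add_tsub_cancel_right]
            ring
        have e4 : ‖polyVal X f ω ^ m * ((m + 1) *
            starRingEnd ℂ (polyVal X f ω) ^ m *
            starRingEnd ℂ (polyVal X (MvPolynomial.pderiv l f) ω))‖ =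
            (m + 1) * ‖polyVal X f ω‖ ^ (2 * m) *
            ‖polyVal X (MvPolynomial.pderiv l f) ω‖ := by
          have : ‖(m : ℂ) + 1‖ = m + 1 := by
            rw [← Nat.cast_succ, Complex.norm_natCast]; simp
          simp only [norm_mul, norm_pow, RCLike.norm_conj, this]
          ring
        rw [norm_mul]
        refine (mul_le_mul_of_nonneg_left ((norm_add_le _ _).trans (add_le_add e3.le e4.le))
          (norm_nonneg _)).trans ?_
        simp only [hD]
        have hs := sq_nonneg (‖polyVal X (MvPolynomial.pderiv l f) ω‖ -
          ‖polyVal X (MvPolynomial.pderiv (bar l) f) ω‖)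
        have hc : 0 ≤ (m / 2 : ℝ) * ‖polyVal X f ω‖ ^ (2 * m) := by positivity
        nlinarith [mul_nonneg hc hs]
    · exact (hDint _).const_mul _
    · exact (hDint _).const_mul _
  refine (norm_sum_le _ _).trans ((Finset.sum_le_sum fun l _ => h3 l).trans ?_)
  rw [Finset.sum_add_distrib, ← Finset.mul_sum, ← Finset.mul_sum,
    sum_letters_bar B (fun l => ∫ ω, D l ω ∂P)]
  apply le_of_eq
  ring

/-- Hölder's inequality with exponents (m+1)/m and m+1. The case m = 0 is separate because the first
exponent is not finite there. -/
theorem integral_pow_mul_sq_le {a b : Ω → ℝ} (ha : HasMoments P a) (hb : HasMoments P b)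
    (ha0 : ∀ ω, 0 ≤ a ω) (hb0 : ∀ ω, 0 ≤ b ω) (m : ℕ) :
    ∫ ω, a ω ^ (2 * m) * b ω ^ 2 ∂P ≤
      (∫ ω, a ω ^ (2 * (m + 1)) ∂P) ^ ((m : ℝ) / (m + 1)) *
      (∫ ω, b ω ^ (2 * (m + 1)) ∂P) ^ ((1 : ℝ) / (m + 1)) := by
  rcases Nat.eq_zero_or_pos m with rfl | hm
  · simp
  have hm' : (0 : ℝ) < m := by exact_mod_cast hm
  have hpq : Real.HolderConjugate (((m : ℝ) + 1) / m) (m + 1) := by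
    rw [Real.holderConjugate_iff]
    refine ⟨by rw [lt_div_iff₀ hm']; linarith, ?_⟩
    field_simp
  have hml : ∀ {f : Ω → ℝ} (_ : HasMoments P f) (p : ℝ), MemLp f (ENNReal.ofReal p) P := by
    intro f hf p
    refine (hf ⌈p⌉₊).mono_exponent ?_
    rw [← ENNReal.ofReal_natCast]
    exact ENNReal.ofReal_le_ofReal (Nat.le_ceil p)
  have := integral_mul_le_Lp_mul_Lq_of_nonneg (μ := P) hpq (f := fun ω => a ω ^ (2 * m))
    (g := fun ω => b ω ^ 2) (.of_forall fun ω => by have := ha0 ω; positivity)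
    (.of_forall fun ω => by positivity) (hml (ha.pow _) _) (hml (hb.pow _) _)
  refine this.trans (le_of_eq ?_)
  congr 2
  · refine integral_congr_ae (.of_forall fun ω => ?_)
    simp only
    rw [← Real.rpow_natCast, ← Real.rpow_mul (ha0 ω), ← Real.rpow_natCast]
    congr 1
    push_cast
    field_simp
  · field_simp
  · refine integral_congr_ae (.of_forall fun ω => ?_)
    simp only
    rw [← Real.rpow_natCast, ← Real.rpow_mul (hb0 ω), ← Real.rpow_natCast]
    congr 1
    push_cast
    ring

/-- Hypercontractivity: the moments of an element of a homogeneous Wiener chaos are controlled by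
its top coefficients. -/
theorem GaussianFamily.moment_le (hX : GaussianFamily P X) {B : Finset ι} {n : ℕ}
    {f : MvPolynomial (ι × Bool) ℂ} {σ : ℝ} (hf : IsChaos B n f σ) (m : ℕ) :
    ∫ ω, ‖polyVal X f ω‖ ^ (2 * (m + 1)) ∂P ≤ ((2 * m + 1) ^ n * σ) ^ (m + 1) := by
  induction n generalizing f σ with
  | zero =>
    obtain ⟨c, rfl, hc⟩ := hf
    simp only [polyVal_C, integral_const, probReal_univ, smul_eq_mul, one_mul, pow_zero]
    rw [pow_mul]
    gcongr
  | succ n ih =>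
    have hσ := hf.nonneg
    obtain ⟨h1, τ, hτ, hs⟩ := hf
    set y := ∫ ω, ‖polyVal X f ω‖ ^ (2 * (m + 1)) ∂P with hy
    have hy0 : 0 ≤ y := integral_nonneg fun ω => by positivity
    have h2 := hX.moment_poincare h1 m
    rw [← hy] at h2
    have h3 : ∀ l ∈ letters B, ∫ ω, ‖polyVal X f ω‖ ^ (2 * m) *
        ‖polyVal X (MvPolynomial.pderiv l f) ω‖ ^ 2 ∂P ≤
        y ^ ((m : ℝ) / (m + 1)) * ((2 * m + 1) ^ n * τ l) := by
      intro l hl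
      have hτ0 := (hτ l hl).nonneg
      refine (integral_pow_mul_sq_le (hX.hasMoments_polyVal f).norm
        (hX.hasMoments_polyVal (MvPolynomial.pderiv l f)).norm (fun _ => norm_nonneg _)
        (fun _ => norm_nonneg _) m).trans ?_
      rw [← hy]
      refine mul_le_mul_of_nonneg_left ?_ (by positivity)
      refine (Real.rpow_le_rpow (integral_nonneg fun ω => by positivity) (ih (hτ l hl))
        (by positivity)).trans (le_of_eq ?_)
      rw [← Real.rpow_natCast, ← Real.rpow_mul (by positivity)]
      push_cast
      rw [mul_one_div_cancel (by positivity), Real.rpow_one]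
    -- The Poincaré inequality, Hölder and the induction hypothesis for the derivatives bound y by a
    -- multiple of its own power m/(m+1). If y > 0 that power can be divided out, leaving a bound on
    -- y^{1/(m+1)}.
    have h4 : ((n + 1 : ℕ) : ℝ) * y ≤ (2 * m + 1) ^ (n + 1) * σ * y ^ ((m : ℝ) / (m + 1)) := by
      refine h2.trans ?_
      refine (mul_le_mul_of_nonneg_left (Finset.sum_le_sum h3) (by positivity)).trans ?_
      rw [← Finset.mul_sum, ← Finset.mul_sum]
      have : 0 ≤ y ^ ((m : ℝ) / (m + 1)) * (2 * m + 1) ^ (n + 1) := by positivity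
      calc _ = y ^ ((m : ℝ) / (m + 1)) * (2 * m + 1) ^ (n + 1) * ∑ l ∈ letters B, τ l := by ring
        _ ≤ y ^ ((m : ℝ) / (m + 1)) * (2 * m + 1) ^ (n + 1) * σ := by gcongr
        _ = _ := by ring
    have h5 : y ≤ (2 * m + 1) ^ (n + 1) * σ * y ^ ((m : ℝ) / (m + 1)) := by
      refine le_trans ?_ h4
      have : (1 : ℝ) ≤ ((n + 1 : ℕ) : ℝ) := by push_cast; linarith [(Nat.cast_nonneg n : (0:ℝ) ≤ n)]
      nlinarith
    rcases hy0.eq_or_lt with h0 | hpos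
    · rw [← h0]; positivity
    · have h6 : y ^ ((1 : ℝ) / (m + 1)) ≤ (2 * m + 1) ^ (n + 1) * σ := by
        have h7 : y = y ^ ((1 : ℝ) / (m + 1)) * y ^ ((m : ℝ) / (m + 1)) := by
          rw [← Real.rpow_add hpos, ← add_div, add_comm (1 : ℝ), div_self (by positivity),
            Real.rpow_one]
        exact le_of_mul_le_mul_right (h7.symm.le.trans h5) (by positivity)
      calc y = (y ^ ((1 : ℝ) / (m + 1))) ^ (m + 1) := by
            rw [← Real.rpow_natCast, ← Real.rpow_mul hy0]
            push_cast
            rw [one_div_mul_cancel (by positivity), Real.rpow_one]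
        _ ≤ _ := by gcongr

end Hyper

end Phi42

end

noncomputable section

namespace Phi42

/-! ### The cutoff interaction in Fourier space -/

section Interaction

variable {Ω ι : Type*} [AddCommGroup ι] [DecidableEq ι] {X : ι → Ω → ℂ}

/-- The Fourier coefficient at `q` of the Wick square of the field with amplitudes `a`. -/
def density (X : ι → Ω → ℂ) (B : Finset ι) (a : ι → ℝ) (q : ι) (ω : Ω) : ℂ :=
  ∑ k ∈ B, ∑ l ∈ B, if l - k = q then
    (a k * a l : ℝ) * (starRingEnd ℂ (X k ω) * X l ω - if k = l then 1 else 0) else 0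

/-- The differences of elements of a finite set. -/
def diffs (B : Finset ι) : Finset ι := (B ×ˢ B).image fun p => p.2 - p.1

/-- The interaction with weight `w`, amplitudes `a` and counterterms `τ`, `E`. -/
def cutoffInteraction (X : ι → Ω → ℂ) (B : Finset ι) (w a : ι → ℝ) (τ E : ℝ) (ω : Ω) : ℝ :=
  (1 / 2) * ∑ q ∈ diffs B, w q * ‖density X B a q ω‖ ^ 2
    - τ * ∑ k ∈ B, a k ^ 2 * (‖X k ω‖ ^ 2 - 1) - E

/-- The quartic chaos with coefficients `A`. -/
def quarticPoly (B : Finset ι) (A : ι → ι → ι → ι → ℝ) : MvPolynomial (ι × Bool) ℂ :=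
  ∑ k ∈ B, creation (k, false) (∑ l' ∈ B, creation (l', false)
    (∑ l ∈ B, creation (l, true) (∑ k' ∈ B, creation (k', true)
      (MvPolynomial.C (A k l' l k' : ℂ)))))

/-- The diagonal quadratic chaos with coefficients `b`. -/
def quadraticPoly (B : Finset ι) (b : ι → ℝ) : MvPolynomial (ι × Bool) ℂ :=
  ∑ k ∈ B, creation (k, false) (∑ l ∈ B, creation (l, true)
      (MvPolynomial.C ((if k = l then b k else 0 : ℝ) : ℂ)))

/-- The coefficients of the quartic part of the interaction. -/
def coeffQuartic (w a : ι → ℝ) (k l' l k' : ι) : ℝ :=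
  if l - k = l' - k' then (1 / 2) * w (l - k) * (a k * a l' * a l * a k') else 0

/-- The coefficients of the quadratic part of the interaction. -/
def coeffQuadratic (B : Finset ι) (w a : ι → ℝ) (τ : ℝ) (l : ι) : ℝ :=
  a l ^ 2 * (∑ k ∈ B, w (l - k) * a k ^ 2 - τ)

/-- The constant part of the interaction. -/
def coeffConst (B : Finset ι) (w a : ι → ℝ) (E : ℝ) : ℝ :=
  (1 / 2) * ∑ k ∈ B, ∑ l ∈ B, w (l - k) * (a k ^ 2 * a l ^ 2) - E

/-- The constant is the product 1 · 4 · 10 · 22 of the first four values of `chaosConst`. In degree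
two the same computation gives 1 · 4. -/
theorem isChaos_quarticPoly (B : Finset ι) (A : ι → ι → ι → ι → ℝ) :
    IsChaos B 4 (quarticPoly B A)
      (880 * ∑ k ∈ B, ∑ l' ∈ B, ∑ l ∈ B, ∑ k' ∈ B, A k l' l k' ^ 2) := by
  have := IsChaos.sum_creation_mode (B := B) (n := 3) false (fun k _ =>
    IsChaos.sum_creation_mode (n := 2) false (fun l' _ =>
    IsChaos.sum_creation_mode (n := 1) true (fun l _ =>
    IsChaos.sum_creation_mode (n := 0) true (fun k' _ =>
      show IsChaos B 0 (MvPolynomial.C (A k l' l k' : ℂ)) (A k l' l k' ^ 2) from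
        ⟨_, rfl, by simp⟩))))
  refine this.mono (le_of_eq ?_)
  simp only [chaosConst, ← Finset.mul_sum]
  ring

theorem isChaos_quadraticPoly (B : Finset ι) (b : ι → ℝ) :
    IsChaos B 2 (quadraticPoly B b) (4 * ∑ k ∈ B, b k ^ 2) := by
  have := IsChaos.sum_creation_mode (B := B) (n := 1) false (fun k _ =>
    IsChaos.sum_creation_mode (n := 0) true (fun l _ =>
      show IsChaos B 0 (MvPolynomial.C ((if k = l then b k else 0 : ℝ) : ℂ))
        (if k = l then b k ^ 2 else 0) from ⟨_, rfl, by split_ifs <;> simp⟩))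
  refine this.mono (le_of_eq ?_)
  simp only [chaosConst, ← Finset.mul_sum]
  rw [Finset.sum_congr rfl fun k hk => by rw [Finset.sum_ite_eq B k, if_pos hk]]
  ring

theorem creation_C (l : ι × Bool) (c : ℂ) :
    creation l (MvPolynomial.C c) = MvPolynomial.C c * MvPolynomial.X l := by
  rw [creation_apply, MvPolynomial.pderiv_C, sub_zero, mul_comm]

theorem creation_C_mul (l : ι × Bool) (c : ℂ) (p : MvPolynomial (ι × Bool) ℂ) :
    creation l (MvPolynomial.C c * p) = MvPolynomial.C c * creation l p := by
  rw [← MvPolynomial.smul_eq_C_mul, map_smul, MvPolynomial.smul_eq_C_mul]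

theorem polyVal_wick_two (k l : ι) (ω : Ω) :
    polyVal X (creation (k, false) (MvPolynomial.X (l, true))) ω =
      starRingEnd ℂ (X k ω) * X l ω - if k = l then 1 else 0 := by
  rw [creation_apply, MvPolynomial.pderiv_X, polyVal_sub, polyVal_mul, polyVal_X, polyVal_X]
  by_cases h : k = l
  · subst h; simp [polyVal]
  · have h' : ¬ l = k := fun h2 => h h2.symm
    simp [polyVal, h, h', Pi.single_apply]

/-- The Wick product of four letters, arranged for comparison with a product of two Wick squares.
The terms subtracted are the contractions between the two squares: one contraction leaves a
quadratic term, two leave a constant. -/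
theorem polyVal_wick_four (k l' l k' : ι) (ω : Ω) :
    polyVal X (creation (k, false) (creation (l', false) (creation (l, true)
      (MvPolynomial.X (k', true))))) ω =
      (starRingEnd ℂ (X k ω) * X l ω - if k = l then 1 else 0) *
        (starRingEnd ℂ (X l' ω) * X k' ω - if l' = k' then 1 else 0)
      - (if k = k' then (starRingEnd ℂ (X l' ω) * X l ω - if l' = l then 1 else 0) else 0)
      - (if l' = l then (starRingEnd ℂ (X k ω) * X k' ω - if k = k' then 1 else 0) else 0)
      - (if k = k' then if l' = l then 1 else 0 else 0) := by
  have h1 : creation (l, true) (MvPolynomial.X (k', true)) =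
      (MvPolynomial.X (l, true) * MvPolynomial.X (k', true) : MvPolynomial (ι × Bool) ℂ) := by
    rw [creation_apply, MvPolynomial.pderiv_X_of_ne (by simp), sub_zero]
  have hd : ∀ i j : ι, MvPolynomial.pderiv (bar (i, false))
      (MvPolynomial.X (j, true) : MvPolynomial (ι × Bool) ℂ) =
      MvPolynomial.C (if i = j then 1 else 0) := by
    intro i j
    by_cases h : i = j
    · subst h; simp
    · have h' : ¬ j = i := fun h2 => h h2.symm
      rw [MvPolynomial.pderiv_X_of_ne (by simp [h'])]; simp [h]
  have hd' : ∀ i j : ι, MvPolynomial.pderiv (bar (i, false))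
      (MvPolynomial.X (j, false) : MvPolynomial (ι × Bool) ℂ) = 0 := fun i j =>
    MvPolynomial.pderiv_X_of_ne (by simp)
  rw [h1, creation_apply (l', false), MvPolynomial.pderiv_mul, hd, hd, creation_apply, map_sub,
    map_add, MvPolynomial.pderiv_mul, MvPolynomial.pderiv_mul, MvPolynomial.pderiv_mul,
    MvPolynomial.pderiv_mul, hd', hd, hd, MvPolynomial.pderiv_C, MvPolynomial.pderiv_C]
  simp only [polyVal_sub, polyVal_add, polyVal_mul, polyVal_X, polyVal_C, letterVal_true,
    letterVal_false]
  simp only [polyVal, map_zero]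
  have hm : ∀ (p : Prop) [Decidable p] (z : ℂ), (if p then z else 0) = (if p then 1 else 0) * z :=
    fun p _ z => by split_ifs <;> simp
  rw [hm (k = k') (_ - _), hm (l' = l) (_ - _), hm (k = k') (if l' = l then 1 else 0)]
  ring

theorem polyVal_quarticPoly (B : Finset ι) (A : ι → ι → ι → ι → ℝ) (ω : Ω) :
    polyVal X (quarticPoly B A) ω = ∑ k ∈ B, ∑ l' ∈ B, ∑ l ∈ B, ∑ k' ∈ B, (A k l' l k' : ℂ) *
      polyVal X (creation (k, false) (creation (l', false) (creation (l, true)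
      (MvPolynomial.X (k', true))))) ω := by
  simp only [quarticPoly, map_sum, polyVal_sum, creation_C, creation_C_mul, polyVal_mul, polyVal_C]

theorem polyVal_quadraticPoly (B : Finset ι) (b : ι → ℝ) (ω : Ω) :
    polyVal X (quadraticPoly B b) ω = ∑ k ∈ B, ((b k * (‖X k ω‖ ^ 2 - 1) : ℝ) : ℂ) := by
  simp only [quadraticPoly, map_sum, polyVal_sum, creation_C, creation_C_mul, polyVal_mul,
    polyVal_C, polyVal_wick_two]
  refine Finset.sum_congr rfl fun k hk => ?_
  rw [Finset.sum_eq_single k]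
  · simp only [if_true]
    rw [mul_comm (starRingEnd ℂ (X k ω)), Complex.mul_conj, Complex.normSq_eq_norm_sq]
    push_cast; rfl
  · intro l _ hl
    simp [Ne.symm hl]
  · exact fun h => absurd hk h

/-- After expansion of |ρ_q|² the sum over q selects q = l − k and leaves the momentum constraint l
− k = l' − k', which is built into `coeffQuartic`; the factor 2 undoes the 1/2 contained there. -/
theorem sum_diffs_mul_norm_density_sq (B : Finset ι) (w a : ι → ℝ) (ω : Ω) :
    ((∑ q ∈ diffs B, w q * ‖density X B a q ω‖ ^ 2 : ℝ) : ℂ) =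
      ∑ k ∈ B, ∑ l' ∈ B, ∑ l ∈ B, ∑ k' ∈ B, (2 * coeffQuartic w a k l' l k' : ℝ) *
        ((starRingEnd ℂ (X k ω) * X l ω - if k = l then 1 else 0) *
          (starRingEnd ℂ (X l' ω) * X k' ω - if l' = k' then 1 else 0)) := by
  have h1 : ∀ q, ((w q * ‖density X B a q ω‖ ^ 2 : ℝ) : ℂ) =
      ∑ k ∈ B, ∑ l ∈ B, ∑ k' ∈ B, ∑ l' ∈ B, if l - k = q then
        (2 * coeffQuartic w a k l' l k' : ℝ) *
        ((starRingEnd ℂ (X k ω) * X l ω - if k = l then 1 else 0) *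
          (starRingEnd ℂ (X l' ω) * X k' ω - if l' = k' then 1 else 0)) else 0 := by
    intro q
    rw [Complex.ofReal_mul, ← Complex.normSq_eq_norm_sq, ← Complex.mul_conj]
    simp only [density, map_sum]
    rw [Finset.sum_mul, Finset.mul_sum]
    refine Finset.sum_congr rfl fun k _ => ?_
    rw [Finset.sum_mul, Finset.mul_sum]
    refine Finset.sum_congr rfl fun l _ => ?_
    rw [Finset.mul_sum, Finset.mul_sum]
    refine Finset.sum_congr rfl fun k' _ => ?_
    rw [Finset.mul_sum, Finset.mul_sum]
    refine Finset.sum_congr rfl fun l' _ => ?_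
    by_cases e1 : l - k = q
    · subst e1
      by_cases e2 : l - k = l' - k'
      · have e3 : (l' = k') ↔ (k' = l') := eq_comm
        rw [if_pos rfl, if_pos e2.symm, if_pos rfl, coeffQuartic, if_pos e2]
        simp only [e3]
        by_cases e4 : k' = l' <;> simp only [e4, if_true, if_false, map_mul, map_sub,
          Complex.conj_conj, map_one, map_zero, Complex.conj_ofReal] <;> push_cast <;> ring
      · have e3 : ¬ l' - k' = l - k := fun h => e2 h.symm
        simp only [coeffQuartic, if_neg e2, if_neg e3]
        simp
    · rw [if_neg e1, if_neg e1]; simp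
  rw [Complex.ofReal_sum, Finset.sum_congr rfl fun q _ => h1 q, Finset.sum_comm]
  refine Finset.sum_congr rfl fun k hk => ?_
  rw [Finset.sum_comm, Finset.sum_comm (s := B) (t := B)
    (f := fun l' l => ∑ k' ∈ B, _)]
  refine Finset.sum_congr rfl fun l hl => ?_
  rw [Finset.sum_comm, Finset.sum_comm (s := B) (t := B) (f := fun l' k' => _ * _)]
  refine Finset.sum_congr rfl fun k' hk' => ?_
  rw [Finset.sum_comm]
  refine Finset.sum_congr rfl fun l' hl' => ?_
  rw [Finset.sum_ite_eq, if_pos]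
  exact Finset.mem_image.2 ⟨(k, l), Finset.mem_product.2 ⟨hk, hl⟩, rfl⟩

/-- The chaos decomposition of the interaction. -/
theorem cutoffInteraction_eq (B : Finset ι) {w : ι → ℝ} (hw : ∀ k, w (-k) = w k) (a : ι → ℝ)
    (τ E : ℝ) (ω : Ω) :
    (cutoffInteraction X B w a τ E ω : ℂ) = polyVal X (quarticPoly B (coeffQuartic w a)) ω +
      polyVal X (quadraticPoly B (coeffQuadratic B w a τ)) ω + (coeffConst B w a E : ℂ) := by
  have hq : ∀ k l' l k' : ι, ((2 * coeffQuartic w a k l' l k' : ℝ) : ℂ) *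
        ((starRingEnd ℂ (X k ω) * X l ω - if k = l then 1 else 0) *
          (starRingEnd ℂ (X l' ω) * X k' ω - if l' = k' then 1 else 0)) =
      2 * ((coeffQuartic w a k l' l k' : ℂ) *
        polyVal X (creation (k, false) (creation (l', false) (creation (l, true)
        (MvPolynomial.X (k', true))))) ω) +
      (if k = k' then if l' = l then ((w (l - k) * (a k ^ 2 * a l ^ 2) *
        ((‖X l ω‖ ^ 2 - 1) + (‖X k ω‖ ^ 2 - 1) + 1) : ℝ) : ℂ) else 0 else 0) := by
    intro k l' l k'
    rw [polyVal_wick_four]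
    by_cases e : l - k = l' - k'
    -- Momentum conservation makes the two possible cross contractions occur together, so the
    -- lower-order terms live on the diagonal l' = l, k' = k alone.
    · have e' : l' = l ↔ k = k' := by
        constructor
        · rintro rfl; exact sub_right_injective e
        · rintro rfl; exact (sub_left_injective e).symm
      by_cases e2 : k = k'
      · have e3 := e'.2 e2
        subst e2 e3
        have hn : ∀ i : ι, starRingEnd ℂ (X i ω) * X i ω = ((‖X i ω‖ ^ 2 : ℝ) : ℂ) := fun i => by
          rw [mul_comm, Complex.mul_conj, Complex.normSq_eq_norm_sq]
        simp only [if_true, coeffQuartic, hn]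
        push_cast
        ring
      · have e3 : ¬ l' = l := fun h => e2 (e'.1 h)
        simp only [if_neg e2, if_neg e3]
        push_cast
        ring
    · have : ¬ (k = k' ∧ l' = l) := by rintro ⟨rfl, rfl⟩; exact e rfl
      simp only [coeffQuartic, if_neg e]
      by_cases e2 : k = k'
      · have e3 : ¬ l' = l := fun h => this ⟨e2, h⟩
        simp [e2, e3]
      · simp [e2]
  have h1 := sum_diffs_mul_norm_density_sq (X := X) B w a ω
  simp_rw [hq, Finset.sum_add_distrib, ← Finset.mul_sum] at h1
  rw [← polyVal_quarticPoly] at h1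
  have h2 : ∑ k ∈ B, ∑ l' ∈ B, ∑ l ∈ B, ∑ k' ∈ B, (if k = k' then if l' = l then
      ((w (l - k) * (a k ^ 2 * a l ^ 2) * ((‖X l ω‖ ^ 2 - 1) + (‖X k ω‖ ^ 2 - 1) + 1) : ℝ) : ℂ)
      else 0 else 0) = ((∑ k ∈ B, ∑ l ∈ B, w (l - k) * (a k ^ 2 * a l ^ 2) *
      ((‖X l ω‖ ^ 2 - 1) + (‖X k ω‖ ^ 2 - 1) + 1) : ℝ) : ℂ) := by
    push_cast
    refine Finset.sum_congr rfl fun k hk => ?_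
    rw [Finset.sum_comm]
    refine Finset.sum_congr rfl fun l hl => ?_
    rw [Finset.sum_eq_single l, Finset.sum_eq_single k]
    · simp
    · intro k' _ hk'; simp [Ne.symm hk']
    · exact fun h => absurd hk h
    · intro l' _ hl'; simp [hl']
    · exact fun h => absurd hl h
  rw [h2] at h1
  have h3 : ∑ k ∈ B, ∑ l ∈ B, w (l - k) * (a k ^ 2 * a l ^ 2) *
      ((‖X l ω‖ ^ 2 - 1) + (‖X k ω‖ ^ 2 - 1) + 1) =
      2 * ∑ l ∈ B, a l ^ 2 * (∑ k ∈ B, w (l - k) * a k ^ 2) * (‖X l ω‖ ^ 2 - 1) +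
      ∑ k ∈ B, ∑ l ∈ B, w (l - k) * (a k ^ 2 * a l ^ 2) := by
    -- Evenness of w permits the exchange of k and l, so both single contractions contribute the
    -- same diagonal quadratic term.
    have e1 : ∑ k ∈ B, ∑ l ∈ B, w (l - k) * (a k ^ 2 * a l ^ 2) * (‖X k ω‖ ^ 2 - 1) =
        ∑ k ∈ B, ∑ l ∈ B, w (l - k) * (a k ^ 2 * a l ^ 2) * (‖X l ω‖ ^ 2 - 1) := by
      rw [Finset.sum_comm]
      refine Finset.sum_congr rfl fun k _ => Finset.sum_congr rfl fun l _ => ?_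
      rw [← hw (k - l), neg_sub]; ring
    have e2 : ∑ k ∈ B, ∑ l ∈ B, w (l - k) * (a k ^ 2 * a l ^ 2) * (‖X l ω‖ ^ 2 - 1) =
        ∑ l ∈ B, a l ^ 2 * (∑ k ∈ B, w (l - k) * a k ^ 2) * (‖X l ω‖ ^ 2 - 1) := by
      rw [Finset.sum_comm]
      refine Finset.sum_congr rfl fun l _ => ?_
      rw [Finset.mul_sum, Finset.sum_mul]
      exact Finset.sum_congr rfl fun k _ => by ring
    simp_rw [mul_add, Finset.sum_add_distrib, e1, e2, mul_one]
    ring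
  rw [h3] at h1
  rw [polyVal_quadraticPoly, cutoffInteraction, Complex.ofReal_sub, Complex.ofReal_sub,
    Complex.ofReal_mul, h1]
  simp only [coeffQuadratic, coeffConst]
  have h4 : ∑ l ∈ B, (((a l ^ 2 * (∑ k ∈ B, w (l - k) * a k ^ 2 - τ)) * (‖X l ω‖ ^ 2 - 1) : ℝ) : ℂ) =
      ((∑ l ∈ B, a l ^ 2 * (∑ k ∈ B, w (l - k) * a k ^ 2) * (‖X l ω‖ ^ 2 - 1) : ℝ) : ℂ) -
      ((τ * ∑ k ∈ B, a k ^ 2 * (‖X k ω‖ ^ 2 - 1) : ℝ) : ℂ) := by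
    rw [Finset.mul_sum, ← Complex.ofReal_sub, ← Finset.sum_sub_distrib, Complex.ofReal_sum]
    exact Finset.sum_congr rfl fun l _ => by congr 1; ring
  rw [h4]
  push_cast
  ring

/-- The interaction is bounded below. -/
theorem cutoffInteraction_ge (B : Finset ι) {w : ι → ℝ} (hw : ∀ k, 0 ≤ w k) (hw0 : w 0 = 1)
    (a : ι → ℝ) (τ E : ℝ) (ω : Ω) : -(τ ^ 2 / 2) - E ≤ cutoffInteraction X B w a τ E ω := by
  have h0 : density X B a 0 ω = ((∑ k ∈ B, a k ^ 2 * (‖X k ω‖ ^ 2 - 1) : ℝ) : ℂ) := by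
    rw [density, Complex.ofReal_sum]
    refine Finset.sum_congr rfl fun k hk => ?_
    rw [Finset.sum_eq_single k]
    · simp only [sub_self, if_true]
      rw [mul_comm (starRingEnd ℂ (X k ω)), Complex.mul_conj, Complex.normSq_eq_norm_sq]
      push_cast
      ring
    · intro l _ hl; rw [if_neg (by rwa [sub_eq_zero])]
    · exact fun h => absurd hk h
  -- Of the nonnegative sum only q = 0 is kept. Since ρ_0 is precisely the sum multiplied by τ,
  -- completing the square (1/2) x² − τ x ≥ −τ²/2 finishes the bound.
  have h1 : ‖density X B a 0 ω‖ ^ 2 ≤ ∑ q ∈ diffs B, w q * ‖density X B a q ω‖ ^ 2 := by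
    by_cases hB : (0 : ι) ∈ diffs B
    · have := Finset.single_le_sum (f := fun q => w q * ‖density X B a q ω‖ ^ 2)
        (fun q _ => mul_nonneg (hw q) (by positivity)) hB
      simpa [hw0] using this
    · have hB' : B = ∅ := by
        by_contra hne
        obtain ⟨k, hk⟩ := Finset.nonempty_iff_ne_empty.2 hne
        exact hB (Finset.mem_image.2 ⟨(k, k), by simp [hk], by simp⟩)
      subst hB'
      simp [density, diffs]
  rw [h0, Complex.norm_real, Real.norm_eq_abs, sq_abs] at h1
  rw [cutoffInteraction]
  nlinarith [sq_nonneg (∑ k ∈ B, a k ^ 2 * (‖X k ω‖ ^ 2 - 1) - τ)]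

/-- Enlarging the set of modes does not change the interaction if the amplitudes vanish there. -/
theorem cutoffInteraction_of_subset {B C : Finset ι} (hBC : B ⊆ C) (w : ι → ℝ) {a : ι → ℝ}
    (ha : ∀ k ∉ B, a k = 0) (τ E : ℝ) (ω : Ω) :
    cutoffInteraction X C w a τ E ω = cutoffInteraction X B w a τ E ω := by
  have h1 : ∀ q, density X C a q ω = density X B a q ω := by
    intro q
    rw [density, density]
    symm
    refine (Finset.sum_subset hBC fun k _ hk => ?_).trans
      (Finset.sum_congr rfl fun k _ => Finset.sum_subset hBC fun l _ hl => ?_)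
    · simp [ha k hk]
    · simp [ha l hl]
  rw [cutoffInteraction, cutoffInteraction]
  simp_rw [h1]
  have h2 : diffs B ⊆ diffs C :=
    Finset.image_subset_image (Finset.product_subset_product hBC hBC)
  have h3 : ∑ q ∈ diffs C, w q * ‖density X B a q ω‖ ^ 2 =
      ∑ q ∈ diffs B, w q * ‖density X B a q ω‖ ^ 2 := by
    refine (Finset.sum_subset h2 fun q _ hq => ?_).symm
    have : density X B a q ω = 0 := by
      refine Finset.sum_eq_zero fun k hk => Finset.sum_eq_zero fun l hl => if_neg fun h => hq ?_
      exact Finset.mem_image.2 ⟨(k, l), by simp [hk, hl], h⟩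
    simp [this]
  have h4 : ∑ k ∈ C, a k ^ 2 * (‖X k ω‖ ^ 2 - 1) = ∑ k ∈ B, a k ^ 2 * (‖X k ω‖ ^ 2 - 1) :=
    (Finset.sum_subset hBC fun k _ hk => by simp [ha k hk]).symm
  rw [h3, h4]

theorem quarticPoly_sub (B : Finset ι) (A A' : ι → ι → ι → ι → ℝ) :
    quarticPoly B A - quarticPoly B A' =
      quarticPoly B fun k l' l k' => A k l' l k' - A' k l' l k' := by
  simp only [quarticPoly, ← Finset.sum_sub_distrib, ← map_sub, Complex.ofReal_sub]

theorem quadraticPoly_sub (B : Finset ι) (b b' : ι → ℝ) :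
    quadraticPoly B b - quadraticPoly B b' = quadraticPoly B fun k => b k - b' k := by
  simp only [quadraticPoly, ← Finset.sum_sub_distrib, ← map_sub, ← Complex.ofReal_sub]
  refine Finset.sum_congr rfl fun k _ => congrArg _ (Finset.sum_congr rfl fun l _ => ?_)
  split_ifs <;> simp

variable [MeasurableSpace Ω] {P : Measure Ω} [IsProbabilityMeasure P]

theorem pow_add_three_le {x y z : ℝ} (hx : 0 ≤ x) (hy : 0 ≤ y) (hz : 0 ≤ z) (n : ℕ) :
    (x + y + z) ^ n ≤ 3 ^ n * (x ^ n + y ^ n + z ^ n) := by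
  set M := max x (max y z) with hM
  have h1 : x + y + z ≤ 3 * M := by
    have := le_max_left x (max y z)
    have := (le_max_left y z).trans (le_max_right x (max y z))
    have := (le_max_right y z).trans (le_max_right x (max y z))
    linarith
  have h2 : M ^ n ≤ x ^ n + y ^ n + z ^ n := by
    have := pow_nonneg hx n
    have := pow_nonneg hy n
    have := pow_nonneg hz n
    rcases max_choice x (max y z) with h | h
    · rw [hM, h]; linarith
    · rcases max_choice y z with h' | h' <;> rw [hM, h, h'] <;> linarith
  calc (x + y + z) ^ n ≤ (3 * M) ^ n := by gcongr
    _ = 3 ^ n * M ^ n := mul_pow _ _ _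
    _ ≤ _ := by gcongr

theorem pow_add_pow_add_pow_le {x y z : ℝ} (hx : 0 ≤ x) (hy : 0 ≤ y) (hz : 0 ≤ z) (n : ℕ) :
    x ^ (n + 1) + y ^ (n + 1) + z ^ (n + 1) ≤ (x + y + z) ^ (n + 1) := by
  have h1 : x ^ n ≤ (x + y + z) ^ n := by gcongr; linarith
  have h2 : y ^ n ≤ (x + y + z) ^ n := by gcongr; linarith
  have h3 : z ^ n ≤ (x + y + z) ^ n := by gcongr; linarith
  rw [pow_succ, pow_succ, pow_succ, pow_succ]
  nlinarith [mul_le_mul_of_nonneg_right h1 hx, mul_le_mul_of_nonneg_right h2 hy,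
    mul_le_mul_of_nonneg_right h3 hz]

/-- Merges the hypercontractive bounds of degrees 4, 2 and 0 into one with the quartic growth K⁴,
the worst of the three; the 9 is 3² from splitting a sum of three terms. -/
theorem three_moments_le {y₄ y₂ S₄ S₂ c K : ℝ} {n : ℕ} (hK : 1 ≤ K) (hS₄ : 0 ≤ S₄) (hS₂ : 0 ≤ S₂)
    (h4 : y₄ ≤ (K ^ 4 * S₄) ^ (n + 1)) (h2 : y₂ ≤ (K ^ 2 * S₂) ^ (n + 1)) :
    3 ^ (2 * (n + 1)) * (y₄ + y₂ + |c| ^ (2 * (n + 1))) ≤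
      (9 * K ^ 4 * (S₄ + S₂ + c ^ 2)) ^ (n + 1) := by
  have hK2 : K ^ 2 ≤ K ^ 4 := pow_le_pow_right₀ hK (by norm_num)
  have h2' : y₂ ≤ (K ^ 4 * S₂) ^ (n + 1) := h2.trans (by gcongr)
  have hc : |c| ^ (2 * (n + 1)) ≤ (K ^ 4 * c ^ 2) ^ (n + 1) := by
    rw [pow_mul, sq_abs]
    refine pow_le_pow_left₀ (by positivity) ?_ _
    exact le_mul_of_one_le_left (by positivity) (one_le_pow₀ hK)
  have h5 := pow_add_pow_add_pow_le (x := K ^ 4 * S₄) (y := K ^ 4 * S₂) (z := K ^ 4 * c ^ 2)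
    (by positivity) (by positivity) (by positivity) n
  calc _ ≤ 3 ^ (2 * (n + 1)) * (K ^ 4 * S₄ + K ^ 4 * S₂ + K ^ 4 * c ^ 2) ^ (n + 1) := by
        gcongr
        linarith
    _ = _ := by
        rw [pow_mul, ← mul_pow]
        congr 1
        ring

theorem GaussianFamily.hasMoments_cutoffInteraction (hX : GaussianFamily P X) (B : Finset ι)
    (w a : ι → ℝ) (τ E : ℝ) : HasMoments P (cutoffInteraction X B w a τ E) := by
  have h1 : ∀ q, HasMoments P (density X B a q) := fun q =>
    HasMoments.sum _ fun k _ => HasMoments.sum _ fun l _ => by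
      split_ifs
      · exact (HasMoments.const _).mul (((hX.hasMoments_letterVal (k, false)).congr
          (by simp)).mul (hX.hasMoments l) |>.sub (HasMoments.const _))
      · exact (HasMoments.const _).mul (((hX.hasMoments_letterVal (k, false)).congr
          (by simp)).mul (hX.hasMoments l) |>.sub (HasMoments.const _))
      · exact HasMoments.const _
  refine HasMoments.sub (HasMoments.sub ((HasMoments.const _).mul (HasMoments.sum _ fun q _ => ?_))
    ((HasMoments.const _).mul (HasMoments.sum _ fun k _ => ?_))) (HasMoments.const _)
  · exact (HasMoments.const _).mul ((h1 q).norm.pow 2)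
  · exact (HasMoments.const _).mul (((hX.hasMoments k).norm.pow 2).sub (HasMoments.const _))

/-- The moments of a difference of two interactions. -/
theorem GaussianFamily.moment_cutoffInteraction_sub_le (hX : GaussianFamily P X) (B : Finset ι)
    {w w' : ι → ℝ} (hw : ∀ k, w (-k) = w k) (hw' : ∀ k, w' (-k) = w' k) (a a' : ι → ℝ)
    (τ E τ' E' : ℝ) (m : ℕ) :
    ∫ ω, |cutoffInteraction X B w a τ E ω - cutoffInteraction X B w' a' τ' E' ω|
        ^ (2 * (m + 1)) ∂P ≤
      (9 * (2 * m + 1) ^ 4 * (880 * (∑ k ∈ B, ∑ l' ∈ B, ∑ l ∈ B, ∑ k' ∈ B,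
          (coeffQuartic w a k l' l k' - coeffQuartic w' a' k l' l k') ^ 2) +
        4 * (∑ k ∈ B, (coeffQuadratic B w a τ k - coeffQuadratic B w' a' τ' k) ^ 2) +
        (coeffConst B w a E - coeffConst B w' a' E') ^ 2)) ^ (m + 1) := by
  set f4 := quarticPoly B fun k l' l k' =>
    coeffQuartic w a k l' l k' - coeffQuartic w' a' k l' l k' with hf4
  set f2 := quadraticPoly B fun k => coeffQuadratic B w a τ k - coeffQuadratic B w' a' τ' k
    with hf2
  set c := coeffConst B w a E - coeffConst B w' a' E' with hc
  set S4 := ∑ k ∈ B, ∑ l' ∈ B, ∑ l ∈ B, ∑ k' ∈ B,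
    (coeffQuartic w a k l' l k' - coeffQuartic w' a' k l' l k') ^ 2
  set S2 := ∑ k ∈ B, (coeffQuadratic B w a τ k - coeffQuadratic B w' a' τ' k) ^ 2
  have hS4 : 0 ≤ S4 := Finset.sum_nonneg fun _ _ => Finset.sum_nonneg fun _ _ =>
    Finset.sum_nonneg fun _ _ => Finset.sum_nonneg fun _ _ => sq_nonneg _
  have hS2 : 0 ≤ S2 := Finset.sum_nonneg fun _ _ => sq_nonneg _
  have h4 : ∫ ω, ‖polyVal X f4 ω‖ ^ (2 * (m + 1)) ∂P ≤ ((2 * m + 1) ^ 4 * (880 * S4)) ^ (m + 1) :=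
    hX.moment_le (isChaos_quarticPoly B _) m
  have h2 : ∫ ω, ‖polyVal X f2 ω‖ ^ (2 * (m + 1)) ∂P ≤ ((2 * m + 1) ^ 2 * (4 * S2)) ^ (m + 1) :=
    hX.moment_le (isChaos_quadraticPoly B _) m
  clear_value S4 S2 c
  have h1 : ∀ ω, |cutoffInteraction X B w a τ E ω - cutoffInteraction X B w' a' τ' E' ω| ≤
      ‖polyVal X f4 ω‖ + ‖polyVal X f2 ω‖ + |c| := by
    intro ω
    -- Over a common set of modes the decompositions subtract coefficient by coefficient, so the
    -- difference has again a quartic, a quadratic and a constant part.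
    have : ((cutoffInteraction X B w a τ E ω - cutoffInteraction X B w' a' τ' E' ω : ℝ) : ℂ) =
        polyVal X f4 ω + polyVal X f2 ω + (c : ℂ) := by
      rw [Complex.ofReal_sub, cutoffInteraction_eq B hw, cutoffInteraction_eq B hw', hf4, hf2,
        ← quarticPoly_sub, ← quadraticPoly_sub, polyVal_sub, polyVal_sub, hc]
      push_cast
      ring
    rw [← Real.norm_eq_abs, ← Complex.norm_real, this]
    refine (norm_add_le _ _).trans (add_le_add (norm_add_le _ _) ?_)
    rw [Complex.norm_real, Real.norm_eq_abs]
  have i4 : Integrable (fun ω => ‖polyVal X f4 ω‖ ^ (2 * (m + 1))) P :=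
    ((hX.hasMoments_polyVal f4).norm.pow _).integrable
  have i2 : Integrable (fun ω => ‖polyVal X f2 ω‖ ^ (2 * (m + 1))) P :=
    ((hX.hasMoments_polyVal f2).norm.pow _).integrable
  have hm1 : (1 : ℝ) ≤ 2 * m + 1 := by have : (0 : ℝ) ≤ m := by positivity
                                       linarith
  calc _ ≤ ∫ ω, 3 ^ (2 * (m + 1)) * (‖polyVal X f4 ω‖ ^ (2 * (m + 1)) +
        ‖polyVal X f2 ω‖ ^ (2 * (m + 1)) + |c| ^ (2 * (m + 1))) ∂P := by
        refine integral_mono_of_nonneg (.of_forall fun ω => by positivity)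
          (((i4.add i2).add (integrable_const _)).const_mul _) (.of_forall fun ω => ?_)
        exact (pow_le_pow_left₀ (abs_nonneg _) (h1 ω) _).trans
          (pow_add_three_le (norm_nonneg _) (norm_nonneg _) (abs_nonneg _) _)
    _ = 3 ^ (2 * (m + 1)) * ((∫ ω, ‖polyVal X f4 ω‖ ^ (2 * (m + 1)) ∂P) +
        (∫ ω, ‖polyVal X f2 ω‖ ^ (2 * (m + 1)) ∂P) + |c| ^ (2 * (m + 1))) := by
        rw [integral_const_mul]
        congr 1
        have e1 := integral_add (i4.add i2) (integrable_const (|c| ^ (2 * (m + 1))))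
        have e2 := integral_add i4 i2
        simp only [Pi.add_apply, integral_const, probReal_univ, one_smul] at e1 e2
        rw [e1, e2]
    _ ≤ _ := three_moments_le hm1 (mul_nonneg (by norm_num) hS4) (mul_nonneg (by norm_num) hS2) h4 h2

end Interaction

end Phi42

end

noncomputable section

namespace Phi42

/-! ### Lattice sums -/

section Lattice

variable {κ : ℝ}

theorem le_eigenvalue (κ : ℝ) (k : Fin 2 → ℤ) : κ ≤ eigenvalue κ k := by
  unfold eigenvalue
  have : 0 ≤ 2 * Real.pi ^ 2 * ∑ i, (k i : ℝ) ^ 2 := by positivity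
  linarith

theorem eigenvalue_pos (hκ : 0 < κ) (k : Fin 2 → ℤ) : 0 < eigenvalue κ k :=
  hκ.trans_le (le_eigenvalue κ k)

theorem sq_le_eigenvalue (hκ : 0 < κ) (k : Fin 2 → ℤ) (i : Fin 2) :
    (k i : ℝ) ^ 2 ≤ eigenvalue κ k := by
  unfold eigenvalue
  have h1 : (k i : ℝ) ^ 2 ≤ ∑ i, (k i : ℝ) ^ 2 :=
    Finset.single_le_sum (f := fun i => (k i : ℝ) ^ 2) (fun j _ => sq_nonneg _) (Finset.mem_univ i)
  have hpi : (1 : ℝ) ≤ 2 * Real.pi ^ 2 := by nlinarith [Real.pi_gt_three]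
  have hs : (0 : ℝ) ≤ ∑ i, (k i : ℝ) ^ 2 := Finset.sum_nonneg fun i _ => sq_nonneg _
  nlinarith

theorem norm_sq_le_eigenvalue (hκ : 0 < κ) (k : Fin 2 → ℤ) : ‖k‖ ^ 2 ≤ eigenvalue κ k := by
  have h : ‖k‖ ≤ √(eigenvalue κ k) := by
    rw [pi_norm_le_iff_of_nonneg (Real.sqrt_nonneg _)]
    intro i
    rw [Int.norm_eq_abs]
    exact Real.abs_le_sqrt (sq_le_eigenvalue hκ k i)
  calc ‖k‖ ^ 2 ≤ √(eigenvalue κ k) ^ 2 := by gcongr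
    _ = _ := Real.sq_sqrt (eigenvalue_pos hκ k).le

theorem summable_eigenvalue_rpow (hκ : 0 < κ) {r : ℝ} (hr : 1 < r) :
    Summable fun k : Fin 2 → ℤ => eigenvalue κ k ^ (-r) := by
  have h4 : Summable fun k : Fin 2 → ℤ => ‖k‖ ^ (-(2 * r)) :=
    EisensteinSeries.summable_one_div_norm_rpow (by linarith)
  refine Summable.of_norm_bounded_eventually h4 ?_
  rw [Filter.eventually_cofinite]
  refine (Set.finite_singleton (0 : Fin 2 → ℤ)).subset ?_
  intro k hk
  by_contra hk0
  apply hk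
  have hpos : 0 < ‖k‖ := norm_pos_iff.mpr hk0
  rw [Real.norm_of_nonneg (Real.rpow_nonneg (eigenvalue_pos hκ k).le _), neg_mul_eq_mul_neg,
    Real.rpow_mul hpos.le, Real.rpow_two]
  exact Real.rpow_le_rpow_of_nonpos (by positivity) (norm_sq_le_eigenvalue hκ k) (by linarith)

/-- The modes of sup norm at most `2 ^ j`. -/
def box (j : ℕ) : Finset (Fin 2 → ℤ) := Fintype.piFinset fun _ => Finset.Icc (-2 ^ j) (2 ^ j)

theorem mem_box {j : ℕ} {k : Fin 2 → ℤ} : k ∈ box j ↔ ∀ i, |k i| ≤ 2 ^ j := by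
  simp [box, abs_le]

theorem box_mono : Monotone box := fun i j hij k hk => by
  rw [mem_box] at hk ⊢
  exact fun a => (hk a).trans (pow_le_pow_right₀ (by norm_num) hij)

theorem four_pow_le_eigenvalue (hκ : 0 < κ) {j : ℕ} {k : Fin 2 → ℤ} (hk : k ∉ box j) :
    (4 : ℝ) ^ j ≤ eigenvalue κ k := by
  rw [mem_box] at hk
  push Not at hk
  obtain ⟨i, hi⟩ := hk
  refine le_trans ?_ (sq_le_eigenvalue hκ k i)
  have h1 : (2 : ℝ) ^ j ≤ |(k i : ℝ)| := by exact_mod_cast hi.le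
  calc (4 : ℝ) ^ j = (2 ^ j) ^ 2 := by rw [← pow_mul, mul_comm, pow_mul]; norm_num
    _ ≤ |(k i : ℝ)| ^ 2 := by gcongr
    _ = _ := sq_abs _

theorem tendsto_box : Tendsto box atTop atTop := by
  refine tendsto_atTop_finset_of_monotone box_mono fun k => ?_
  refine ⟨(∑ i, (k i).natAbs), mem_box.2 fun i => ?_⟩
  have h1 : (k i).natAbs ≤ ∑ i, (k i).natAbs :=
    Finset.single_le_sum (f := fun i => (k i).natAbs) (fun _ _ => Nat.zero_le _) (Finset.mem_univ i)
  have h2 : (k i).natAbs ≤ 2 ^ (∑ i, (k i).natAbs) := h1.trans Nat.lt_two_pow_self.le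
  rw [Int.abs_eq_natAbs]
  exact_mod_cast h2

theorem card_box (j : ℕ) : (box j).card = (2 * 2 ^ j + 1) ^ 2 := by
  rw [box, Fintype.card_piFinset]
  simp only [Int.card_Icc, Finset.prod_const, Finset.card_univ, Fintype.card_fin]
  congr 1
  have : (2 : ℤ) ^ j + 1 - -2 ^ j = ((2 * 2 ^ j + 1 : ℕ) : ℤ) := by push_cast; ring
  rw [this, Int.toNat_natCast]

/-- The logarithmic divergence in two dimensions: a dyadic shell has at most (4 · 2^j + 1)² ≤ 25 ·
4^j points, each contributing at most 4^{−j}. The 9 points of the smallest box contribute at most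
1/κ each. -/
theorem sum_box_inv_eigenvalue_le (hκ : 0 < κ) (j : ℕ) :
    ∑ k ∈ box j, (eigenvalue κ k)⁻¹ ≤ (9 / κ + 25) * (j + 1) := by
  induction j with
  | zero =>
    refine (Finset.sum_le_card_nsmul _ _ κ⁻¹ fun k _ =>
      inv_anti₀ hκ (le_eigenvalue κ k)).trans ?_
    rw [card_box]
    simp only [pow_zero, nsmul_eq_mul]
    push_cast
    rw [div_eq_mul_inv]
    nlinarith
  | succ j ih =>
    rw [← Finset.sum_sdiff (box_mono (Nat.le_succ j))]
    have h1 : ∑ k ∈ box (j + 1) \ box j, (eigenvalue κ k)⁻¹ ≤ 25 := by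
      refine (Finset.sum_le_card_nsmul _ _ ((4 : ℝ) ^ j)⁻¹ fun k hk =>
        inv_anti₀ (by positivity) (four_pow_le_eigenvalue hκ (Finset.mem_sdiff.1 hk).2)).trans ?_
      rw [nsmul_eq_mul, mul_inv_le_iff₀ (by positivity)]
      have h2 : ((box (j + 1) \ box j).card : ℝ) ≤ ((box (j + 1)).card : ℝ) := by
        exact_mod_cast Finset.card_le_card Finset.sdiff_subset
      refine h2.trans ?_
      rw [card_box]
      push_cast
      have h3 : (1 : ℝ) ≤ 2 ^ j := one_le_pow₀ (by norm_num)
      have h4 : (4 : ℝ) ^ j = (2 ^ j) ^ 2 := by rw [← pow_mul, mul_comm, pow_mul]; norm_num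
      rw [h4, pow_succ (2 : ℝ) j]
      nlinarith
    have : 0 < 9 / κ := by positivity
    push_cast
    nlinarith

/-- The convolution estimate for four inverse eigenvalues on the momentum-conserving hyperplane. -/
theorem summable_quartic_rpow (hκ : 0 < κ) {r : ℝ} (hr : 3 / 4 < r) :
    Summable fun q : (Fin 2 → ℤ) × (Fin 2 → ℤ) × (Fin 2 → ℤ) =>
      eigenvalue κ q.1 ^ (-r) * eigenvalue κ q.2.1 ^ (-r) * eigenvalue κ q.2.2 ^ (-r) *
        eigenvalue κ (q.2.1 - q.2.2 + q.1) ^ (-r) := by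
  -- The summand is the product of four factors x^{3/4}, hence the geometric mean of the four
  -- products of three x's, each omitting one momentum. Any three momenta determine the fourth, so
  -- each such product sums freely, and 4r/3 > 1 makes it converge.
  set x : (Fin 2 → ℤ) → ℝ := fun k => eigenvalue κ k ^ (-(4 / 3 * r)) with hx
  have hx0 : ∀ k, 0 ≤ x k := fun k => Real.rpow_nonneg (eigenvalue_pos hκ k).le _
  have hxs : Summable x := summable_eigenvalue_rpow hκ (by linarith)
  have hF : Summable fun q : (Fin 2 → ℤ) × (Fin 2 → ℤ) × (Fin 2 → ℤ) =>
      x q.1 * (x q.2.1 * x q.2.2) :=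
    hxs.mul_of_nonneg (hxs.mul_of_nonneg hxs hx0 hx0) hx0 fun q => mul_nonneg (hx0 _) (hx0 _)
  have i1 : Function.Injective fun q : (Fin 2 → ℤ) × (Fin 2 → ℤ) × (Fin 2 → ℤ) =>
      (q.2.1 - q.2.2 + q.1, q.2.1, q.2.2) := by
    rintro ⟨a, b, c⟩ ⟨a', b', c'⟩ h
    simp only [Prod.mk.injEq] at h
    obtain ⟨h1, rfl, rfl⟩ := h
    simpa using h1
  have i2 : Function.Injective fun q : (Fin 2 → ℤ) × (Fin 2 → ℤ) × (Fin 2 → ℤ) =>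
      (q.1, q.2.1 - q.2.2 + q.1, q.2.2) := by
    rintro ⟨a, b, c⟩ ⟨a', b', c'⟩ h
    simp only [Prod.mk.injEq] at h
    obtain ⟨rfl, h1, rfl⟩ := h
    simpa using h1
  have i3 : Function.Injective fun q : (Fin 2 → ℤ) × (Fin 2 → ℤ) × (Fin 2 → ℤ) =>
      (q.1, q.2.1, q.2.1 - q.2.2 + q.1) := by
    rintro ⟨a, b, c⟩ ⟨a', b', c'⟩ h
    simp only [Prod.mk.injEq] at h
    obtain ⟨rfl, rfl, h1⟩ := h
    simpa using h1
  have hsum := ((hF.add (hF.comp_injective i1)).add (hF.comp_injective i2)).add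
    (hF.comp_injective i3)
  refine Summable.of_nonneg_of_le (fun q => ?_) (fun q => ?_) hsum
  · have := eigenvalue_pos hκ
    have h := fun k => Real.rpow_nonneg (this k).le (-r)
    exact mul_nonneg (mul_nonneg (mul_nonneg (h _) (h _)) (h _)) (h _)
  · obtain ⟨k, l, m⟩ := q
    simp only [Function.comp_apply]
    set n := l - m + k
    have hy : ∀ k, eigenvalue κ k ^ (-r) = x k ^ ((3 : ℝ) / 4) := fun k => by
      rw [hx, ← Real.rpow_mul (eigenvalue_pos hκ k).le]
      congr 1
      ring
    rw [hy, hy, hy, hy]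
    have e : x k ^ ((3 : ℝ) / 4) * x l ^ ((3 : ℝ) / 4) * x m ^ ((3 : ℝ) / 4) * x n ^ ((3 : ℝ) / 4) =
        (x k * (x l * x m)) ^ ((1 : ℝ) / 4) * (x n * (x l * x m)) ^ ((1 : ℝ) / 4) *
        (x k * (x n * x m)) ^ ((1 : ℝ) / 4) * (x k * (x l * x n)) ^ ((1 : ℝ) / 4) := by
      have h3 : ∀ k, x k ^ ((3 : ℝ) / 4) =
          x k ^ ((1 : ℝ) / 4) * x k ^ ((1 : ℝ) / 4) * x k ^ ((1 : ℝ) / 4) := fun k => by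
        have hp : 0 < x k := Real.rpow_pos_of_pos (eigenvalue_pos hκ k) _
        rw [← Real.rpow_add hp, ← Real.rpow_add hp]
        norm_num
      simp only [Real.mul_rpow (hx0 _) (mul_nonneg (hx0 _) (hx0 _)), Real.mul_rpow (hx0 _) (hx0 _),
        h3]
      ring
    rw [e]
    have hnn : ∀ a b c, 0 ≤ x a * (x b * x c) := fun a b c =>
      mul_nonneg (hx0 _) (mul_nonneg (hx0 _) (hx0 _))
    have := Real.geom_mean_le_arith_mean4_weighted (w₁ := 1 / 4) (w₂ := 1 / 4) (w₃ := 1 / 4)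
      (w₄ := 1 / 4) (by norm_num) (by norm_num) (by norm_num) (by norm_num) (hnn k l m) (hnn n l m)
      (hnn k n m) (hnn k l n) (by norm_num)
    linarith [hnn k l m, hnn n l m, hnn k n m, hnn k l n]

/-- Summation over quadruples of modes conserving momentum. -/
theorem sum_quadruples_le {f : (Fin 2 → ℤ) → (Fin 2 → ℤ) → (Fin 2 → ℤ) → (Fin 2 → ℤ) → ℝ}
    {g : (Fin 2 → ℤ) × (Fin 2 → ℤ) × (Fin 2 → ℤ) → ℝ} (hg : Summable g) (hg0 : ∀ q, 0 ≤ g q)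
    (hf0 : ∀ k l' l k', l - k ≠ l' - k' → f k l' l k' = 0)
    (B : Finset (Fin 2 → ℤ))
    (hfg : ∀ k ∈ B, ∀ l' ∈ B, ∀ l ∈ B, l' - l + k ∈ B → f k l' l (l' - l + k) ≤ g (k, l', l)) :
    ∑ k ∈ B, ∑ l' ∈ B, ∑ l ∈ B, ∑ k' ∈ B, f k l' l k' ≤ ∑' q, g q := by
  have h1 : ∑ k ∈ B, ∑ l' ∈ B, ∑ l ∈ B, ∑ k' ∈ B, f k l' l k' ≤
      ∑ k ∈ B, ∑ l' ∈ B, ∑ l ∈ B, g (k, l', l) := by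
    refine Finset.sum_le_sum fun k hk => Finset.sum_le_sum fun l' hl' =>
      Finset.sum_le_sum fun l hl => ?_
    by_cases h : l' - l + k ∈ B
    · rw [Finset.sum_eq_single (l' - l + k)]
      · exact hfg k hk l' hl' l hl h
      · intro k' _ hk'
        refine hf0 _ _ _ _ fun he => hk' ?_
        rw [sub_eq_sub_iff_add_eq_add] at he
        rw [sub_add_eq_add_sub, eq_sub_iff_add_eq, ← he, add_comm]
      · exact fun h' => absurd h h'
    · rw [Finset.sum_eq_zero]
      · exact hg0 _
      · intro k' hk'
        refine hf0 _ _ _ _ fun he => h ?_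
        rw [sub_eq_sub_iff_add_eq_add] at he
        have : l' - l + k = k' := by
          rw [sub_add_eq_add_sub, sub_eq_iff_eq_add, ← he, add_comm]
        rwa [this]
  refine h1.trans ?_
  have h2 : ∑ k ∈ B, ∑ l' ∈ B, ∑ l ∈ B, g (k, l', l) = ∑ q ∈ B ×ˢ B ×ˢ B, g q := by
    rw [Finset.sum_product]
    refine Finset.sum_congr rfl fun k _ => ?_
    rw [Finset.sum_product]
  rw [h2]
  exact hg.sum_le_tsum _ fun q _ => hg0 q

end Lattice

end Phi42

end

noncomputable section

namespace Phi42

/-! ### Interaction weights and the interactions with sharp cutoff -/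

section Weights

variable {κ C : ℝ}

/-- The weights (Fourier coefficients of interaction potentials) for which the estimates are
uniform. -/
structure IsWeight (κ C : ℝ) (w : (Fin 2 → ℤ) → ℝ) : Prop where
  nonneg : ∀ k, 0 ≤ w k
  le : ∀ k, w k ≤ C
  zero : w 0 = 1
  even : ∀ k, w (-k) = w k
  holder : ∀ l k, |w (l - k) - w k| ≤
    C * (eigenvalue κ l ^ (1 / 8 : ℝ) * eigenvalue κ k ^ (-(1 / 8) : ℝ))

theorem IsWeight.one_le {w : (Fin 2 → ℤ) → ℝ} (hw : IsWeight κ C w) : 1 ≤ C := hw.zero ▸ hw.le 0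

/-- The amplitudes of the free field with multipliers `s`. -/
def amp (κ : ℝ) (s : (Fin 2 → ℤ) → ℝ) (k : Fin 2 → ℤ) : ℝ := s k / √(eigenvalue κ k)

theorem amp_sq (hκ : 0 < κ) (s : (Fin 2 → ℤ) → ℝ) (k : Fin 2 → ℤ) :
    amp κ s k ^ 2 = s k ^ 2 * (eigenvalue κ k)⁻¹ := by
  rw [amp, div_pow, Real.sq_sqrt (eigenvalue_pos hκ k).le, div_eq_mul_inv]

/-- The mass counterterm for a sharp cutoff. -/
def ballMass (κ : ℝ) (w : (Fin 2 → ℤ) → ℝ) (j : ℕ) : ℝ :=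
  ∑ k ∈ box j, w k * (eigenvalue κ k)⁻¹

/-- The energy counterterm for a sharp cutoff. -/
def ballEnergy (κ : ℝ) (w : (Fin 2 → ℤ) → ℝ) (j : ℕ) : ℝ :=
  (1 / 2) * ∑ k ∈ box j, ∑ l ∈ box j, w (l - k) * ((eigenvalue κ k)⁻¹ * (eigenvalue κ l)⁻¹)

/-- The interaction with sharp cutoff. -/
def ballInteraction {Ω : Type*} (κ : ℝ) (X : (Fin 2 → ℤ) → Ω → ℂ) (w : (Fin 2 → ℤ) → ℝ) (j : ℕ) :
    Ω → ℝ :=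
  cutoffInteraction X (box j) w (amp κ 1) (ballMass κ w j) (ballEnergy κ w j)

theorem ballMass_le (hκ : 0 < κ) {w : (Fin 2 → ℤ) → ℝ} (hw : IsWeight κ C w) (j : ℕ) :
    ballMass κ w j ≤ C * ((9 / κ + 25) * (j + 1)) := by
  have hC : 0 ≤ C := zero_le_one.trans hw.one_le
  refine le_trans ?_ (mul_le_mul_of_nonneg_left (sum_box_inv_eigenvalue_le hκ j) hC)
  rw [Finset.mul_sum]
  exact Finset.sum_le_sum fun k _ =>
    mul_le_mul_of_nonneg_right (hw.le k) (inv_nonneg.2 (eigenvalue_pos hκ k).le)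

theorem ballMass_nonneg (hκ : 0 < κ) {w : (Fin 2 → ℤ) → ℝ} (hw : IsWeight κ C w) (j : ℕ) :
    0 ≤ ballMass κ w j :=
  Finset.sum_nonneg fun k _ => mul_nonneg (hw.nonneg k) (inv_nonneg.2 (eigenvalue_pos hκ k).le)

theorem ballEnergy_le (hκ : 0 < κ) {w : (Fin 2 → ℤ) → ℝ} (hw : IsWeight κ C w) (j : ℕ) :
    ballEnergy κ w j ≤ (1 / 2) * (C * ((9 / κ + 25) * (j + 1)) ^ 2) := by
  have hC : 0 ≤ C := zero_le_one.trans hw.one_le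
  have h0 : 0 ≤ ∑ k ∈ box j, (eigenvalue κ k)⁻¹ :=
    Finset.sum_nonneg fun k _ => inv_nonneg.2 (eigenvalue_pos hκ k).le
  have h1 : ∑ k ∈ box j, ∑ l ∈ box j, w (l - k) * ((eigenvalue κ k)⁻¹ * (eigenvalue κ l)⁻¹) ≤
      C * (∑ k ∈ box j, (eigenvalue κ k)⁻¹) ^ 2 := by
    rw [sq, Finset.sum_mul_sum, Finset.mul_sum]
    refine Finset.sum_le_sum fun k _ => ?_
    rw [Finset.mul_sum]
    exact Finset.sum_le_sum fun l _ => mul_le_mul_of_nonneg_right (hw.le _)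
      (mul_nonneg (inv_nonneg.2 (eigenvalue_pos hκ k).le) (inv_nonneg.2 (eigenvalue_pos hκ l).le))
  rw [ballEnergy]
  gcongr
  refine h1.trans ?_
  gcongr
  exact sum_box_inv_eigenvalue_le hκ j

/-- The mass counterterm grows at most like j and the energy counterterm like j², so completing the
square costs O(j²): polynomial in the logarithm of the cutoff, which Nelson's argument needs. -/
theorem ballInteraction_ge (hκ : 0 < κ) {w : (Fin 2 → ℤ) → ℝ} (hw : IsWeight κ C w) {Ω : Type*}
    (X : (Fin 2 → ℤ) → Ω → ℂ) (j : ℕ) (ω : Ω) :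
    -(C ^ 2 * (9 / κ + 25) ^ 2) * (j + 1) ^ 2 ≤ ballInteraction κ X w j ω := by
  refine le_trans ?_ (cutoffInteraction_ge (box j) hw.nonneg hw.zero _ _ _ ω)
  have h1 := ballMass_le hκ hw j
  have h2 := ballEnergy_le hκ hw j
  have h3 : ballMass κ w j ^ 2 ≤ (C * ((9 / κ + 25) * (j + 1))) ^ 2 :=
    pow_le_pow_left₀ (ballMass_nonneg hκ hw j) h1 2
  have h4 : C ≤ C ^ 2 := by nlinarith [hw.one_le]
  have h5 : C * ((9 / κ + 25) * (j + 1)) ^ 2 ≤ C ^ 2 * ((9 / κ + 25) * (j + 1)) ^ 2 := by gcongr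
  nlinarith

/-- The multipliers of a sharp cutoff. -/
def boxInd (j : ℕ) (k : Fin 2 → ℤ) : ℝ := if k ∈ box j then 1 else 0

theorem sum_mul_boxInd_sq {j M : ℕ} (hjM : j ≤ M) (f : (Fin 2 → ℤ) → ℝ) :
    ∑ k ∈ box M, f k * boxInd j k ^ 2 = ∑ k ∈ box j, f k := by
  rw [← Finset.sum_subset (box_mono hjM)]
  · exact Finset.sum_congr rfl fun k hk => by simp [boxInd, hk]
  · intro k _ hk; simp [boxInd, hk]

/-- Moves the smaller cutoff from the set of modes into the amplitudes, so that interactions with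
different cutoffs can be compared over one box. -/
theorem ballInteraction_eq {Ω : Type*} (κ : ℝ) (X : (Fin 2 → ℤ) → Ω → ℂ) (w : (Fin 2 → ℤ) → ℝ)
    {j M : ℕ} (hjM : j ≤ M) (ω : Ω) :
    ballInteraction κ X w j ω = cutoffInteraction X (box M) w (amp κ (boxInd j))
      (ballMass κ w j) (ballEnergy κ w j) ω := by
  rw [cutoffInteraction_of_subset (box_mono hjM)]
  · rw [ballInteraction, cutoffInteraction, cutoffInteraction]
    have h1 : ∀ k ∈ box j, amp κ (boxInd j) k = amp κ 1 k := fun k hk => by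
      simp [amp, boxInd, hk]
    have h2 : ∀ q, density X (box j) (amp κ (boxInd j)) q ω = density X (box j) (amp κ 1) q ω :=
      fun q => Finset.sum_congr rfl fun k hk => Finset.sum_congr rfl fun l hl => by
        rw [h1 k hk, h1 l hl]
    have h3 : ∑ k ∈ box j, amp κ (boxInd j) k ^ 2 * (‖X k ω‖ ^ 2 - 1) =
        ∑ k ∈ box j, amp κ 1 k ^ 2 * (‖X k ω‖ ^ 2 - 1) :=
      Finset.sum_congr rfl fun k hk => by rw [h1 k hk]
    simp_rw [h2, h3]
  · intro k hk; simp [amp, boxInd, hk]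

theorem coeffConst_ball (hκ : 0 < κ) (w : (Fin 2 → ℤ) → ℝ) {j M : ℕ} (hjM : j ≤ M) :
    coeffConst (box M) w (amp κ (boxInd j)) (ballEnergy κ w j) = 0 := by
  rw [coeffConst, ballEnergy, sub_eq_zero]
  congr 1
  simp_rw [amp_sq hκ]
  have h1 : ∀ k, ∑ l ∈ box M, w (l - k) * (boxInd j k ^ 2 * (eigenvalue κ k)⁻¹ *
      (boxInd j l ^ 2 * (eigenvalue κ l)⁻¹)) =
      (∑ l ∈ box j, w (l - k) * ((eigenvalue κ k)⁻¹ * (eigenvalue κ l)⁻¹)) * boxInd j k ^ 2 := by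
    intro k
    rw [← sum_mul_boxInd_sq hjM, Finset.sum_mul]
    exact Finset.sum_congr rfl fun l _ => by ring
  simp_rw [h1]
  exact sum_mul_boxInd_sq hjM _

/-- This is the mass renormalization: subtracting ∑ w(k)/λ_k replaces w(l − k) by the increment w(l
− k) − w(k), whose decay in k makes the sum converge. -/
theorem coeffQuadratic_ball (hκ : 0 < κ) (w : (Fin 2 → ℤ) → ℝ) {j M : ℕ} (hjM : j ≤ M)
    (l : Fin 2 → ℤ) :
    coeffQuadratic (box M) w (amp κ (boxInd j)) (ballMass κ w j) l = boxInd j l ^ 2 *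
      ((eigenvalue κ l)⁻¹ * ∑ k ∈ box j, (w (l - k) - w k) * (eigenvalue κ k)⁻¹) := by
  rw [coeffQuadratic, ballMass]
  simp_rw [amp_sq hκ]
  have h1 : ∑ k ∈ box M, w (l - k) * (boxInd j k ^ 2 * (eigenvalue κ k)⁻¹) =
      ∑ k ∈ box j, w (l - k) * (eigenvalue κ k)⁻¹ := by
    rw [← sum_mul_boxInd_sq hjM]
    exact Finset.sum_congr rfl fun l _ => by ring
  rw [h1, ← Finset.sum_sub_distrib, mul_assoc]
  simp_rw [sub_mul]

theorem coeffQuartic_sub_sq (hκ : 0 < κ) (w w' s s' : (Fin 2 → ℤ) → ℝ) (k l' l k' : Fin 2 → ℤ) :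
    (coeffQuartic w (amp κ s) k l' l k' - coeffQuartic w' (amp κ s') k l' l k') ^ 2 =
      if l - k = l' - k' then (1 / 4) * (w (l - k) * (s k * s l' * s l * s k') -
        w' (l - k) * (s' k * s' l' * s' l * s' k')) ^ 2 *
        ((eigenvalue κ k)⁻¹ * (eigenvalue κ l')⁻¹ * (eigenvalue κ l)⁻¹ * (eigenvalue κ k')⁻¹)
      else 0 := by
  simp only [coeffQuartic]
  split_ifs with h
  · have h1 : ∀ k, (eigenvalue κ k)⁻¹ = (√(eigenvalue κ k))⁻¹ ^ 2 := fun k => by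
      rw [inv_pow, Real.sq_sqrt (eigenvalue_pos hκ k).le]
    simp only [amp, h1, div_eq_mul_inv]
    ring
  · simp

theorem inv_eigenvalue_eq (hκ : 0 < κ) (k : Fin 2 → ℤ) (r s : ℝ) (h : r + s = 1) :
    (eigenvalue κ k)⁻¹ = eigenvalue κ k ^ (-r) * eigenvalue κ k ^ (-s) := by
  rw [← Real.rpow_add (eigenvalue_pos hκ k), ← Real.rpow_neg_one]
  congr 1
  linarith

/-- The gain of 1/8 raises the decay in k to the summable exponent 9/8, at the price of the growth
λ_l^{1/8}, which the prefactor λ_l⁻¹ of the quadratic coefficient can afford. -/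
theorem IsWeight.sum_abs_sub_le (hκ : 0 < κ) {w : (Fin 2 → ℤ) → ℝ} (hw : IsWeight κ C w)
    (l k : Fin 2 → ℤ) : |w (l - k) - w k| * (eigenvalue κ k)⁻¹ ≤
      C * eigenvalue κ l ^ (1 / 8 : ℝ) * eigenvalue κ k ^ (-(9 / 8) : ℝ) := by
  have h := mul_le_mul_of_nonneg_right (hw.holder l k) (inv_nonneg.2 (eigenvalue_pos hκ k).le)
  refine h.trans (le_of_eq ?_)
  have : eigenvalue κ k ^ (-(9 / 8) : ℝ) = eigenvalue κ k ^ (-(1 / 8) : ℝ) * (eigenvalue κ k)⁻¹ := by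
    rw [← Real.rpow_neg_one, ← Real.rpow_add (eigenvalue_pos hκ k)]
    norm_num
  rw [this]
  ring

/-- The rate of convergence of the sharp cutoff. -/
def boxRate : ℝ := (4 : ℝ) ^ (-(1 / 16) : ℝ)

theorem boxRate_pos : 0 < boxRate := Real.rpow_pos_of_pos (by norm_num) _

theorem boxRate_lt_one : boxRate < 1 :=
  Real.rpow_lt_one_of_one_lt_of_neg (by norm_num) (by norm_num)

/-- Outside the j-th box the eigenvalue is at least 4^j, so any spare power λ^{−1/16} becomes a
geometric factor. -/
theorem eigenvalue_rpow_le_boxRate (hκ : 0 < κ) {j : ℕ} {k : Fin 2 → ℤ} (hk : k ∉ box j) :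
    eigenvalue κ k ^ (-(1 / 16) : ℝ) ≤ boxRate ^ j := by
  refine (Real.rpow_le_rpow_of_nonpos (by positivity) (four_pow_le_eigenvalue hκ hk)
    (by norm_num)).trans (le_of_eq ?_)
  rw [boxRate, ← Real.rpow_natCast, ← Real.rpow_natCast, ← Real.rpow_mul (by norm_num),
    ← Real.rpow_mul (by norm_num), mul_comm]

theorem eigenvalue_rpow_le (hκ : 0 < κ) (k : Fin 2 → ℤ) :
    eigenvalue κ k ^ (-(1 / 16) : ℝ) ≤ κ ^ (-(1 / 16) : ℝ) :=
  Real.rpow_le_rpow_of_nonpos hκ (le_eigenvalue κ k) (by norm_num)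

theorem four_mul_le {d₁ d₂ d₃ d₄ b r : ℝ} (h₁ : 0 ≤ d₁) (h₂ : 0 ≤ d₂) (h₃ : 0 ≤ d₃) (h₄ : 0 ≤ d₄)
    (hb₁ : d₁ ≤ b) (hb₂ : d₂ ≤ b) (hb₃ : d₃ ≤ b) (hb₄ : d₄ ≤ b)
    (h : d₁ ≤ r ∨ d₂ ≤ r ∨ d₃ ≤ r ∨ d₄ ≤ r) : d₁ * d₂ * d₃ * d₄ ≤ b ^ 3 * r := by
  have hb : 0 ≤ b := h₁.trans hb₁
  rcases h with h | h | h | h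
  · have : 0 ≤ r := h₁.trans h
    calc d₁ * d₂ * d₃ * d₄ ≤ r * b * b * b := by gcongr
      _ = _ := by ring
  · have : 0 ≤ r := h₂.trans h
    calc d₁ * d₂ * d₃ * d₄ ≤ b * r * b * b := by gcongr
      _ = _ := by ring
  · have : 0 ≤ r := h₃.trans h
    calc d₁ * d₂ * d₃ * d₄ ≤ b * b * r * b := by gcongr
      _ = _ := by ring
  · have : 0 ≤ r := h₄.trans h
    calc d₁ * d₂ * d₃ * d₄ ≤ b * b * b * r := by gcongr
      _ = _ := by ring

/-- Split λ⁻¹ = λ^{−15/16} λ^{−1/16}. The difference vanishes unless one of the four momenta lies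
outside the smaller box, and the spare power at that momentum gives the rate. The powers 15/16 > 3/4
still sum over the momentum-conserving quadruples. -/
theorem quartic_ball_le (hκ : 0 < κ) (C : ℝ) : ∃ D, 0 ≤ D ∧ ∀ w, IsWeight κ C w → ∀ j M, j ≤ M →
    ∑ k ∈ box M, ∑ l' ∈ box M, ∑ l ∈ box M, ∑ k' ∈ box M,
      (coeffQuartic w (amp κ (boxInd M)) k l' l k' -
        coeffQuartic w (amp κ (boxInd j)) k l' l k') ^ 2 ≤ D * boxRate ^ j := by
  set e : (Fin 2 → ℤ) → ℝ := fun k => eigenvalue κ k ^ (-(15 / 16) : ℝ) with he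
  set d : (Fin 2 → ℤ) → ℝ := fun k => eigenvalue κ k ^ (-(1 / 16) : ℝ) with hd
  have he0 : ∀ k, 0 ≤ e k := fun k => Real.rpow_nonneg (eigenvalue_pos hκ k).le _
  have hd0 : ∀ k, 0 ≤ d k := fun k => Real.rpow_nonneg (eigenvalue_pos hκ k).le _
  have hed : ∀ k, (eigenvalue κ k)⁻¹ = e k * d k := fun k =>
    inv_eigenvalue_eq hκ k _ _ (by norm_num)
  have hg : Summable fun q : (Fin 2 → ℤ) × (Fin 2 → ℤ) × (Fin 2 → ℤ) =>
      e q.1 * e q.2.1 * e q.2.2 * e (q.2.1 - q.2.2 + q.1) :=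
    summable_quartic_rpow hκ (r := 15 / 16) (by norm_num)
  set b := κ ^ (-(1 / 16) : ℝ) with hb
  have hb0 : 0 ≤ b := Real.rpow_nonneg hκ.le _
  have hdle : ∀ k, d k ≤ b := fun k => eigenvalue_rpow_le hκ k
  have hdr : ∀ j, ∀ k ∉ box j, d k ≤ boxRate ^ j := fun j k hk => eigenvalue_rpow_le_boxRate hκ hk
  clear_value e d b
  refine ⟨C ^ 2 * b ^ 3 * ∑' q : (Fin 2 → ℤ) × (Fin 2 → ℤ) × (Fin 2 → ℤ),
      e q.1 * e q.2.1 * e q.2.2 * e (q.2.1 - q.2.2 + q.1), ?_, fun w hw j M hjM => ?_⟩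
  · refine mul_nonneg (by positivity) (tsum_nonneg fun q => ?_)
    exact mul_nonneg (mul_nonneg (mul_nonneg (he0 _) (he0 _)) (he0 _)) (he0 _)
  have hr0 : 0 ≤ boxRate ^ j := pow_nonneg boxRate_pos.le _
  rw [mul_right_comm, ← tsum_mul_left]
  refine sum_quadruples_le (hg.mul_left _) (fun q => ?_) (fun k l' l k' h => ?_) _
    (fun k hk l' hl' l hl hk' => ?_)
  · exact mul_nonneg (by positivity)
      (mul_nonneg (mul_nonneg (mul_nonneg (he0 _) (he0 _)) (he0 _)) (he0 _))
  · rw [coeffQuartic_sub_sq hκ, if_neg h]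
  · set k' := l' - l + k with hk'e
    rw [coeffQuartic_sub_sq hκ, if_pos (by rw [hk'e]; abel)]
    have hM : ∀ k ∈ box M, boxInd M k = 1 := fun k hk => by simp [boxInd, hk]
    rw [hM k hk, hM l' hl', hM l hl, hM k' hk', hed, hed, hed, hed]
    have hw2 : w (l - k) ^ 2 ≤ C ^ 2 := pow_le_pow_left₀ (hw.nonneg _) (hw.le _) 2
    have hee : 0 ≤ e k * e l' * e l * e k' :=
      mul_nonneg (mul_nonneg (mul_nonneg (he0 _) (he0 _)) (he0 _)) (he0 _)
    have key : (1 / 4) * (w (l - k) * (1 * 1 * 1 * 1) -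
        w (l - k) * (boxInd j k * boxInd j l' * boxInd j l * boxInd j k')) ^ 2 *
        (d k * d l' * d l * d k') ≤ C ^ 2 * b ^ 3 * boxRate ^ j := by
      by_cases hall : k ∈ box j ∧ l' ∈ box j ∧ l ∈ box j ∧ k' ∈ box j
      · obtain ⟨h1, h2, h3, h4⟩ := hall
        simp only [boxInd, h1, h2, h3, h4, if_true]
        simp only [sub_self, ne_eq, OfNat.ofNat_ne_zero, not_false_eq_true, zero_pow, mul_zero,
          zero_mul]
        positivity
      · have hz : boxInd j k * boxInd j l' * boxInd j l * boxInd j k' = 0 := by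
          by_contra hne
          apply hall
          simp only [mul_ne_zero_iff, boxInd, ne_eq, ite_eq_right_iff, one_ne_zero, imp_false,
            not_not] at hne
          tauto
        rw [hz, mul_zero, sub_zero]
        have hdd : d k * d l' * d l * d k' ≤ b ^ 3 * boxRate ^ j := by
          refine four_mul_le (hd0 _) (hd0 _) (hd0 _) (hd0 _) (hdle _) (hdle _) (hdle _) (hdle _) ?_
          by_contra hcon
          push Not at hcon
          have hmem : ∀ k, boxRate ^ j < d k → k ∈ box j := fun k hk =>
            not_not.1 fun h => (hdr j k h).not_gt hk
          exact hall ⟨hmem _ hcon.1, hmem _ hcon.2.1, hmem _ hcon.2.2.1, hmem _ hcon.2.2.2⟩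
        have hdd0 : 0 ≤ d k * d l' * d l * d k' :=
          mul_nonneg (mul_nonneg (mul_nonneg (hd0 _) (hd0 _)) (hd0 _)) (hd0 _)
        calc _ ≤ C ^ 2 * (d k * d l' * d l * d k') := by
              gcongr
              nlinarith
          _ ≤ C ^ 2 * (b ^ 3 * boxRate ^ j) := by gcongr
          _ = _ := by ring
    calc _ = (1 / 4) * (w (l - k) * (1 * 1 * 1 * 1) -
        w (l - k) * (boxInd j k * boxInd j l' * boxInd j l * boxInd j k')) ^ 2 *
        (d k * d l' * d l * d k') * (e k * e l' * e l * e k') := by ring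
      _ ≤ C ^ 2 * b ^ 3 * boxRate ^ j * (e k * e l' * e l * e k') := by gcongr
      _ = _ := rfl

/-- The exponents split as 9/8 = 17/16 + 1/16 in k and 1 − 1/8 = 13/16 + 1/16 in l, and 17/16 and 2
· 13/16 both exceed 1. For l in the smaller box the difference is a tail of the sum over k and the
spare power in k gives the rate; for l outside it the whole coefficient is new and the spare power
in l gives the rate. Squaring doubles the rate, and one factor is discarded. -/
theorem quadratic_ball_le (hκ : 0 < κ) (C : ℝ) : ∃ D, 0 ≤ D ∧ ∀ w, IsWeight κ C w → ∀ j M, j ≤ M →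
    ∑ k ∈ box M, (coeffQuadratic (box M) w (amp κ (boxInd M)) (ballMass κ w M) k -
        coeffQuadratic (box M) w (amp κ (boxInd j)) (ballMass κ w j) k) ^ 2 ≤ D * boxRate ^ j := by
  set T := ∑' k, eigenvalue κ k ^ (-(17 / 16) : ℝ) with hT
  have hTs := summable_eigenvalue_rpow hκ (r := 17 / 16) (by norm_num)
  have hT0 : 0 ≤ T := tsum_nonneg fun k => Real.rpow_nonneg (eigenvalue_pos hκ k).le _
  set S := ∑' k, eigenvalue κ k ^ (-(13 / 8) : ℝ) with hS
  have hSs := summable_eigenvalue_rpow hκ (r := 13 / 8) (by norm_num)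
  set b := κ ^ (-(1 / 16) : ℝ) with hb
  have hb0 : 0 ≤ b := Real.rpow_nonneg hκ.le _
  refine ⟨(C * T * b) ^ 2 * S, mul_nonneg (sq_nonneg _)
    (tsum_nonneg fun k => Real.rpow_nonneg (eigenvalue_pos hκ k).le _), fun w hw j M hjM => ?_⟩
  have hC : 0 ≤ C := zero_le_one.trans hw.one_le
  have hr0 : 0 ≤ boxRate ^ j := pow_nonneg boxRate_pos.le _
  have hr1 : boxRate ^ j ≤ 1 := pow_le_one₀ boxRate_pos.le boxRate_lt_one.le
  have hsplit : ∀ k, eigenvalue κ k ^ (-(9 / 8) : ℝ) =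
      eigenvalue κ k ^ (-(17 / 16) : ℝ) * eigenvalue κ k ^ (-(1 / 16) : ℝ) := fun k => by
    rw [← Real.rpow_add (eigenvalue_pos hκ k)]; norm_num
  have hsumle : ∀ (l : Fin 2 → ℤ) (A : Finset (Fin 2 → ℤ)) (c : ℝ), 0 ≤ c →
      (∀ k ∈ A, eigenvalue κ k ^ (-(1 / 16) : ℝ) ≤ c) →
      |∑ k ∈ A, (w (l - k) - w k) * (eigenvalue κ k)⁻¹| ≤ C * eigenvalue κ l ^ (1 / 8 : ℝ) * (T * c) := by
    intro l A c hc hA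
    have hl0 : 0 ≤ eigenvalue κ l ^ (1 / 8 : ℝ) := Real.rpow_nonneg (eigenvalue_pos hκ l).le _
    calc _ ≤ ∑ k ∈ A, |(w (l - k) - w k) * (eigenvalue κ k)⁻¹| := Finset.abs_sum_le_sum_abs _ _
      _ ≤ ∑ k ∈ A, C * eigenvalue κ l ^ (1 / 8 : ℝ) * (eigenvalue κ k ^ (-(17 / 16) : ℝ) * c) := by
          refine Finset.sum_le_sum fun k hk => ?_
          rw [abs_mul, abs_of_nonneg (inv_nonneg.2 (eigenvalue_pos hκ k).le)]
          refine (hw.sum_abs_sub_le hκ l k).trans ?_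
          rw [hsplit]
          gcongr
          · exact Real.rpow_nonneg (eigenvalue_pos hκ k).le _
          · exact hA k hk
      _ = C * eigenvalue κ l ^ (1 / 8 : ℝ) * ((∑ k ∈ A, eigenvalue κ k ^ (-(17 / 16) : ℝ)) * c) := by
          rw [← Finset.mul_sum, Finset.sum_mul]
      _ ≤ _ := by
          gcongr
          exact hTs.sum_le_tsum _ fun k _ => Real.rpow_nonneg (eigenvalue_pos hκ k).le _
  have hpt : ∀ l ∈ box M, (coeffQuadratic (box M) w (amp κ (boxInd M)) (ballMass κ w M) l -
        coeffQuadratic (box M) w (amp κ (boxInd j)) (ballMass κ w j) l) ^ 2 ≤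
      (C * T * b) ^ 2 * boxRate ^ j * eigenvalue κ l ^ (-(13 / 8) : ℝ) := by
    intro l hl
    have hlam := eigenvalue_pos hκ l
    have e1 : (eigenvalue κ l)⁻¹ * eigenvalue κ l ^ (1 / 8 : ℝ) =
        eigenvalue κ l ^ (-(13 / 16) : ℝ) * eigenvalue κ l ^ (-(1 / 16) : ℝ) := by
      rw [← Real.rpow_neg_one, ← Real.rpow_add hlam, ← Real.rpow_add hlam]; norm_num
    have hx0 : 0 ≤ eigenvalue κ l ^ (-(13 / 16) : ℝ) := Real.rpow_nonneg hlam.le _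
    have key : |coeffQuadratic (box M) w (amp κ (boxInd M)) (ballMass κ w M) l -
        coeffQuadratic (box M) w (amp κ (boxInd j)) (ballMass κ w j) l| ≤
        C * T * b * boxRate ^ j * eigenvalue κ l ^ (-(13 / 16) : ℝ) := by
      rw [coeffQuadratic_ball hκ w le_rfl, coeffQuadratic_ball hκ w hjM]
      by_cases hlj : l ∈ box j
      · simp only [boxInd, hl, hlj, if_true, one_pow, one_mul]
        rw [← mul_sub, ← Finset.sum_sdiff (box_mono hjM), add_sub_cancel_right, abs_mul,
          abs_of_nonneg (inv_nonneg.2 hlam.le)]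
        have h := hsumle l (box M \ box j) (boxRate ^ j) hr0 fun k hk =>
          eigenvalue_rpow_le_boxRate hκ (Finset.mem_sdiff.1 hk).2
        calc _ ≤ (eigenvalue κ l)⁻¹ * (C * eigenvalue κ l ^ (1 / 8 : ℝ) * (T * boxRate ^ j)) := by
              gcongr
          _ = C * T * eigenvalue κ l ^ (-(1 / 16) : ℝ) * boxRate ^ j *
              eigenvalue κ l ^ (-(13 / 16) : ℝ) := by
              rw [show (eigenvalue κ l)⁻¹ * (C * eigenvalue κ l ^ (1 / 8 : ℝ) * (T * boxRate ^ j)) =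
                ((eigenvalue κ l)⁻¹ * eigenvalue κ l ^ (1 / 8 : ℝ)) * (C * (T * boxRate ^ j)) by ring,
                e1]
              ring
          _ ≤ _ := by
              gcongr
              exact eigenvalue_rpow_le hκ l
      · simp only [boxInd, hl, hlj, if_true, if_false, one_pow, one_mul]
        simp only [ne_eq, OfNat.ofNat_ne_zero, not_false_eq_true, zero_pow, zero_mul, sub_zero]
        rw [abs_mul, abs_of_nonneg (inv_nonneg.2 hlam.le)]
        have h := hsumle l (box M) b hb0 fun k hk => eigenvalue_rpow_le hκ k
        calc _ ≤ (eigenvalue κ l)⁻¹ * (C * eigenvalue κ l ^ (1 / 8 : ℝ) * (T * b)) := by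
              gcongr
          _ = C * T * b * eigenvalue κ l ^ (-(1 / 16) : ℝ) *
              eigenvalue κ l ^ (-(13 / 16) : ℝ) := by
              rw [show (eigenvalue κ l)⁻¹ * (C * eigenvalue κ l ^ (1 / 8 : ℝ) * (T * b)) =
                ((eigenvalue κ l)⁻¹ * eigenvalue κ l ^ (1 / 8 : ℝ)) * (C * (T * b)) by ring,
                e1]
              ring
          _ ≤ _ := by
              gcongr
              exact eigenvalue_rpow_le_boxRate hκ hlj
    calc _ = |coeffQuadratic (box M) w (amp κ (boxInd M)) (ballMass κ w M) l -
        coeffQuadratic (box M) w (amp κ (boxInd j)) (ballMass κ w j) l| ^ 2 := (sq_abs _).symm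
      _ ≤ (C * T * b * boxRate ^ j * eigenvalue κ l ^ (-(13 / 16) : ℝ)) ^ 2 := by gcongr
      _ = (C * T * b) ^ 2 * (boxRate ^ j * boxRate ^ j) *
          (eigenvalue κ l ^ (-(13 / 16) : ℝ) * eigenvalue κ l ^ (-(13 / 16) : ℝ)) := by ring
      _ ≤ (C * T * b) ^ 2 * (boxRate ^ j * 1) *
          (eigenvalue κ l ^ (-(13 / 16) : ℝ) * eigenvalue κ l ^ (-(13 / 16) : ℝ)) := by gcongr
      _ = _ := by
          rw [← Real.rpow_add hlam, mul_one]; norm_num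
  refine (Finset.sum_le_sum hpt).trans ?_
  rw [← Finset.mul_sum, mul_right_comm]
  gcongr
  exact hSs.sum_le_tsum _ fun k _ => Real.rpow_nonneg (eigenvalue_pos hκ k).le _

/-- The interactions with sharp cutoff form a Cauchy sequence, with uniform rate. -/
theorem moment_ballInteraction_sub_le (hκ : 0 < κ) (C : ℝ) : ∃ D, 0 ≤ D ∧
    ∀ {Ω : Type*} [MeasurableSpace Ω] {P : Measure Ω} [IsProbabilityMeasure P]
      {X : (Fin 2 → ℤ) → Ω → ℂ}, GaussianFamily P X → ∀ w, IsWeight κ C w → ∀ j M, j ≤ M → ∀ m : ℕ,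
      ∫ ω, |ballInteraction κ X w M ω - ballInteraction κ X w j ω| ^ (2 * (m + 1)) ∂P ≤
        (D * (2 * m + 1) ^ 4 * boxRate ^ j) ^ (m + 1) := by
  obtain ⟨D4, hD4, h4⟩ := quartic_ball_le hκ C
  obtain ⟨D2, hD2, h2⟩ := quadratic_ball_le hκ C
  refine ⟨9 * (880 * D4 + 4 * D2), by positivity, fun {Ω _ P _ X} hX w hw j M hjM m => ?_⟩
  simp_rw [ballInteraction_eq κ X w (le_refl M), ballInteraction_eq κ X w hjM]
  refine (hX.moment_cutoffInteraction_sub_le (box M) hw.even hw.even _ _ _ _ _ _ m).trans ?_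
  rw [coeffConst_ball hκ w le_rfl, coeffConst_ball hκ w hjM]
  have e4 := h4 w hw j M hjM
  have e2 := h2 w hw j M hjM
  refine pow_le_pow_left₀ ?_ ?_ _
  · refine mul_nonneg (by positivity) (add_nonneg (add_nonneg (mul_nonneg (by norm_num) ?_)
      (mul_nonneg (by norm_num) ?_)) (sq_nonneg _))
    · exact Finset.sum_nonneg fun _ _ => Finset.sum_nonneg fun _ _ =>
        Finset.sum_nonneg fun _ _ => Finset.sum_nonneg fun _ _ => sq_nonneg _
    · exact Finset.sum_nonneg fun _ _ => sq_nonneg _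
  · calc _ ≤ 9 * (2 * m + 1 : ℝ) ^ 4 * (880 * (D4 * boxRate ^ j) + 4 * (D2 * boxRate ^ j) +
          (0 - 0) ^ 2) := by gcongr
      _ = _ := by ring

end Weights

end Phi42

end

noncomputable section

namespace Phi42

/-! ### Nelson's argument -/

section Nelson

/-- A sequence of random variables which is Cauchy with a geometric rate, hypercontractive, and
bounded below by a slowly growing quantity. -/
structure IsNelson {Ω : Type*} [MeasurableSpace Ω] (P : Measure Ω) (A D r : ℝ) (U : ℕ → Ω → ℝ) :
    Prop where
  hasMoments : ∀ j, HasMoments P (U j)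
  ge : ∀ j ω, -A * (j + 1) ^ 2 ≤ U j ω
  cauchy : ∀ j M, j ≤ M → ∀ m : ℕ, ∫ ω, |U M ω - U j ω| ^ (2 * (m + 1)) ∂P ≤
    (D * (2 * m + 1) ^ 4 * r ^ j) ^ (m + 1)

theorem tendsto_nelson_base {r : ℝ} (hr0 : 0 ≤ r) (hr1 : r < 1) (c : ℝ) :
    Tendsto (fun j : ℕ => c * (2 * (j : ℝ) ^ 2 + 1) ^ 4 * r ^ j) atTop (𝓝 0) := by
  have h := fun k => tendsto_pow_const_mul_const_pow_of_abs_lt_one k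
    (show |r| < 1 by rwa [abs_of_nonneg hr0])
  have h1 := (((((h 8).const_mul 16).add ((h 6).const_mul 32)).add ((h 4).const_mul 24)).add
    ((h 2).const_mul 8)).add (h 0)
  have h2 := h1.const_mul c
  simp only [mul_zero, add_zero] at h2
  refine h2.congr fun j => ?_
  ring

/-- The moment order 2(j² + 1) is chosen so that its power j² + 1 matches the exponent O(j²) of the
exponential. The exponential is then absorbed into the base, which still tends to zero because r^j
beats the polynomial (2j² + 1)⁴. -/
theorem summable_nelson {r : ℝ} (hr0 : 0 ≤ r) (hr1 : r < 1) {A D q : ℝ} (hA : 0 ≤ A) (hD : 0 ≤ D)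
    (hq : 0 ≤ q) : Summable fun j : ℕ => (D * (2 * ((j ^ 2 : ℕ) : ℝ) + 1) ^ 4 * r ^ j) ^ (j ^ 2 + 1) *
      Real.exp (q * (A * ((j : ℝ) + 2) ^ 2 + 1)) := by
  set c := D * Real.exp (q * (8 * A + 1)) with hc
  have hlim := tendsto_nelson_base hr0 hr1 c
  refine Summable.of_norm_bounded_eventually_nat summable_geometric_two ?_
  filter_upwards [hlim.eventually (gt_mem_nhds (show (0 : ℝ) < 1 / 2 by norm_num))] with j hj
  rw [Real.norm_of_nonneg (by positivity)]
  have h1 : Real.exp (q * (A * ((j : ℝ) + 2) ^ 2 + 1)) ≤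
      Real.exp (q * (8 * A + 1)) ^ (j ^ 2 + 1) := by
    rw [← Real.exp_nat_mul]
    refine Real.exp_le_exp.2 ?_
    push_cast
    have e1 : ((j : ℝ) + 2) ^ 2 ≤ 8 * ((j : ℝ) ^ 2 + 1) := by nlinarith [sq_nonneg ((j : ℝ) - 1)]
    have e2 : A * ((j : ℝ) + 2) ^ 2 + 1 ≤ ((j : ℝ) ^ 2 + 1) * (8 * A + 1) := by
      nlinarith [mul_le_mul_of_nonneg_left e1 hA, sq_nonneg (j : ℝ)]
    calc _ ≤ q * (((j : ℝ) ^ 2 + 1) * (8 * A + 1)) := by gcongr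
      _ = _ := by ring
  calc _ ≤ (D * (2 * ((j ^ 2 : ℕ) : ℝ) + 1) ^ 4 * r ^ j) ^ (j ^ 2 + 1) *
        Real.exp (q * (8 * A + 1)) ^ (j ^ 2 + 1) := by gcongr
    _ = (c * (2 * (j : ℝ) ^ 2 + 1) ^ 4 * r ^ j) ^ (j ^ 2 + 1) := by
        rw [← mul_pow, hc]
        push_cast
        congr 1
        ring
    _ ≤ (1 / 2) ^ (j ^ 2 + 1) := by gcongr
    _ ≤ (1 / 2) ^ j := by
        refine pow_le_pow_of_le_one (by norm_num) (by norm_num) ?_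
        nlinarith

/-- Let J be the first index with |u_M − u_J| ≤ 1; it exists since M qualifies. If J = 0, the lower
bound on u_0 suffices. If J = i + 1, then u_M ≥ u_{i+1} − 1 ≥ −A (i+2)² − 1, while |u_M − u_i| > 1,
so any power of it may be inserted as a factor. Summing over all i removes the dependence of J on
the sample point. -/
theorem exp_neg_le_of_nelson {A q : ℝ} (hq : 0 ≤ q) {u : ℕ → ℝ}
    (hu : ∀ j : ℕ, -A * (j + 1) ^ 2 ≤ u j) (n : ℕ → ℕ) (M : ℕ) :
    Real.exp (-(q * u M)) ≤ Real.exp (q * (A + 1)) +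
      ∑ j ∈ Finset.range M, |u M - u j| ^ (2 * n j) *
        Real.exp (q * (A * ((j : ℝ) + 2) ^ 2 + 1)) := by
  classical
  have hex : ∃ j, |u M - u j| ≤ 1 := ⟨M, by simp⟩
  have hspec := Nat.find_spec hex
  have hle : Nat.find hex ≤ M := Nat.find_min' hex (by simp)
  rcases hj : Nat.find hex with _ | i
  · rw [hj] at hspec
    have h1 := (abs_le.1 hspec).1
    have h2 := hu 0
    have h3 : Real.exp (-(q * u M)) ≤ Real.exp (q * (A + 1)) := by
      refine Real.exp_le_exp.2 ?_
      rw [← mul_neg]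
      refine mul_le_mul_of_nonneg_left ?_ hq
      simp at h2
      linarith
    exact h3.trans (le_add_of_nonneg_right (Finset.sum_nonneg fun _ _ => by positivity))
  · rw [hj] at hspec hle
    have hlt : 1 < |u M - u i| := not_le.1 (Nat.find_min hex (by omega))
    have h1 := (abs_le.1 hspec).1
    have h2 := hu (i + 1)
    have h3 : Real.exp (-(q * u M)) ≤ |u M - u i| ^ (2 * n i) *
        Real.exp (q * (A * ((i : ℝ) + 2) ^ 2 + 1)) := by
      refine le_trans ?_ (le_mul_of_one_le_left (Real.exp_pos _).le (one_le_pow₀ hlt.le))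
      refine Real.exp_le_exp.2 ?_
      rw [← mul_neg]
      refine mul_le_mul_of_nonneg_left ?_ hq
      push_cast at h2
      have : (i : ℝ) + 1 + 1 = i + 2 := by ring
      rw [this] at h2
      linarith
    refine h3.trans (le_trans ?_ (le_add_of_nonneg_left (Real.exp_pos _).le))
    exact Finset.single_le_sum (f := fun j : ℕ => |u M - u j| ^ (2 * n j) *
        Real.exp (q * (A * ((j : ℝ) + 2) ^ 2 + 1))) (fun _ _ => by positivity)
        (Finset.mem_range.2 (by omega))

/-- The uniform bound on the exponential moments. -/
def nelsonBound (A D r q : ℝ) : ℝ := Real.exp (q * (A + 1)) +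
  ∑' j : ℕ, (D * (2 * ((j ^ 2 : ℕ) : ℝ) + 1) ^ 4 * r ^ j) ^ (j ^ 2 + 1) *
      Real.exp (q * (A * ((j : ℝ) + 2) ^ 2 + 1))

variable {Ω : Type*} [MeasurableSpace Ω] {P : Measure Ω} [IsProbabilityMeasure P]
  {A D r : ℝ} {U : ℕ → Ω → ℝ}

/-- The pointwise bound is integrated with moments of order 2(j² + 1); the sum up to M is dominated
by the full series, hence uniformity in M. -/
theorem IsNelson.lintegral_exp_le (h : IsNelson P A D r U) (hA : 0 ≤ A) (hD : 0 ≤ D) (hr0 : 0 ≤ r)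
    (hr1 : r < 1) {q : ℝ} (hq : 0 ≤ q) (M : ℕ) :
    ∫⁻ ω, ENNReal.ofReal (Real.exp (-(q * U M ω))) ∂P ≤ ENNReal.ofReal (nelsonBound A D r q) := by
  have hint : ∀ j ∈ Finset.range M, Integrable (fun ω => |U M ω - U j ω| ^ (2 * (j ^ 2 + 1)) *
      Real.exp (q * (A * ((j : ℝ) + 2) ^ 2 + 1))) P := fun j _ =>
    ((((h.hasMoments M).sub (h.hasMoments j)).norm.pow (2 * (j ^ 2 + 1))).integrable).mul_const _
  set F : Ω → ℝ := fun ω => Real.exp (q * (A + 1)) +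
      ∑ j ∈ Finset.range M, |U M ω - U j ω| ^ (2 * (j ^ 2 + 1)) *
        Real.exp (q * (A * ((j : ℝ) + 2) ^ 2 + 1)) with hF
  have hFint : Integrable F P := (integrable_const _).add (integrable_finsetSum _ hint)
  calc _ ≤ ∫⁻ ω, ENNReal.ofReal (F ω) ∂P := lintegral_mono fun ω => ENNReal.ofReal_le_ofReal
        (exp_neg_le_of_nelson hq (fun j => h.ge j ω) (fun j => j ^ 2 + 1) M)
    _ = ENNReal.ofReal (∫ ω, F ω ∂P) := by
        rw [ofReal_integral_eq_lintegral_ofReal hFint (.of_forall fun ω => ?_)]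
        exact add_nonneg (Real.exp_pos _).le (Finset.sum_nonneg fun _ _ => by positivity)
    _ ≤ _ := by
        refine ENNReal.ofReal_le_ofReal ?_
        rw [hF, integral_add (integrable_const _) (integrable_finsetSum _ hint),
          integral_finsetSum _ hint, nelsonBound]
        simp only [integral_const, probReal_univ, one_smul, integral_mul_const]
        gcongr
        refine le_trans (Finset.sum_le_sum fun j hj => ?_)
          ((summable_nelson hr0 hr1 hA hD hq).sum_le_tsum (Finset.range M)
            fun _ _ => by positivity)
        gcongr
        exact h.cauchy j M (Finset.mem_range.1 hj).le (j ^ 2)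

theorem eLpNorm_four_le {f : Ω → ℝ} (hf : HasMoments P f) {c : ℝ} (hc : 0 ≤ c)
    (h : ∫ ω, |f ω| ^ 4 ∂P ≤ c ^ 4) : eLpNorm f 4 P ≤ ENNReal.ofReal c := by
  have hm : MemLp f 4 P := by simpa using hf 4
  rw [hm.eLpNorm_eq_integral_rpow_norm (by norm_num) (by norm_num)]
  refine ENNReal.ofReal_le_ofReal ?_
  have h4 : (4 : ℝ≥0∞).toReal = 4 := by norm_num
  rw [h4]
  have e : ∀ ω, ‖f ω‖ ^ (4 : ℝ) = |f ω| ^ 4 := fun ω => by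
    rw [Real.norm_eq_abs]; exact_mod_cast Real.rpow_natCast _ 4
  simp_rw [e]
  calc _ ≤ (c ^ 4) ^ (4⁻¹ : ℝ) := by
        refine Real.rpow_le_rpow (integral_nonneg fun ω => by positivity) h (by norm_num)
    _ = c := by
        rw [← Real.rpow_natCast, ← Real.rpow_mul hc]
        norm_num

theorem IsNelson.eLpNorm_sub_le (h : IsNelson P A D r U) (hD : 0 ≤ D) (hr0 : 0 ≤ r)
    {j M : ℕ} (hjM : j ≤ M) :
    eLpNorm (U M - U j) 4 P ≤ ENNReal.ofReal (9 * √D * √r ^ j) := by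
  refine eLpNorm_four_le (f := U M - U j) ((h.hasMoments M).sub (h.hasMoments j))
    (by positivity) ?_
  -- With m = 1 the fourth moment is at most (81 D r^j)², whose fourth root is 9 √D √r^j.
  have h1 := h.cauchy j M hjM 1
  norm_num at h1
  refine h1.trans (le_of_eq ?_)
  have e1 : √D ^ 4 = D ^ 2 := by
    rw [show 4 = 2 * 2 by norm_num, pow_mul, Real.sq_sqrt hD]
  have e2 : (√r ^ j) ^ 4 = (r ^ j) ^ 2 := by
    rw [← pow_mul, mul_comm j 4, show 4 * j = 2 * (j * 2) by ring, pow_mul, Real.sq_sqrt hr0,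
      pow_mul]
  rw [show (9 * √D * √r ^ j) ^ 4 = 9 ^ 4 * √D ^ 4 * (√r ^ j) ^ 4 by ring, e1, e2]
  ring

/-- The almost sure limit of a Nelson sequence. -/
def nelsonLimit (U : ℕ → Ω → ℝ) (ω : Ω) : ℝ := limUnder atTop fun j => U j ω

theorem IsNelson.ae_tendsto (h : IsNelson P A D r U) (hD : 0 ≤ D) (hr0 : 0 ≤ r) (hr1 : r < 1) :
    ∀ᵐ ω ∂P, Tendsto (fun j => U j ω) atTop (𝓝 (nelsonLimit U ω)) := by
  have hs0 : 0 ≤ √r := Real.sqrt_nonneg r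
  have hs1 : √r < 1 := by rw [Real.sqrt_lt' one_pos]; simpa using hr1
  -- Almost sure convergence follows from summability of the L⁴ Cauchy bounds. These must be strict;
  -- the added (1/2)^N provides strictness even when D or r vanishes.
  have hlim := Lp.ae_tendsto_of_cauchy_eLpNorm (μ := P) (p := 4) (f := U)
    (B := fun N => ENNReal.ofReal ((9 * √D + 1) * √r ^ N + (1 / 2) ^ N))
    (fun n => (h.hasMoments n).aestronglyMeasurable) (by norm_num) ?_ ?_
  · filter_upwards [hlim] with ω hω
    exact tendsto_nhds_limUnder hω
  · have hs : Summable fun N : ℕ => (9 * √D + 1) * √r ^ N + (1 / 2) ^ N :=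
      ((summable_geometric_of_lt_one hs0 hs1).mul_left _).add summable_geometric_two
    rw [← ENNReal.ofReal_tsum_of_nonneg (fun N => by positivity) hs]
    exact ENNReal.ofReal_ne_top
  · intro N n m hn hm
    have hlt : ∀ i, N ≤ i → ENNReal.ofReal (9 * √D * √r ^ i) <
        ENNReal.ofReal ((9 * √D + 1) * √r ^ N + (1 / 2) ^ N) := by
      intro i hi
      rw [ENNReal.ofReal_lt_ofReal_iff (by positivity)]
      have h1 : √r ^ i ≤ √r ^ N := pow_le_pow_of_le_one hs0 hs1.le hi
      have h2 : (0 : ℝ) < (1 / 2) ^ N := by positivity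
      have h3 : 9 * √D * √r ^ i ≤ 9 * √D * √r ^ N := by gcongr
      have h4 : 0 ≤ √r ^ N := by positivity
      linarith
    rcases le_total m n with hmn | hmn
    · exact (h.eLpNorm_sub_le hD hr0 hmn).trans_lt (hlt m hm)
    · rw [eLpNorm_sub_comm]
      exact (h.eLpNorm_sub_le hD hr0 hmn).trans_lt (hlt n hn)

theorem IsNelson.aestronglyMeasurable_limit (h : IsNelson P A D r U) (hD : 0 ≤ D) (hr0 : 0 ≤ r)
    (hr1 : r < 1) : AEStronglyMeasurable (nelsonLimit U) P :=
  aestronglyMeasurable_of_tendsto_ae atTop (fun n => (h.hasMoments n).aestronglyMeasurable)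
    (h.ae_tendsto hD hr0 hr1)

/-- A version of Fatou's lemma for `L^p` norms. -/
theorem eLpNorm_le_of_ae_tendsto {E : Type*} [NormedAddCommGroup E] {f : ℕ → Ω → E} {g : Ω → E}
    {p : ℝ≥0∞} {c : ℝ≥0∞} (hf : ∀ n, AEStronglyMeasurable (f n) P)
    (hlim : ∀ᵐ ω ∂P, Tendsto (fun n => f n ω) atTop (𝓝 (g ω)))
    (hc : ∀ᶠ n in atTop, eLpNorm (f n) p P ≤ c) : eLpNorm g p P ≤ c := by
  refine (Lp.eLpNorm_lim_le_liminf_eLpNorm hf g hlim).trans ?_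
  exact liminf_le_of_frequently_le hc.frequently

theorem IsNelson.eLpNorm_limit_sub_le (h : IsNelson P A D r U) (hD : 0 ≤ D) (hr0 : 0 ≤ r)
    (hr1 : r < 1) (j : ℕ) :
    eLpNorm (nelsonLimit U - U j) 4 P ≤ ENNReal.ofReal (9 * √D * √r ^ j) := by
  refine eLpNorm_le_of_ae_tendsto (f := fun M => U M - U j)
    (fun n => ((h.hasMoments n).sub (h.hasMoments j)).aestronglyMeasurable) ?_ ?_
  · filter_upwards [h.ae_tendsto hD hr0 hr1] with ω hω
    exact hω.sub_const _
  · filter_upwards [eventually_ge_atTop j] with M hM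
    exact h.eLpNorm_sub_le hD hr0 hM

theorem IsNelson.memLp_limit (h : IsNelson P A D r U) (hD : 0 ≤ D) (hr0 : 0 ≤ r) (hr1 : r < 1) :
    MemLp (nelsonLimit U) 4 P := by
  have h1 : MemLp (nelsonLimit U - U 0) 4 P :=
    ⟨(h.aestronglyMeasurable_limit hD hr0 hr1).sub (h.hasMoments 0).aestronglyMeasurable,
      (h.eLpNorm_limit_sub_le hD hr0 hr1 0).trans_lt ENNReal.ofReal_lt_top⟩
  have h2 : MemLp (U 0) 4 P := by simpa using h.hasMoments 0 4
  simpa using h1.add h2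

theorem eLpNorm_exp_four_le {f : Ω → ℝ} {K : ℝ}
    (h : ∫⁻ ω, ENNReal.ofReal (Real.exp (-(4 * f ω))) ∂P ≤ ENNReal.ofReal K) :
    eLpNorm (fun ω => Real.exp (-f ω)) 4 P ≤ ENNReal.ofReal K ^ (1 / 4 : ℝ) := by
  rw [eLpNorm_eq_lintegral_rpow_enorm_toReal (by norm_num) (by norm_num)]
  have h4 : (4 : ℝ≥0∞).toReal = 4 := by norm_num
  rw [h4]
  gcongr
  refine le_trans (le_of_eq (lintegral_congr fun ω => ?_)) h
  rw [Real.enorm_eq_ofReal (Real.exp_pos _).le, ENNReal.ofReal_rpow_of_nonneg (Real.exp_pos _).le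
    (by norm_num), ← Real.exp_mul]
  congr 2
  ring

theorem IsNelson.eLpNorm_exp_le (h : IsNelson P A D r U) (hA : 0 ≤ A) (hD : 0 ≤ D) (hr0 : 0 ≤ r)
    (hr1 : r < 1) (j : ℕ) : eLpNorm (fun ω => Real.exp (-U j ω)) 4 P ≤
      ENNReal.ofReal (nelsonBound A D r 4) ^ (1 / 4 : ℝ) :=
  eLpNorm_exp_four_le (h.lintegral_exp_le hA hD hr0 hr1 (by norm_num) j)

theorem IsNelson.eLpNorm_exp_limit_le (h : IsNelson P A D r U) (hA : 0 ≤ A) (hD : 0 ≤ D)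
    (hr0 : 0 ≤ r) (hr1 : r < 1) : eLpNorm (fun ω => Real.exp (-nelsonLimit U ω)) 4 P ≤
      ENNReal.ofReal (nelsonBound A D r 4) ^ (1 / 4 : ℝ) := by
  refine eLpNorm_le_of_ae_tendsto (f := fun j ω => Real.exp (-U j ω)) (fun n => ?_) ?_
    (.of_forall (h.eLpNorm_exp_le hA hD hr0 hr1))
  · exact Real.continuous_exp.comp_aestronglyMeasurable (h.hasMoments n).aestronglyMeasurable.neg
  · filter_upwards [h.ae_tendsto hD hr0 hr1] with ω hω
    exact (Real.continuous_exp.tendsto _).comp hω.neg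

/-- For a ≤ b, convexity gives 1 − e^{−(b−a)} ≤ b − a; the larger exponential is bounded by the sum
to keep the statement symmetric. -/
theorem abs_exp_neg_sub_le (a b : ℝ) :
    |Real.exp (-a) - Real.exp (-b)| ≤ |a - b| * (Real.exp (-a) + Real.exp (-b)) := by
  wlog hab : a ≤ b generalizing a b
  · have := this b a (le_of_not_ge hab)
    rwa [abs_sub_comm, abs_sub_comm a b, add_comm (Real.exp (-a))]
  have h1 : Real.exp (-b) ≤ Real.exp (-a) := Real.exp_le_exp.2 (by linarith)
  rw [abs_of_nonneg (by linarith), abs_of_nonpos (by linarith)]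
  have h2 : 1 - (b - a) ≤ Real.exp (-(b - a)) := by linarith [Real.add_one_le_exp (-(b - a))]
  have h3 : Real.exp (-b) = Real.exp (-a) * Real.exp (-(b - a)) := by
    rw [← Real.exp_add]; congr 1; ring
  have h4 := Real.exp_pos (-a)
  have h5 := Real.exp_pos (-b)
  nlinarith [mul_le_mul_of_nonneg_left h2 h4.le]

/-- Hölder with 1/4 + 1/4 = 1/2. This is why differences of interactions and exponential moments are
both controlled in L⁴: the Boltzmann factors then converge in L² and can be paired with Wick
monomials. -/
theorem eLpNorm_exp_sub_le {f g : Ω → ℝ} (hf : AEStronglyMeasurable f P)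
    (hg : AEStronglyMeasurable g P) :
    eLpNorm (fun ω => Real.exp (-f ω) - Real.exp (-g ω)) 2 P ≤ eLpNorm (f - g) 4 P *
      (eLpNorm (fun ω => Real.exp (-f ω)) 4 P + eLpNorm (fun ω => Real.exp (-g ω)) 4 P) := by
  have hef : AEStronglyMeasurable (fun ω => Real.exp (-f ω)) P :=
    Real.continuous_exp.comp_aestronglyMeasurable hf.neg
  have heg : AEStronglyMeasurable (fun ω => Real.exp (-g ω)) P :=
    Real.continuous_exp.comp_aestronglyMeasurable hg.neg
  have hT : ENNReal.HolderTriple 4 4 2 := by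
    refine ⟨?_⟩
    rw [← two_mul, show (4 : ℝ≥0∞) = 2 * 2 by norm_num, ENNReal.mul_inv (by simp) (by simp),
      ← mul_assoc, ENNReal.mul_inv_cancel (by simp) (by simp), one_mul]
  have h1 : eLpNorm (fun ω => Real.exp (-f ω) - Real.exp (-g ω)) 2 P ≤
      eLpNorm (fun ω => (f - g) ω * (Real.exp (-f ω) + Real.exp (-g ω))) 2 P := by
    refine eLpNorm_mono fun ω => ?_
    rw [norm_mul, Real.norm_eq_abs, Real.norm_eq_abs, Real.norm_eq_abs,
      abs_of_nonneg (add_nonneg (Real.exp_pos (-f ω)).le (Real.exp_pos (-g ω)).le)]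
    exact abs_exp_neg_sub_le _ _
  have h2 := eLpNorm_smul_le_mul_eLpNorm (p := 4) (q := 4) (r := 2) (μ := P)
    (f := fun ω => Real.exp (-f ω) + Real.exp (-g ω)) (φ := f - g) (hef.add heg) (hf.sub hg)
  refine h1.trans (h2.trans ?_)
  gcongr
  exact eLpNorm_add_le hef heg (by norm_num)

end Nelson

end Phi42

end

noncomputable section

namespace Phi42

/-! ### The interaction without cutoff -/

section Limits

variable {κ C : ℝ} {Ω : Type*} [MeasurableSpace Ω] {P : Measure Ω} [IsProbabilityMeasure P]
  {X : (Fin 2 → ℤ) → Ω → ℂ}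

/-- The interaction with weight `w`, as the limit of the interactions with sharp cutoff. -/
def interaction (κ : ℝ) (X : (Fin 2 → ℤ) → Ω → ℂ) (w : (Fin 2 → ℤ) → ℝ) : Ω → ℝ :=
  nelsonLimit (ballInteraction κ X w)

theorem GaussianFamily.hasMoments_ballInteraction (hX : GaussianFamily P X)
    (w : (Fin 2 → ℤ) → ℝ) (j : ℕ) : HasMoments P (ballInteraction κ X w j) :=
  hX.hasMoments_cutoffInteraction _ _ _ _ _

/-- A and D are chosen before the weight; this order of quantifiers is the uniformity in ε. -/
theorem isNelson_ball (hκ : 0 < κ) (hX : GaussianFamily P X) (C : ℝ) : ∃ A D, 0 ≤ A ∧ 0 ≤ D ∧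
    ∀ w, IsWeight κ C w → IsNelson P A D boxRate (ballInteraction κ X w) := by
  obtain ⟨D, hD, h⟩ := moment_ballInteraction_sub_le hκ C
  refine ⟨C ^ 2 * (9 / κ + 25) ^ 2, D, by positivity, hD, fun w hw => ⟨fun j => ?_, fun j ω => ?_,
    fun j M hjM m => h hX w hw j M hjM m⟩⟩
  · exact hX.hasMoments_ballInteraction w j
  · exact ballInteraction_ge hκ hw X j ω

/-- The square of the `L⁴` distance of two interactions, up to a constant. -/
def coeffDist (B : Finset (Fin 2 → ℤ)) (w a : (Fin 2 → ℤ) → ℝ) (τ E : ℝ)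
    (w' a' : (Fin 2 → ℤ) → ℝ) (τ' E' : ℝ) : ℝ :=
  880 * (∑ k ∈ B, ∑ l' ∈ B, ∑ l ∈ B, ∑ k' ∈ B,
          (coeffQuartic w a k l' l k' - coeffQuartic w' a' k l' l k') ^ 2) +
        4 * (∑ k ∈ B, (coeffQuadratic B w a τ k - coeffQuadratic B w' a' τ' k) ^ 2) +
        (coeffConst B w a E - coeffConst B w' a' E') ^ 2

theorem coeffDist_nonneg (B : Finset (Fin 2 → ℤ)) (w a : (Fin 2 → ℤ) → ℝ) (τ E : ℝ)
    (w' a' : (Fin 2 → ℤ) → ℝ) (τ' E' : ℝ) : 0 ≤ coeffDist B w a τ E w' a' τ' E' := by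
  refine add_nonneg (add_nonneg (mul_nonneg (by norm_num) ?_)
      (mul_nonneg (by norm_num) ?_)) (sq_nonneg _)
  · exact Finset.sum_nonneg fun _ _ => Finset.sum_nonneg fun _ _ =>
        Finset.sum_nonneg fun _ _ => Finset.sum_nonneg fun _ _ => sq_nonneg _
  · exact Finset.sum_nonneg fun _ _ => sq_nonneg _

theorem GaussianFamily.eLpNorm_cutoffInteraction_sub_le (hX : GaussianFamily P X)
    (B : Finset (Fin 2 → ℤ)) {w w' : (Fin 2 → ℤ) → ℝ} (hw : ∀ k, w (-k) = w k)
    (hw' : ∀ k, w' (-k) = w' k) (a a' : (Fin 2 → ℤ) → ℝ) (τ E τ' E' : ℝ) :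
    eLpNorm (cutoffInteraction X B w a τ E - cutoffInteraction X B w' a' τ' E') 4 P ≤
      ENNReal.ofReal √(729 * coeffDist B w a τ E w' a' τ' E') := by
  refine eLpNorm_four_le ((hX.hasMoments_cutoffInteraction B w a τ E).sub
    (hX.hasMoments_cutoffInteraction B w' a' τ' E')) (Real.sqrt_nonneg _) ?_
  -- Here m = 1, so the constant is 9 · 3⁴ = 729.
  have h := hX.moment_cutoffInteraction_sub_le B hw hw' a a' τ E τ' E' 1
  refine h.trans (le_of_eq ?_)
  change _ = √_ ^ (2 * 2)
  have h0 := coeffDist_nonneg B w a τ E w' a' τ' E'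
  rw [pow_mul (√_) 2 2, Real.sq_sqrt (by positivity), coeffDist]
  norm_num

/-- At a fixed cutoff only finitely many weights enter, so continuity holds for the topology of
pointwise convergence. -/
theorem continuous_coeffDist (B : Finset (Fin 2 → ℤ)) (a w' : (Fin 2 → ℤ) → ℝ) (j : ℕ) :
    Continuous fun w : (Fin 2 → ℤ) → ℝ => coeffDist B w a (ballMass κ w j) (ballEnergy κ w j)
      w' a (ballMass κ w' j) (ballEnergy κ w' j) := by
  have h1 : ∀ k l' l k', Continuous fun w : (Fin 2 → ℤ) → ℝ => coeffQuartic w a k l' l k' := by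
    intro k l' l k'
    unfold coeffQuartic
    split_ifs <;> fun_prop
  unfold coeffDist coeffQuadratic coeffConst ballMass ballEnergy
  fun_prop

theorem tendsto_ballInteraction_weight (hX : GaussianFamily P X) {β : Type*}
    {F : Filter β} {w : β → (Fin 2 → ℤ) → ℝ} {w₀ : (Fin 2 → ℤ) → ℝ}
    (hw : ∀ᶠ b in F, IsWeight κ C (w b)) (hw₀ : IsWeight κ C w₀)
    (hlim : ∀ k, Tendsto (fun b => w b k) F (𝓝 (w₀ k))) (j : ℕ) :
    Tendsto (fun b => eLpNorm (ballInteraction κ X (w b) j - ballInteraction κ X w₀ j) 4 P) F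
      (𝓝 0) := by
  have h1 := ((continuous_coeffDist (κ := κ) (box j) (amp κ 1) w₀ j).tendsto w₀).comp
    (tendsto_pi_nhds.2 hlim)
  have h2 : coeffDist (box j) w₀ (amp κ 1) (ballMass κ w₀ j) (ballEnergy κ w₀ j)
      w₀ (amp κ 1) (ballMass κ w₀ j) (ballEnergy κ w₀ j) = 0 := by simp [coeffDist]
  rw [h2] at h1
  have h3 := ENNReal.tendsto_ofReal ((h1.const_mul 729).sqrt)
  rw [mul_zero, Real.sqrt_zero, ENNReal.ofReal_zero] at h3
  refine tendsto_of_tendsto_of_tendsto_of_le_of_le' tendsto_const_nhds h3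
    (.of_forall fun _ => zero_le) ?_
  filter_upwards [hw] with b hb
  exact hX.eLpNorm_cutoffInteraction_sub_le (box j) hb.even hw₀.even _ _ _ _ _ _

/-- The Boltzmann factors are uniformly bounded in `L²` and converge geometrically. -/
theorem exists_boltzmann_bounds (hκ : 0 < κ) (hX : GaussianFamily P X) (C : ℝ) :
    ∃ L θ : ℝ, 0 ≤ L ∧ 0 ≤ θ ∧ θ < 1 ∧ ∀ w, IsWeight κ C w →
      AEStronglyMeasurable (interaction κ X w) P ∧ MemLp (interaction κ X w) 4 P ∧
      (∀ᵐ ω ∂P, Tendsto (fun j => ballInteraction κ X w j ω) atTop (𝓝 (interaction κ X w ω))) ∧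
      (∀ j, eLpNorm (fun ω => Real.exp (-ballInteraction κ X w j ω)) 4 P ≤ ENNReal.ofReal L) ∧
      eLpNorm (fun ω => Real.exp (-interaction κ X w ω)) 4 P ≤ ENNReal.ofReal L ∧
      (∀ j, eLpNorm (interaction κ X w - ballInteraction κ X w j) 4 P ≤
        ENNReal.ofReal (L * θ ^ j)) ∧
      (∀ j, eLpNorm (fun ω => Real.exp (-ballInteraction κ X w (j + 1) ω) -
        Real.exp (-ballInteraction κ X w j ω)) 2 P ≤ ENNReal.ofReal (L * θ ^ j)) ∧
      (∀ j, eLpNorm (fun ω => Real.exp (-interaction κ X w ω) -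
        Real.exp (-ballInteraction κ X w j ω)) 2 P ≤ ENNReal.ofReal (L * θ ^ j)) := by
  obtain ⟨A, D, hA, hD, h⟩ := isNelson_ball hκ hX C
  have hr0 := boxRate_pos.le
  have hr1 := boxRate_lt_one
  set K : ℝ := max (nelsonBound A D boxRate 4) 0 ^ (1 / 4 : ℝ) with hK
  have hK0 : 0 ≤ K := Real.rpow_nonneg (le_max_right _ _) _
  have hKe : ENNReal.ofReal (nelsonBound A D boxRate 4) ^ (1 / 4 : ℝ) ≤ ENNReal.ofReal K := by
    rw [hK, ← ENNReal.ofReal_rpow_of_nonneg (le_max_right _ _) (by norm_num)]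
    gcongr
    exact le_max_left _ _
  -- The three summands serve the exponential moments, the L⁴ distances of the interactions and the
  -- L² distances of the Boltzmann factors, so that one L covers all bounds.
  refine ⟨K + 9 * √D + 9 * √D * (K + K), √boxRate, by positivity, Real.sqrt_nonneg _, ?_,
    fun w hw => ?_⟩
  · rw [Real.sqrt_lt' one_pos]; simpa using hr1
  have hN := h w hw
  have hm := hN.aestronglyMeasurable_limit hD hr0 hr1
  have e1 : ∀ j, eLpNorm (fun ω => Real.exp (-ballInteraction κ X w j ω)) 4 P ≤
      ENNReal.ofReal K := fun j => (hN.eLpNorm_exp_le hA hD hr0 hr1 j).trans hKe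
  have e2 := (hN.eLpNorm_exp_limit_le hA hD hr0 hr1).trans hKe
  have hle : ∀ {x : ℝ≥0∞} {j : ℕ}, x ≤ ENNReal.ofReal (9 * √D * √boxRate ^ j) →
      x * (ENNReal.ofReal K + ENNReal.ofReal K) ≤
      ENNReal.ofReal ((K + 9 * √D + 9 * √D * (K + K)) * √boxRate ^ j) := by
    intro x j hx
    calc _ ≤ ENNReal.ofReal (9 * √D * √boxRate ^ j) * (ENNReal.ofReal K + ENNReal.ofReal K) := by
          gcongr
      _ = ENNReal.ofReal (9 * √D * √boxRate ^ j * (K + K)) := by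
          rw [← ENNReal.ofReal_add hK0 hK0, ← ENNReal.ofReal_mul (by positivity)]
      _ ≤ _ := by
          refine ENNReal.ofReal_le_ofReal ?_
          have : 0 ≤ (K + 9 * √D) * √boxRate ^ j := by positivity
          nlinarith
  have hKL : ENNReal.ofReal K ≤ ENNReal.ofReal (K + 9 * √D + 9 * √D * (K + K)) := by
    refine ENNReal.ofReal_le_ofReal ?_
    have : 0 ≤ 9 * √D + 9 * √D * (K + K) := by positivity
    linarith
  refine ⟨hm, hN.memLp_limit hD hr0 hr1, hN.ae_tendsto hD hr0 hr1, fun j => (e1 j).trans hKL,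
    e2.trans hKL, fun j => ?_, fun j => ?_, fun j => ?_⟩
  · refine (hN.eLpNorm_limit_sub_le hD hr0 hr1 j).trans (ENNReal.ofReal_le_ofReal ?_)
    gcongr
    have : 0 ≤ K + 9 * √D * (K + K) := by positivity
    linarith
  · exact ((eLpNorm_exp_sub_le (hN.hasMoments _).aestronglyMeasurable
      (hN.hasMoments _).aestronglyMeasurable).trans (by gcongr; exacts [e1 _, e1 _])).trans
      (hle (hN.eLpNorm_sub_le hD hr0 j.le_succ))
  · exact ((eLpNorm_exp_sub_le hm (hN.hasMoments _).aestronglyMeasurable).trans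
      (mul_le_mul_right (add_le_add e2 (e1 j)) _)).trans (hle (hN.eLpNorm_limit_sub_le hD hr0 hr1 j))

/-- Continuity of the Boltzmann factors with sharp cutoff in the weight. -/
theorem tendsto_ball_boltzmann_weight (hκ : 0 < κ) (hX : GaussianFamily P X) {β : Type*}
    {F : Filter β} {w : β → (Fin 2 → ℤ) → ℝ} {w₀ : (Fin 2 → ℤ) → ℝ}
    (hw : ∀ᶠ b in F, IsWeight κ C (w b)) (hw₀ : IsWeight κ C w₀)
    (hlim : ∀ k, Tendsto (fun b => w b k) F (𝓝 (w₀ k))) (j : ℕ) :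
    Tendsto (fun b => eLpNorm (fun ω => Real.exp (-ballInteraction κ X (w b) j ω) -
      Real.exp (-ballInteraction κ X w₀ j ω)) 2 P) F (𝓝 0) := by
  obtain ⟨L, θ, hL, -, -, h⟩ := exists_boltzmann_bounds hκ hX C
  have h1 := ENNReal.Tendsto.mul_const (tendsto_ballInteraction_weight hX hw hw₀ hlim j)
    (b := ENNReal.ofReal L + ENNReal.ofReal L) (Or.inr (by simp))
  rw [zero_mul] at h1
  refine tendsto_of_tendsto_of_tendsto_of_le_of_le' tendsto_const_nhds h1
    (.of_forall fun _ => zero_le) ?_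
  filter_upwards [hw] with b hb
  refine (eLpNorm_exp_sub_le
    (hX.hasMoments_ballInteraction _ _).aestronglyMeasurable
    (hX.hasMoments_ballInteraction _ _).aestronglyMeasurable).trans ?_
  gcongr
  exacts [(h _ hb).2.2.2.1 j, (h _ hw₀).2.2.2.1 j]

/-- Continuity of the Boltzmann factor in the weight. -/
theorem tendsto_boltzmann_weight (hκ : 0 < κ) (hX : GaussianFamily P X) {β : Type*}
    {F : Filter β} {w : β → (Fin 2 → ℤ) → ℝ} {w₀ : (Fin 2 → ℤ) → ℝ}
    (hw : ∀ᶠ b in F, IsWeight κ C (w b)) (hw₀ : IsWeight κ C w₀)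
    (hlim : ∀ k, Tendsto (fun b => w b k) F (𝓝 (w₀ k))) :
    Tendsto (fun b => eLpNorm (fun ω => Real.exp (-interaction κ X (w b) ω) -
      Real.exp (-interaction κ X w₀ ω)) 2 P) F (𝓝 0) := by
  obtain ⟨L, θ, hL, hθ0, hθ1, h⟩ := exists_boltzmann_bounds hκ hX C
  rw [ENNReal.tendsto_nhds_zero]
  intro δ hδ
  have h1 : Tendsto (fun j : ℕ => ENNReal.ofReal (L * θ ^ j)) atTop (𝓝 0) := by
    rw [← ENNReal.ofReal_zero]
    refine ENNReal.tendsto_ofReal ?_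
    simpa using (tendsto_pow_atTop_nhds_zero_of_lt_one hθ0 hθ1).const_mul L
  have hδ3 : 0 < δ / 3 := ENNReal.div_pos hδ.ne' (by simp)
  -- The cutoff j is fixed first and works for all weights at once; only the middle term at this j
  -- depends on the convergence of the weights.
  obtain ⟨j, hj⟩ := (ENNReal.tendsto_nhds_zero.1 h1 _ hδ3).exists
  filter_upwards [hw, ENNReal.tendsto_nhds_zero.1
    (tendsto_ball_boltzmann_weight hκ hX hw hw₀ hlim j) _ hδ3] with b hb hbj
  have hbm := fun {w} (hw : IsWeight κ C w) => Real.continuous_exp.comp_aestronglyMeasurable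
    (h w hw).1.neg
  have hjm := fun {w} (_ : IsWeight κ C w) => Real.continuous_exp.comp_aestronglyMeasurable
    (hX.hasMoments_ballInteraction (κ := κ) w j).aestronglyMeasurable.neg
  have e : (fun ω => Real.exp (-interaction κ X (w b) ω) - Real.exp (-interaction κ X w₀ ω)) =
      ((fun ω => Real.exp (-interaction κ X (w b) ω) - Real.exp (-ballInteraction κ X (w b) j ω)) +
      (fun ω => Real.exp (-ballInteraction κ X (w b) j ω) -
        Real.exp (-ballInteraction κ X w₀ j ω))) -
      (fun ω => Real.exp (-interaction κ X w₀ ω) - Real.exp (-ballInteraction κ X w₀ j ω)) := by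
    funext ω
    simp only [Pi.add_apply, Pi.sub_apply]
    ring
  rw [e]
  refine (eLpNorm_sub_le (((hbm hb).sub (hjm hb)).add ((hjm hb).sub (hjm hw₀)))
    ((hbm hw₀).sub (hjm hw₀)) (by norm_num)).trans ?_
  refine (add_le_add (eLpNorm_add_le ((hbm hb).sub (hjm hb)) ((hjm hb).sub (hjm hw₀))
    (by norm_num)) le_rfl).trans ?_
  calc _ ≤ δ / 3 + δ / 3 + δ / 3 := by
        gcongr
        exacts [((h _ hb).2.2.2.2.2.2.2 j).trans hj, hbj, ((h _ hw₀).2.2.2.2.2.2.2 j).trans hj]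
    _ = δ := ENNReal.add_thirds δ

end Limits

end Phi42

end

noncomputable section

namespace Phi42

/-! ### Removal of a general cutoff -/

/-- Dominated convergence for series, with the moving finite range of summation absorbed into the
coefficients. -/
theorem tendsto_sum_mul_of_summable {α β : Type*} {F : Filter α} {B : α → Finset β}
    (hB : ∀ b, ∀ᶠ a in F, b ∈ B a) {f : β → ℝ} (hf : Summable f) {c : α → β → ℝ} {K : ℝ}
    (hc : ∀ a b, |c a b| ≤ K) {c₀ : β → ℝ} (hc₀ : ∀ b, Tendsto (fun a => c a b) F (𝓝 (c₀ b))) :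
    Tendsto (fun a => ∑ b ∈ B a, c a b * f b) F (𝓝 (∑' b, c₀ b * f b)) := by
  classical
  have h1 : ∀ a, ∑ b ∈ B a, c a b * f b = ∑' b, if b ∈ B a then c a b * f b else 0 := by
    intro a
    rw [tsum_eq_sum (s := B a) fun b hb => if_neg hb]
    exact Finset.sum_congr rfl fun b hb => (if_pos hb).symm
  simp_rw [h1]
  refine tendsto_tsum_of_dominated_convergence (bound := fun b => K * |f b|)
    (hf.abs.mul_left K) (fun b => ?_) (.of_forall fun a b => ?_)
  · refine ((hc₀ b).mul_const (f b)).congr' ?_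
    filter_upwards [hB b] with a ha
    rw [if_pos ha]
  · have h0 : 0 ≤ K * |f b| := mul_nonneg ((abs_nonneg _).trans (hc a b)) (abs_nonneg _)
    split_ifs
    · rw [Real.norm_eq_abs, abs_mul]
      exact mul_le_mul_of_nonneg_right (hc a b) (abs_nonneg _)
    · simpa using h0

theorem eventually_mem_box (k : Fin 2 → ℤ) : ∀ᶠ j in atTop, k ∈ box j := by
  filter_upwards [tendsto_box.eventually (eventually_ge_atTop {k})] with j hj
  exact hj (Finset.mem_singleton_self k)

theorem eventually_mem_box_snd (k : Fin 2 → ℤ) :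
    ∀ᶠ q : ℝ × ℕ in atTop ×ˢ atTop, k ∈ box q.2 :=
  tendsto_snd.eventually (eventually_mem_box k)

section Cutoff

variable {κ C S : ℝ} {w : (Fin 2 → ℤ) → ℝ} {s : ℝ → (Fin 2 → ℤ) → ℝ}

/-- The sum over any box is dominated by a full series that depends on N alone, and dominated
convergence sends this series to zero. The limit is therefore joint in the cutoff N and the
truncation j. -/
theorem tendsto_quartic_cutoff (hκ : 0 < κ) (hw : IsWeight κ C w) (hS : ∀ N k, |s N k| ≤ S)
    (hs : ∀ k, Tendsto (fun N => s N k) atTop (𝓝 1)) :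
    Tendsto (fun q : ℝ × ℕ => ∑ k ∈ box q.2, ∑ l' ∈ box q.2, ∑ l ∈ box q.2, ∑ k' ∈ box q.2,
      (coeffQuartic w (amp κ (s q.1)) k l' l k' - coeffQuartic w (amp κ 1) k l' l k') ^ 2)
      (atTop ×ˢ atTop) (𝓝 0) := by
  set e : (Fin 2 → ℤ) → ℝ := fun k => (eigenvalue κ k)⁻¹ with he
  have he0 : ∀ k, 0 ≤ e k := fun k => inv_nonneg.2 (eigenvalue_pos hκ k).le
  have hg : Summable fun q : (Fin 2 → ℤ) × (Fin 2 → ℤ) × (Fin 2 → ℤ) =>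
      e q.1 * e q.2.1 * e q.2.2 * e (q.2.1 - q.2.2 + q.1) := by
    have := summable_quartic_rpow hκ (r := 1) (by norm_num)
    simpa only [Real.rpow_neg_one] using this
  have hep : ∀ k l' l k', 0 ≤ e k * e l' * e l * e k' := fun k l' l k' =>
    mul_nonneg (mul_nonneg (mul_nonneg (he0 _) (he0 _)) (he0 _)) (he0 _)
  have hS0 : 0 ≤ S := (abs_nonneg _).trans (hS 0 0)
  set d : ℝ → (Fin 2 → ℤ) × (Fin 2 → ℤ) × (Fin 2 → ℤ) → ℝ := fun N q =>
    C ^ 2 * (s N q.1 * s N q.2.1 * s N q.2.2 * s N (q.2.1 - q.2.2 + q.1) - 1) ^ 2 with hd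
  have hdS : ∀ N q, d N q ≤ C ^ 2 * (S ^ 4 + 1) ^ 2 := by
    intro N q
    refine mul_le_mul_of_nonneg_left ?_ (sq_nonneg C)
    rw [sq_le_sq, abs_of_nonneg (show 0 ≤ S ^ 4 + 1 by positivity)]
    refine (abs_sub _ _).trans ?_
    rw [abs_one, abs_mul, abs_mul, abs_mul, show S ^ 4 = S * S * S * S by ring]
    gcongr <;> exact hS _ _
  have hd0 : ∀ N q, 0 ≤ d N q := fun N q => mul_nonneg (sq_nonneg _) (sq_nonneg _)
  have hlim : Tendsto (fun N => ∑' q : (Fin 2 → ℤ) × (Fin 2 → ℤ) × (Fin 2 → ℤ),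
      d N q * (e q.1 * e q.2.1 * e q.2.2 * e (q.2.1 - q.2.2 + q.1))) atTop (𝓝 0) := by
    rw [show (0 : ℝ) = ∑' q : (Fin 2 → ℤ) × (Fin 2 → ℤ) × (Fin 2 → ℤ), 0 by simp]
    refine tendsto_tsum_of_dominated_convergence (hg.mul_left (C ^ 2 * (S ^ 4 + 1) ^ 2))
      (fun q => ?_) (.of_forall fun N q => ?_)
    · have := (((((hs q.1).mul (hs q.2.1)).mul (hs q.2.2)).mul
        (hs (q.2.1 - q.2.2 + q.1))).sub_const 1).pow 2
      have := (this.const_mul (C ^ 2)).mul_const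
        (e q.1 * e q.2.1 * e q.2.2 * e (q.2.1 - q.2.2 + q.1))
      simpa using this
    · rw [Real.norm_of_nonneg (mul_nonneg (hd0 _ _) (hep _ _ _ _))]
      exact mul_le_mul_of_nonneg_right (hdS _ _) (hep _ _ _ _)
  refine squeeze_zero (fun q => Finset.sum_nonneg fun _ _ => Finset.sum_nonneg fun _ _ =>
    Finset.sum_nonneg fun _ _ => Finset.sum_nonneg fun _ _ => sq_nonneg _) (fun q => ?_)
    (hlim.comp tendsto_fst)
  refine sum_quadruples_le
    (Summable.of_nonneg_of_le (fun p => mul_nonneg (hd0 q.1 p) (hep _ _ _ _))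
      (fun p => mul_le_mul_of_nonneg_right (hdS q.1 p) (hep _ _ _ _)) (hg.mul_left _))
    (fun p => mul_nonneg (hd0 _ _) (hep _ _ _ _)) (fun k l' l k' h => ?_) _
    (fun k hk l' hl' l hl hk' => ?_)
  · rw [coeffQuartic_sub_sq hκ, if_neg h]
  · rw [coeffQuartic_sub_sq hκ, if_pos (by abel)]
    simp only [Pi.one_apply, mul_one]
    refine mul_le_mul_of_nonneg_right ?_ (hep _ _ _ _)
    have hw2 : w (l - k) ^ 2 ≤ C ^ 2 := pow_le_pow_left₀ (hw.nonneg _) (hw.le _) 2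
    have h0 := sq_nonneg (s q.1 k * s q.1 l' * s q.1 l * s q.1 (l' - l + k) - 1)
    calc _ = (1 / 4) * (w (l - k) ^ 2 *
          (s q.1 k * s q.1 l' * s q.1 l * s q.1 (l' - l + k) - 1) ^ 2) := by ring
      _ ≤ 1 * (C ^ 2 * (s q.1 k * s q.1 l' * s q.1 l * s q.1 (l' - l + k) - 1) ^ 2) := by
          gcongr
          norm_num
      _ = _ := one_mul _

theorem coeffConst_amp_one (hκ : 0 < κ) (w : (Fin 2 → ℤ) → ℝ) (j : ℕ) :
    coeffConst (box j) w (amp κ 1) (ballEnergy κ w j) = 0 := by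
  simp [coeffConst, ballEnergy, amp_sq hκ]

variable {Ω : Type*} [MeasurableSpace Ω] {P : Measure Ω} [IsProbabilityMeasure P]
  {X : (Fin 2 → ℤ) → Ω → ℂ}

/-- Convergence of interactions with general cutoffs, from the convergence of the quadratic
and constant parts of their chaos decomposition. -/
theorem tendsto_cutoff_interaction (hκ : 0 < κ) (hX : GaussianFamily P X) (hw : IsWeight κ C w)
    (hS : ∀ N k, |s N k| ≤ S) (hs : ∀ k, Tendsto (fun N => s N k) atTop (𝓝 1))
    {τ E : ℝ → ℕ → ℝ}
    (h₂ : Tendsto (fun q : ℝ × ℕ => ∑ l ∈ box q.2,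
      (coeffQuadratic (box q.2) w (amp κ (s q.1)) (τ q.1 q.2) l -
        coeffQuadratic (box q.2) w (amp κ 1) (ballMass κ w q.2) l) ^ 2) (atTop ×ˢ atTop) (𝓝 0))
    (h₀ : Tendsto (fun q : ℝ × ℕ => coeffConst (box q.2) w (amp κ (s q.1)) (E q.1 q.2))
      (atTop ×ˢ atTop) (𝓝 0)) {U : ℝ → Ω → ℝ}
    (hU : ∀ᶠ N in atTop, ∀ᵐ ω ∂P, Tendsto (fun j => cutoffInteraction X (box j) w (amp κ (s N))
      (τ N j) (E N j) ω) atTop (𝓝 (U N ω))) :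
    Tendsto (fun N => eLpNorm (U N - interaction κ X w) 2 P) atTop (𝓝 0) := by
  obtain ⟨L, θ, -, -, -, hb⟩ := exists_boltzmann_bounds hκ hX C
  have hae := (hb w hw).2.2.1
  have hD : Tendsto (fun q : ℝ × ℕ => coeffDist (box q.2) w (amp κ (s q.1)) (τ q.1 q.2)
      (E q.1 q.2) w (amp κ 1) (ballMass κ w q.2) (ballEnergy κ w q.2)) (atTop ×ˢ atTop)
      (𝓝 0) := by
    have := (((tendsto_quartic_cutoff hκ hw hS hs).const_mul 880).add (h₂.const_mul 4)).add
      (h₀.pow 2)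
    simp only [mul_zero, add_zero, ne_eq, OfNat.ofNat_ne_zero, not_false_eq_true, zero_pow] at this
    refine this.congr fun q => ?_
    rw [coeffDist, coeffConst_amp_one hκ, sub_zero]
  have hD' := ENNReal.tendsto_ofReal ((hD.const_mul 729).sqrt)
  rw [mul_zero, Real.sqrt_zero, ENNReal.ofReal_zero] at hD'
  rw [ENNReal.tendsto_nhds_zero] at hD' ⊢
  intro δ hδ
  -- The joint limit gives, for each large N, the bound for all large truncations j. Fatou's lemma
  -- in j transfers it to the untruncated interaction.
  filter_upwards [(hD' δ hδ).curry, hU] with N hN hUN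
  refine eLpNorm_le_of_ae_tendsto (f := fun j => cutoffInteraction X (box j) w (amp κ (s N))
    (τ N j) (E N j) - ballInteraction κ X w j) (fun j => ?_) ?_ ?_
  · exact ((hX.hasMoments_cutoffInteraction _ _ _ _ _).sub
      (hX.hasMoments_ballInteraction w j)).aestronglyMeasurable
  · filter_upwards [hUN, hae] with ω h1 h2
    exact h1.sub h2
  · filter_upwards [hN] with j hj
    refine (eLpNorm_le_eLpNorm_of_exponent_le (q := 4) (by norm_num)
      ((hX.hasMoments_cutoffInteraction _ _ _ _ _).sub
      (hX.hasMoments_ballInteraction w j)).aestronglyMeasurable).trans ?_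
    exact (hX.eLpNorm_cutoffInteraction_sub_le _ hw.even hw.even _ _ _ _ _ _).trans hj

/-- Convergence of the local interaction with general cutoffs. -/
theorem tendsto_cutoff_interaction_local (hκ : 0 < κ) (hX : GaussianFamily P X)
    (hw : IsWeight κ C 1)
    (hS : ∀ N k, |s N k| ≤ S) (hs : ∀ k, Tendsto (fun N => s N k) atTop (𝓝 1)) {U : ℝ → Ω → ℝ}
    (hU : ∀ᶠ N in atTop, ∀ᵐ ω ∂P, Tendsto (fun j => cutoffInteraction X (box j) 1 (amp κ (s N))
      (∑ k ∈ box j, amp κ (s N) k ^ 2) ((1 / 2) * (∑ k ∈ box j, amp κ (s N) k ^ 2) ^ 2) ω) atTop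
      (𝓝 (U N ω))) :
    Tendsto (fun N => eLpNorm (U N - interaction κ X 1) 2 P) atTop (𝓝 0) := by
  refine tendsto_cutoff_interaction hκ hX hw hS hs ?_ ?_ hU
  -- For the constant weight 1 the counterterms of Wick ordering cancel the quadratic and constant
  -- parts exactly, so the interaction is a pure quartic chaos.
  · refine tendsto_const_nhds.congr fun q => (Finset.sum_eq_zero fun l _ => ?_).symm
    simp [coeffQuadratic, ballMass, amp_sq hκ]
  · refine tendsto_const_nhds.congr fun q => ?_
    rw [coeffConst, sq, Finset.sum_mul_sum]
    simp

/-- From ab ≤ a² + b², each half depends on one eigenvalue and on the difference of the momenta, and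
the corresponding sums factorize. -/
theorem summable_weight_pairs (hκ : 0 < κ) (hw0 : ∀ k, 0 ≤ w k) (hws : Summable w) :
    Summable fun p : (Fin 2 → ℤ) × (Fin 2 → ℤ) =>
      w (p.2 - p.1) * ((eigenvalue κ p.1)⁻¹ * (eigenvalue κ p.2)⁻¹) := by
  have h1 := (summable_eigenvalue_inv_sq hκ).mul_of_nonneg hws (fun k => sq_nonneg _) hw0
  have h2 := h1.comp_injective (i := fun p : (Fin 2 → ℤ) × (Fin 2 → ℤ) => (p.1, p.2 - p.1))
    (by rintro ⟨a, b⟩ ⟨c, d⟩ h; simp only [Prod.mk.injEq] at h; obtain ⟨rfl, h⟩ := h; simpa using h)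
  have h3 := h1.comp_injective (i := fun p : (Fin 2 → ℤ) × (Fin 2 → ℤ) => (p.2, p.2 - p.1))
    (by rintro ⟨a, b⟩ ⟨c, d⟩ h; simp only [Prod.mk.injEq] at h; obtain ⟨rfl, h⟩ := h; simpa using h)
  refine Summable.of_nonneg_of_le (fun p => ?_) (fun p => ?_) (h2.add h3)
  · exact mul_nonneg (hw0 _) (mul_nonneg (inv_nonneg.2 (eigenvalue_pos hκ _).le)
      (inv_nonneg.2 (eigenvalue_pos hκ _).le))
  · simp only [Function.comp_apply]
    have h := hw0 (p.2 - p.1)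
    rw [← add_mul, mul_comm]
    refine mul_le_mul_of_nonneg_right ?_ h
    nlinarith [sq_nonneg ((eigenvalue κ p.1)⁻¹ - (eigenvalue κ p.2)⁻¹),
      sq_nonneg ((eigenvalue κ p.1)⁻¹), sq_nonneg ((eigenvalue κ p.2)⁻¹)]

theorem summable_weight_mul (hκ : 0 < κ) (hw0 : ∀ k, 0 ≤ w k) (hws : Summable w)
    (l : Fin 2 → ℤ) : Summable fun k => w (l - k) * (eigenvalue κ k)⁻¹ := by
  have h1 : Summable fun k => w (l - k) := hws.comp_injective sub_right_injective
  refine Summable.of_nonneg_of_le (fun k => mul_nonneg (hw0 _)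
    (inv_nonneg.2 (eigenvalue_pos hκ k).le)) (fun k => ?_) (h1.mul_right κ⁻¹)
  exact mul_le_mul_of_nonneg_left (inv_anti₀ hκ (le_eigenvalue κ k)) (hw0 _)

/-- Convergence of the nonlocal interaction with general cutoffs. -/
theorem tendsto_cutoff_interaction_nonlocal (hκ : 0 < κ) (hX : GaussianFamily P X)
    (hw : IsWeight κ C w) (hws : Summable w)
    (hS : ∀ N k, |s N k| ≤ S) (hs : ∀ k, Tendsto (fun N => s N k) atTop (𝓝 1)) {U : ℝ → Ω → ℝ}
    {τ E : ℝ} (hτ : τ = ∑' k, w k * (eigenvalue κ k)⁻¹)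
    (hE : E = (1 / 2) * ∑' p : (Fin 2 → ℤ) × (Fin 2 → ℤ),
      w (p.2 - p.1) * ((eigenvalue κ p.1)⁻¹ * (eigenvalue κ p.2)⁻¹))
    (hU : ∀ᶠ N in atTop, ∀ᵐ ω ∂P, Tendsto (fun j => cutoffInteraction X (box j) w (amp κ (s N))
      τ E ω) atTop (𝓝 (U N ω))) :
    Tendsto (fun N => eLpNorm (U N - interaction κ X w) 2 P) atTop (𝓝 0) := by
  have hS0 : 0 ≤ S := (abs_nonneg _).trans (hS 0 0)
  have hS2 : ∀ N k, s N k ^ 2 ≤ S ^ 2 := fun N k => sq_le_sq' (abs_le.1 (hS N k)).1 (abs_le.1 (hS N k)).2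
  have hinv : ∀ k, 0 ≤ (eigenvalue κ k)⁻¹ := fun k => inv_nonneg.2 (eigenvalue_pos hκ k).le
  have hsum := summable_weight_mul hκ hw.nonneg hws
  have hneg : ∀ k, w (0 - k) = w k := fun k => by rw [zero_sub, hw.even]
  have hτs : Summable fun k => w k * (eigenvalue κ k)⁻¹ := by simpa only [hneg] using hsum 0
  have hlim1 : ∀ l, Tendsto (fun q : ℝ × ℕ => ∑ k ∈ box q.2, s q.1 k ^ 2 *
      (w (l - k) * (eigenvalue κ k)⁻¹)) (atTop ×ˢ atTop)
      (𝓝 (∑' k, 1 * (w (l - k) * (eigenvalue κ k)⁻¹))) := fun l =>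
    tendsto_sum_mul_of_summable eventually_mem_box_snd (hsum l) (K := S ^ 2)
      (fun q k => by rw [abs_of_nonneg (sq_nonneg _)]; exact hS2 _ _)
      (fun k => by simpa using ((hs k).comp tendsto_fst).pow 2)
  have hlim2 : ∀ l, Tendsto (fun q : ℝ × ℕ => ∑ k ∈ box q.2, 1 *
      (w (l - k) * (eigenvalue κ k)⁻¹)) (atTop ×ˢ atTop)
      (𝓝 (∑' k, 1 * (w (l - k) * (eigenvalue κ k)⁻¹))) := fun l =>
    tendsto_sum_mul_of_summable eventually_mem_box_snd (hsum l) (K := 1)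
      (fun q k => by simp) (fun k => tendsto_const_nhds)
  have hlimτ : Tendsto (fun q : ℝ × ℕ => ballMass κ w q.2) (atTop ×ˢ atTop) (𝓝 τ) := by
    have := hlim2 0
    simp only [one_mul, hneg] at this
    rw [hτ]
    exact this
  set M : ℝ := (∑' k, w k) * κ⁻¹ with hM
  have hM0 : 0 ≤ M := mul_nonneg (tsum_nonneg hw.nonneg) (inv_nonneg.2 hκ.le)
  have hbd : ∀ l, ∀ B : Finset (Fin 2 → ℤ), ∑ k ∈ B, w (l - k) * (eigenvalue κ k)⁻¹ ≤ M := by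
    intro l B
    have h1 : Summable fun k => w (l - k) := hws.comp_injective sub_right_injective
    calc _ ≤ ∑ k ∈ B, w (l - k) * κ⁻¹ := Finset.sum_le_sum fun k _ =>
          mul_le_mul_of_nonneg_left (inv_anti₀ hκ (le_eigenvalue κ k)) (hw.nonneg _)
      _ = (∑ k ∈ B, w (l - k)) * κ⁻¹ := (Finset.sum_mul _ _ _).symm
      _ ≤ (∑' k, w (l - k)) * κ⁻¹ := mul_le_mul_of_nonneg_right
          (h1.sum_le_tsum _ fun k _ => hw.nonneg _) (inv_nonneg.2 hκ.le)
      _ = M := congrArg (· * κ⁻¹) ((Equiv.subLeft l).tsum_eq w)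
  have hτ0 : 0 ≤ τ := hτ ▸ tsum_nonneg fun k => mul_nonneg (hw.nonneg k) (hinv k)
  -- Here τ is the full, cutoff-independent series, while the sharp interaction subtracts a partial
  -- sum; as w is summable, both brackets tend to ∑_k w(l−k)/λ_k − τ. They are bounded uniformly in
  -- l, so λ_l⁻² serves as the dominating series.
  have hform : ∀ (q : ℝ × ℕ) l, (coeffQuadratic (box q.2) w (amp κ (s q.1)) τ l -
        coeffQuadratic (box q.2) w (amp κ 1) (ballMass κ w q.2) l) ^ 2 =
      (s q.1 l ^ 2 * (∑ k ∈ box q.2, s q.1 k ^ 2 * (w (l - k) * (eigenvalue κ k)⁻¹) - τ) -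
        (∑ k ∈ box q.2, 1 * (w (l - k) * (eigenvalue κ k)⁻¹) - ballMass κ w q.2)) ^ 2 *
        (eigenvalue κ l)⁻¹ ^ 2 := by
    intro q l
    simp only [coeffQuadratic, amp_sq hκ, Pi.one_apply, one_pow, one_mul]
    simp_rw [mul_left_comm (w _)]
    ring
  refine tendsto_cutoff_interaction hκ hX hw hS hs (τ := fun _ _ => τ) (E := fun _ _ => E)
    ?_ ?_ hU
  · simp_rw [hform]
    rw [show (0 : ℝ) = ∑' l : Fin 2 → ℤ, 0 * (eigenvalue κ l)⁻¹ ^ 2 by simp]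
    refine tendsto_sum_mul_of_summable (c₀ := fun _ => 0)
      eventually_mem_box_snd (summable_eigenvalue_inv_sq hκ)
      (K := (S ^ 2 * (S ^ 2 * M + τ) + (M + M)) ^ 2) (fun q l => ?_) (fun l => ?_)
    · rw [abs_of_nonneg (sq_nonneg _), sq_le_sq, abs_of_nonneg
        (show 0 ≤ S ^ 2 * (S ^ 2 * M + τ) + (M + M) by positivity)]
      have a1 : ∑ k ∈ box q.2, s q.1 k ^ 2 * (w (l - k) * (eigenvalue κ k)⁻¹) ≤ S ^ 2 * M := by
        refine (Finset.sum_le_sum fun k _ => mul_le_mul_of_nonneg_right (hS2 _ _)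
          (mul_nonneg (hw.nonneg _) (hinv k))).trans ?_
        rw [← Finset.mul_sum]
        exact mul_le_mul_of_nonneg_left (hbd _ _) (sq_nonneg _)
      have a0 : 0 ≤ ∑ k ∈ box q.2, s q.1 k ^ 2 * (w (l - k) * (eigenvalue κ k)⁻¹) :=
        Finset.sum_nonneg fun k _ => mul_nonneg (sq_nonneg _) (mul_nonneg (hw.nonneg _) (hinv k))
      have b1 : ∑ k ∈ box q.2, 1 * (w (l - k) * (eigenvalue κ k)⁻¹) ≤ M := by
        simpa only [one_mul] using hbd l _
      have b0 : 0 ≤ ∑ k ∈ box q.2, 1 * (w (l - k) * (eigenvalue κ k)⁻¹) :=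
        Finset.sum_nonneg fun k _ => mul_nonneg zero_le_one (mul_nonneg (hw.nonneg _) (hinv k))
      have c1 : ballMass κ w q.2 ≤ M := by
        have := hbd 0 (box q.2)
        simp only [hneg] at this
        exact this
      have c0 := ballMass_nonneg hκ hw q.2
      refine (abs_sub _ _).trans ?_
      rw [abs_mul, abs_of_nonneg (sq_nonneg _)]
      refine add_le_add (mul_le_mul (hS2 _ _) ?_ (abs_nonneg _) (sq_nonneg _)) ?_
      · rw [abs_le]; constructor <;> nlinarith
      · rw [abs_le]; constructor <;> linarith
    · have := (((((hs l).comp tendsto_fst).pow 2).mul ((hlim1 l).sub_const τ)).sub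
        ((hlim2 l).sub hlimτ)).pow 2
      simpa using this
  · have h1 := tendsto_sum_mul_of_summable (F := (atTop ×ˢ atTop : Filter (ℝ × ℕ)))
      (B := fun q => box q.2 ×ˢ box q.2) (c := fun q p => s q.1 p.1 ^ 2 * s q.1 p.2 ^ 2)
      (K := S ^ 2 * S ^ 2) (c₀ := fun _ => 1) (fun p => ?_)
      (summable_weight_pairs hκ hw.nonneg hws) (fun q p => ?_) (fun p => ?_)
    · have h2 := (h1.const_mul (1 / 2)).sub_const E
      simp only [one_mul] at h2
      rw [← hE, sub_self] at h2
      refine h2.congr fun q => ?_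
      rw [coeffConst, Finset.sum_product]
      congr 2
      refine Finset.sum_congr rfl fun k _ => Finset.sum_congr rfl fun l _ => ?_
      rw [amp_sq hκ, amp_sq hκ]
      ring
    · filter_upwards [eventually_mem_box_snd p.1, eventually_mem_box_snd p.2] with q h1 h2
      exact Finset.mem_product.2 ⟨h1, h2⟩
    · rw [abs_of_nonneg (by positivity)]
      exact mul_le_mul (hS2 _ _) (hS2 _ _) (sq_nonneg _) (sq_nonneg _)
    · simpa using (((hs p.1).comp tendsto_fst).pow 2).mul (((hs p.2).comp tendsto_fst).pow 2)

end Cutoff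

end Phi42

end

noncomputable section

namespace Phi42

/-! ### Fourier coefficients of the interaction potential -/

section PotentialWeight

variable {κ : ℝ} {v : EuclideanSpace ℝ (Fin 2) → ℝ}

/-- The Fourier coefficients of the rescaled periodized potential. -/
def potentialWeight (v : EuclideanSpace ℝ (Fin 2) → ℝ) (ε : ℝ) (m : Fin 2 → ℤ) : ℝ :=
  (𝓕 (fun x => (v x : ℂ)) (ε • latticePoint m)).re

/-- A potential as a Schwartz function. -/
def IsPotential.schwartz (hv : IsPotential v) : SchwartzMap (EuclideanSpace ℝ (Fin 2)) ℂ :=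
  HasCompactSupport.toSchwartzMap (f := fun x => (v x : ℂ))
    (hv.compact_support.comp_left Complex.ofReal_zero) (Complex.ofRealCLM.contDiff.comp hv.smooth)

theorem IsPotential.fourier_schwartz (hv : IsPotential v) :
    ((𝓕 hv.schwartz : SchwartzMap (EuclideanSpace ℝ (Fin 2)) ℂ) : _ → ℂ) =
      𝓕 (fun x => (v x : ℂ)) := rfl

theorem norm_fourier_le {V : Type*} [NormedAddCommGroup V] [InnerProductSpace ℝ V]
    [MeasurableSpace V] [BorelSpace V] [FiniteDimensional ℝ V] (f : V → ℂ) (ξ : V) :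
    ‖𝓕 f ξ‖ ≤ ∫ x, ‖f x‖ := by
  rw [Real.fourier_eq']
  refine (norm_integral_le_integral_norm _).trans (le_of_eq ?_)
  refine integral_congr_ae (.of_forall fun x => ?_)
  simp only [norm_smul, Complex.norm_exp_ofReal_mul_I, one_mul]

theorem IsPotential.fourier_zero (hv : IsPotential v) : 𝓕 (fun x => (v x : ℂ)) 0 = 1 := by
  rw [Real.fourier_eq']
  simp only [inner_zero_right, mul_zero, Complex.ofReal_zero, zero_mul, Complex.exp_zero, one_smul]
  rw [integral_complex_ofReal, hv.integral_eq_one, Complex.ofReal_one]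

theorem IsPotential.fourier_neg (hv : IsPotential v) (ξ : EuclideanSpace ℝ (Fin 2)) :
    𝓕 (fun x => (v x : ℂ)) (-ξ) = 𝓕 (fun x => (v x : ℂ)) ξ := by
  rw [Real.fourier_eq', Real.fourier_eq', ← integral_neg_eq_self]
  simp only [inner_neg_neg, hv.even]

theorem IsPotential.ofReal_potentialWeight (hv : IsPotential v) (ε : ℝ) (m : Fin 2 → ℤ) :
    (potentialWeight v ε m : ℂ) = 𝓕 (fun x => (v x : ℂ)) (ε • latticePoint m) :=
  Complex.ext rfl (by rw [Complex.ofReal_im, (hv.positive_type _).2])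

theorem latticePoint_neg (m : Fin 2 → ℤ) : latticePoint (-m) = -latticePoint m := by
  ext i; simp [latticePoint]

theorem latticePoint_sub (m n : Fin 2 → ℤ) :
    latticePoint (m - n) = latticePoint m - latticePoint n := by
  ext i; simp [latticePoint]

theorem norm_latticePoint_sq (m : Fin 2 → ℤ) : ‖latticePoint m‖ ^ 2 = ∑ i, (m i : ℝ) ^ 2 := by
  simp [EuclideanSpace.norm_sq_eq, latticePoint]

theorem eigenvalue_eq (κ : ℝ) (m : Fin 2 → ℤ) :
    eigenvalue κ m = κ + 2 * Real.pi ^ 2 * ‖latticePoint m‖ ^ 2 := by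
  rw [norm_latticePoint_sq, eigenvalue]

theorem IsPotential.tendsto_potentialWeight (hv : IsPotential v) (m : Fin 2 → ℤ) :
    Tendsto (fun ε => potentialWeight v ε m) (𝓝 0) (𝓝 1) := by
  have h1 : Continuous (𝓕 (fun x => (v x : ℂ))) := by
    rw [← hv.fourier_schwartz]; exact SchwartzMap.continuous _
  have h2 : Continuous fun ε => potentialWeight v ε m :=
    Complex.continuous_re.comp (h1.comp (continuous_id.smul continuous_const))
  have h3 := h2.tendsto 0
  rwa [potentialWeight, zero_smul, hv.fourier_zero, Complex.one_re] at h3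

/-- Mean value inequality on the ball of radius |η| about ξ, where |x| ≥ |ξ|/2 and the gradient of
v̂ is O(1/|x|). The bound involves only the ratio |η|/|ξ|, which is invariant under scaling; this is
the source of uniformity in ε. -/
theorem IsPotential.norm_fourier_sub_le (hv : IsPotential v) : ∃ C, 0 ≤ C ∧
    ∀ ξ η : EuclideanSpace ℝ (Fin 2), ‖η‖ ≤ ‖ξ‖ / 2 → 0 < ‖ξ‖ →
      ‖𝓕 (fun x => (v x : ℂ)) (ξ - η) - 𝓕 (fun x => (v x : ℂ)) ξ‖ ≤ C * (‖η‖ / ‖ξ‖) := by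
  obtain ⟨C, hC, h⟩ := (𝓕 hv.schwartz : SchwartzMap (EuclideanSpace ℝ (Fin 2)) ℂ).decay 1 1
  rw [hv.fourier_schwartz] at h
  refine ⟨2 * C, by positivity, fun ξ η hη hξ => ?_⟩
  have hsub : ∀ x ∈ Metric.closedBall ξ ‖η‖, ‖ξ‖ / 2 ≤ ‖x‖ := by
    intro x hx
    rw [mem_closedBall_iff_norm] at hx
    have := norm_sub_norm_le ξ x
    rw [norm_sub_rev] at this
    linarith
  have hdiff : Differentiable ℝ (𝓕 (fun x => (v x : ℂ))) := by
    rw [← hv.fourier_schwartz]; exact SchwartzMap.differentiable _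
  have := Convex.norm_image_sub_le_of_norm_fderiv_le (𝕜 := ℝ) (f := 𝓕 (fun x => (v x : ℂ)))
    (C := 2 * C / ‖ξ‖) (s := Metric.closedBall ξ ‖η‖) (x := ξ) (y := ξ - η)
    (fun x _ => hdiff x) (fun x hx => ?_) (convex_closedBall _ _)
    (Metric.mem_closedBall_self (norm_nonneg _)) (by simp)
  · refine this.trans (le_of_eq ?_)
    rw [sub_sub_cancel_left, norm_neg]; ring
  · have h1 := h x
    rw [norm_iteratedFDeriv_one, pow_one] at h1
    have h2 := hsub x hx
    rw [le_div_iff₀ hξ]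
    nlinarith [norm_nonneg (fderiv ℝ (𝓕 (fun x => (v x : ℂ))) x)]

/-- The Fourier coefficients of the potential satisfy estimates uniform in the range `ε`. -/
theorem IsPotential.isWeight (hκ : 0 < κ) (hv : IsPotential v) : ∃ C,
    ∀ ε > 0, IsWeight κ C (potentialWeight v ε) := by
  obtain ⟨D, hD, hd⟩ := hv.norm_fourier_sub_le
  set I := ∫ x, ‖(v x : ℂ)‖ with hI
  have hI0 : 0 ≤ I := integral_nonneg fun _ => norm_nonneg _
  have hF : ∀ ξ, ‖𝓕 (fun x => (v x : ℂ)) ξ‖ ≤ I := fun ξ => norm_fourier_le _ ξ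
  have hle : ∀ ε m, potentialWeight v ε m ≤ I := fun ε m =>
    (Complex.re_le_norm _).trans (hF _)
  have hnn : ∀ ε m, 0 ≤ potentialWeight v ε m := fun ε m => (hv.positive_type _).1
  have heven : ∀ ε m, potentialWeight v ε (-m) = potentialWeight v ε m := fun ε m => by
    rw [potentialWeight, latticePoint_neg, smul_neg, hv.fourier_neg, potentialWeight]
  set a : ℝ := 8 ^ (1 / 8 : ℝ) with ha
  have ha1 : 1 ≤ a := Real.one_le_rpow (by norm_num) (by norm_num)
  refine ⟨I * a + D * 2, fun ε hε => ⟨hnn ε, fun m => (hle ε m).trans ?_, ?_, heven ε,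
    fun l k => ?_⟩⟩
  · nlinarith
  · have h0 : latticePoint 0 = 0 := by ext i; simp [latticePoint]
    rw [potentialWeight, h0, smul_zero, hv.fourier_zero, Complex.one_re]
  have hl := eigenvalue_pos hκ l
  have hk := eigenvalue_pos hκ k
  set t := eigenvalue κ l / eigenvalue κ k with ht
  have ht0 : 0 < t := div_pos hl hk
  have hrpow : eigenvalue κ l ^ (1 / 8 : ℝ) * eigenvalue κ k ^ (-(1 / 8) : ℝ) = t ^ (1 / 8 : ℝ) := by
    rw [ht, Real.div_rpow hl.le hk.le, Real.rpow_neg hk.le, ← div_eq_mul_inv]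
  rw [hrpow]
  have htp : 0 ≤ t ^ (1 / 8 : ℝ) := Real.rpow_nonneg ht0.le _
  -- If λ_l/λ_k ≥ 1/8, the trivial bound suffices, with 8^{1/8} compensating for t^{1/8}. Otherwise
  -- κ ≤ λ_l < λ_k/8 forces both momenta into the regime |l| ≤ |k|/2, where the gradient bound gives
  -- O(|l|/|k|) with |l|/|k| ≤ 2 t^{1/2} ≤ 2 t^{1/8}.
  rcases le_or_gt (1 / 8) t with h8 | h8
  · have h1 : 1 ≤ a * t ^ (1 / 8 : ℝ) := by
      rw [ha, ← Real.mul_rpow (by norm_num) ht0.le]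
      exact Real.one_le_rpow (by linarith) (by norm_num)
    have h2 : |potentialWeight v ε (l - k) - potentialWeight v ε k| ≤ I := by
      rw [abs_le]
      constructor <;> linarith [hle ε (l - k), hle ε k, hnn ε (l - k), hnn ε k]
    calc _ ≤ I * 1 := by rw [mul_one]; exact h2
      _ ≤ I * (a * t ^ (1 / 8 : ℝ)) := by gcongr
      _ ≤ _ := by nlinarith [mul_nonneg hD htp]
  · have hlk : eigenvalue κ l < eigenvalue κ k / 8 := by
      rw [ht, div_lt_iff₀ hk] at h8; linarith
    have hκl := le_eigenvalue κ l
    have e1 := eigenvalue_eq κ l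
    have e2 := eigenvalue_eq κ k
    have hpi : 0 < 2 * Real.pi ^ 2 := by positivity
    set x := ‖latticePoint l‖ with hx
    set y := ‖latticePoint k‖ with hy
    have hx0 : 0 ≤ x := norm_nonneg _
    have hy0 : 0 ≤ y := norm_nonneg _
    have hy2 : eigenvalue κ k ≤ 4 * (2 * Real.pi ^ 2 * y ^ 2) := by linarith
    have hx2 : 2 * Real.pi ^ 2 * x ^ 2 ≤ eigenvalue κ l := by linarith
    have hypos : 0 < y := by
      rcases hy0.eq_or_lt with h | h
      · rw [← h] at hy2; norm_num at hy2; linarith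
      · exact h
    have hxy2 : x ^ 2 ≤ 4 * t * y ^ 2 := by
      have h1 : eigenvalue κ l = t * eigenvalue κ k := by rw [ht]; field_simp
      have h2 : t * eigenvalue κ k ≤ t * (4 * (2 * Real.pi ^ 2 * y ^ 2)) := by gcongr
      have h3 : 2 * Real.pi ^ 2 * x ^ 2 ≤ 2 * Real.pi ^ 2 * (4 * t * y ^ 2) := by nlinarith
      exact le_of_mul_le_mul_left h3 hpi
    have hxy : x ≤ y / 2 := by
      have hy2 : 0 < y ^ 2 := by positivity
      have : 7 * (2 * Real.pi ^ 2 * x ^ 2) ≤ 2 * Real.pi ^ 2 * y ^ 2 := by linarith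
      have : 7 * x ^ 2 ≤ y ^ 2 := by
        refine le_of_mul_le_mul_left ?_ hpi
        linarith
      refine abs_le_of_sq_le_sq' ?_ (by linarith) |>.2
      nlinarith
    have hratio : x / y ≤ 2 * t ^ (1 / 8 : ℝ) := by
      have h1 : t ^ (1 / 2 : ℝ) ≤ t ^ (1 / 8 : ℝ) :=
        Real.rpow_le_rpow_of_exponent_ge ht0 (by linarith) (by norm_num)
      have h2 : x ≤ 2 * t ^ (1 / 2 : ℝ) * y := by
        rw [← Real.sqrt_eq_rpow]
        refine abs_le_of_sq_le_sq' ?_ (by positivity) |>.2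
        rw [mul_pow, mul_pow, Real.sq_sqrt ht0.le]
        linarith
      rw [div_le_iff₀ hypos]
      refine h2.trans ?_
      gcongr
    have hmain := hd (ε • latticePoint k) (ε • latticePoint l) (by
      rw [norm_smul, norm_smul, Real.norm_of_nonneg hε.le]; nlinarith) (by
      rw [norm_smul, Real.norm_of_nonneg hε.le]; positivity)
    rw [← smul_sub, ← latticePoint_sub, norm_smul, norm_smul, Real.norm_of_nonneg hε.le,
      mul_div_mul_left _ _ hε.ne', ← hx, ← hy] at hmain
    have hre : |potentialWeight v ε (l - k) - potentialWeight v ε k| ≤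
        ‖𝓕 (fun x => (v x : ℂ)) (ε • latticePoint (k - l)) -
          𝓕 (fun x => (v x : ℂ)) (ε • latticePoint k)‖ := by
      rw [← heven ε (l - k), neg_sub, potentialWeight, potentialWeight, ← Complex.sub_re]
      exact Complex.abs_re_le_norm _
    calc _ ≤ D * (x / y) := hre.trans hmain
      _ ≤ D * (2 * t ^ (1 / 8 : ℝ)) := by gcongr
      _ ≤ _ := by
        have : 0 ≤ I * a * t ^ (1 / 8 : ℝ) := by positivity
        nlinarith

/-- Schwartz decay of order four allows comparison with λ⁻². Unlike the `IsWeight` bounds this is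
not uniform in ε; it is used only at fixed ε to make sense of the counterterms without cutoff. -/
theorem IsPotential.summable_potentialWeight (hκ : 0 < κ) (hv : IsPotential v) {ε : ℝ}
    (hε : 0 < ε) : Summable (potentialWeight v ε) := by
  obtain ⟨C, hC, h⟩ := (𝓕 hv.schwartz : SchwartzMap (EuclideanSpace ℝ (Fin 2)) ℂ).decay 4 0
  rw [hv.fourier_schwartz] at h
  have hnn : ∀ m, 0 ≤ potentialWeight v ε m := fun m => (hv.positive_type _).1
  set I := ∫ x, ‖(v x : ℂ)‖ with hI
  have hle : ∀ m, potentialWeight v ε m ≤ I := fun m =>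
    (Complex.re_le_norm _).trans (norm_fourier_le _ _)
  have hle2 : ∀ m, ‖latticePoint m‖ ^ 4 * potentialWeight v ε m ≤ C * (ε ^ 4)⁻¹ := by
    intro m
    have h1 := h (ε • latticePoint m)
    rw [norm_iteratedFDeriv_zero, norm_smul, Real.norm_of_nonneg hε.le, mul_pow] at h1
    rw [← div_eq_mul_inv, le_div_iff₀ (by positivity)]
    refine le_trans ?_ h1
    have h2 : potentialWeight v ε m ≤ ‖𝓕 (fun x => (v x : ℂ)) (ε • latticePoint m)‖ :=
      Complex.re_le_norm _
    calc _ = ε ^ 4 * ‖latticePoint m‖ ^ 4 * potentialWeight v ε m := by ring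
      _ ≤ _ := by gcongr
  refine Summable.of_nonneg_of_le hnn (fun m => ?_) ((summable_eigenvalue_inv_sq hκ).mul_left
    (2 * κ ^ 2 * I + 8 * Real.pi ^ 4 * (C * (ε ^ 4)⁻¹)))
  rw [inv_pow, ← div_eq_mul_inv, le_div_iff₀ (pow_pos (eigenvalue_pos hκ m) 2), eigenvalue_eq]
  have h1 : (κ + 2 * Real.pi ^ 2 * ‖latticePoint m‖ ^ 2) ^ 2 ≤
      2 * κ ^ 2 + 8 * Real.pi ^ 4 * ‖latticePoint m‖ ^ 4 := by
    nlinarith [sq_nonneg (κ - 2 * Real.pi ^ 2 * ‖latticePoint m‖ ^ 2)]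
  calc _ ≤ potentialWeight v ε m * (2 * κ ^ 2 + 8 * Real.pi ^ 4 * ‖latticePoint m‖ ^ 4) :=
        mul_le_mul_of_nonneg_left h1 (hnn m)
    _ = 2 * κ ^ 2 * potentialWeight v ε m +
        8 * Real.pi ^ 4 * (‖latticePoint m‖ ^ 4 * potentialWeight v ε m) := by ring
    _ ≤ _ := by
      exact add_le_add (mul_le_mul_of_nonneg_left (hle m) (by positivity))
        (mul_le_mul_of_nonneg_left (hle2 m) (by positivity))

end PotentialWeight

end Phi42

end

/-! ### Periodization of the potential and its Fourier coefficients -/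

noncomputable section

namespace Phi42

section Periodization

/-- The translates of a half-open unit cube. -/
def unitCube (n : Fin 2 → ℤ) : Set (Fin 2 → ℝ) :=
  {y | ∀ i, y i ∈ Set.Ioc (-1 / 2 - n i : ℝ) (-1 / 2 - n i + 1)}

/-- The index of the cube is an explicit function of the point, so the cubes tile the plane. The
cube of index n is centred at −n, to match translations by −n in the periodization. -/
theorem mem_unitCube_iff (n : Fin 2 → ℤ) (y : Fin 2 → ℝ) :
    y ∈ unitCube n ↔ (fun i => -(⌈y i + 1 / 2⌉ - 1)) = n := by
  simp only [unitCube, Set.mem_ofPred_eq, Set.mem_Ioc, funext_iff]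
  refine forall_congr' fun i => ?_
  have : (-(⌈y i + 1 / 2⌉ - 1) = n i) ↔ ⌈y i + 1 / 2⌉ = 1 - n i := by omega
  rw [this, Int.ceil_eq_iff]
  push_cast
  constructor <;> rintro ⟨h1, h2⟩ <;> constructor <;> linarith

theorem measurableSet_unitCube (n : Fin 2 → ℤ) : MeasurableSet (unitCube n) :=
  MeasurableSet.univ_pi' fun _ => measurableSet_Ioc

/-- Unfolding: the plane is tiled by cubes and each is translated back to the central one. -/
theorem hasSum_integral_unitCube {g : (Fin 2 → ℝ) → ℂ} (hg : Integrable g) :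
    HasSum (fun n : Fin 2 → ℤ => ∫ y in unitCube 0, g (y - fun i => (n i : ℝ))) (∫ y, g y) := by
  have h1 : ⋃ n, unitCube n = Set.univ := by
    refine Set.eq_univ_of_forall fun y => Set.mem_iUnion.2 ⟨_, (mem_unitCube_iff _ y).2 rfl⟩
  have h2 : Pairwise (Function.onFun Disjoint unitCube) := by
    intro m n hmn
    refine Set.disjoint_left.2 fun y h1 h2 => hmn ?_
    rw [mem_unitCube_iff] at h1 h2
    exact h1.symm.trans h2
  have h3 := hasSum_integral_iUnion (μ := volume) measurableSet_unitCube h2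
    (f := g) (by rw [h1]; exact hg.integrableOn)
  rw [h1, Measure.restrict_univ] at h3
  refine h3.congr_fun fun n => ?_
  rw [← integral_indicator (measurableSet_unitCube n),
    ← integral_indicator (measurableSet_unitCube 0),
    ← integral_sub_right_eq_self ((unitCube n).indicator g) (fun i => (n i : ℝ))]
  refine integral_congr_ae (.of_forall fun y => ?_)
  have : (y - fun i => (n i : ℝ)) ∈ unitCube n ↔ y ∈ unitCube 0 := by
    simp only [unitCube, Set.mem_ofPred_eq, Set.mem_Ioc, Pi.sub_apply, Pi.zero_apply, Int.cast_zero]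
    refine forall_congr' fun i => ?_
    constructor <;> rintro ⟨h1, h2⟩ <;> constructor <;> linarith
  beta_reduce
  by_cases h : y ∈ unitCube 0
  · rw [Set.indicator_of_mem h, Set.indicator_of_mem (this.2 h)]
  · rw [Set.indicator_of_notMem h, Set.indicator_of_notMem fun h' => h (this.1 h')]

variable {v : EuclideanSpace ℝ (Fin 2) → ℝ} {ε : ℝ}

/-- The rescaled potential on the plane. -/
def scaledPotential (v : EuclideanSpace ℝ (Fin 2) → ℝ) (ε : ℝ) (y : Fin 2 → ℝ) : ℝ :=
  (ε ^ 2)⁻¹ * v (ε⁻¹ • WithLp.toLp 2 y)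

theorem potential_eq_tsum (v : EuclideanSpace ℝ (Fin 2) → ℝ) (ε : ℝ) (x : Torus) :
    potential v ε x =
      ∑' n : Fin 2 → ℤ, scaledPotential v ε ((fun i => rep x i) - fun i => (n i : ℝ)) := rfl

theorem rep_coe (y : Fin 2 → ℝ) : ∃ c : Fin 2 → ℤ,
    (fun i => rep (fun i => (y i : UnitAddCircle)) i) = y - fun i => (c i : ℝ) := by
  refine ⟨fun i => toIcoDiv (zero_lt_one' ℝ) (-1 / 2) (y i), funext fun i => ?_⟩
  change toIcoMod _ (-1 / 2) (y i) = _
  rw [toIcoMod]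
  simp

/-- The chosen representative differs from y by a lattice vector, which a shift of the summation
index absorbs. -/
theorem potential_coe (v : EuclideanSpace ℝ (Fin 2) → ℝ) (ε : ℝ) (y : Fin 2 → ℝ) :
    potential v ε (fun i => (y i : UnitAddCircle)) =
      ∑' n : Fin 2 → ℤ, scaledPotential v ε (y - fun i => (n i : ℝ)) := by
  obtain ⟨c, hc⟩ := rep_coe y
  rw [potential_eq_tsum, hc, ← (Equiv.addLeft c).tsum_eq fun n =>
    scaledPotential v ε (y - fun i => (n i : ℝ))]
  refine tsum_congr fun n => ?_
  congr 1
  ext i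
  simp only [Pi.sub_apply, Equiv.coe_addLeft, Pi.add_apply, Int.cast_add]
  ring

theorem abs_rep_le (x : Torus) (i : Fin 2) : |rep x i| ≤ 1 / 2 := by
  have h := (AddCircle.equivIco (1 : ℝ) (-1 / 2) (x i)).2
  rw [Set.mem_Ico] at h
  change |((AddCircle.equivIco (1 : ℝ) (-1 / 2) (x i)) : ℝ)| ≤ 1 / 2
  rw [abs_le]
  constructor <;> linarith [h.1, h.2]

theorem measurable_rep (i : Fin 2) : Measurable fun x : Torus => rep x i :=
  measurable_subtype_coe.comp ((AddCircle.measurableEquivIco 1 (-1 / 2)).measurable.comp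
    (measurable_pi_apply i))

/-- If the support of v has radius R, a contributing n satisfies |n_i| ≤ εR + 1/2. So the
periodization is a finite sum with a range common to all points of the cell. -/
theorem IsPotential.scaledPotential_eq_zero (hv : IsPotential v) (hε : 0 < ε) : ∃ j : ℕ,
    ∀ y : Fin 2 → ℝ, (∀ i, |y i| ≤ 1 / 2) → ∀ n : Fin 2 → ℤ, n ∉ box j →
      scaledPotential v ε (y - fun i => (n i : ℝ)) = 0 := by
  obtain ⟨R, hR⟩ := hv.compact_support.isBounded.exists_norm_le
  obtain ⟨j, hj⟩ := pow_unbounded_of_one_lt (ε * R + 1 / 2) (one_lt_two (α := ℝ))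
  refine ⟨j, fun y hy n hn => ?_⟩
  rw [mem_box] at hn
  push Not at hn
  obtain ⟨i, hi⟩ := hn
  by_contra hne
  have hmem : ε⁻¹ • WithLp.toLp 2 (y - fun i => (n i : ℝ)) ∈ tsupport v :=
    subset_tsupport v fun h => hne (by rw [scaledPotential, h, mul_zero])
  have h1 := hR _ hmem
  rw [norm_smul, Real.norm_of_nonneg (inv_nonneg.2 hε.le), inv_mul_le_iff₀ hε] at h1
  have h2 := (PiLp.norm_apply_le (WithLp.toLp 2 (y - fun i => (n i : ℝ)) : EuclideanSpace ℝ (Fin 2)) i).trans h1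
  rw [Real.norm_eq_abs] at h2
  change |y i - n i| ≤ _ at h2
  have h3 : (2 : ℝ) ^ j < |(n i : ℝ)| := by exact_mod_cast hi
  have h4 := abs_sub_abs_le_abs_sub (n i : ℝ) (y i)
  rw [abs_sub_comm] at h4
  linarith [hy i]

theorem IsPotential.continuous_scaledPotential (hv : IsPotential v) :
    Continuous (scaledPotential v ε) := by
  have h1 := hv.smooth.continuous
  have h2 : Continuous fun y : Fin 2 → ℝ => (WithLp.toLp 2 y : EuclideanSpace ℝ (Fin 2)) :=
    PiLp.continuous_toLp 2 _
  exact continuous_const.mul (h1.comp (h2.const_smul ε⁻¹))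

theorem IsPotential.measurable_potential (hv : IsPotential v) (hε : 0 < ε) :
    Measurable (potential v ε) := by
  obtain ⟨j, hj⟩ := hv.scaledPotential_eq_zero hε
  have : potential v ε = fun x => ∑ n ∈ box j,
      scaledPotential v ε ((fun i => rep x i) - fun i => (n i : ℝ)) := by
    funext x
    rw [potential_eq_tsum, tsum_eq_sum fun n hn => hj _ (abs_rep_le x) n hn]
  rw [this]
  refine Finset.measurable_sum _ fun n _ => hv.continuous_scaledPotential.measurable.comp ?_
  exact (measurable_pi_lambda _ measurable_rep).sub_const _

theorem IsPotential.exists_bound_potential (hv : IsPotential v) (hε : 0 < ε) :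
    ∃ K, ∀ x, |potential v ε x| ≤ K := by
  obtain ⟨j, hj⟩ := hv.scaledPotential_eq_zero hε
  obtain ⟨K, hK⟩ := hv.compact_support.exists_bound_of_continuous hv.smooth.continuous
  refine ⟨∑ n ∈ box j, (ε ^ 2)⁻¹ * K, fun x => ?_⟩
  rw [potential_eq_tsum, tsum_eq_sum fun n hn => hj _ (abs_rep_le x) n hn]
  refine (Finset.abs_sum_le_sum_abs _ _).trans (Finset.sum_le_sum fun n _ => ?_)
  rw [scaledPotential, abs_mul, abs_of_nonneg (show 0 ≤ (ε ^ 2)⁻¹ by positivity)]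
  gcongr
  exact hK _

theorem mFourier_coe (m : Fin 2 → ℤ) (y : Fin 2 → ℝ) :
    UnitAddTorus.mFourier m (fun i => (y i : UnitAddCircle)) =
      Complex.exp ((2 * Real.pi * ∑ i, m i * y i : ℝ) * Complex.I) := by
  rw [UnitAddTorus.mFourier, ContinuousMap.coe_mk]
  simp only [fourier_coe_apply]
  rw [← Complex.exp_sum]
  congr 1
  push_cast
  rw [Finset.mul_sum, Finset.sum_mul]
  exact Finset.sum_congr rfl fun i _ => by ring

theorem mFourier_coe_sub_int (m : Fin 2 → ℤ) (y : Fin 2 → ℝ) (n : Fin 2 → ℤ) :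
    UnitAddTorus.mFourier m (fun i => ((y - fun i => (n i : ℝ)) i : UnitAddCircle)) =
      UnitAddTorus.mFourier m (fun i => (y i : UnitAddCircle)) := by
  congr 1
  funext i
  rw [Pi.sub_apply, AddCircle.coe_sub]
  have : ((n i : ℝ) : UnitAddCircle) = 0 := by
    rw [AddCircle.coe_eq_zero_iff]
    exact ⟨n i, by simp⟩
  rw [this, sub_zero]

/-- Substitution y = εz. The character enters with the opposite sign to the Fourier transform, which
evenness of v repairs. -/
theorem IsPotential.integral_scaledPotential (hv : IsPotential v) (hε : 0 < ε) (m : Fin 2 → ℤ) :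
    ∫ y : Fin 2 → ℝ, UnitAddTorus.mFourier m (fun i => (y i : UnitAddCircle)) *
      (scaledPotential v ε y : ℂ) = potentialWeight v ε m := by
  rw [hv.ofReal_potentialWeight, ← hv.fourier_neg, Real.fourier_eq']
  set g : EuclideanSpace ℝ (Fin 2) → ℂ := fun z =>
    Complex.exp ((-2 * Real.pi * inner ℝ z (-(ε • latticePoint m)) : ℝ) * Complex.I) • (v z : ℂ)
    with hg
  have h1 := Measure.integral_comp_smul volume g ε⁻¹
  rw [finrank_euclideanSpace_fin, inv_pow, inv_inv, abs_of_nonneg (sq_nonneg ε)] at h1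
  have h2 : ∫ z, g z = ((ε ^ 2)⁻¹ : ℝ) • ∫ z, g (ε⁻¹ • z) := by
    rw [h1, smul_smul, inv_mul_cancel₀ (by positivity), one_smul]
  rw [h2, ← integral_smul, ← (PiLp.volume_preserving_toLp (Fin 2)).integral_comp
    (MeasurableEquiv.toLp 2 (Fin 2 → ℝ)).measurableEmbedding]
  refine integral_congr_ae (.of_forall fun y => ?_)
  simp only [hg, mFourier_coe, scaledPotential, smul_eq_mul, Complex.real_smul]
  have : -2 * Real.pi * inner ℝ (ε⁻¹ • (WithLp.toLp 2 y : EuclideanSpace ℝ (Fin 2)))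
      (-(ε • latticePoint m)) = 2 * Real.pi * ∑ i, m i * y i := by
    rw [inner_neg_right, inner_smul_left, inner_smul_right, PiLp.inner_apply]
    simp only [latticePoint, RCLike.inner_apply, conj_trivial]
    field_simp
    
  rw [this]
  push_cast
  ring

theorem IsPotential.integrable_scaledPotential (hv : IsPotential v) (hε : 0 < ε) :
    Integrable (scaledPotential v ε) := by
  refine (hv.continuous_scaledPotential).integrable_of_hasCompactSupport ?_
  have h1 : HasCompactSupport fun y : Fin 2 → ℝ => v (ε⁻¹ • WithLp.toLp 2 y) := by
    have := hv.compact_support.comp_homeomorph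
      ((PiLp.continuousLinearEquiv 2 ℝ (fun _ : Fin 2 => ℝ)).symm.toHomeomorph.trans
        (Homeomorph.smulOfNeZero ε⁻¹ (inv_ne_zero hε.ne')))
    exact this
  exact h1.mul_left

/-- The Fourier coefficients of the potential on the torus. -/
theorem IsPotential.integral_mFourier_mul_potential (hv : IsPotential v) (hε : 0 < ε)
    (m : Fin 2 → ℤ) :
    ∫ x, UnitAddTorus.mFourier m x * (potential v ε x : ℂ) ∂torusMeasure =
      potentialWeight v ε m := by
  obtain ⟨j, hj⟩ := hv.scaledPotential_eq_zero hε
  set g : (Fin 2 → ℝ) → ℂ := fun y => UnitAddTorus.mFourier m (fun i => (y i : UnitAddCircle)) *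
      (scaledPotential v ε y : ℂ) with hg
  have hgi : Integrable g := by
    refine (hv.integrable_scaledPotential hε).ofReal.bdd_mul (c := 1) ?_ ?_
    · refine Continuous.aestronglyMeasurable ?_
      refine (UnitAddTorus.mFourier m).continuous.comp (continuous_pi fun i => ?_)
      exact (AddCircle.continuous_mk' 1).comp (continuous_apply i)
    · refine .of_forall fun y => ?_
      exact ((UnitAddTorus.mFourier m).norm_coe_le_norm _).trans UnitAddTorus.mFourier_norm.le
  have hcube : ∀ y ∈ unitCube 0, ∀ i, |y i| ≤ 1 / 2 := by
    intro y hy i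
    have := hy i
    simp only [Pi.zero_apply, Int.cast_zero, sub_zero, Set.mem_Ioc] at this
    rw [abs_le]; constructor <;> linarith [this.1, this.2]
  -- The torus integral is an integral over the central cell. There only translates from one box
  -- contribute, so sum and integral are exchanged finitely and unfolding reassembles the integral
  -- over the plane.
  have hsum := hasSum_integral_unitCube hgi
  rw [← hv.integral_scaledPotential hε m, ← hsum.tsum_eq]
  have h1 := UnitAddTorus.integral_preimage
    (fun x : Torus => UnitAddTorus.mFourier m x * (potential v ε x : ℂ)) (fun _ => -1 / 2)
  have h2 : {x : Fin 2 → ℝ | ∀ i, x i ∈ Set.Ioc (-1 / 2 : ℝ) (-1 / 2 + 1)} = unitCube 0 := by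
    simp [unitCube]
  rw [h2] at h1
  refine Eq.trans h1 ?_
  rw [tsum_eq_sum (s := box j) fun n hn => ?_, ← integral_finsetSum]
  · refine setIntegral_congr_fun (measurableSet_unitCube 0) fun y hy => ?_
    simp only [hg, mFourier_coe_sub_int]
    rw [potential_coe, tsum_eq_sum fun n hn => hj _ (hcube y hy) n hn, Complex.ofReal_sum,
      Finset.mul_sum]
  · intro n _
    exact (hgi.comp_sub_right _).integrableOn
  · refine setIntegral_eq_zero_of_forall_eq_zero fun y hy => ?_
    simp only [hg]
    rw [hj _ (hcube y hy) n hn, Complex.ofReal_zero, mul_zero]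

end Periodization

end Phi42

end

noncomputable section

namespace Phi42

/-! ### Counterterms -/

section Counterterms

variable {κ : ℝ} {v : EuclideanSpace ℝ (Fin 2) → ℝ} {ε : ℝ}

theorem measurable_mFourier (m : Fin 2 → ℤ) : Measurable (UnitAddTorus.mFourier m : Torus → ℂ) :=
  (UnitAddTorus.mFourier m).continuous.measurable

theorem norm_mFourier_apply (m : Fin 2 → ℤ) (x : Torus) : ‖UnitAddTorus.mFourier m x‖ = 1 := by
  simp [UnitAddTorus.mFourier, fourier_apply, Circle.norm_coe]

theorem IsPotential.memLp_mFourier_mul (hv : IsPotential v) (hε : 0 < ε) (m : Fin 2 → ℤ)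
    (p : ℝ≥0∞) : MemLp (fun x => UnitAddTorus.mFourier m x * (potential v ε x : ℂ)) p
      torusMeasure := by
  obtain ⟨K, hK⟩ := hv.exists_bound_potential hε
  refine MemLp.of_bound ((measurable_mFourier m).mul
    (Complex.measurable_ofReal.comp (hv.measurable_potential hε))).aestronglyMeasurable K
    (.of_forall fun x => ?_)
  rw [norm_mul, norm_mFourier_apply, one_mul, Complex.norm_real]
  exact hK x

theorem mFourierCoeff_congr {f g : Torus → ℂ} (h : f =ᵐ[torusMeasure] g) (m : Fin 2 → ℤ) :
    UnitAddTorus.mFourierCoeff f m = UnitAddTorus.mFourierCoeff g m := by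
  unfold UnitAddTorus.mFourierCoeff
  refine integral_congr_ae ?_
  filter_upwards [h] with x hx
  rw [hx]

theorem IsPotential.mFourierCoeff_mFourier_mul (hv : IsPotential v) (hε : 0 < ε)
    (m l : Fin 2 → ℤ) : UnitAddTorus.mFourierCoeff
      ((hv.memLp_mFourier_mul hε m 2).toLp _ : Torus → ℂ) l = potentialWeight v ε (m - l) := by
  rw [mFourierCoeff_congr (MemLp.coeFn_toLp _), ← hv.integral_mFourier_mul_potential hε]
  unfold UnitAddTorus.mFourierCoeff
  refine integral_congr_ae (.of_forall fun x => ?_)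
  simp only [smul_eq_mul]
  rw [← mul_assoc, ← UnitAddTorus.mFourier_add, sub_eq_neg_add]

/-- The Fourier coefficients of the product of the potential and the Green function. -/
theorem IsPotential.hasSum_potential_mul_green (hv : IsPotential v) (hκ : 0 < κ) (hε : 0 < ε)
    (m : Fin 2 → ℤ) :
    HasSum (fun l => ((potentialWeight v ε (m - l) * (eigenvalue κ l)⁻¹ : ℝ) : ℂ))
      (∫ x, UnitAddTorus.mFourier (-m) x * ((potential v ε x : ℂ) * green κ x) ∂torusMeasure) := by
  have h := UnitAddTorus.hasSum_prod_mFourierCoeff ((hv.memLp_mFourier_mul hε m 2).toLp _)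
    (green κ)
  simp only [hv.mFourierCoeff_mFourier_mul hε, mFourierCoeff_green hκ, Complex.conj_ofReal] at h
  push_cast at h ⊢
  convert h using 1
  refine integral_congr_ae ?_
  filter_upwards [(hv.memLp_mFourier_mul hε m 2).coeFn_toLp] with x hx
  rw [hx, map_mul, Complex.conj_ofReal, UnitAddTorus.mFourier_neg, mul_assoc]

/-- Since λ_{−k} = λ_k is real, G and its conjugate have the same Fourier coefficients. Hence the
real part used in the counterterms loses nothing. -/
theorem green_im_ae (hκ : 0 < κ) : ∀ᵐ x ∂torusMeasure, (green κ x).im = 0 := by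
  have hm : MemLp (fun x => starRingEnd ℂ (green κ x)) 2 torusMeasure :=
    (Lp.memLp (green κ)).star
  have h1 : hm.toLp _ = green κ := by
    refine (UnitAddTorus.mFourierBasis (d := Fin 2)).repr.injective (lp.ext (funext fun k => ?_))
    rw [UnitAddTorus.mFourierBasis_repr, UnitAddTorus.mFourierBasis_repr,
      mFourierCoeff_congr (MemLp.coeFn_toLp hm), mFourierCoeff_green hκ]
    have h2 := mFourierCoeff_green hκ (-k)
    have h3 : eigenvalue κ (-k) = eigenvalue κ k := by simp [eigenvalue]
    rw [h3] at h2
    rw [← Complex.conj_ofReal, ← h2]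
    unfold UnitAddTorus.mFourierCoeff
    rw [← integral_conj]
    refine integral_congr_ae (.of_forall fun x => ?_)
    simp [UnitAddTorus.mFourier_neg]
  have h2 := MemLp.coeFn_toLp hm
  rw [h1] at h2
  filter_upwards [h2] with x hx
  have := congrArg Complex.im hx
  rw [Complex.conj_im] at this
  linarith

theorem IsPotential.memLp_potential_mul_green (hv : IsPotential v) (hε : 0 < ε) :
    MemLp (fun x => (potential v ε x : ℂ) * green κ x) 2 torusMeasure := by
  have h1 := hv.memLp_mFourier_mul hε 0 ∞
  simp only [UnitAddTorus.mFourier_zero, ContinuousMap.one_apply, one_mul] at h1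
  exact (Lp.memLp (green κ)).mul h1

theorem IsPotential.massCounterterm_eq (hv : IsPotential v) (hκ : 0 < κ) (hε : 0 < ε) :
    massCounterterm κ v ε = ∑' k, potentialWeight v ε k * (eigenvalue κ k)⁻¹ := by
  have h := hv.hasSum_potential_mul_green hκ hε 0
  simp only [neg_zero, UnitAddTorus.mFourier_zero, ContinuousMap.one_apply, one_mul] at h
  have h2 := (Complex.hasSum_re h).tsum_eq
  simp only [Complex.ofReal_re, zero_sub] at h2
  obtain ⟨C, hC⟩ := hv.isWeight hκ
  simp only [(hC ε hε).even] at h2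
  rw [h2, massCounterterm]
  have h3 := integral_re ((hv.memLp_potential_mul_green (κ := κ) hε).integrable (by norm_num))
  refine Eq.trans ?_ h3
  simp

/-- Parseval for the pairing of G with v^ε G; the latter is in L² because v^ε is bounded, and its
coefficients are convolutions of those of v^ε and G. -/
theorem IsPotential.energyCounterterm_eq (hv : IsPotential v) (hκ : 0 < κ) (hε : 0 < ε) :
    energyCounterterm κ v ε = (1 / 2) * ∑' p : (Fin 2 → ℤ) × (Fin 2 → ℤ),
      potentialWeight v ε (p.2 - p.1) * ((eigenvalue κ p.1)⁻¹ * (eigenvalue κ p.2)⁻¹) := by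
  obtain ⟨C, hC⟩ := hv.isWeight hκ
  have hw := hC ε hε
  set H := (hv.memLp_potential_mul_green (κ := κ) hε).toLp _ with hH
  have h1 := UnitAddTorus.hasSum_prod_mFourierCoeff (green κ) H
  have h2 : ∀ k, UnitAddTorus.mFourierCoeff (H : Torus → ℂ) k =
      ((∑' l, potentialWeight v ε (k - l) * (eigenvalue κ l)⁻¹ : ℝ) : ℂ) := by
    intro k
    rw [mFourierCoeff_congr (MemLp.coeFn_toLp _), Complex.ofReal_tsum]
    exact (hv.hasSum_potential_mul_green hκ hε k).tsum_eq.symm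
  have h3 := (summable_weight_pairs hκ hw.nonneg (hv.summable_potentialWeight hκ hε)).hasSum
  have h4 := h3.prod_fiberwise (g := fun k => (eigenvalue κ k)⁻¹ *
    ∑' l, potentialWeight v ε (k - l) * (eigenvalue κ l)⁻¹) (fun k => by
      have := ((summable_weight_mul hκ hw.nonneg
        (hv.summable_potentialWeight hκ hε) k).hasSum).mul_left (eigenvalue κ k)⁻¹
      refine this.congr_fun fun l => ?_
      rw [← hw.even (k - l), neg_sub]
      ring)
  simp only [h2, mFourierCoeff_green hκ, Complex.conj_ofReal, ← Complex.ofReal_mul] at h1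
  have h5 := h4.unique (by simpa only [Complex.ofReal_re] using Complex.hasSum_re h1)
  rw [h5, energyCounterterm]
  congr 1
  have hint : Integrable (fun x => starRingEnd ℂ (green κ x) * H x) torusMeasure :=
    (Lp.memLp (green κ)).star.integrable_mul (Lp.memLp H)
  refine Eq.trans ?_ (integral_re hint)
  refine integral_congr_ae ?_
  filter_upwards [green_im_ae hκ, MemLp.coeFn_toLp (hv.memLp_potential_mul_green (κ := κ) hε)]
    with x h1 h2
  rw [hH, h2]
  have : green κ x = ((green κ x).re : ℂ) := Complex.ext rfl (by simpa using h1)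
  rw [this]
  simp
  ring

end Counterterms

/-! ### Trigonometric polynomials -/

section Trig

theorem integral_mFourier_mul_conj (m n : Fin 2 → ℤ) :
    ∫ x, UnitAddTorus.mFourier m x * starRingEnd ℂ (UnitAddTorus.mFourier n x) ∂torusMeasure =
      if n = m then 1 else 0 := by
  have h := orthonormal_iff_ite.mp (UnitAddTorus.orthonormal_mFourier (d := Fin 2)) n m
  rw [ContinuousMap.inner_toLp] at h
  exact h

variable {v : EuclideanSpace ℝ (Fin 2) → ℝ} {ε : ℝ}

theorem integral_sum_mFourier_mul_conj (Q : Finset (Fin 2 → ℤ)) (a b : (Fin 2 → ℤ) → ℂ) :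
    ∫ x, (∑ q ∈ Q, a q * UnitAddTorus.mFourier q x) *
      starRingEnd ℂ (∑ q ∈ Q, b q * UnitAddTorus.mFourier q x) ∂torusMeasure =
      ∑ q ∈ Q, a q * starRingEnd ℂ (b q) := by
  have hi : ∀ m n : Fin 2 → ℤ, Integrable (fun x => UnitAddTorus.mFourier m x *
      starRingEnd ℂ (UnitAddTorus.mFourier n x)) torusMeasure := fun m n => by
    refine Integrable.of_bound (C := 1) ?_ (.of_forall fun x => ?_)
    · exact ((measurable_mFourier m).mul
        (Complex.continuous_conj.measurable.comp (measurable_mFourier n))).aestronglyMeasurable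
    · simp [norm_mFourier_apply]
  have h1 : ∀ x, (∑ q ∈ Q, a q * UnitAddTorus.mFourier q x) *
      starRingEnd ℂ (∑ q ∈ Q, b q * UnitAddTorus.mFourier q x) =
      ∑ q ∈ Q, ∑ r ∈ Q, a q * starRingEnd ℂ (b r) *
        (UnitAddTorus.mFourier q x * starRingEnd ℂ (UnitAddTorus.mFourier r x)) := by
    intro x
    rw [map_sum, Finset.sum_mul_sum]
    refine Finset.sum_congr rfl fun q _ => Finset.sum_congr rfl fun r _ => ?_
    rw [map_mul]; ring
  simp_rw [h1]
  rw [integral_finsetSum _ fun q _ => integrable_finsetSum _ fun r _ => (hi q r).const_mul _]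
  refine Finset.sum_congr rfl fun q hq => ?_
  rw [integral_finsetSum _ fun r _ => (hi q r).const_mul _]
  simp_rw [integral_const_mul, integral_mFourier_mul_conj]
  simp [hq]

instance : torusMeasure.IsNegInvariant := by
  have : (AddCircle.haarAddCircle : Measure UnitAddCircle).IsNegInvariant := inferInstance
  exact Measure.pi.isNegInvariant _

theorem IsPotential.integral_potential_sub_mul (hv : IsPotential v) (hε : 0 < ε) (x : Torus)
    (q : Fin 2 → ℤ) :
    ∫ y, (potential v ε (x - y) : ℂ) * UnitAddTorus.mFourier q y ∂torusMeasure =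
      potentialWeight v ε (-q) * UnitAddTorus.mFourier q x := by
  rw [← hv.integral_mFourier_mul_potential hε, ← integral_mul_const,
    ← integral_sub_left_eq_self (fun y => UnitAddTorus.mFourier (-q) y * (potential v ε y : ℂ) *
      UnitAddTorus.mFourier q x) torusMeasure x]
  refine integral_congr_ae (.of_forall fun y => ?_)
  have h : UnitAddTorus.mFourier q y = UnitAddTorus.mFourier (-q) (x - y) *
      UnitAddTorus.mFourier q x := by
    simp only [UnitAddTorus.mFourier, ContinuousMap.coe_mk, ← Finset.prod_mul_distrib]
    refine Finset.prod_congr rfl fun i _ => ?_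
    simp only [fourier_apply, Pi.neg_apply, Pi.sub_apply, neg_smul, smul_sub, neg_sub,
      ← Circle.coe_mul, ← AddCircle.toCircle_add]
    congr 2
    abel
  simp only [h]
  ring

/-- Convolution with the potential is diagonal on characters, and the outer integral is evaluated by
orthogonality after replacing the real function d by its own conjugate. -/
theorem IsPotential.integral_integral_potential (hv : IsPotential v) (hε : 0 < ε)
    (Q : Finset (Fin 2 → ℤ)) (ρ : (Fin 2 → ℤ) → ℂ) {d : Torus → ℝ}
    (hd : ∀ x, (d x : ℂ) = ∑ q ∈ Q, ρ q * UnitAddTorus.mFourier q x) :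
    ∫ x, ∫ y, d x * potential v ε (x - y) * d y ∂torusMeasure ∂torusMeasure =
      ∑ q ∈ Q, potentialWeight v ε (-q) * ‖ρ q‖ ^ 2 := by
  have hint : ∀ x q, Integrable (fun y => (potential v ε (x - y) : ℂ) *
      UnitAddTorus.mFourier q y) torusMeasure := by
    intro x q
    obtain ⟨K, hK⟩ := hv.exists_bound_potential hε
    refine Integrable.of_bound (C := K) ?_ (.of_forall fun y => ?_)
    · refine (Measurable.mul ?_ (measurable_mFourier q)).aestronglyMeasurable
      exact Complex.measurable_ofReal.comp
        ((hv.measurable_potential hε).comp (measurable_const.sub measurable_id))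
    · rw [norm_mul, norm_mFourier_apply, mul_one, Complex.norm_real]
      exact hK _
  have h1 : ∀ x, ((∫ y, d x * potential v ε (x - y) * d y ∂torusMeasure : ℝ) : ℂ) =
      (∑ q ∈ Q, (ρ q * potentialWeight v ε (-q)) * UnitAddTorus.mFourier q x) *
        starRingEnd ℂ (∑ q ∈ Q, ρ q * UnitAddTorus.mFourier q x) := by
    intro x
    rw [← integral_complex_ofReal, ← hd x, Complex.conj_ofReal, mul_comm]
    have h2 : ∀ y, ((d x * potential v ε (x - y) * d y : ℝ) : ℂ) =
        d x * ∑ q ∈ Q, ρ q * ((potential v ε (x - y) : ℂ) * UnitAddTorus.mFourier q y) := by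
      intro y
      push_cast
      rw [hd y, mul_assoc, Finset.mul_sum]
      congr 1
      exact Finset.sum_congr rfl fun q _ => by ring
    simp_rw [h2]
    rw [integral_const_mul, integral_finsetSum _ fun q _ => (hint x q).const_mul _]
    congr 1
    refine Finset.sum_congr rfl fun q _ => ?_
    rw [integral_const_mul, hv.integral_potential_sub_mul hε, mul_assoc]
  rw [← Complex.ofReal_inj, ← integral_complex_ofReal]
  simp_rw [h1]
  rw [integral_sum_mFourier_mul_conj, Complex.ofReal_sum]
  refine Finset.sum_congr rfl fun q _ => ?_
  rw [mul_right_comm, Complex.mul_conj, Complex.normSq_eq_norm_sq]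
  push_cast
  ring

theorem integral_trig_sq (Q : Finset (Fin 2 → ℤ)) (ρ : (Fin 2 → ℤ) → ℂ) {d : Torus → ℝ}
    (hd : ∀ x, (d x : ℂ) = ∑ q ∈ Q, ρ q * UnitAddTorus.mFourier q x) :
    ∫ x, d x ^ 2 ∂torusMeasure = ∑ q ∈ Q, ‖ρ q‖ ^ 2 := by
  have h1 : ∀ x, ((d x ^ 2 : ℝ) : ℂ) = (∑ q ∈ Q, ρ q * UnitAddTorus.mFourier q x) *
        starRingEnd ℂ (∑ q ∈ Q, ρ q * UnitAddTorus.mFourier q x) := by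
    intro x
    rw [← hd x, Complex.conj_ofReal]
    push_cast; ring
  rw [← Complex.ofReal_inj, ← integral_complex_ofReal]
  simp_rw [h1]
  rw [integral_sum_mFourier_mul_conj, Complex.ofReal_sum]
  refine Finset.sum_congr rfl fun q _ => ?_
  rw [Complex.mul_conj, Complex.normSq_eq_norm_sq]

end Trig

end Phi42

end

noncomputable section

namespace Phi42

/-! ### The field and its truncations -/

section AmpField

variable {Ω : Type*} {X : (Fin 2 → ℤ) → Ω → ℂ} {a : (Fin 2 → ℤ) → ℝ}

/-- The Gaussian field with amplitudes `a`. -/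
def ampField (X : (Fin 2 → ℤ) → Ω → ℂ) (a : (Fin 2 → ℤ) → ℝ) (x : Torus) (ω : Ω) : ℂ :=
  ∑' k, (a k : ℂ) * X k ω * UnitAddTorus.mFourier k x

/-- The Gaussian field with amplitudes `a`, truncated to a box of modes. -/
def boxField (X : (Fin 2 → ℤ) → Ω → ℂ) (a : (Fin 2 → ℤ) → ℝ) (j : ℕ) (x : Torus) (ω : Ω) : ℂ :=
  ∑ k ∈ box j, (a k : ℂ) * X k ω * UnitAddTorus.mFourier k x

/-- A random bound for the field. -/
def ampSum (X : (Fin 2 → ℤ) → Ω → ℂ) (a : (Fin 2 → ℤ) → ℝ) (ω : Ω) : ℝ := ∑' k, a k * ‖X k ω‖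

theorem norm_mode_term (ha : ∀ k, 0 ≤ a k) (x : Torus) (ω : Ω) (k : Fin 2 → ℤ) :
    ‖(a k : ℂ) * X k ω * UnitAddTorus.mFourier k x‖ = a k * ‖X k ω‖ := by
  rw [norm_mul, norm_mul, norm_mFourier_apply, mul_one, Complex.norm_real,
    Real.norm_of_nonneg (ha k)]

theorem tendsto_boxField (ha : ∀ k, 0 ≤ a k) {ω : Ω} (hω : Summable fun k => a k * ‖X k ω‖)
    (x : Torus) : Tendsto (fun j => boxField X a j x ω) atTop (𝓝 (ampField X a x ω)) := by
  have : Summable fun k => (a k : ℂ) * X k ω * UnitAddTorus.mFourier k x :=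
    .of_norm (by simpa only [norm_mode_term ha] using hω)
  exact this.hasSum.comp tendsto_box

theorem norm_boxField_le (ha : ∀ k, 0 ≤ a k) {ω : Ω} (hω : Summable fun k => a k * ‖X k ω‖)
    (x : Torus) (j : ℕ) : ‖boxField X a j x ω‖ ≤ ampSum X a ω := by
  refine (norm_sum_le _ _).trans ?_
  simp only [norm_mode_term ha]
  exact hω.sum_le_tsum _ fun k _ => mul_nonneg (ha k) (norm_nonneg _)

theorem norm_ampField_le (ha : ∀ k, 0 ≤ a k) {ω : Ω} (hω : Summable fun k => a k * ‖X k ω‖)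
    (x : Torus) : ‖ampField X a x ω‖ ≤ ampSum X a ω :=
  le_of_tendsto' (tendsto_boxField ha hω x).norm fun j => norm_boxField_le ha hω x j

theorem continuous_boxField (X : (Fin 2 → ℤ) → Ω → ℂ) (a : (Fin 2 → ℤ) → ℝ) (j : ℕ) (ω : Ω) :
    Continuous fun x => boxField X a j x ω :=
  continuous_finsetSum _ fun k _ => continuous_const.mul (UnitAddTorus.mFourier k).continuous

/-- The Fourier expansion of the Wick square. -/
theorem wickSquare_boxField (X : (Fin 2 → ℤ) → Ω → ℂ) (a : (Fin 2 → ℤ) → ℝ) (j : ℕ) (x : Torus)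
    (ω : Ω) : ((‖boxField X a j x ω‖ ^ 2 - ∑ k ∈ box j, a k ^ 2 : ℝ) : ℂ) =
      ∑ q ∈ diffs (box j), density X (box j) a q ω * UnitAddTorus.mFourier q x := by
  have h1 : ∑ q ∈ diffs (box j), density X (box j) a q ω * UnitAddTorus.mFourier q x =
      ∑ k ∈ box j, ∑ l ∈ box j, ((a k * a l : ℝ) *
        (starRingEnd ℂ (X k ω) * X l ω - if k = l then 1 else 0)) *
          UnitAddTorus.mFourier (l - k) x := by
    simp only [density, Finset.sum_mul]
    rw [Finset.sum_comm]
    refine Finset.sum_congr rfl fun k hk => ?_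
    rw [Finset.sum_comm]
    refine Finset.sum_congr rfl fun l hl => ?_
    rw [Finset.sum_eq_single (l - k)]
    · rw [if_pos rfl]
    · intro q _ hq; rw [if_neg (Ne.symm hq), zero_mul]
    · exact fun h => absurd (Finset.mem_image.2 ⟨(k, l), Finset.mem_product.2 ⟨hk, hl⟩, rfl⟩) h
  have h2 : ((∑ k ∈ box j, a k ^ 2 : ℝ) : ℂ) = ∑ k ∈ box j, ∑ l ∈ box j, ((a k * a l : ℝ) *
        (if k = l then 1 else 0)) * UnitAddTorus.mFourier (l - k) x := by
    rw [Complex.ofReal_sum]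
    refine Finset.sum_congr rfl fun k hk => ?_
    rw [Finset.sum_eq_single k]
    · rw [if_pos rfl, sub_self, UnitAddTorus.mFourier_zero]
      simp only [ContinuousMap.one_apply]
      push_cast; ring
    · intro l _ hl; rw [if_neg (Ne.symm hl)]; ring
    · exact fun h => absurd hk h
  rw [Complex.ofReal_sub, h2, ← Complex.normSq_eq_norm_sq, Complex.normSq_eq_conj_mul_self,
    boxField, map_sum, Finset.sum_mul_sum, h1, ← Finset.sum_sub_distrib]
  refine Finset.sum_congr rfl fun k _ => ?_
  rw [← Finset.sum_sub_distrib]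
  refine Finset.sum_congr rfl fun l _ => ?_
  rw [sub_eq_add_neg l k, UnitAddTorus.mFourier_add, UnitAddTorus.mFourier_neg]
  simp only [map_mul, Complex.conj_ofReal]
  push_cast
  ring

theorem integral_norm_boxField_sq (X : (Fin 2 → ℤ) → Ω → ℂ) (a : (Fin 2 → ℤ) → ℝ) (j : ℕ)
    (ω : Ω) : ∫ x, ‖boxField X a j x ω‖ ^ 2 ∂torusMeasure = ∑ k ∈ box j, a k ^ 2 * ‖X k ω‖ ^ 2 := by
  have h := integral_sum_mFourier_mul_conj (box j) (fun k => (a k : ℂ) * X k ω)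
    (fun k => (a k : ℂ) * X k ω)
  simp only [Complex.mul_conj, Complex.normSq_eq_norm_sq, ← Complex.ofReal_sum] at h
  rw [integral_complex_ofReal, Complex.ofReal_inj] at h
  refine Eq.trans ?_ (h.trans ?_)
  · rfl
  · refine Finset.sum_congr rfl fun k _ => ?_
    rw [norm_mul, mul_pow, Complex.norm_real, Real.norm_eq_abs, sq_abs]

theorem integrable_norm_boxField_pow (X : (Fin 2 → ℤ) → Ω → ℂ) (a : (Fin 2 → ℤ) → ℝ) (j : ℕ)
    (ω : Ω) (n : ℕ) : Integrable (fun x => ‖boxField X a j x ω‖ ^ n) torusMeasure :=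
  ((continuous_boxField X a j ω).norm.pow n).integrable_of_hasCompactSupport
    (HasCompactSupport.of_compactSpace _)

theorem integral_wickSquare_boxField (X : (Fin 2 → ℤ) → Ω → ℂ) (a : (Fin 2 → ℤ) → ℝ) (j : ℕ)
    (ω : Ω) : ∫ x, (‖boxField X a j x ω‖ ^ 2 - ∑ k ∈ box j, a k ^ 2) ∂torusMeasure =
      ∑ k ∈ box j, a k ^ 2 * (‖X k ω‖ ^ 2 - 1) := by
  rw [integral_sub (integrable_norm_boxField_pow X a j ω 2) (integrable_const _),
    integral_norm_boxField_sq, integral_const, probReal_univ, one_smul,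
    ← Finset.sum_sub_distrib]
  exact Finset.sum_congr rfl fun k _ => by ring

/-- With σ the variance, |φ|⁴ − 4σ|φ|² + 2σ² = (|φ|² − σ)² − 2σ(|φ|² − σ) − σ². Parseval identifies
the first term with the weight 1, and the others give τ = σ and E = σ²/2. The local interaction is
thereby an instance of the general form. -/
theorem cutoffInteraction_local_eq (X : (Fin 2 → ℤ) → Ω → ℂ) (a : (Fin 2 → ℤ) → ℝ) (j : ℕ)
    (ω : Ω) : cutoffInteraction X (box j) 1 a (∑ k ∈ box j, a k ^ 2)
        ((1 / 2) * (∑ k ∈ box j, a k ^ 2) ^ 2) ω =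
      (1 / 2) * ∫ x, (‖boxField X a j x ω‖ ^ 4 - 4 * (∑ k ∈ box j, a k ^ 2) *
        ‖boxField X a j x ω‖ ^ 2 + 2 * (∑ k ∈ box j, a k ^ 2) ^ 2) ∂torusMeasure := by
  set σ := ∑ k ∈ box j, a k ^ 2 with hσ
  have h1 := integral_trig_sq (diffs (box j)) (fun q => density X (box j) a q ω)
    (fun x => wickSquare_boxField X a j x ω)
  have h2 := integral_wickSquare_boxField X a j ω
  rw [← hσ] at h2
  simp only [← hσ] at h1
  have hc : Continuous fun x => ‖boxField X a j x ω‖ ^ 2 - σ :=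
    ((continuous_boxField X a j ω).norm.pow 2).sub continuous_const
  have hci : ∀ {f : Torus → ℝ}, Continuous f → Integrable f torusMeasure := fun hf =>
    hf.integrable_of_hasCompactSupport (HasCompactSupport.of_compactSpace _)
  rw [cutoffInteraction, ← h2]
  simp only [Pi.one_apply, one_mul]
  rw [← h1]
  have h3 : ∀ x, ‖boxField X a j x ω‖ ^ 4 - 4 * σ * ‖boxField X a j x ω‖ ^ 2 + 2 * σ ^ 2 =
      (‖boxField X a j x ω‖ ^ 2 - σ) ^ 2 - 2 * σ * (‖boxField X a j x ω‖ ^ 2 - σ) - σ ^ 2 :=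
    fun x => by ring
  simp_rw [h3]
  have i1 : Integrable (fun x => (‖boxField X a j x ω‖ ^ 2 - σ) ^ 2) torusMeasure := hci (hc.pow 2)
  have i2 : Integrable (fun x => 2 * σ * (‖boxField X a j x ω‖ ^ 2 - σ)) torusMeasure :=
    (hci hc).const_mul _
  have i3 : Integrable (fun x => (‖boxField X a j x ω‖ ^ 2 - σ) ^ 2 -
    2 * σ * (‖boxField X a j x ω‖ ^ 2 - σ)) torusMeasure := i1.sub i2
  rw [integral_sub i3 (integrable_const _), integral_sub i1 i2, integral_const_mul,
    integral_const,
    probReal_univ, one_smul]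
  ring

theorem cutoffInteraction_nonlocal_eq {v : EuclideanSpace ℝ (Fin 2) → ℝ} (hv : IsPotential v)
    {ε : ℝ} (hε : 0 < ε) (hw : ∀ k, potentialWeight v ε (-k) = potentialWeight v ε k)
    (X : (Fin 2 → ℤ) → Ω → ℂ) (a : (Fin 2 → ℤ) → ℝ) (j : ℕ) (τ E : ℝ) (ω : Ω) :
    cutoffInteraction X (box j) (potentialWeight v ε) a τ E ω =
      (1 / 2) * (∫ x, ∫ y, (‖boxField X a j x ω‖ ^ 2 - ∑ k ∈ box j, a k ^ 2) *
        potential v ε (x - y) * (‖boxField X a j y ω‖ ^ 2 - ∑ k ∈ box j, a k ^ 2)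
        ∂torusMeasure ∂torusMeasure) -
      τ * (∫ x, (‖boxField X a j x ω‖ ^ 2 - ∑ k ∈ box j, a k ^ 2) ∂torusMeasure) - E := by
  rw [hv.integral_integral_potential hε _ _ (fun x => wickSquare_boxField X a j x ω),
    integral_wickSquare_boxField]
  simp only [hw, cutoffInteraction]

theorem tendsto_integral_torus {f : ℕ → Torus → ℝ} {g : Torus → ℝ} {C : ℝ}
    (hf : ∀ j, AEStronglyMeasurable (f j) torusMeasure) (hC : ∀ j x, |f j x| ≤ C)
    (h : ∀ x, Tendsto (fun j => f j x) atTop (𝓝 (g x))) :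
    Tendsto (fun j => ∫ x, f j x ∂torusMeasure) atTop (𝓝 (∫ x, g x ∂torusMeasure)) :=
  tendsto_integral_of_dominated_convergence (fun _ => C) hf (integrable_const C)
    (fun j => .of_forall fun x => hC j x) (.of_forall h)

theorem tendsto_sum_box {f : (Fin 2 → ℤ) → ℝ} (hf : Summable f) :
    Tendsto (fun j => ∑ k ∈ box j, f k) atTop (𝓝 (∑' k, f k)) :=
  hf.hasSum.comp tendsto_box

theorem summable_sq_of_summable (ha : ∀ k, 0 ≤ a k) (has : Summable a) :
    Summable fun k => a k ^ 2 := by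
  refine Summable.of_nonneg_of_le (fun k => sq_nonneg _) (fun k => ?_) (has.mul_left (∑' k, a k))
  rw [sq]
  exact mul_le_mul_of_nonneg_right (has.le_tsum k fun l _ => ha l) (ha k)

/-- The truncated local interactions converge. -/
theorem tendsto_cutoffInteraction_local (ha : ∀ k, 0 ≤ a k) (has : Summable fun k => a k ^ 2) {ω : Ω}
    (hω : Summable fun k => a k * ‖X k ω‖) :
    Tendsto (fun j => cutoffInteraction X (box j) 1 a (∑ k ∈ box j, a k ^ 2)
        ((1 / 2) * (∑ k ∈ box j, a k ^ 2) ^ 2) ω) atTop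
      (𝓝 ((1 / 2) * ∫ x, (‖ampField X a x ω‖ ^ 4 - 4 * (∑' k, a k ^ 2) *
        ‖ampField X a x ω‖ ^ 2 + 2 * (∑' k, a k ^ 2) ^ 2) ∂torusMeasure)) := by
  simp_rw [cutoffInteraction_local_eq]
  have hσ := tendsto_sum_box has
  have hσ0 : ∀ j, 0 ≤ ∑ k ∈ box j, a k ^ 2 := fun j => Finset.sum_nonneg fun _ _ => sq_nonneg _
  have hσ1 : ∀ j, ∑ k ∈ box j, a k ^ 2 ≤ ∑' k, a k ^ 2 := fun j =>
    has.sum_le_tsum _ fun _ _ => sq_nonneg _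
  set T := ampSum X a ω with hT
  have hT1 : ∀ j x, ‖boxField X a j x ω‖ ≤ T := fun j x => norm_boxField_le ha hω x j
  refine (tendsto_integral_torus (C := T ^ 4 + 4 * (∑' k, a k ^ 2) * T ^ 2 +
    2 * (∑' k, a k ^ 2) ^ 2) (fun j => ?_) (fun j x => ?_) fun x => ?_).const_mul _
  · have hc := (continuous_boxField X a j ω).norm
    exact (((hc.pow 4).sub (continuous_const.mul (hc.pow 2))).add
      continuous_const).aestronglyMeasurable
  · refine (abs_add_le _ _).trans (add_le_add ((abs_sub _ _).trans (add_le_add ?_ ?_)) ?_)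
    · rw [abs_of_nonneg (by positivity)]
      have := hT1 j x
      gcongr
    · have h0 := hσ0 j
      have h1 := hσ1 j
      have := hT1 j x
      rw [abs_of_nonneg (by positivity)]
      gcongr
    · have h0 := hσ0 j
      have h1 := hσ1 j
      rw [abs_of_nonneg (by positivity)]
      gcongr
  · have hφ := (tendsto_boxField ha hω x).norm
    exact ((hφ.pow 4).sub ((hσ.const_mul 4).mul (hφ.pow 2))).add ((hσ.pow 2).const_mul 2)

/-- The truncated nonlocal interactions converge. -/
theorem tendsto_cutoffInteraction_nonlocal {v : EuclideanSpace ℝ (Fin 2) → ℝ} (hv : IsPotential v)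
    {ε : ℝ} (hε : 0 < ε) (hw : ∀ k, potentialWeight v ε (-k) = potentialWeight v ε k)
    (τ E : ℝ) (ha : ∀ k, 0 ≤ a k) (has : Summable fun k => a k ^ 2) {ω : Ω}
    (hω : Summable fun k => a k * ‖X k ω‖) :
    Tendsto (fun j => cutoffInteraction X (box j) (potentialWeight v ε) a τ E ω) atTop
      (𝓝 ((1 / 2) * (∫ x, ∫ y, (‖ampField X a x ω‖ ^ 2 - ∑' k, a k ^ 2) *
        potential v ε (x - y) * (‖ampField X a y ω‖ ^ 2 - ∑' k, a k ^ 2)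
        ∂torusMeasure ∂torusMeasure) -
      τ * (∫ x, (‖ampField X a x ω‖ ^ 2 - ∑' k, a k ^ 2) ∂torusMeasure) - E)) := by
  simp_rw [cutoffInteraction_nonlocal_eq hv hε hw]
  obtain ⟨K, hK⟩ := hv.exists_bound_potential hε
  have hσ := tendsto_sum_box has
  have hσ0 : ∀ j, 0 ≤ ∑ k ∈ box j, a k ^ 2 := fun j => Finset.sum_nonneg fun _ _ => sq_nonneg _
  have hσ1 : ∀ j, ∑ k ∈ box j, a k ^ 2 ≤ ∑' k, a k ^ 2 := fun j =>
    has.sum_le_tsum _ fun _ _ => sq_nonneg _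
  set M := ampSum X a ω ^ 2 + ∑' k, a k ^ 2 with hM
  set d : ℕ → Torus → ℝ := fun j x => ‖boxField X a j x ω‖ ^ 2 - ∑ k ∈ box j, a k ^ 2 with hd
  have hdc : ∀ j, Continuous (d j) := fun j =>
    ((continuous_boxField X a j ω).norm.pow 2).sub continuous_const
  have hdM : ∀ j x, |d j x| ≤ M := fun j x => by
    refine (abs_sub _ _).trans (add_le_add ?_ ?_)
    · rw [abs_of_nonneg (by positivity)]
      have := norm_boxField_le ha hω x j
      gcongr
    · rw [abs_of_nonneg (hσ0 j)]; exact hσ1 j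
  have hdl : ∀ x, Tendsto (fun j => d j x) atTop
      (𝓝 (‖ampField X a x ω‖ ^ 2 - ∑' k, a k ^ 2)) := fun x =>
    ((tendsto_boxField ha hω x).norm.pow 2).sub hσ
  have hM0 : 0 ≤ M := (abs_nonneg _).trans (hdM 0 0)
  have hK0 : 0 ≤ K := (abs_nonneg _).trans (hK 0)
  have hpm := hv.measurable_potential hε
  have hb : ∀ j x y, |d j x * potential v ε (x - y) * d j y| ≤ M * K * M := fun j x y => by
    rw [abs_mul, abs_mul]
    gcongr
    exacts [hdM j x, hK _, hdM j y]
  have hjm : ∀ j, Measurable fun p : Torus × Torus =>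
      d j p.1 * potential v ε (p.1 - p.2) * d j p.2 := fun j =>
    (((hdc j).measurable.comp measurable_fst).mul (hpm.comp (measurable_fst.sub measurable_snd))).mul
      ((hdc j).measurable.comp measurable_snd)
  refine ((Tendsto.const_mul _ ?_).sub ((tendsto_integral_torus (C := M)
    (fun j => (hdc j).aestronglyMeasurable) hdM hdl).const_mul _)).sub_const _
  refine tendsto_integral_torus (C := M * K * M) (fun j => ?_) (fun j x => ?_) fun x => ?_
  · exact ((hjm j).stronglyMeasurable.integral_prod_right').aestronglyMeasurable
  · have := norm_integral_le_of_norm_le_const (μ := torusMeasure) (C := M * K * M)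
      (f := fun y => d j x * potential v ε (x - y) * d j y) (.of_forall (hb j x))
    simpa using this
  · refine tendsto_integral_torus (C := M * K * M) (fun j => ?_) (fun j y => hb j x y) fun y => ?_
    · exact ((hjm j).comp (measurable_const.prodMk measurable_id)).aestronglyMeasurable
    · exact ((hdl x).mul_const _).mul (hdl y)

variable [MeasurableSpace Ω] {P : Measure Ω} [IsProbabilityMeasure P]

theorem GaussianFamily.eLpNorm_mode (hX : GaussianFamily P X) (p : ℝ≥0∞) (k : Fin 2 → ℤ) :
    eLpNorm (X k) p P = eLpNorm (fun z : ℂ => z) p stdComplexGaussian := by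
  rw [← (hX.hasLaw k).map_eq, eLpNorm_map_measure (by fun_prop) (hX.measurable k).aemeasurable]
  rfl

/-- All modes share the same first absolute moment, so the expectation of the sum is finite. -/
theorem GaussianFamily.ae_summable (hX : GaussianFamily P X) (ha : ∀ k, 0 ≤ a k)
    (has : Summable a) : ∀ᵐ ω ∂P, Summable fun k => a k * ‖X k ω‖ := by
  have h1 : ∫⁻ ω, ∑' k, ENNReal.ofReal (a k) * ‖X k ω‖ₑ ∂P ≠ ∞ := by
    rw [lintegral_tsum fun k => ((hX.measurable k).enorm.const_mul _).aemeasurable]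
    have h2 : ∀ k, ∫⁻ ω, ENNReal.ofReal (a k) * ‖X k ω‖ₑ ∂P =
        ENNReal.ofReal (a k) * eLpNorm (fun z : ℂ => z) 1 stdComplexGaussian := fun k => by
      rw [lintegral_const_mul _ (hX.measurable k).enorm, ← eLpNorm_one_eq_lintegral_enorm,
        hX.eLpNorm_mode]
    simp_rw [h2]
    rw [ENNReal.tsum_mul_right, ← ENNReal.ofReal_tsum_of_nonneg ha has]
    refine ENNReal.mul_ne_top ENNReal.ofReal_ne_top ?_
    rw [← hX.eLpNorm_mode 1 0]
    have := (hX.hasMoments 0 1).2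
    rw [Nat.cast_one] at this
    exact this.ne
  have h3 := ae_lt_top (Measurable.tsum fun k => (hX.measurable k).enorm.const_mul _) h1
  filter_upwards [h3] with ω hω
  have h4 := ENNReal.summable_toReal hω.ne
  refine h4.congr fun k => ?_
  rw [ENNReal.toReal_mul, ENNReal.toReal_ofReal (ha k), toReal_enorm]

theorem GaussianFamily.hasMoments_ampSum (hX : GaussianFamily P X) (ha : ∀ k, 0 ≤ a k)
    (has : Summable a) : HasMoments P (ampSum X a) := by
  have hlim : ∀ᵐ ω ∂P, Tendsto (fun j => ∑ k ∈ box j, a k * ‖X k ω‖) atTop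
      (𝓝 (ampSum X a ω)) := by
    filter_upwards [hX.ae_summable ha has] with ω hω
    exact tendsto_sum_box hω
  have hm : ∀ j, AEStronglyMeasurable (fun ω => ∑ k ∈ box j, a k * ‖X k ω‖) P := fun j =>
    (Finset.measurable_sum _ fun k _ => (hX.measurable k).norm.const_mul _).aestronglyMeasurable
  intro n
  -- Minkowski's inequality needs an exponent at least 1, so the exponent n + 1 is treated and then
  -- lowered.
  refine (show ∀ m : ℕ, 1 ≤ m → MemLp (ampSum X a) m P from fun m hm1 => ?_) (n + 1) (by omega)
    |>.mono_exponent (by exact_mod_cast n.le_succ)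
  refine ⟨aestronglyMeasurable_of_tendsto_ae atTop hm hlim, ?_⟩
  set c := eLpNorm (fun z : ℂ => z) m stdComplexGaussian with hc
  have hcf : c ≠ ∞ := by rw [hc, ← hX.eLpNorm_mode m 0]; exact (hX.hasMoments 0 m).2.ne
  refine (eLpNorm_le_of_ae_tendsto (c := ENNReal.ofReal (∑' k, a k) * c) hm hlim
    (.of_forall fun j => ?_)).trans_lt (ENNReal.mul_lt_top ENNReal.ofReal_lt_top hcf.lt_top)
  have h1 : (fun ω => ∑ k ∈ box j, a k * ‖X k ω‖) = ∑ k ∈ box j, fun ω => a k * ‖X k ω‖ := by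
    funext ω; simp
  rw [h1]
  refine (eLpNorm_sum_le (fun k _ => ((hX.measurable k).norm.const_mul _).aestronglyMeasurable)
    (by exact_mod_cast hm1)).trans ?_
  have h2 : ∀ k, eLpNorm (fun ω => a k * ‖X k ω‖) m P = ENNReal.ofReal (a k) * c := fun k => by
    have h3 := eLpNorm_const_smul (a k) (fun ω => ‖X k ω‖) m P
    rw [eLpNorm_norm, hX.eLpNorm_mode, Real.enorm_eq_ofReal (ha k)] at h3
    exact h3
  simp_rw [h2]
  rw [← Finset.sum_mul, ← ENNReal.ofReal_sum_of_nonneg fun k _ => ha k]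
  gcongr
  exact has.sum_le_tsum _ fun k _ => ha k

theorem GaussianFamily.integral_norm_boxField_sq' (hX : GaussianFamily P X)
    (a : (Fin 2 → ℤ) → ℝ) (j : ℕ) (x : Torus) :
    ∫ ω, ‖boxField X a j x ω‖ ^ 2 ∂P = ∑ k ∈ box j, a k ^ 2 := by
  rw [← Complex.ofReal_inj, ← integral_complex_ofReal]
  have h1 : ∀ ω, ((‖boxField X a j x ω‖ ^ 2 : ℝ) : ℂ) = ∑ k ∈ box j, ∑ l ∈ box j,
      ((a k : ℂ) * UnitAddTorus.mFourier k x * ((a l : ℂ) *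
        starRingEnd ℂ (UnitAddTorus.mFourier l x))) *
        (letterVal X (k, true) ω * letterVal X (l, false) ω) := by
    intro ω
    rw [← Complex.normSq_eq_norm_sq, ← Complex.mul_conj, boxField, map_sum, Finset.sum_mul_sum]
    refine Finset.sum_congr rfl fun k _ => Finset.sum_congr rfl fun l _ => ?_
    simp only [map_mul, Complex.conj_ofReal, letterVal_true, letterVal_false]
    ring
  simp_rw [h1]
  have hi : ∀ k l, Integrable (fun ω => letterVal X (k, true) ω * letterVal X (l, false) ω) P :=
    fun k l => ((hX.hasMoments_letterVal _).mul (hX.hasMoments_letterVal _)).integrable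
  rw [integral_finsetSum _ fun k _ => integrable_finsetSum _ fun l _ => (hi k l).const_mul _,
    Complex.ofReal_sum]
  refine Finset.sum_congr rfl fun k hk => ?_
  rw [integral_finsetSum _ fun l _ => (hi k l).const_mul _]
  simp_rw [integral_const_mul, hX.integral_letterVal_mul_letterVal]
  rw [Finset.sum_eq_single k]
  · rw [if_pos (by simp [bar]), mul_one, mul_mul_mul_comm, Complex.mul_conj, Complex.normSq_eq_norm_sq,
      norm_mFourier_apply]
    push_cast; ring
  · intro l _ hl
    rw [if_neg, mul_zero]
    simpa [bar] using hl
  · exact fun h => absurd hk h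

theorem GaussianFamily.measurable_boxField (hX : GaussianFamily P X) (a : (Fin 2 → ℤ) → ℝ)
    (j : ℕ) (x : Torus) : Measurable (boxField X a j x) :=
  Finset.measurable_sum _ fun k _ => ((hX.measurable k).const_mul _).mul_const _

/-- The variance of the field. -/
theorem GaussianFamily.integral_norm_ampField_sq (hX : GaussianFamily P X) (ha : ∀ k, 0 ≤ a k)
    (has : Summable a) (x : Torus) : ∫ ω, ‖ampField X a x ω‖ ^ 2 ∂P = ∑' k, a k ^ 2 := by
  have h1 : Tendsto (fun j => ∫ ω, ‖boxField X a j x ω‖ ^ 2 ∂P) atTop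
      (𝓝 (∫ ω, ‖ampField X a x ω‖ ^ 2 ∂P)) := by
    refine tendsto_integral_of_dominated_convergence (fun ω => ampSum X a ω ^ 2) (fun j => ?_) ?_
      (fun j => ?_) ?_
    · exact ((hX.measurable_boxField a j x).norm.pow_const 2).aestronglyMeasurable
    · exact ((hX.hasMoments_ampSum ha has).pow 2).integrable
    · filter_upwards [hX.ae_summable ha has] with ω hω
      rw [Real.norm_of_nonneg (by positivity)]
      have := norm_boxField_le ha hω x j
      gcongr
    · filter_upwards [hX.ae_summable ha has] with ω hω
      exact (tendsto_boxField ha hω x).norm.pow 2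
  refine tendsto_nhds_unique h1 ?_
  simp_rw [hX.integral_norm_boxField_sq']
  exact tendsto_sum_box (summable_sq_of_summable ha has)

end AmpField

end Phi42

end

noncomputable section

namespace Phi42

/-! ### Convergence of the regularized interactions -/

section Regularized

variable {κ : ℝ} {ϑ : EuclideanSpace ℝ (Fin 2) → ℝ}

/-- The Fourier multipliers of a cutoff function. -/
def multiplier (ϑ : EuclideanSpace ℝ (Fin 2) → ℝ) (N : ℝ) (k : Fin 2 → ℤ) : ℝ :=
  √(ϑ (N⁻¹ • latticePoint k))

theorem IsCutoff.exists_multiplier_le (hϑ : IsCutoff ϑ) : ∃ S, ∀ N k, |multiplier ϑ N k| ≤ S := by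
  obtain ⟨C, hC⟩ := hϑ.rapid_decay 0
  refine ⟨√C, fun N k => ?_⟩
  rw [multiplier, abs_of_nonneg (Real.sqrt_nonneg _)]
  refine Real.sqrt_le_sqrt ?_
  simpa using hC (N⁻¹ • latticePoint k)

theorem IsCutoff.tendsto_multiplier (hϑ : IsCutoff ϑ) (k : Fin 2 → ℤ) :
    Tendsto (fun N => multiplier ϑ N k) atTop (𝓝 1) := by
  have h1 : Tendsto (fun N : ℝ => N⁻¹ • latticePoint k) atTop (𝓝 0) := by
    have := (tendsto_inv_atTop_zero (𝕜 := ℝ)).smul_const (latticePoint k)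
    rwa [zero_smul] at this
  have h2 := (hϑ.continuousAt_zero.tendsto.comp h1).sqrt
  rwa [hϑ.map_zero, Real.sqrt_one] at h2

theorem amp_multiplier_nonneg (k : Fin 2 → ℤ) (N : ℝ) : 0 ≤ amp κ (multiplier ϑ N) k :=
  div_nonneg (Real.sqrt_nonneg _) (Real.sqrt_nonneg _)

/-- Decay of ϑ to order 8 bounds λ⁴ϑ, so √ϑ = O(λ⁻²). At fixed N the series of the field then
converges absolutely almost surely. -/
theorem IsCutoff.summable_amp (hϑ : IsCutoff ϑ) (hκ : 0 < κ) {N : ℝ} (hN : 0 < N) :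
    Summable (amp κ (multiplier ϑ N)) := by
  obtain ⟨C₀, h₀⟩ := hϑ.rapid_decay 0
  obtain ⟨C₈, h₈⟩ := hϑ.rapid_decay 8
  set D := 2 * Real.pi ^ 2 with hD
  have hD0 : 0 < D := by positivity
  have hbd : ∀ k, eigenvalue κ k ^ 4 * ϑ (N⁻¹ • latticePoint k) ≤
      8 * κ ^ 4 * C₀ + 8 * D ^ 4 * (N ^ 8 * C₈) := by
    intro k
    have h1 := h₀ (N⁻¹ • latticePoint k)
    have h2 := h₈ (N⁻¹ • latticePoint k)
    have hnn := hϑ.nonneg (N⁻¹ • latticePoint k)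
    rw [pow_zero, one_mul] at h1
    rw [norm_smul, Real.norm_of_nonneg (inv_nonneg.2 hN.le), mul_pow, inv_pow, mul_assoc,
      inv_mul_le_iff₀ (by positivity)] at h2
    set y := ‖latticePoint k‖ ^ 2 with hy
    have hy8 : ‖latticePoint k‖ ^ 8 = y ^ 4 := by rw [hy, ← pow_mul]
    rw [hy8] at h2
    have h3 : eigenvalue κ k ^ 4 ≤ 8 * κ ^ 4 + 8 * D ^ 4 * y ^ 4 := by
      rw [eigenvalue_eq, ← hD, ← hy]
      have e1 : (κ + D * y) ^ 2 ≤ 2 * (κ ^ 2 + (D * y) ^ 2) := by nlinarith [sq_nonneg (κ - D * y)]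
      calc (κ + D * y) ^ 4 = ((κ + D * y) ^ 2) ^ 2 := by ring
        _ ≤ (2 * (κ ^ 2 + (D * y) ^ 2)) ^ 2 := by gcongr
        _ ≤ _ := by nlinarith [sq_nonneg (κ ^ 2 - (D * y) ^ 2)]
    calc _ ≤ (8 * κ ^ 4 + 8 * D ^ 4 * y ^ 4) * ϑ (N⁻¹ • latticePoint k) := by gcongr
      _ = 8 * κ ^ 4 * ϑ (N⁻¹ • latticePoint k) +
          8 * D ^ 4 * (y ^ 4 * ϑ (N⁻¹ • latticePoint k)) := by ring
      _ ≤ _ := add_le_add (mul_le_mul_of_nonneg_left h1 (by positivity))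
          (mul_le_mul_of_nonneg_left h2 (by positivity))
  set K := 8 * κ ^ 4 * C₀ + 8 * D ^ 4 * (N ^ 8 * C₈) with hK
  refine Summable.of_nonneg_of_le (fun k => amp_multiplier_nonneg k N) (fun k => ?_)
    ((summable_eigenvalue_inv_sq hκ).mul_left (√K / √κ))
  have hl := eigenvalue_pos hκ k
  have h1 : multiplier ϑ N k ≤ √K * (eigenvalue κ k)⁻¹ ^ 2 := by
    rw [multiplier, inv_pow, ← div_eq_mul_inv, le_div_iff₀ (by positivity)]
    refine le_trans (le_of_eq ?_) (Real.sqrt_le_sqrt (hbd k))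
    rw [Real.sqrt_mul (by positivity), show eigenvalue κ k ^ 4 = (eigenvalue κ k ^ 2) ^ 2 by ring,
      Real.sqrt_sq (by positivity), mul_comm]
  rw [amp, div_mul_eq_mul_div]
  have h2 : √κ ≤ √(eigenvalue κ k) := Real.sqrt_le_sqrt (le_eigenvalue κ k)
  have h3 : 0 < √κ := Real.sqrt_pos.2 hκ
  gcongr

variable {Ω : Type*} {X : (Fin 2 → ℤ) → Ω → ℂ}

theorem field_eq (κ : ℝ) (X : (Fin 2 → ℤ) → Ω → ℂ) (ϑ : EuclideanSpace ℝ (Fin 2) → ℝ) (N : ℝ)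
    (x : Torus) (ω : Ω) : field κ X ϑ N x ω = ampField X (amp κ (multiplier ϑ N)) x ω := by
  refine tsum_congr fun k => ?_
  rw [amp, multiplier, Complex.ofReal_div]
  ring

theorem isWeight_one (hκ : 0 < κ) {C : ℝ} (hC : 1 ≤ C) : IsWeight κ C 1 where
  nonneg _ := zero_le_one
  le _ := hC
  zero := rfl
  even _ := rfl
  holder l k := by
    simp only [Pi.one_apply, sub_self, abs_zero]
    exact mul_nonneg (by linarith) (mul_nonneg (Real.rpow_nonneg (eigenvalue_pos hκ l).le _)
      (Real.rpow_nonneg (eigenvalue_pos hκ k).le _))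

variable [MeasurableSpace Ω] {P : Measure Ω} [IsProbabilityMeasure P]

theorem GaussianFamily.fieldVariance_eq (hX : GaussianFamily P X) (hϑ : IsCutoff ϑ) (hκ : 0 < κ)
    {N : ℝ} (hN : 0 < N) (x : Torus) :
    fieldVariance κ P X ϑ N x = ∑' k, amp κ (multiplier ϑ N) k ^ 2 := by
  simp only [fieldVariance, field_eq]
  exact hX.integral_norm_ampField_sq (fun k => amp_multiplier_nonneg k N)
    (hϑ.summable_amp hκ hN) x

theorem GaussianFamily.memLp_interaction (hX : GaussianFamily P X) (hκ : 0 < κ) {C : ℝ}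
    {w : (Fin 2 → ℤ) → ℝ} (hw : IsWeight κ C w) : MemLp (interaction κ X w) 2 P := by
  obtain ⟨L, θ, -, -, -, h⟩ := exists_boltzmann_bounds hκ hX C
  exact (h w hw).2.1.mono_exponent (by norm_num)

theorem GaussianFamily.isInteractionLimit_local (hX : GaussianFamily P X) (hκ : 0 < κ) :
    IsInteractionLimit P (localInteraction κ P X) (interaction κ X 1) := by
  have hw := isWeight_one hκ le_rfl
  refine ⟨hX.memLp_interaction hκ hw, fun ϑ hϑ => ?_⟩
  obtain ⟨S, hS⟩ := hϑ.exists_multiplier_le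
  refine tendsto_cutoff_interaction_local hκ hX hw hS hϑ.tendsto_multiplier ?_
  filter_upwards [eventually_gt_atTop 0] with N hN
  have ha := fun k => amp_multiplier_nonneg (κ := κ) (ϑ := ϑ) k N
  have has := hϑ.summable_amp hκ hN
  filter_upwards [hX.ae_summable ha has] with ω hω
  have := tendsto_cutoffInteraction_local ha (summable_sq_of_summable ha has) hω
  simp only [localInteraction, wickFourth, field_eq, hX.fieldVariance_eq hϑ hκ hN]
  exact this

theorem GaussianFamily.isInteractionLimit_nonlocal (hX : GaussianFamily P X) (hκ : 0 < κ)
    {v : EuclideanSpace ℝ (Fin 2) → ℝ} (hv : IsPotential v) {ε : ℝ} (hε : 0 < ε) :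
    IsInteractionLimit P (nonlocalInteraction κ v P X ε)
      (interaction κ X (potentialWeight v ε)) := by
  obtain ⟨C, hC⟩ := hv.isWeight hκ
  have hw := hC ε hε
  refine ⟨hX.memLp_interaction hκ hw, fun ϑ hϑ => ?_⟩
  obtain ⟨S, hS⟩ := hϑ.exists_multiplier_le
  refine tendsto_cutoff_interaction_nonlocal hκ hX hw (hv.summable_potentialWeight hκ hε) hS
    hϑ.tendsto_multiplier (hv.massCounterterm_eq hκ hε) (hv.energyCounterterm_eq hκ hε) ?_
  filter_upwards [eventually_gt_atTop 0] with N hN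
  have ha := fun k => amp_multiplier_nonneg (κ := κ) (ϑ := ϑ) k N
  have has := hϑ.summable_amp hκ hN
  filter_upwards [hX.ae_summable ha has] with ω hω
  have := tendsto_cutoffInteraction_nonlocal hv hε hw.even (massCounterterm κ v ε)
    (energyCounterterm κ v ε) ha (summable_sq_of_summable ha has) hω
  simp only [nonlocalInteraction, wickSquare, field_eq, hX.fieldVariance_eq hϑ hκ hN]
  exact this

end Regularized

end Phi42

end

noncomputable section

namespace Phi42

/-! ### Wick monomials -/

section WickSlot

variable {ι : Type*} [Fintype ι] [DecidableEq ι]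

theorem mem_partialPairings {Q : Finset (Finset ι)} : Q ∈ partialPairings ι ↔
    (∀ e ∈ Q, e.card = 2) ∧ ∀ a ∈ Q, ∀ b ∈ Q, a ≠ b → Disjoint a b := by
  simp only [partialPairings, Finset.mem_filter, Finset.mem_powerset, Finset.subset_iff,
    Finset.mem_powersetCard, Finset.subset_univ, true_and, Finset.mem_univ, implies_true]

/-- The partial pairings which do not contain the slot `i`. -/
def pairingsAvoiding (i : ι) : Finset (Finset (Finset ι)) :=
  (partialPairings ι).filter fun Q => ∀ e ∈ Q, i ∉ e

/-- The slots other than `i` which are not paired by `Q`. -/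
def freeSlots (i : ι) (Q : Finset (Finset ι)) : Finset ι := (Finset.univ \ Q.sup id).erase i

theorem mem_freeSlots {i j : ι} {Q : Finset (Finset ι)} :
    j ∈ freeSlots i Q ↔ j ≠ i ∧ ∀ e ∈ Q, j ∉ e := by
  simp [freeSlots]

/-- Sums over partial pairings, sorted by the partner of the slot `i`. -/
theorem sum_partialPairings {M : Type*} [AddCommMonoid M] (i : ι) (f : Finset (Finset ι) → M) :
    ∑ Q ∈ partialPairings ι, f Q = ∑ Q ∈ pairingsAvoiding i,
      (f Q + ∑ j ∈ freeSlots i Q, f (insert {i, j} Q)) := by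
  rw [Finset.sum_add_distrib, ← Finset.sum_filter_add_sum_filter_not (partialPairings ι)
    fun Q => ∀ e ∈ Q, i ∉ e]
  congr 1
  rw [Finset.sum_sigma']
  symm
  -- A pairing that contains i amounts to the partner j of i and the remaining pairs, which avoid
  -- both i and j.
  refine Finset.sum_bij (fun a _ => insert {i, a.2} a.1) ?_ ?_ ?_ (fun a _ => rfl)
  · rintro ⟨Q, j⟩ h
    rw [Finset.mem_sigma, mem_freeSlots, pairingsAvoiding, Finset.mem_filter,
      mem_partialPairings] at h
    obtain ⟨⟨⟨h1, h2⟩, h3⟩, hji, hj⟩ := h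
    simp only at h1 h2 h3 hji hj
    have hd : ∀ e ∈ Q, Disjoint {i, j} e := fun e he => by
      rw [Finset.disjoint_left]
      intro x hx
      rcases Finset.mem_insert.1 hx with rfl | hx
      · exact h3 e he
      · rw [Finset.mem_singleton.1 hx]; exact hj e he
    rw [Finset.mem_filter, mem_partialPairings]
    refine ⟨⟨?_, ?_⟩, ?_⟩
    · intro e he
      rcases Finset.mem_insert.1 he with rfl | he
      · exact Finset.card_pair hji.symm
      · exact h1 e he
    · intro a ha b hb hab
      rcases Finset.mem_insert.1 ha with rfl | ha <;> rcases Finset.mem_insert.1 hb with rfl | hb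
      · exact absurd rfl hab
      · exact hd b hb
      · exact (hd a ha).symm
      · exact h2 a ha b hb hab
    · intro h
      exact h _ (Finset.mem_insert_self _ _) (Finset.mem_insert_self _ _)
  · rintro ⟨Q, j⟩ h ⟨Q', j'⟩ h' heq
    rw [Finset.mem_sigma, mem_freeSlots, pairingsAvoiding, Finset.mem_filter] at h h'
    obtain ⟨⟨-, h3⟩, hji, hj⟩ := h
    obtain ⟨⟨-, h3'⟩, hji', hj'⟩ := h'
    simp only at h3 hji hj h3' hji' hj' heq
    have hQ : Q = Q' := by
      have h1 : (insert {i, j} Q).filter (fun e => i ∉ e) = Q := by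
        rw [Finset.filter_insert, if_neg (by simp), Finset.filter_true_of_mem h3]
      have h2 : (insert {i, j'} Q').filter (fun e => i ∉ e) = Q' := by
        rw [Finset.filter_insert, if_neg (by simp), Finset.filter_true_of_mem h3']
      rw [← h1, ← h2, heq]
    have hmem : ({i, j} : Finset ι) ∈ insert {i, j'} Q' := heq ▸ Finset.mem_insert_self _ _
    have hpair : ({i, j} : Finset ι) = {i, j'} := by
      rcases Finset.mem_insert.1 hmem with h | h
      · exact h
      · exact absurd (Finset.mem_insert_self _ _) (h3' _ h)
    have hjj : j = j' := by
      have : j ∈ ({i, j'} : Finset ι) := hpair ▸ (by simp)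
      rcases Finset.mem_insert.1 this with h | h
      · exact absurd h hji
      · exact Finset.mem_singleton.1 h
    rw [hQ, hjj]
  · intro Q h
    rw [Finset.mem_filter, mem_partialPairings] at h
    obtain ⟨⟨h1, h2⟩, h3⟩ := h
    push Not at h3
    obtain ⟨e, he, hie⟩ := h3
    obtain ⟨j, hj⟩ := Finset.card_eq_one.1 (show (e.erase i).card = 1 by
      rw [Finset.card_erase_of_mem hie, h1 e he])
    have hej : e = {i, j} := by rw [← Finset.insert_erase hie, hj]
    have hji : j ≠ i := by
      have : j ∈ e.erase i := hj ▸ Finset.mem_singleton_self j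
      exact (Finset.mem_erase.1 this).1
    have hav : ∀ x ∈ e, ∀ e' ∈ Q.erase e, x ∉ e' := fun x hx e' he' hx' => by
      rw [Finset.mem_erase] at he'
      exact Finset.disjoint_left.1 (h2 e he e' he'.2 he'.1.symm) hx hx'
    refine ⟨⟨Q.erase e, j⟩, ?_, ?_⟩
    · rw [Finset.mem_sigma, mem_freeSlots, pairingsAvoiding, Finset.mem_filter,
        mem_partialPairings]
      refine ⟨⟨⟨fun a ha => h1 a (Finset.mem_of_mem_erase ha), fun a ha b hb =>
        h2 a (Finset.mem_of_mem_erase ha) b (Finset.mem_of_mem_erase hb)⟩, hav i hie⟩, hji,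
        hav j (by rw [hej]; simp)⟩
    · simp only
      rw [← hej, Finset.insert_erase he]

variable {Ω : Type*} [MeasurableSpace Ω] {P : Measure Ω}

/-- The Wick monomial as a function of one slot. -/
theorem wick_eq_sum_slot (ξ : ι → Ω → ℂ) (i : ι) (ω : Ω) :
    wick P ξ ω = ∑ Q ∈ pairingsAvoiding i, (∏ e ∈ Q, (-∫ ω', ∏ k ∈ e, ξ k ω' ∂P)) *
      (ξ i ω * ∏ k ∈ freeSlots i Q, ξ k ω -
        ∑ j ∈ freeSlots i Q, (∫ ω', ξ i ω' * ξ j ω' ∂P) *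
          ∏ k ∈ (freeSlots i Q).erase j, ξ k ω) := by
  rw [wick, sum_partialPairings i]
  refine Finset.sum_congr rfl fun Q hQ => ?_
  rw [pairingsAvoiding, Finset.mem_filter] at hQ
  have hi : i ∈ Finset.univ \ Q.sup id := by simpa using hQ.2
  rw [mul_sub, ← Finset.mul_prod_erase _ _ hi, ← freeSlots, sub_eq_add_neg, ← mul_neg,
    ← Finset.sum_neg_distrib, Finset.mul_sum, mul_comm]
  congr 1
  refine Finset.sum_congr rfl fun j hj => ?_
  rw [mem_freeSlots] at hj
  have h1 : Finset.univ \ (insert {i, j} Q).sup id = (freeSlots i Q).erase j := by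
    ext x
    simp only [Finset.sup_insert, id, Finset.mem_sdiff, Finset.mem_univ, true_and, Finset.sup_eq_union,
      Finset.mem_union, Finset.mem_insert, Finset.mem_singleton, Finset.mem_erase, freeSlots]
    tauto
  have h2 : ({i, j} : Finset ι) ∉ Q := fun h => hQ.2 _ h (Finset.mem_insert_self _ _)
  rw [h1, Finset.prod_insert h2]
  simp only [Finset.prod_pair hj.1.symm]
  ring

/-- Each term of the slot expansion contains the i-th factor exactly once, either as a factor or
inside one covariance. Integrability is needed only to split the covariances. -/
theorem wick_update_add {ξ : ι → Ω → ℂ} (i : ι) {f g : Ω → ℂ}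
    (hf : ∀ j, j ≠ i → Integrable (fun ω => f ω * ξ j ω) P)
    (hg : ∀ j, j ≠ i → Integrable (fun ω => g ω * ξ j ω) P) (ω : Ω) :
    wick P (Function.update ξ i (f + g)) ω =
      wick P (Function.update ξ i f) ω + wick P (Function.update ξ i g) ω := by
  simp only [wick_eq_sum_slot _ i]
  rw [← Finset.sum_add_distrib]
  refine Finset.sum_congr rfl fun Q hQ => ?_
  rw [pairingsAvoiding, Finset.mem_filter] at hQ
  have hne : ∀ {s : Finset ι}, i ∉ s → ∀ (h : Ω → ℂ) (ω : Ω),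
      ∏ k ∈ s, Function.update ξ i h k ω = ∏ k ∈ s, ξ k ω := fun hs h ω =>
    Finset.prod_congr rfl fun k hk => by rw [Function.update_of_ne (by rintro rfl; exact hs hk)]
  have hQ1 : ∀ h : Ω → ℂ, ∏ e ∈ Q, (-∫ ω', ∏ k ∈ e, Function.update ξ i h k ω' ∂P) =
      ∏ e ∈ Q, (-∫ ω', ∏ k ∈ e, ξ k ω' ∂P) := fun h =>
    Finset.prod_congr rfl fun e he => by simp_rw [hne (hQ.2 e he)]
  have hi : i ∉ freeSlots i Q := by simp [freeSlots]
  have hfree : ∀ h : Ω → ℂ, ∑ j ∈ freeSlots i Q, (∫ ω', Function.update ξ i h i ω' *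
      Function.update ξ i h j ω' ∂P) * ∏ k ∈ (freeSlots i Q).erase j, Function.update ξ i h k ω =
      ∑ j ∈ freeSlots i Q, (∫ ω', h ω' * ξ j ω' ∂P) * ∏ k ∈ (freeSlots i Q).erase j, ξ k ω :=
    fun h => Finset.sum_congr rfl fun j hj => by
      rw [hne fun h' => hi (Finset.mem_of_mem_erase h'), Function.update_self,
        Function.update_of_ne (mem_freeSlots.1 hj).1]
  rw [hQ1, hQ1, hQ1, hfree, hfree, hfree, hne hi, hne hi, hne hi, Function.update_self,
    Function.update_self, Function.update_self, ← mul_add]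
  congr 1
  have : ∑ j ∈ freeSlots i Q, (∫ ω', (f + g) ω' * ξ j ω' ∂P) *
      ∏ k ∈ (freeSlots i Q).erase j, ξ k ω =
      ∑ j ∈ freeSlots i Q, (∫ ω', f ω' * ξ j ω' ∂P) * ∏ k ∈ (freeSlots i Q).erase j, ξ k ω +
      ∑ j ∈ freeSlots i Q, (∫ ω', g ω' * ξ j ω' ∂P) * ∏ k ∈ (freeSlots i Q).erase j, ξ k ω := by
    rw [← Finset.sum_add_distrib]
    refine Finset.sum_congr rfl fun j hj => ?_
    have hj' := (mem_freeSlots.1 hj).1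
    simp only [Pi.add_apply, add_mul]
    rw [integral_add (hf j hj') (hg j hj'), add_mul]
  rw [this, Pi.add_apply]
  ring

/-- The degree of the polynomial bound on Wick monomials. -/
def wickDegree (ι : Type*) [Fintype ι] : ℕ :=
  Fintype.card ι + 2 * (Fintype.card ι).choose 2

/-- Crude counting: each unpaired slot costs M and each pair M², and there are at most as many pairs
as two-element subsets. -/
theorem norm_wick_le (ξ : ι → Ω → ℂ) {ω : Ω} {M : ℝ} (hM : 1 ≤ M) (h1 : ∀ i, ‖ξ i ω‖ ≤ M)
    (h2 : ∀ i j, ‖∫ ω', ξ i ω' * ξ j ω' ∂P‖ ≤ M ^ 2) :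
    ‖wick P ξ ω‖ ≤ (partialPairings ι).card * M ^ wickDegree ι := by
  have hM0 : 0 ≤ M := zero_le_one.trans hM
  rw [wick, ← nsmul_eq_mul]
  refine norm_sum_le_of_le _ (fun Q hQ => ?_) |>.trans (Finset.sum_le_card_nsmul _ _ _ fun Q _ => le_rfl)
  have hQ2 := mem_partialPairings.1 hQ
  rw [norm_mul, norm_prod, norm_prod, wickDegree, pow_add]
  refine mul_le_mul ?_ ?_ (Finset.prod_nonneg fun _ _ => norm_nonneg _) (pow_nonneg hM0 _)
  · refine (Finset.prod_le_prod (fun _ _ => norm_nonneg _) fun i _ => h1 i).trans ?_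
    rw [Finset.prod_const]
    exact pow_le_pow_right₀ hM (Finset.card_le_univ _)
  · refine (Finset.prod_le_prod (fun _ _ => norm_nonneg _) (g := fun _ => M ^ 2) fun e he => ?_).trans ?_
    · obtain ⟨i, j, hij, rfl⟩ := Finset.card_eq_two.1 (hQ2.1 e he)
      rw [norm_neg]
      simp only [Finset.prod_pair hij]
      exact h2 i j
    · rw [Finset.prod_const, ← pow_mul]
      refine pow_le_pow_right₀ hM (Nat.mul_le_mul_left 2 ?_)
      rw [← Finset.card_univ, ← Finset.card_powersetCard]
      refine Finset.card_le_card fun e he => ?_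
      exact Finset.mem_powersetCard.2 ⟨Finset.subset_univ _, hQ2.1 e he⟩

end WickSlot

section WickGaussian

variable {ι m Ω : Type*} [DecidableEq ι] [DecidableEq m] {X : m → Ω → ℂ}

/-- A linear combination of letters. -/
def linPoly (B : Finset m) (b : Bool) (c : m → ℂ) : MvPolynomial (m × Bool) ℂ :=
  ∑ k ∈ B, MvPolynomial.C (c k) * MvPolynomial.X (k, b)

theorem polyVal_linPoly (B : Finset m) (b : Bool) (c : m → ℂ) (ω : Ω) :
    polyVal X (linPoly B b c) ω = ∑ k ∈ B, c k * letterVal X (k, b) ω := by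
  simp only [linPoly, polyVal_sum, polyVal_mul, polyVal_C, polyVal_X]

theorem pderiv_linPoly (B : Finset m) (b : Bool) (c : m → ℂ) (l : m × Bool) :
    ∃ d, MvPolynomial.pderiv l (linPoly B b c) = MvPolynomial.C d := by
  refine ⟨∑ k ∈ B, c k * (if (k, b) = l then 1 else 0), ?_⟩
  rw [linPoly, map_sum, map_sum]
  refine Finset.sum_congr rfl fun k _ => ?_
  rw [MvPolynomial.pderiv_C_mul, MvPolynomial.pderiv_X, map_mul, Pi.single_apply]
  by_cases h : (k, b) = l
  · rw [if_pos h, if_pos h, map_one]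
  · rw [if_neg h, if_neg h, map_zero]

theorem pderiv_prod (l : m × Bool) (p : ι → MvPolynomial (m × Bool) ℂ) (A : Finset ι) :
    MvPolynomial.pderiv l (∏ i ∈ A, p i) =
      ∑ j ∈ A, MvPolynomial.pderiv l (p j) * ∏ i ∈ A.erase j, p i := by
  induction A using Finset.induction_on with
  | empty => simp
  | insert i A hi ih =>
    rw [Finset.prod_insert hi, MvPolynomial.pderiv_mul, ih, Finset.sum_insert hi,
      Finset.erase_insert hi, Finset.mul_sum]
    congr 1
    refine Finset.sum_congr rfl fun j hj => ?_
    have hij : i ≠ j := fun h => hi (h ▸ hj)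
    rw [Finset.erase_insert_of_ne hij, Finset.prod_insert fun h => hi (Finset.mem_of_mem_erase h)]
    ring

variable [Fintype ι] [MeasurableSpace Ω] {P : Measure Ω} [IsProbabilityMeasure P]

/-- A Wick monomial with one high-mode slot is orthogonal to all low-mode random variables. -/
theorem GaussianFamily.integral_mul_wick_eq_zero (hX : GaussianFamily P X) {S : Set m} {G : Ω → ℂ}
    (hG : Measurable[modeAlgebra X S] G) (hG2 : MemLp G 2 P)
    {p : ι → MvPolynomial (m × Bool) ℂ}
    (hp : ∀ i l, ∃ d, MvPolynomial.pderiv l (p i) = MvPolynomial.C d) (i : ι) {B : Finset m}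
    (hB : ∀ k ∈ B, k ∉ S) {b : Bool} {c : m → ℂ} (hi : p i = linPoly B b c) :
    ∫ ω, G ω * wick P (fun i => polyVal X (p i)) ω ∂P = 0 := by
  choose d hd using hp
  have hint : ∀ q : MvPolynomial (m × Bool) ℂ, Integrable (fun ω => G ω * polyVal X q ω) P :=
    fun q => hG2.integrable_mul (hX.hasMoments_polyVal q).memLp_two
  have hslot : ∀ q : MvPolynomial (m × Bool) ℂ, ∀ ω, polyVal X (p i) ω * polyVal X q ω =
      ∑ k ∈ B, c k * (letterVal X (k, b) ω * polyVal X q ω) := fun q ω => by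
    rw [hi, polyVal_linPoly, Finset.sum_mul]
    exact Finset.sum_congr rfl fun k _ => by ring
  have hIBP : ∀ q : MvPolynomial (m × Bool) ℂ, ∫ ω, G ω * (polyVal X (p i) ω * polyVal X q ω) ∂P =
      ∑ k ∈ B, c k * ∫ ω, G ω * polyVal X (MvPolynomial.pderiv (bar (k, b)) q) ω ∂P := by
    intro q
    simp_rw [hslot, Finset.mul_sum]
    rw [integral_finsetSum]
    · refine Finset.sum_congr rfl fun k hk => ?_
      rw [← hX.integral_mul_letterVal_mul_polyVal hG hG2 (l := (k, b)) (hB k hk),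
        ← integral_const_mul]
      exact integral_congr_ae (.of_forall fun ω => by ring)
    · intro k _
      have := (hint (MvPolynomial.X (k, b) * q)).const_mul (c k)
      refine this.congr (.of_forall fun ω => ?_)
      simp only [polyVal_mul, polyVal_X]
      ring
  have hcov : ∀ j, ∫ ω, polyVal X (p i) ω * polyVal X (p j) ω ∂P =
      ∑ k ∈ B, c k * d j (bar (k, b)) := by
    intro j
    simp_rw [hslot]
    rw [integral_finsetSum]
    · refine Finset.sum_congr rfl fun k hk => ?_
      rw [integral_const_mul, hX.integral_letterVal_mul_polyVal, hd]
      simp [polyVal_C]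
    · intro k _
      exact ((hX.hasMoments_letterVal _).mul (hX.hasMoments_polyVal _)).integrable.const_mul _
  have hprod : ∀ (A : Finset ι) ω, ∏ k ∈ A, polyVal X (p k) ω = polyVal X (∏ k ∈ A, p k) ω :=
    fun A ω => (polyVal_prod A p ω).symm
  simp only [wick_eq_sum_slot _ i, hprod]
  -- Fix the pairing among the other slots. Integrating slot i by parts lets it contract with each
  -- free slot but never with G, and the subtracted covariances are exactly these contractions, so
  -- every bracket integrates to zero separately.
  have hterm : ∀ A : Finset ι, Integrable (fun ω => G ω * (polyVal X (p i) ω *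
      polyVal X (∏ k ∈ A, p k) ω - ∑ j ∈ A, (∫ ω', polyVal X (p i) ω' * polyVal X (p j) ω' ∂P) *
          polyVal X (∏ k ∈ A.erase j, p k) ω)) P ∧
      ∫ ω, G ω * (polyVal X (p i) ω * polyVal X (∏ k ∈ A, p k) ω -
        ∑ j ∈ A, (∫ ω', polyVal X (p i) ω' * polyVal X (p j) ω' ∂P) *
          polyVal X (∏ k ∈ A.erase j, p k) ω) ∂P = 0 := by
    intro A
    have e1 : ∀ ω, G ω * (polyVal X (p i) ω * polyVal X (∏ k ∈ A, p k) ω -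
        ∑ j ∈ A, (∫ ω', polyVal X (p i) ω' * polyVal X (p j) ω' ∂P) *
          polyVal X (∏ k ∈ A.erase j, p k) ω) =
        G ω * (polyVal X (p i) ω * polyVal X (∏ k ∈ A, p k) ω) -
        ∑ j ∈ A, (∫ ω', polyVal X (p i) ω' * polyVal X (p j) ω' ∂P) *
          (G ω * polyVal X (∏ k ∈ A.erase j, p k) ω) := by
      intro ω
      rw [mul_sub, Finset.mul_sum]
      congr 1
      exact Finset.sum_congr rfl fun j _ => by ring
    have i1 : Integrable (fun ω => G ω * (polyVal X (p i) ω * polyVal X (∏ k ∈ A, p k) ω)) P := by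
      simpa only [polyVal_mul] using hint (p i * ∏ k ∈ A, p k)
    have i2 : Integrable (fun ω => ∑ j ∈ A, (∫ ω', polyVal X (p i) ω' * polyVal X (p j) ω' ∂P) *
          (G ω * polyVal X (∏ k ∈ A.erase j, p k) ω)) P :=
      integrable_finsetSum _ fun j _ => (hint (∏ k ∈ A.erase j, p k)).const_mul _
    simp_rw [e1]
    refine ⟨i1.sub i2, ?_⟩
    rw [integral_sub i1 i2, hIBP, integral_finsetSum _ fun j _ =>
      (hint (∏ k ∈ A.erase j, p k)).const_mul _, sub_eq_zero]
    simp_rw [integral_const_mul, hcov, pderiv_prod, hd, polyVal_sum, polyVal_mul, polyVal_C]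
    have e2 : ∀ k, ∫ ω, G ω * ∑ j ∈ A, d j (bar (k, b)) * polyVal X (∏ i ∈ A.erase j, p i) ω ∂P =
        ∑ j ∈ A, d j (bar (k, b)) * ∫ ω, G ω * polyVal X (∏ i ∈ A.erase j, p i) ω ∂P := by
      intro k
      simp_rw [Finset.mul_sum]
      rw [integral_finsetSum]
      · refine Finset.sum_congr rfl fun j _ => ?_
        rw [← integral_const_mul]
        exact integral_congr_ae (.of_forall fun ω => by ring)
      · intro j _
        refine ((hint (∏ i ∈ A.erase j, p i)).const_mul (d j (bar (k, b)))).congr (.of_forall fun ω => ?_)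
        ring
    simp_rw [e2, Finset.mul_sum, Finset.sum_mul]
    rw [Finset.sum_comm]
    exact Finset.sum_congr rfl fun j _ => Finset.sum_congr rfl fun k _ => by ring
  simp_rw [Finset.mul_sum, mul_left_comm (G _)]
  rw [integral_finsetSum _ fun Q _ => (hterm _).1.const_mul _]
  refine Finset.sum_eq_zero fun Q _ => ?_
  rw [integral_const_mul, (hterm _).2, mul_zero]

end WickGaussian

end Phi42

end

/-! ### Expectations of Wick monomials and their L² bounds -/

noncomputable section

namespace Phi42

section WickExpectation

variable {ι m Ω : Type*} [Fintype ι] [DecidableEq ι] [DecidableEq m] {X : m → Ω → ℂ}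
  [MeasurableSpace Ω] {P : Measure Ω} [IsProbabilityMeasure P]

theorem hasMoments_wick {ξ : ι → Ω → ℂ} (h : ∀ i, HasMoments P (ξ i)) :
    HasMoments P (wick P ξ) :=
  HasMoments.sum _ fun _ _ => (HasMoments.prod _ fun i _ => h i).mul (HasMoments.const _)

/-- The expectation of a Wick monomial against a low-mode random variable does not depend on the
high modes. -/
theorem GaussianFamily.integral_mul_wick_linPoly_mono (hX : GaussianFamily P X)
    {B B' : Finset m}
    (hBB : B ⊆ B') {G : Ω → ℂ} (hG : Measurable[modeAlgebra X ↑B] G) (hG2 : MemLp G 2 P)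
    (b : ι → Bool) (c : ι → m → ℂ) :
    ∫ ω, G ω * wick P (fun i => polyVal X (linPoly B' (b i) (c i))) ω ∂P =
      ∫ ω, G ω * wick P (fun i => polyVal X (linPoly B (b i) (c i))) ω ∂P := by
  -- The slots are enlarged from B to B' one at a time. Each enlargement adds, by multilinearity, a
  -- Wick monomial with one slot supported on B' \ B, which is orthogonal to G.
  set q : Finset ι → ι → MvPolynomial (m × Bool) ℂ :=
    fun A i => linPoly (if i ∈ A then B' else B) (b i) (c i) with hq
  have key : ∀ A : Finset ι, ∫ ω, G ω * wick P (fun i => polyVal X (q A i)) ω ∂P =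
      ∫ ω, G ω * wick P (fun i => polyVal X (q ∅ i)) ω ∂P := by
    intro A
    induction A using Finset.induction_on with
    | empty => rfl
    | insert i A hi ih =>
      rw [← ih]
      set ξ : ι → Ω → ℂ := fun i => polyVal X (q A i) with hξ
      set g := linPoly (B' \ B) (b i) (c i) with hg
      have h1 : (fun j => polyVal X (q (insert i A) j)) =
          Function.update ξ i (ξ i + polyVal X g) := by
        funext j
        by_cases hj : j = i
        · subst hj
          rw [Function.update_self]
          funext ω
          simp only [hξ, hq, Finset.mem_insert_self, if_true, hi, if_false, Pi.add_apply, hg,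
            polyVal_linPoly]
          rw [add_comm, Finset.sum_sdiff hBB]
        · rw [Function.update_of_ne hj]
          simp only [hξ, hq, Finset.mem_insert, hj, false_or]
      have h2 : Function.update ξ i (polyVal X g) =
          fun j => polyVal X (Function.update (q A) i g j) := by
        funext j
        by_cases hj : j = i
        · subst hj; simp
        · simp [hj, hξ]
      have hm : ∀ p : MvPolynomial (m × Bool) ℂ, HasMoments P (polyVal X p) :=
        hX.hasMoments_polyVal
      have h0 : ∫ ω, G ω * wick P (Function.update ξ i (polyVal X g)) ω ∂P = 0 := by
        rw [h2]
        refine hX.integral_mul_wick_eq_zero hG hG2 (fun j l => ?_) i (B := B' \ B) (b := b i)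
          (c := c i) (fun k hk => ?_) (Function.update_self _ _ _)
        · by_cases hj : j = i
          · subst hj; rw [Function.update_self]; exact pderiv_linPoly _ _ _ _
          · rw [Function.update_of_ne hj]; exact pderiv_linPoly _ _ _ _
        · exact fun h => (Finset.mem_sdiff.1 hk).2 (Finset.mem_coe.1 h)
      rw [h1]
      simp_rw [wick_update_add (P := P) (ξ := ξ) i (f := ξ i) (g := polyVal X g)
        (fun j _ => ((hm _).mul (hm _)).integrable) (fun j _ => ((hm _).mul (hm _)).integrable),
        Function.update_eq_self, mul_add]
      rw [integral_add, h0, add_zero]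
      · exact hG2.integrable_mul (hasMoments_wick fun j => hm _).memLp_two
      · rw [h2]
        exact hG2.integrable_mul (hasMoments_wick fun j => hm _).memLp_two
  simpa [hq] using key Finset.univ

/-- Expanding the product of finite sums moves the parameter out of the expectation: what remains is
a polynomial in the coefficients with fixed numbers as coefficients. -/
theorem GaussianFamily.continuous_integral_mul_prod (hX : GaussianFamily P X) {T : Type*}
    [TopologicalSpace T] {G : Ω → ℂ} (hG2 : MemLp G 2 P) (B : Finset m) (b : ι → Bool)
    {c : ι → m → T → ℂ} (hc : ∀ i k, Continuous (c i k)) (A : Finset ι) :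
    Continuous fun t => ∫ ω, G ω *
      ∏ i ∈ A, polyVal X (linPoly B (b i) fun k => c i k t) ω ∂P := by
  have h : ∀ t, ∫ ω, G ω * ∏ i ∈ A, polyVal X (linPoly B (b i) fun k => c i k t) ω ∂P =
      ∑ s ∈ A.pi fun _ => B, (∏ i ∈ A.attach, c i (s i i.2) t) *
        ∫ ω, G ω * ∏ i ∈ A.attach, letterVal X (s i i.2, b i) ω ∂P := by
    intro t
    simp only [polyVal_linPoly, Finset.prod_sum, Finset.mul_sum]
    rw [integral_finsetSum]
    · refine Finset.sum_congr rfl fun s _ => ?_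
      rw [← integral_const_mul]
      refine integral_congr_ae (.of_forall fun ω => ?_)
      simp only [Finset.prod_mul_distrib]
      ring
    · exact fun s _ => hG2.integrable_mul (HasMoments.prod _ fun i _ =>
        (HasMoments.const _).mul (hX.hasMoments_letterVal _)).memLp_two
  simp_rw [h]
  fun_prop

theorem GaussianFamily.continuous_integral_mul_wick (hX : GaussianFamily P X) {T : Type*}
    [TopologicalSpace T] {G : Ω → ℂ} (hG2 : MemLp G 2 P) (B : Finset m) (b : ι → Bool)
    {c : ι → m → T → ℂ} (hc : ∀ i k, Continuous (c i k)) :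
    Continuous fun t => ∫ ω, G ω *
      wick P (fun i => polyVal X (linPoly B (b i) fun k => c i k t)) ω ∂P := by
  have h : ∀ t, ∫ ω, G ω * wick P (fun i => polyVal X (linPoly B (b i) fun k => c i k t)) ω ∂P =
      ∑ Q ∈ partialPairings ι, (∫ ω, G ω * ∏ i ∈ Finset.univ \ Q.sup id,
        polyVal X (linPoly B (b i) fun k => c i k t) ω ∂P) *
        ∏ e ∈ Q, (-∫ ω, 1 * ∏ i ∈ e, polyVal X (linPoly B (b i) fun k => c i k t) ω ∂P) := by
    intro t
    simp only [wick, Finset.mul_sum, ← mul_assoc, one_mul]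
    rw [integral_finsetSum]
    · exact Finset.sum_congr rfl fun Q _ => integral_mul_const _ _
    · exact fun Q _ => (hG2.integrable_mul (HasMoments.prod _ fun i _ =>
        hX.hasMoments_polyVal _).memLp_two).mul_const _
  simp_rw [h]
  refine continuous_finsetSum _ fun Q _ => (hX.continuous_integral_mul_prod hG2 B b hc _).mul
    (continuous_finsetProd _ fun e _ => ?_)
  exact (hX.continuous_integral_mul_prod (memLp_const (1 : ℂ)) B b hc _).neg

theorem norm_integral_mul_le {f g : Ω → ℂ} (hf : AEStronglyMeasurable f P)
    (hg : AEStronglyMeasurable g P) {a b : ℝ} (ha : 0 ≤ a) (hb : 0 ≤ b)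
    (h1 : eLpNorm f 2 P ≤ ENNReal.ofReal a) (h2 : eLpNorm g 2 P ≤ ENNReal.ofReal b) :
    ‖∫ ω, f ω * g ω ∂P‖ ≤ a * b := by
  have h3 := eLpNorm_smul_le_mul_eLpNorm (p := 2) (q := 2) (r := 1) (μ := P) hg hf
  have h4 : ‖∫ ω, f ω * g ω ∂P‖ₑ ≤ ENNReal.ofReal (a * b) := by
    refine (enorm_integral_le_lintegral_enorm _).trans ?_
    rw [← eLpNorm_one_eq_lintegral_enorm, ENNReal.ofReal_mul ha]
    exact h3.trans (mul_le_mul' h1 h2)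
  rw [← ofReal_norm] at h4
  exact (ENNReal.ofReal_le_ofReal_iff (by positivity)).1 h4

theorem eLpNorm_two_le {f : Ω → ℂ} (hf : HasMoments P f) {c : ℝ} (hc : 0 ≤ c)
    (h : ∫ ω, ‖f ω‖ ^ 2 ∂P ≤ c ^ 2) : eLpNorm f 2 P ≤ ENNReal.ofReal c := by
  rw [hf.memLp_two.eLpNorm_eq_integral_rpow_norm (by norm_num) (by norm_num)]
  refine ENNReal.ofReal_le_ofReal ?_
  have h2 : (2 : ℝ≥0∞).toReal = 2 := by norm_num
  rw [h2]
  simp_rw [Real.rpow_two]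
  calc _ ≤ (c ^ 2) ^ (2⁻¹ : ℝ) := by
        refine Real.rpow_le_rpow (integral_nonneg fun ω => by positivity) h (by norm_num)
    _ = c := by
        rw [← Real.rpow_natCast, ← Real.rpow_mul hc]
        norm_num

theorem norm_integral_mul_le_of_sq {f g : Ω → ℂ} (hf : MemLp f 2 P) (hg : MemLp g 2 P) {σ : ℝ}
    (h1 : ∫ ω, ‖f ω‖ ^ 2 ∂P ≤ σ) (h2 : ∫ ω, ‖g ω‖ ^ 2 ∂P ≤ σ) : ‖∫ ω, f ω * g ω ∂P‖ ≤ σ := by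
  have i1 := hf.integrable_norm_pow (p := 2) (by norm_num)
  have i2 := hg.integrable_norm_pow (p := 2) (by norm_num)
  calc ‖∫ ω, f ω * g ω ∂P‖ ≤ ∫ ω, ‖f ω * g ω‖ ∂P := norm_integral_le_integral_norm _
    _ ≤ ∫ ω, (2⁻¹ * ‖f ω‖ ^ 2 + 2⁻¹ * ‖g ω‖ ^ 2) ∂P := by
        refine integral_mono (hf.integrable_mul hg).norm ((i1.const_mul _).add (i2.const_mul _))
          fun ω => ?_
        simp only [norm_mul]
        nlinarith [sq_nonneg (‖f ω‖ - ‖g ω‖)]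
    _ ≤ σ := by
        rw [integral_add (i1.const_mul _) (i2.const_mul _), integral_const_mul, integral_const_mul]
        linarith

theorem isChaos_linPoly (B : Finset m) (b : Bool) (c : m → ℂ) :
    IsChaos B 1 (linPoly B b c) (∑ k ∈ B, ‖c k‖ ^ 2) := by
  have h := IsChaos.sum_creation_mode (B := B) (n := 0) b (g := fun k => MvPolynomial.C (c k))
    (τ := fun k => ‖c k‖ ^ 2) fun k _ => ⟨c k, rfl, le_rfl⟩
  rw [chaosConst, one_mul] at h
  convert h using 1
  refine Finset.sum_congr rfl fun k _ => ?_
  simp [creation, mul_comm]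

/-- Wick monomials of Gaussian variables have `L²` norm polynomially bounded in the variance. -/
theorem GaussianFamily.exists_eLpNorm_wick_le (hX : GaussianFamily P X) (ι : Type*) [Fintype ι]
    [DecidableEq ι] : ∃ K : ℝ, 0 ≤ K ∧ ∀ (B : Finset m) (p : ι → MvPolynomial (m × Bool) ℂ) (σ : ℝ),
      0 ≤ σ → (∀ i, IsChaos B 1 (p i) σ) →
        eLpNorm (wick P fun i => polyVal X (p i)) 2 P ≤
          ENNReal.ofReal (K * (1 + σ) ^ (wickDegree ι + 1)) := by
  set d := wickDegree ι
  set N : ℝ := ((partialPairings ι).card : ℝ)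
  set n : ℝ := (Fintype.card ι : ℝ)
  refine ⟨√(N ^ 2 * (n + 1) ^ (2 * d + 1) * (1 + n * (2 * d + 1) ^ (d + 1))), Real.sqrt_nonneg _,
    fun B p σ hσ hp => eLpNorm_two_le (hasMoments_wick fun i => hX.hasMoments_polyVal _)
      (by positivity) ?_⟩
  set ξ : ι → Ω → ℂ := fun i => polyVal X (p i) with hξ
  have hξm : ∀ i, HasMoments P (ξ i) := fun i => hX.hasMoments_polyVal _
  have hmom : ∀ i (q : ℕ), ∫ ω, ‖ξ i ω‖ ^ (2 * (q + 1)) ∂P ≤ ((2 * q + 1) * σ) ^ (q + 1) :=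
    fun i q => by simpa using hX.moment_le (hp i) q
  have hvar : ∀ i, ∫ ω, ‖ξ i ω‖ ^ 2 ∂P ≤ σ := fun i => by simpa using hmom i 0
  have hcov : ∀ i j, ‖∫ ω, ξ i ω * ξ j ω ∂P‖ ≤ σ := fun i j =>
    norm_integral_mul_le_of_sq (hξm i).memLp_two (hξm j).memLp_two (hvar i) (hvar j)
  have hpt : ∀ ω, ‖wick P ξ ω‖ ^ 2 ≤ N ^ 2 * ((n + 1) ^ (2 * d + 1) *
      ((1 + σ) ^ (2 * (d + 1)) + ∑ i, ‖ξ i ω‖ ^ (2 * (d + 1)))) := by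
    intro ω
    -- M dominates 1, every factor, and, through σ ≤ M², every covariance.
    set M : ℝ := (1 + σ) + ∑ i, ‖ξ i ω‖
    have hs : 0 ≤ ∑ i, ‖ξ i ω‖ := Finset.sum_nonneg fun i _ => norm_nonneg _
    have hM : 1 ≤ M := by simp only [M]; linarith
    have h1 := norm_wick_le (P := P) ξ (ω := ω) hM (fun i => by
        have := Finset.single_le_sum (f := fun i => ‖ξ i ω‖) (fun j _ => norm_nonneg _)
          (Finset.mem_univ i)
        simp only [M]; linarith) (fun i j => (hcov i j).trans (by
          simp only [M]; nlinarith))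
    -- The extra index carries the constant summand 1 + σ. The exponent 2d is raised to 2(d + 1),
    -- which is harmless since M ≥ 1, to match the form of the available moment bounds.
    have h3 := pow_sum_div_card_le_sum_pow (s := (Finset.univ : Finset (Option ι)))
      (f := fun o => o.elim (1 + σ) fun i => ‖ξ i ω‖) (n := 2 * d + 1) (by
        rintro (_ | i) - <;> simp; positivity)
    rw [Fintype.sum_option, Fintype.sum_option, Finset.card_univ, Fintype.card_option,
      div_le_iff₀ (by positivity)] at h3
    simp only [Option.elim] at h3
    push_cast at h3
    calc ‖wick P ξ ω‖ ^ 2 ≤ (N * M ^ d) ^ 2 := by gcongr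
      _ = N ^ 2 * M ^ (2 * d) := by ring
      _ ≤ N ^ 2 * M ^ (2 * d + 1 + 1) := by
          gcongr
          · omega
      _ ≤ _ := by
          rw [mul_comm ((n + 1) ^ (2 * d + 1))]
          exact mul_le_mul_of_nonneg_left h3 (by positivity)
  have hint : ∀ i, Integrable (fun ω => ‖ξ i ω‖ ^ (2 * (d + 1))) P := fun i =>
    ((hξm i).norm.pow _).integrable
  calc ∫ ω, ‖wick P ξ ω‖ ^ 2 ∂P ≤ ∫ ω, N ^ 2 * ((n + 1) ^ (2 * d + 1) *
      ((1 + σ) ^ (2 * (d + 1)) + ∑ i, ‖ξ i ω‖ ^ (2 * (d + 1)))) ∂P := by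
        refine integral_mono ((hasMoments_wick hξm).norm.pow 2).integrable ?_ hpt
        exact (((integrable_const _).add (integrable_finsetSum _ fun i _ => hint i)).const_mul
          _).const_mul _
    _ = N ^ 2 * ((n + 1) ^ (2 * d + 1) *
      ((1 + σ) ^ (2 * (d + 1)) + ∑ i, ∫ ω, ‖ξ i ω‖ ^ (2 * (d + 1)) ∂P)) := by
        rw [integral_const_mul, integral_const_mul, integral_add (integrable_const _)
          (integrable_finsetSum _ fun i _ => hint i), integral_finsetSum _ fun i _ => hint i]
        simp
    _ ≤ N ^ 2 * ((n + 1) ^ (2 * d + 1) *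
      ((1 + σ) ^ (2 * (d + 1)) + ∑ _i : ι, ((2 * d + 1) ^ (d + 1) * (1 + σ) ^ (2 * (d + 1))))) := by
        gcongr with i
        refine (hmom i d).trans ?_
        rw [mul_pow]
        gcongr
        calc σ ^ (d + 1) ≤ (1 + σ) ^ (d + 1) := by gcongr; linarith
          _ ≤ _ := pow_le_pow_right₀ (by linarith) (by omega)
    _ = _ := by
        rw [mul_pow, Real.sq_sqrt (by positivity), Finset.sum_const, Finset.card_univ, nsmul_eq_mul]
        ring

end WickExpectation

end Phi42

end

/-! ### Wick monomials of the field and their truncation -/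

noncomputable section

namespace Phi42

section Slots

variable {Ω : Type*} {X : (Fin 2 → ℤ) → Ω → ℂ} {p : ℕ}

/-- The factors of a Wick monomial of a field. -/
def slotField (φ : Torus → Ω → ℂ) (z : (Fin p → Torus) × (Fin p → Torus)) :
    Fin p ⊕ Fin p → Ω → ℂ :=
  Sum.elim (fun i ω => starRingEnd ℂ (φ (z.2 i) ω)) fun i => φ (z.1 i)

/-- Whether a slot carries the field or its conjugate. -/
def slotSign : Fin p ⊕ Fin p → Bool := Sum.elim (fun _ => false) fun _ => true

/-- The Fourier coefficients of the factors of a Wick monomial. -/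
def slotCoeff (a : (Fin 2 → ℤ) → ℝ) (z : (Fin p → Torus) × (Fin p → Torus)) (i : Fin p ⊕ Fin p)
    (k : Fin 2 → ℤ) : ℂ :=
  (a k : ℂ) * Sum.elim (fun i => starRingEnd ℂ (UnitAddTorus.mFourier k (z.2 i)))
    (fun i => UnitAddTorus.mFourier k (z.1 i)) i

theorem norm_slotCoeff (a : (Fin 2 → ℤ) → ℝ) (z : (Fin p → Torus) × (Fin p → Torus))
    (i : Fin p ⊕ Fin p) (k : Fin 2 → ℤ) : ‖slotCoeff a z i k‖ = |a k| := by
  rcases i with i | i <;> simp [slotCoeff, norm_mFourier_apply]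

theorem slotField_boxField (X : (Fin 2 → ℤ) → Ω → ℂ) (a : (Fin 2 → ℤ) → ℝ) (j : ℕ)
    (z : (Fin p → Torus) × (Fin p → Torus)) : slotField (boxField X a j) z =
      fun i => polyVal X (linPoly (box j) (slotSign i) (slotCoeff a z i)) := by
  funext i ω
  rw [polyVal_linPoly]
  rcases i with i | i
  · simp only [slotField, Sum.elim_inl, boxField, map_sum, map_mul, Complex.conj_ofReal, slotCoeff,
      slotSign, letterVal]
    exact Finset.sum_congr rfl fun k _ => by simp; ring
  · simp only [slotField, Sum.elim_inr, boxField, slotCoeff, slotSign, letterVal]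
    exact Finset.sum_congr rfl fun k _ => by simp; ring

/-- Joint continuity in the multiplier and the points, with the product topology on multipliers,
later turns pointwise convergence of multipliers into uniform convergence in the points. -/
theorem continuous_slotCoeff_amp (κ : ℝ) (i : Fin p ⊕ Fin p) (k : Fin 2 → ℤ) :
    Continuous fun t : ((Fin 2 → ℤ) → ℝ) × ((Fin p → Torus) × (Fin p → Torus)) =>
      slotCoeff (amp κ t.1) t.2 i k := by
  have h1 : Continuous fun t : ((Fin 2 → ℤ) → ℝ) × ((Fin p → Torus) × (Fin p → Torus)) =>
      (amp κ t.1 k : ℂ) := by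
    unfold amp
    fun_prop
  rcases i with i | i
  · exact h1.mul (Complex.continuous_conj.comp ((UnitAddTorus.mFourier k).continuous.comp
      (by fun_prop)))
  · exact h1.mul ((UnitAddTorus.mFourier k).continuous.comp (by fun_prop))

theorem norm_slotField (φ : Torus → Ω → ℂ) (z : (Fin p → Torus) × (Fin p → Torus))
    (i : Fin p ⊕ Fin p) (ω : Ω) :
    ∃ x, ‖slotField φ z i ω‖ = ‖φ x ω‖ := by
  rcases i with i | i
  · exact ⟨z.2 i, by simp [slotField]⟩
  · exact ⟨z.1 i, rfl⟩

variable [MeasurableSpace Ω] {P : Measure Ω} [IsProbabilityMeasure P]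

theorem GaussianFamily.hasMoments_slotField_boxField (hX : GaussianFamily P X)
    (a : (Fin 2 → ℤ) → ℝ) (j : ℕ) (z : (Fin p → Torus) × (Fin p → Torus)) (i : Fin p ⊕ Fin p) :
    HasMoments P (slotField (boxField X a j) z i) := by
  rw [slotField_boxField]
  exact hX.hasMoments_polyVal _

/-- Truncation to finitely many modes in expectations of Wick monomials. -/
theorem GaussianFamily.tendsto_integral_mul_wick_boxField (hX : GaussianFamily P X)
    {a : (Fin 2 → ℤ) → ℝ} (ha : ∀ k, 0 ≤ a k) (has : Summable a) {F : Ω → ℂ} (hF : MemLp F 2 P)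
    (z : (Fin p → Torus) × (Fin p → Torus)) :
    Integrable (fun ω => F ω * wick P (slotField (ampField X a) z) ω) P ∧
    Tendsto (fun j => ∫ ω, F ω * wick P (slotField (boxField X a j) z) ω ∂P) atTop
      (𝓝 (∫ ω, F ω * wick P (slotField (ampField X a) z) ω ∂P)) := by
  set T := ampSum X a with hT
  have hTm : HasMoments P T := hX.hasMoments_ampSum ha has
  have hbox : ∀ j i, ∀ᵐ ω ∂P, ‖slotField (boxField X a j) z i ω‖ ≤ T ω := fun j i => by
    filter_upwards [hX.ae_summable ha has] with ω hω
    obtain ⟨x, hx⟩ := norm_slotField (boxField X a j) z i ω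
    exact hx ▸ norm_boxField_le ha hω x j
  have hamp : ∀ i, ∀ᵐ ω ∂P, ‖slotField (ampField X a) z i ω‖ ≤ T ω := fun i => by
    filter_upwards [hX.ae_summable ha has] with ω hω
    obtain ⟨x, hx⟩ := norm_slotField (ampField X a) z i ω
    exact hx ▸ norm_ampField_le ha hω x
  have hlim : ∀ i, ∀ᵐ ω ∂P, Tendsto (fun j => slotField (boxField X a j) z i ω) atTop
      (𝓝 (slotField (ampField X a) z i ω)) := fun i => by
    filter_upwards [hX.ae_summable ha has] with ω hω
    rcases i with i | i
    · exact (Complex.continuous_conj.tendsto _).comp (tendsto_boxField ha hω _)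
    · exact tendsto_boxField ha hω _
  have hmbox : ∀ j i, HasMoments P (slotField (boxField X a j) z i) := fun j i =>
    hX.hasMoments_slotField_boxField a j z i
  have hmamp : ∀ i, HasMoments P (slotField (ampField X a) z i) := fun i =>
    hTm.of_le (aestronglyMeasurable_of_tendsto_ae atTop
      (fun j => (hmbox j i).aestronglyMeasurable) (hlim i)) (hamp i)
  have hcov : ∀ e : Finset (Fin p ⊕ Fin p), Tendsto (fun j =>
      ∫ ω, ∏ i ∈ e, slotField (boxField X a j) z i ω ∂P) atTop
      (𝓝 (∫ ω, ∏ i ∈ e, slotField (ampField X a) z i ω ∂P)) := by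
    intro e
    refine tendsto_integral_of_dominated_convergence (fun ω => T ω ^ e.card)
      (fun j => (HasMoments.prod _ fun i _ => hmbox j i).aestronglyMeasurable)
      (hTm.pow _).integrable (fun j => ?_) ?_
    · filter_upwards [ae_all_iff.2 (hbox j)] with ω hω
      rw [norm_prod, ← Finset.prod_const]
      exact Finset.prod_le_prod (fun _ _ => norm_nonneg _) fun i _ => hω i
    · filter_upwards [ae_all_iff.2 hlim] with ω hω
      exact tendsto_finsetProd _ fun i _ => hω i
  have hwlim : ∀ᵐ ω ∂P, Tendsto (fun j => wick P (slotField (boxField X a j) z) ω) atTop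
      (𝓝 (wick P (slotField (ampField X a) z) ω)) := by
    filter_upwards [ae_all_iff.2 hlim] with ω hω
    exact tendsto_finsetSum _ fun Q _ => (tendsto_finsetProd _ fun i _ => hω i).mul
      (tendsto_finsetProd _ fun e _ => (hcov e).neg)
  set τ := ∫ ω, T ω ^ 2 ∂P with hτ
  have hτ0 : 0 ≤ τ := integral_nonneg fun ω => sq_nonneg _
  -- The base 1 + τ + T is at least 1, dominates every factor, and its square dominates every
  -- covariance; so D dominates the Wick monomials of all truncations at once.
  set D : Ω → ℝ := fun ω => (partialPairings (Fin p ⊕ Fin p)).card *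
    (1 + τ + T ω) ^ wickDegree (Fin p ⊕ Fin p) with hD
  have hDm : HasMoments P D := (HasMoments.const _).mul
    (((HasMoments.const (1 + τ)).add hTm).pow _)
  have hT0 : ∀ᵐ ω ∂P, 0 ≤ T ω := .of_forall fun ω =>
    tsum_nonneg fun k => mul_nonneg (ha k) (norm_nonneg _)
  have hle : ∀ ξ : Fin p ⊕ Fin p → Ω → ℂ, (∀ i, ∀ᵐ ω ∂P, ‖ξ i ω‖ ≤ T ω) →
      ∀ᵐ ω ∂P, ‖wick P ξ ω‖ ≤ D ω := by
    intro ξ hξ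
    have hc : ∀ i j, ‖∫ ω, ξ i ω * ξ j ω ∂P‖ ≤ τ := fun i j => by
      refine norm_integral_le_of_norm_le (hTm.pow 2).integrable ?_
      filter_upwards [hξ i, hξ j, hT0] with ω h1 h2 h3
      rw [norm_mul, sq]
      gcongr
    filter_upwards [ae_all_iff.2 hξ, hT0] with ω hω h0
    exact norm_wick_le ξ (by linarith) (fun i => (hω i).trans (by linarith)) fun i j =>
      (hc i j).trans (by nlinarith)
  have hwm : HasMoments P (wick P (slotField (ampField X a) z)) := hasMoments_wick hmamp
  refine ⟨hF.integrable_mul hwm.memLp_two, ?_⟩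
  refine tendsto_integral_of_dominated_convergence (fun ω => ‖F ω‖ * D ω) (fun j => ?_)
    (hF.norm.integrable_mul hDm.memLp_two) (fun j => ?_) ?_
  · exact hF.aestronglyMeasurable.mul (hasMoments_wick (hmbox j)).aestronglyMeasurable
  · filter_upwards [hle _ (hbox j)] with ω hω
    rw [norm_mul]
    gcongr
  · filter_upwards [hwlim] with ω hω
    exact hω.const_mul _

/-- The truncated field has variance O(j), so its Wick monomials grow only polynomially in j,
uniformly in the points and in bounded multipliers. This is slow enough for the geometric
convergence of the Boltzmann factors. -/
theorem GaussianFamily.exists_eLpNorm_wick_boxField_le {κ : ℝ} (hκ : 0 < κ)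
    (hX : GaussianFamily P X) (p : ℕ) : ∃ K : ℝ, 0 ≤ K ∧ ∀ (S : ℝ) (s : (Fin 2 → ℤ) → ℝ),
      (∀ k, |s k| ≤ S) → ∀ (j : ℕ) (z : (Fin p → Torus) × (Fin p → Torus)),
        eLpNorm (wick P (slotField (boxField X (amp κ s) j) z)) 2 P ≤
          ENNReal.ofReal (K * (1 + S ^ 2 * ((9 / κ + 25) * (j + 1))) ^
            (wickDegree (Fin p ⊕ Fin p) + 1)) := by
  obtain ⟨K, hK, h⟩ := hX.exists_eLpNorm_wick_le (Fin p ⊕ Fin p)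
  refine ⟨K, hK, fun S s hs j z => ?_⟩
  rw [slotField_boxField]
  refine h (box j) _ _ (by positivity) fun i => (isChaos_linPoly _ _ _).mono ?_
  refine le_trans ?_ (mul_le_mul_of_nonneg_left (sum_box_inv_eigenvalue_le hκ j) (sq_nonneg S))
  rw [Finset.mul_sum]
  refine Finset.sum_le_sum fun k _ => ?_
  rw [norm_slotCoeff, sq_abs, amp_sq hκ]
  have := inv_nonneg.2 (eigenvalue_pos hκ k).le
  gcongr ?_ * _
  exact sq_le_sq.2 ((hs k).trans (le_abs_self S))

end Slots

end Phi42

end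

/-! ### Convergence and continuity of the unnormalized correlation functions -/

noncomputable section

namespace Phi42

theorem measurable_cutoffInteraction {Ω ι : Type*} [AddCommGroup ι] [DecidableEq ι]
    [MeasurableSpace Ω] {X : ι → Ω → ℂ} {B : Finset ι} (hX : ∀ k ∈ B, Measurable (X k))
    (w a : ι → ℝ) (τ E : ℝ) : Measurable (cutoffInteraction X B w a τ E) := by
  have hd : ∀ q, Measurable (density X B a q) := fun q => by
    refine Finset.measurable_sum _ fun k hk => Finset.measurable_sum _ fun l hl => ?_
    by_cases h : l - k = q
    · simp only [if_pos h]
      exact (((Complex.continuous_conj.measurable.comp (hX k hk)).mul (hX l hl)).sub_const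
        _).const_mul _
    · simp only [if_neg h]
      exact measurable_const
  exact (((Finset.measurable_sum _ fun q _ => ((hd q).norm.pow_const 2).const_mul _).const_mul
    _).sub ((Finset.measurable_sum _ fun k hk => (((hX k hk).norm.pow_const 2).sub_const
      _).const_mul _).const_mul _)).sub_const _

theorem summable_geometric_mul_pow {θ : ℝ} (h0 : 0 ≤ θ) (h1 : θ < 1) (L K A : ℝ) (hA : 0 ≤ A)
    (hL : 0 ≤ L) (hK : 0 ≤ K) (q : ℕ) :
    Summable fun j : ℕ => L * θ ^ j * (K * (1 + A * (j + 1 + 1)) ^ q) := by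
  have hs : ∀ n : ℕ, Summable fun j : ℕ => (j : ℝ) ^ n * θ ^ j := fun n =>
    summable_pow_mul_geometric_of_norm_lt_one n (by rwa [Real.norm_of_nonneg h0])
  refine Summable.of_nonneg_of_le (fun j => by positivity) (fun j => ?_)
    ((((hs q).add (hs 0)).mul_left (L * (K * (2 * (1 + 2 * A)) ^ q))))
  have h3 : (1 + A * ((j : ℝ) + 1 + 1)) ^ q ≤ (2 * (1 + 2 * A)) ^ q * ((j : ℝ) ^ q + 1) := by
    rcases Nat.eq_zero_or_pos j with rfl | hj
    · calc (1 + A * (((0 : ℕ) : ℝ) + 1 + 1)) ^ q ≤ (2 * (1 + 2 * A)) ^ q := by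
            gcongr
            push_cast
            linarith
        _ ≤ _ := le_mul_of_one_le_right (by positivity) (by simp)
    · have hj' : (1 : ℝ) ≤ j := by exact_mod_cast hj
      calc (1 + A * ((j : ℝ) + 1 + 1)) ^ q ≤ (2 * (1 + 2 * A) * j) ^ q := by
            gcongr
            nlinarith
        _ = (2 * (1 + 2 * A)) ^ q * (j : ℝ) ^ q := mul_pow _ _ _
        _ ≤ _ := by gcongr; linarith
  calc L * θ ^ j * (K * (1 + A * (j + 1 + 1)) ^ q)
      ≤ L * θ ^ j * (K * ((2 * (1 + 2 * A)) ^ q * ((j : ℝ) ^ q + 1))) := by gcongr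
    _ = _ := by ring

/-- The three-epsilon exchange of limits; it suffices that the error R j holds eventually along F
for each j. -/
theorem tendstoUniformly_of_approx {Z β E : Type*} [PseudoMetricSpace E] {F : Filter β}
    {f : β → Z → E} {f₀ : Z → E} {g : ℕ → β → Z → E} {g₀ : ℕ → Z → E} {R : ℕ → ℝ}
    (hR : Tendsto R atTop (𝓝 0)) (h1 : ∀ j, ∀ᶠ b in F, ∀ z, dist (f b z) (g j b z) ≤ R j)
    (h2 : ∀ j z, dist (f₀ z) (g₀ j z) ≤ R j) (h3 : ∀ j, TendstoUniformly (g j) (g₀ j) F) :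
    TendstoUniformly f f₀ F := by
  rw [Metric.tendstoUniformly_iff]
  intro δ hδ
  obtain ⟨j, hj⟩ := (hR.eventually_lt_const (show 0 < δ / 3 by positivity)).exists
  filter_upwards [h1 j, Metric.tendstoUniformly_iff.1 (h3 j) (δ / 3) (by positivity)] with b hb hb' z
  have := dist_triangle4 (f₀ z) (g₀ j z) (g j b z) (f b z)
  have := hb z
  have := h2 j z
  have := hb' z
  rw [dist_comm (f b z)] at *
  linarith

/-- Currying gives a continuous map into the space of continuous functions on Z, whose compact-open
topology is that of uniform convergence because Z is compact. -/
theorem tendstoUniformly_of_continuous_prod {A Z E β : Type*} [TopologicalSpace A]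
    [TopologicalSpace Z] [CompactSpace Z] [PseudoMetricSpace E] {g : A × Z → E} (hg : Continuous g)
    {F : Filter β} {s : β → A} {s₀ : A} (hs : Tendsto s F (𝓝 s₀)) :
    TendstoUniformly (fun b z => g (s b, z)) (fun z => g (s₀, z)) F := by
  have h := ((ContinuousMap.curry ⟨g, hg⟩).continuous.tendsto s₀).comp hs
  rw [ContinuousMap.tendsto_iff_tendstoUniformly] at h
  exact h

section Correlations

variable {κ C : ℝ} {Ω : Type*} [MeasurableSpace Ω] {P : Measure Ω} [IsProbabilityMeasure P]
  {X : (Fin 2 → ℤ) → Ω → ℂ} {p : ℕ}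

theorem norm_integral_mul_sub_integral_mul_le {f f' : Ω → ℝ} {g : Ω → ℂ}
    (hf : MemLp (fun ω => (f ω : ℂ)) 2 P) (hf' : MemLp (fun ω => (f' ω : ℂ)) 2 P) (hg : MemLp g 2 P)
    {a b : ℝ} (ha : 0 ≤ a) (hb : 0 ≤ b)
    (h1 : eLpNorm (fun ω => f ω - f' ω) 2 P ≤ ENNReal.ofReal a)
    (h2 : eLpNorm g 2 P ≤ ENNReal.ofReal b) :
    ‖∫ ω, (f ω : ℂ) * g ω ∂P - ∫ ω, (f' ω : ℂ) * g ω ∂P‖ ≤ a * b := by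
  have i1 : Integrable (fun ω => (f ω : ℂ) * g ω) P := hf.integrable_mul hg
  have i2 : Integrable (fun ω => (f' ω : ℂ) * g ω) P := hf'.integrable_mul hg
  rw [← integral_sub i1 i2]
  simp_rw [← sub_mul]
  refine norm_integral_mul_le (hf.aestronglyMeasurable.sub hf'.aestronglyMeasurable)
    hg.aestronglyMeasurable ha hb (le_trans (le_of_eq ?_) h1) h2
  refine eLpNorm_congr_norm_ae (.of_forall fun ω => ?_)
  rw [← Complex.norm_real, Complex.ofReal_sub]
  rfl

/-- The unnormalized correlation functions with truncated field and interaction. -/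
def truncCorrelation (κ : ℝ) (P : Measure Ω) (X : (Fin 2 → ℤ) → Ω → ℂ) (w : (Fin 2 → ℤ) → ℝ)
    (j : ℕ) (s : (Fin 2 → ℤ) → ℝ) (z : (Fin p → Torus) × (Fin p → Torus)) : ℂ :=
  ∫ ω, (Real.exp (-ballInteraction κ X w j ω) : ℂ) *
    wick P (slotField (boxField X (amp κ s) j) z) ω ∂P

/-- The unnormalized correlation functions. -/
def limitCorrelation (κ : ℝ) (P : Measure Ω) (X : (Fin 2 → ℤ) → Ω → ℂ) (w : (Fin 2 → ℤ) → ℝ)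
    (s : (Fin 2 → ℤ) → ℝ) (z : (Fin p → Torus) × (Fin p → Torus)) : ℂ :=
  limUnder atTop fun j => truncCorrelation κ P X w j s z

theorem memLp_ofReal_exp {U : Ω → ℝ} {L : ℝ} (hU : AEStronglyMeasurable U P)
    (h : eLpNorm (fun ω => Real.exp (-U ω)) 4 P ≤ ENNReal.ofReal L) :
    MemLp (fun ω => (Real.exp (-U ω) : ℂ)) 2 P := by
  have : MemLp (fun ω => (Real.exp (-U ω) : ℂ)) 4 P :=
    ⟨Complex.continuous_ofReal.comp_aestronglyMeasurable
      (Real.continuous_exp.comp_aestronglyMeasurable hU.neg),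
      (le_trans (eLpNorm_congr_norm_ae (.of_forall fun ω => Complex.norm_real _)).le h).trans_lt
        ENNReal.ofReal_lt_top⟩
  exact this.mono_exponent (by norm_num)

theorem memLp_exp_ballInteraction (hκ : 0 < κ) (hX : GaussianFamily P X) {w : (Fin 2 → ℤ) → ℝ}
    (hw : IsWeight κ C w) (j : ℕ) :
    MemLp (fun ω => (Real.exp (-ballInteraction κ X w j ω) : ℂ)) 2 P := by
  obtain ⟨L, θ, hL, hθ0, hθ1, h⟩ := exists_boltzmann_bounds hκ hX C
  exact memLp_ofReal_exp (hX.hasMoments_ballInteraction w j).aestronglyMeasurable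
    ((h w hw).2.2.2.1 j)

theorem memLp_exp_interaction (hκ : 0 < κ) (hX : GaussianFamily P X) {w : (Fin 2 → ℤ) → ℝ}
    (hw : IsWeight κ C w) : MemLp (fun ω => (Real.exp (-interaction κ X w ω) : ℂ)) 2 P := by
  obtain ⟨L, θ, hL, hθ0, hθ1, h⟩ := exists_boltzmann_bounds hκ hX C
  exact memLp_ofReal_exp (h w hw).1 (h w hw).2.2.2.2.1

theorem continuous_truncCorrelation (hκ : 0 < κ) (hX : GaussianFamily P X)
    {w : (Fin 2 → ℤ) → ℝ} (hw : IsWeight κ C w) (j : ℕ) :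
    Continuous fun t : ((Fin 2 → ℤ) → ℝ) × ((Fin p → Torus) × (Fin p → Torus)) =>
      truncCorrelation κ P X w j t.1 t.2 := by
  simp only [truncCorrelation, slotField_boxField]
  have h := hX.continuous_integral_mul_wick (memLp_exp_ballInteraction hκ hX hw j) (box j)
    (slotSign (p := p)) (c := fun i k (t : ((Fin 2 → ℤ) → ℝ) × ((Fin p → Torus) × (Fin p → Torus))) =>
      slotCoeff (amp κ t.1) t.2 i k) fun i k => continuous_slotCoeff_amp κ i k
  exact h

/-- The Boltzmann factor at level j is a function of the modes in the j-th box, so the new modes of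
the field drop out of the expectation by orthogonality. -/
theorem integral_exp_ball_mul_wick_succ (hκ : 0 < κ) (hX : GaussianFamily P X)
    {w : (Fin 2 → ℤ) → ℝ} (hw : IsWeight κ C w) (j : ℕ) (s : (Fin 2 → ℤ) → ℝ)
    (z : (Fin p → Torus) × (Fin p → Torus)) :
    ∫ ω, (Real.exp (-ballInteraction κ X w j ω) : ℂ) *
      wick P (slotField (boxField X (amp κ s) (j + 1)) z) ω ∂P =
        truncCorrelation κ P X w j s z := by
  simp only [truncCorrelation, slotField_boxField]
  refine hX.integral_mul_wick_linPoly_mono (box_mono (Nat.le_succ j)) ?_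
    (memLp_exp_ballInteraction hκ hX hw j) _ _
  have h := @measurable_cutoffInteraction Ω _ _ _ (modeAlgebra X ↑(box j)) X (box j)
    (fun k hk => measurable_mode (Finset.mem_coe.2 hk)) w (amp κ 1) (ballMass κ w j)
    (ballEnergy κ w j)
  exact Complex.measurable_ofReal.comp (Real.measurable_exp.comp
    (measurable_neg.comp h))

/-- Uniform convergence of the truncated correlation functions. -/
theorem exists_dist_truncCorrelation_le (hκ : 0 < κ) (hX : GaussianFamily P X) (C S : ℝ) (p : ℕ) :
    ∃ R : ℕ → ℝ, Tendsto R atTop (𝓝 0) ∧ ∀ w, IsWeight κ C w → ∀ s : (Fin 2 → ℤ) → ℝ,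
      (∀ k, |s k| ≤ S) → ∀ z : (Fin p → Torus) × (Fin p → Torus),
      (∀ j, dist (limitCorrelation κ P X w s z) (truncCorrelation κ P X w j s z) ≤ R j) ∧
      Tendsto (fun j => ∫ ω, (Real.exp (-interaction κ X w ω) : ℂ) *
        wick P (slotField (boxField X (amp κ s) j) z) ω ∂P) atTop
        (𝓝 (limitCorrelation κ P X w s z)) := by
  obtain ⟨L, θ, hL, hθ0, hθ1, h⟩ := exists_boltzmann_bounds hκ hX C
  obtain ⟨K, hK, hwick⟩ := hX.exists_eLpNorm_wick_boxField_le hκ p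
  set q := wickDegree (Fin p ⊕ Fin p) + 1
  set A := S ^ 2 * (9 / κ + 25) with hA
  have hA0 : 0 ≤ A := by positivity
  set r : ℕ → ℝ := fun j => L * θ ^ j * (K * (1 + A * (j + 1 + 1)) ^ q) with hr
  have hsum : Summable r := summable_geometric_mul_pow hθ0 hθ1 L K A hA0 hL hK q
  have hwick' : ∀ s : (Fin 2 → ℤ) → ℝ, (∀ k, |s k| ≤ S) → ∀ (j : ℕ)
      (z : (Fin p → Torus) × (Fin p → Torus)),
      eLpNorm (wick P (slotField (boxField X (amp κ s) j) z)) 2 P ≤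
          ENNReal.ofReal (K * (1 + A * (j + 1)) ^ q) := fun s hs j z => by
    rw [hA, mul_assoc]; exact hwick S s hs j z
  have hwm : ∀ s j (z : (Fin p → Torus) × (Fin p → Torus)),
      HasMoments P (wick P (slotField (boxField X (amp κ s) j) z)) := fun s j z =>
    hasMoments_wick fun i => hX.hasMoments_slotField_boxField _ _ _ _
  refine ⟨fun j => ∑' i, r (i + j), tendsto_sum_nat_add r, fun w hw s hs z => ?_⟩
  have hball := memLp_exp_ballInteraction hκ hX hw
  have hint := memLp_exp_interaction hκ hX hw
  -- Both correlations are written with the field at level j + 1, so only the Boltzmann factors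
  -- differ and Cauchy–Schwarz gives geometric times polynomial.
  have hstep : ∀ j, dist (truncCorrelation κ P X w j s z) (truncCorrelation κ P X w (j + 1) s z) ≤
      r j := by
    intro j
    rw [dist_comm, ← integral_exp_ball_mul_wick_succ hκ hX hw j s z, truncCorrelation, dist_eq_norm]
    refine norm_integral_mul_sub_integral_mul_le (hball _) (hball _) (hwm _ _ _).memLp_two
      (by positivity) (by positivity) ((h w hw).2.2.2.2.2.2.1 j) ?_
    have := hwick' s hs (j + 1) z
    push_cast at this
    exact this
  have hlim : Tendsto (fun j => truncCorrelation κ P X w j s z) atTop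
      (𝓝 (limitCorrelation κ P X w s z)) :=
    (cauchySeq_of_dist_le_of_summable _ hstep hsum).tendsto_limUnder
  refine ⟨fun j => ?_, ?_⟩
  · have := dist_le_tsum_of_dist_le_of_tendsto _ hstep hsum hlim j
    rw [dist_comm]
    simpa only [add_comm j] using this
  · have hz : Tendsto (fun j => ∫ ω, (Real.exp (-interaction κ X w ω) : ℂ) *
        wick P (slotField (boxField X (amp κ s) j) z) ω ∂P - truncCorrelation κ P X w j s z) atTop
        (𝓝 0) := by
      refine squeeze_zero_norm (fun j => ?_) hsum.tendsto_atTop_zero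
      rw [truncCorrelation]
      refine norm_integral_mul_sub_integral_mul_le hint (hball _) (hwm _ _ _).memLp_two
        (by positivity) (by positivity) ((h w hw).2.2.2.2.2.2.2 j)
        ((hwick' s hs j z).trans (ENNReal.ofReal_le_ofReal ?_))
      gcongr
      linarith
    simpa using hz.add hlim

/-- Convergence of the truncated correlation functions in the weight. -/
theorem tendstoUniformly_truncCorrelation_weight (hκ : 0 < κ) (hX : GaussianFamily P X) {β : Type*}
    {F : Filter β} {w : β → (Fin 2 → ℤ) → ℝ} {w₀ : (Fin 2 → ℤ) → ℝ}
    (hw : ∀ᶠ b in F, IsWeight κ C (w b)) (hw₀ : IsWeight κ C w₀)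
    (hlim : ∀ k, Tendsto (fun b => w b k) F (𝓝 (w₀ k))) (j : ℕ) {s : (Fin 2 → ℤ) → ℝ} {S : ℝ}
    (hs : ∀ k, |s k| ≤ S) (p : ℕ) :
    TendstoUniformly (fun b (z : (Fin p → Torus) × (Fin p → Torus)) =>
      truncCorrelation κ P X (w b) j s z) (truncCorrelation κ P X w₀ j s) F := by
  obtain ⟨K, hK, hwick⟩ := hX.exists_eLpNorm_wick_boxField_le hκ p
  set D := K * (1 + S ^ 2 * ((9 / κ + 25) * (j + 1))) ^ (wickDegree (Fin p ⊕ Fin p) + 1) with hD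
  have hD0 : 0 ≤ D := by positivity
  have h := tendsto_ball_boltzmann_weight hκ hX hw hw₀ hlim j
  rw [Metric.tendstoUniformly_iff]
  intro δ hδ
  have hδ' : 0 < δ / (D + 1) := by positivity
  have hev := (ENNReal.tendsto_nhds_zero.1 h) (ENNReal.ofReal (δ / (D + 1)))
    (ENNReal.ofReal_pos.2 hδ')
  filter_upwards [hw, hev] with b hb hb' z
  have hwm : HasMoments P (wick P (slotField (boxField X (amp κ s) j) z)) :=
    hasMoments_wick fun i => hX.hasMoments_slotField_boxField _ _ _ _
  have m1 := memLp_exp_ballInteraction hκ hX hb j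
  have m2 := memLp_exp_ballInteraction hκ hX hw₀ j
  rw [dist_comm, dist_eq_norm, truncCorrelation, truncCorrelation]
  refine (norm_integral_mul_sub_integral_mul_le m1 m2 hwm.memLp_two hδ'.le hD0 hb'
    (hwick S s hs j z)).trans_lt ?_
  rw [div_mul_eq_mul_div, div_lt_iff₀ (by positivity)]
  nlinarith

/-- Continuity of the correlation functions in the multiplier. -/
theorem tendstoUniformly_limitCorrelation (hκ : 0 < κ) (hX : GaussianFamily P X)
    {w : (Fin 2 → ℤ) → ℝ} (hw : IsWeight κ C w) {β : Type*} {F : Filter β}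
    {s : β → (Fin 2 → ℤ) → ℝ} {s₀ : (Fin 2 → ℤ) → ℝ} {S : ℝ} (hs : ∀ b k, |s b k| ≤ S)
    (hs₀ : ∀ k, |s₀ k| ≤ S) (hlim : ∀ k, Tendsto (fun b => s b k) F (𝓝 (s₀ k))) (p : ℕ) :
    TendstoUniformly (fun b (z : (Fin p → Torus) × (Fin p → Torus)) =>
      limitCorrelation κ P X w (s b) z) (limitCorrelation κ P X w s₀) F := by
  obtain ⟨R, hR, h⟩ := exists_dist_truncCorrelation_le hκ hX C S p
  refine tendstoUniformly_of_approx hR (g := fun j b => truncCorrelation κ P X w j (s b))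
    (g₀ := fun j => truncCorrelation κ P X w j s₀)
    (fun j => .of_forall fun b z => (h w hw _ (hs b) z).1 j) (fun j z => (h w hw _ hs₀ z).1 j)
    fun j => ?_
  exact tendstoUniformly_of_continuous_prod (continuous_truncCorrelation hκ hX hw j)
    (tendsto_pi_nhds.2 hlim)

/-- Continuity of the correlation functions in the weight. -/
theorem tendstoUniformly_limitCorrelation_weight (hκ : 0 < κ) (hX : GaussianFamily P X) {β : Type*}
    {F : Filter β} {w : β → (Fin 2 → ℤ) → ℝ} {w₀ : (Fin 2 → ℤ) → ℝ}
    (hw : ∀ᶠ b in F, IsWeight κ C (w b)) (hw₀ : IsWeight κ C w₀)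
    (hlim : ∀ k, Tendsto (fun b => w b k) F (𝓝 (w₀ k))) {s : (Fin 2 → ℤ) → ℝ} {S : ℝ}
    (hs : ∀ k, |s k| ≤ S) (p : ℕ) :
    TendstoUniformly (fun b (z : (Fin p → Torus) × (Fin p → Torus)) =>
      limitCorrelation κ P X (w b) s z) (limitCorrelation κ P X w₀ s) F := by
  obtain ⟨R, hR, h⟩ := exists_dist_truncCorrelation_le hκ hX C S p
  refine tendstoUniformly_of_approx hR (g := fun j b => truncCorrelation κ P X (w b) j s)
    (g₀ := fun j => truncCorrelation κ P X w₀ j s)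
    (fun j => hw.mono fun b hb z => (h _ hb s hs z).1 j) (fun j z => (h w₀ hw₀ s hs z).1 j)
    fun j => tendstoUniformly_truncCorrelation_weight hκ hX hw hw₀ hlim j hs p

theorem continuous_limitCorrelation (hκ : 0 < κ) (hX : GaussianFamily P X)
    {w : (Fin 2 → ℤ) → ℝ} (hw : IsWeight κ C w) {s : (Fin 2 → ℤ) → ℝ} {S : ℝ}
    (hs : ∀ k, |s k| ≤ S) (p : ℕ) :
    Continuous fun z : (Fin p → Torus) × (Fin p → Torus) => limitCorrelation κ P X w s z := by
  obtain ⟨R, hR, h⟩ := exists_dist_truncCorrelation_le hκ hX C S p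
  have hc : ∀ j, Continuous fun z : (Fin p → Torus) × (Fin p → Torus) =>
      truncCorrelation κ P X w j s z := fun j =>
    Continuous.uncurry_left (f := fun s z => truncCorrelation κ P X w j s z) s
      (continuous_truncCorrelation hκ hX hw j)
  refine TendstoUniformly.continuous (F := fun j => truncCorrelation κ P X w j s) (p := atTop) ?_
    (Eventually.of_forall hc).frequently
  rw [Metric.tendstoUniformly_iff]
  intro δ hδ
  filter_upwards [hR.eventually_lt_const hδ] with j hj z
  exact ((h w hw s hs z).1 j).trans_lt hj

/-- The Boltzmann weights define honest regularized correlation functions. -/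
theorem integrable_and_integral_eq_limitCorrelation (hκ : 0 < κ) (hX : GaussianFamily P X)
    {w : (Fin 2 → ℤ) → ℝ} (hw : IsWeight κ C w) {s : (Fin 2 → ℤ) → ℝ} {S : ℝ}
    (hs : ∀ k, |s k| ≤ S) (ha : ∀ k, 0 ≤ amp κ s k) (has : Summable (amp κ s))
    (z : (Fin p → Torus) × (Fin p → Torus)) :
    Integrable (fun ω => (Real.exp (-interaction κ X w ω) : ℂ) *
      wick P (slotField (ampField X (amp κ s)) z) ω) P ∧
    ∫ ω, (Real.exp (-interaction κ X w ω) : ℂ) *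
      wick P (slotField (ampField X (amp κ s)) z) ω ∂P = limitCorrelation κ P X w s z := by
  obtain ⟨R, hR, h⟩ := exists_dist_truncCorrelation_le hκ hX C S p
  -- For summable amplitudes the same truncated expectations converge also by domination, so the two
  -- limits agree.
  have h2 := hX.tendsto_integral_mul_wick_boxField ha has (memLp_exp_interaction hκ hX hw) z
  exact ⟨h2.1, tendsto_nhds_unique h2.2 (h w hw s hs z).2⟩

end Correlations

end Phi42

end

/-! ### Normalized correlation functions -/

noncomputable section

namespace Phi42

theorem tendstoUniformly_of_eventuallyEq {Z β E : Type*} [UniformSpace E] {F : Filter β}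
    {f g : β → Z → E} {f₀ : Z → E} (hf : TendstoUniformly f f₀ F)
    (h : ∀ᶠ b in F, ∀ z, f b z = g b z) : TendstoUniformly g f₀ F := by
  intro u hu
  filter_upwards [hf u hu, h] with b hb he z
  exact he z ▸ hb z

section Limit

variable {κ C : ℝ} {Ω : Type*} [MeasurableSpace Ω] {P : Measure Ω} [IsProbabilityMeasure P]
  {X : (Fin 2 → ℤ) → Ω → ℂ} {p : ℕ}

open Classical in
/-- The unnormalized correlation function as a continuous function. -/
def limitCorrelationMap (κ : ℝ) (P : Measure Ω) (X : (Fin 2 → ℤ) → Ω → ℂ) (p : ℕ)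
    (w : (Fin 2 → ℤ) → ℝ) : C((Fin p → Torus) × (Fin p → Torus), ℂ) :=
  -- The multiplier 1 corresponds to no cutoff at all. The default value 0 is never taken under the
  -- standing hypotheses on κ, X and w.
  if h : Continuous fun z : (Fin p → Torus) × (Fin p → Torus) => limitCorrelation κ P X w 1 z
    then ⟨_, h⟩ else 0

theorem limitCorrelationMap_apply (hκ : 0 < κ) (hX : GaussianFamily P X) {w : (Fin 2 → ℤ) → ℝ}
    (hw : IsWeight κ C w) (z : (Fin p → Torus) × (Fin p → Torus)) :
    limitCorrelationMap κ P X p w z = limitCorrelation κ P X w 1 z := by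
  have h := continuous_limitCorrelation hκ hX hw (s := 1) (S := 1) (fun k => by simp) p
  rw [limitCorrelationMap, dif_pos h]
  rfl

/-- The correlation function of the interaction with weight `w`. -/
def correlation (κ : ℝ) (P : Measure Ω) (X : (Fin 2 → ℤ) → Ω → ℂ) (p : ℕ)
    (w : (Fin 2 → ℤ) → ℝ) : C((Fin p → Torus) × (Fin p → Torus), ℂ) :=
  ((partitionFunction P (interaction κ X w))⁻¹ : ℂ) • limitCorrelationMap κ P X p w

theorem integrable_exp_interaction (hκ : 0 < κ) (hX : GaussianFamily P X) {w : (Fin 2 → ℤ) → ℝ}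
    (hw : IsWeight κ C w) : Integrable (fun ω => Real.exp (-interaction κ X w ω)) P := by
  have h := (memLp_exp_interaction hκ hX hw).integrable (by norm_num)
  exact h.re

theorem partitionFunction_pos (hκ : 0 < κ) (hX : GaussianFamily P X) {w : (Fin 2 → ℤ) → ℝ}
    (hw : IsWeight κ C w) : 0 < partitionFunction P (interaction κ X w) :=
  integral_exp_pos (integrable_exp_interaction hκ hX hw)

theorem tendsto_partitionFunction_weight (hκ : 0 < κ) (hX : GaussianFamily P X) {β : Type*}
    {F : Filter β} {w : β → (Fin 2 → ℤ) → ℝ} {w₀ : (Fin 2 → ℤ) → ℝ}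
    (hw : ∀ᶠ b in F, IsWeight κ C (w b)) (hw₀ : IsWeight κ C w₀)
    (hlim : ∀ k, Tendsto (fun b => w b k) F (𝓝 (w₀ k))) :
    Tendsto (fun b => partitionFunction P (interaction κ X (w b))) F
      (𝓝 (partitionFunction P (interaction κ X w₀))) := by
  refine tendsto_integral_of_L1' _ (integrable_exp_interaction hκ hX hw₀).aestronglyMeasurable
    (hw.mono fun b hb => integrable_exp_interaction hκ hX hb) ?_
  refine tendsto_of_tendsto_of_tendsto_of_le_of_le' tendsto_const_nhds
    (tendsto_boltzmann_weight hκ hX hw hw₀ hlim) (.of_forall fun _ => zero_le) ?_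
  filter_upwards [hw] with b hb
  exact eLpNorm_le_eLpNorm_of_exponent_le (by norm_num)
    ((integrable_exp_interaction hκ hX hb).sub
      (integrable_exp_interaction hκ hX hw₀)).aestronglyMeasurable

theorem tendsto_correlation_weight (hκ : 0 < κ) (hX : GaussianFamily P X) {β : Type*}
    {F : Filter β} {w : β → (Fin 2 → ℤ) → ℝ} {w₀ : (Fin 2 → ℤ) → ℝ}
    (hw : ∀ᶠ b in F, IsWeight κ C (w b)) (hw₀ : IsWeight κ C w₀)
    (hlim : ∀ k, Tendsto (fun b => w b k) F (𝓝 (w₀ k))) (p : ℕ) :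
    Tendsto (fun b => correlation κ P X p (w b)) F (𝓝 (correlation κ P X p w₀)) := by
  have h1 : Tendsto (fun b => limitCorrelationMap κ P X p (w b)) F
      (𝓝 (limitCorrelationMap κ P X p w₀)) := by
    rw [ContinuousMap.tendsto_iff_tendstoUniformly]
    have h2 := tendstoUniformly_limitCorrelation_weight hκ hX hw hw₀ hlim (s := 1) (S := 1)
      (fun k => by simp) p
    rw [show limitCorrelation κ P X w₀ 1 = ⇑(limitCorrelationMap κ P X p w₀) from
      funext fun z => (limitCorrelationMap_apply hκ hX hw₀ z).symm] at h2
    refine tendstoUniformly_of_eventuallyEq h2 ?_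
    filter_upwards [hw] with b hb z
    exact (limitCorrelationMap_apply hκ hX hb z).symm
  refine Tendsto.smul ?_ h1
  refine Tendsto.inv₀ ((Complex.continuous_ofReal.tendsto _).comp
    (tendsto_partitionFunction_weight hκ hX hw hw₀ hlim)) ?_
  exact Complex.ofReal_ne_zero.2 (partitionFunction_pos hκ hX hw₀).ne'

theorem wickMonomial_eq (κ : ℝ) (P : Measure Ω) (X : (Fin 2 → ℤ) → Ω → ℂ)
    (ϑ : EuclideanSpace ℝ (Fin 2) → ℝ) (N : ℝ) (z : (Fin p → Torus) × (Fin p → Torus)) :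
    wickMonomial κ P X ϑ N z.1 z.2 =
      wick P (slotField (ampField X (amp κ (multiplier ϑ N))) z) := by
  have h : field κ X ϑ N = ampField X (amp κ (multiplier ϑ N)) :=
    funext fun x => funext fun ω => field_eq κ X ϑ N x ω
  funext ω
  rw [wickMonomial, h]
  rfl

theorem isCorrelation_correlation (hκ : 0 < κ) (hX : GaussianFamily P X) {w : (Fin 2 → ℤ) → ℝ}
    (hw : IsWeight κ C w) : IsCorrelation κ P X (interaction κ X w) (correlation κ P X p w) := by
  intro ϑ hϑ
  obtain ⟨S, hS⟩ := hϑ.exists_multiplier_le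
  have key := fun (N : ℝ) (hN : 0 < N) (z : (Fin p → Torus) × (Fin p → Torus)) =>
    integrable_and_integral_eq_limitCorrelation hκ hX hw (hS N)
      (fun k => amp_multiplier_nonneg k N) (hϑ.summable_amp hκ hN) z
  refine ⟨fun N hN x y => ?_, ?_⟩
  · rw [show wickMonomial κ P X ϑ N x y = _ from wickMonomial_eq κ P X ϑ N (x, y)]
    exact (key N hN (x, y)).1
  -- The bound max S 1 covers both the multipliers of the cutoff and their limit 1. As this limit is
  -- the same for every cutoff, so is the correlation function.
  · have h1 := tendstoUniformly_limitCorrelation hκ hX hw (S := max S 1)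
      (fun N k => (hS N k).trans (le_max_left _ _)) (s₀ := 1) (fun k => by simp)
      hϑ.tendsto_multiplier p
    have h2 := (uniformContinuous_const_smul
      ((partitionFunction P (interaction κ X w))⁻¹ : ℂ)).comp_tendstoUniformly h1
    have h3 : ⇑(correlation κ P X p w) =
        (fun c => ((partitionFunction P (interaction κ X w))⁻¹ : ℂ) • c) ∘
          limitCorrelation κ P X w 1 := by
      funext z
      rw [correlation, ContinuousMap.smul_apply, limitCorrelationMap_apply hκ hX hw]
      rfl
    rw [h3]
    refine tendstoUniformly_of_eventuallyEq h2 ?_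
    filter_upwards [eventually_gt_atTop 0] with N hN z
    rw [regCorrelation, wickMonomial_eq, (key N hN z).2]
    rfl

end Limit

/-! ### Invariance under almost sure modification of the Gaussian variables -/

section Modification

variable {κ : ℝ} {Ω : Type*} [MeasurableSpace Ω] {P : Measure Ω}
  {X X' : (Fin 2 → ℤ) → Ω → ℂ}

theorem field_congr {ω : Ω} (h : ∀ k, X k ω = X' k ω) (κ : ℝ)
    (ϑ : EuclideanSpace ℝ (Fin 2) → ℝ) (N : ℝ) (x : Torus) :
    field κ X ϑ N x ω = field κ X' ϑ N x ω := by
  simp only [field, h]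

theorem fieldVariance_congr (h : ∀ᵐ ω ∂P, ∀ k, X k ω = X' k ω) (κ : ℝ)
    (ϑ : EuclideanSpace ℝ (Fin 2) → ℝ) (N : ℝ) (x : Torus) :
    fieldVariance κ P X ϑ N x = fieldVariance κ P X' ϑ N x :=
  integral_congr_ae (h.mono fun ω hω => by simp only [field_congr hω])

theorem localInteraction_congr (h : ∀ᵐ ω ∂P, ∀ k, X k ω = X' k ω)
    (ϑ : EuclideanSpace ℝ (Fin 2) → ℝ) (N : ℝ) :
    localInteraction κ P X ϑ N =ᵐ[P] localInteraction κ P X' ϑ N :=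
  h.mono fun ω hω => by
    simp only [localInteraction, wickFourth, field_congr hω, fieldVariance_congr h]

theorem nonlocalInteraction_congr (h : ∀ᵐ ω ∂P, ∀ k, X k ω = X' k ω)
    (v : EuclideanSpace ℝ (Fin 2) → ℝ) (ε : ℝ) (ϑ : EuclideanSpace ℝ (Fin 2) → ℝ) (N : ℝ) :
    nonlocalInteraction κ v P X ε ϑ N =ᵐ[P] nonlocalInteraction κ v P X' ε ϑ N :=
  h.mono fun ω hω => by
    simp only [nonlocalInteraction, wickSquare, field_congr hω, fieldVariance_congr h]

theorem IsInteractionLimit.congr {U_N U_N' : (EuclideanSpace ℝ (Fin 2) → ℝ) → ℝ → Ω → ℝ}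
    {U : Ω → ℝ} (hU : IsInteractionLimit P U_N' U) (h : ∀ ϑ N, U_N ϑ N =ᵐ[P] U_N' ϑ N) :
    IsInteractionLimit P U_N U :=
  ⟨hU.1, fun ϑ hϑ => (hU.2 ϑ hϑ).congr fun N =>
    eLpNorm_congr_ae ((h ϑ N).sub (EventuallyEq.refl _ _)).symm⟩

theorem wick_congr {ι : Type*} [Fintype ι] [DecidableEq ι] {ξ ξ' : ι → Ω → ℂ}
    (h : ∀ᵐ ω ∂P, ∀ i, ξ i ω = ξ' i ω) : wick P ξ =ᵐ[P] wick P ξ' := by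
  have h2 : ∀ e : Finset ι, ∫ ω, ∏ i ∈ e, ξ i ω ∂P = ∫ ω, ∏ i ∈ e, ξ' i ω ∂P := fun e =>
    integral_congr_ae (h.mono fun ω hω => by simp only [hω])
  exact h.mono fun ω hω => by simp only [wick, hω, h2]

theorem IsCorrelation.congr {U : Ω → ℝ} {p : ℕ}
    {γ : C((Fin p → Torus) × (Fin p → Torus), ℂ)} (hγ : IsCorrelation κ P X' U γ)
    (h : ∀ᵐ ω ∂P, ∀ k, X k ω = X' k ω) : IsCorrelation κ P X U γ := by
  have hw : ∀ ϑ N (x y : Fin p → Torus),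
      wickMonomial κ P X ϑ N x y =ᵐ[P] wickMonomial κ P X' ϑ N x y := fun ϑ N x y =>
    wick_congr (h.mono fun ω hω i => by
      rcases i with i | i <;> simp only [Sum.elim_inl, Sum.elim_inr, field_congr hω])
  intro ϑ hϑ
  refine ⟨fun N hN x y => ((hγ ϑ hϑ).1 N hN x y).congr ?_,
    tendstoUniformly_of_eventuallyEq (hγ ϑ hϑ).2 ?_⟩
  · exact (hw ϑ N x y).mono fun ω hω => by simp only [hω]
  · refine .of_forall fun N z => ?_
    rw [regCorrelation, regCorrelation]
    congr 1
    exact integral_congr_ae ((hw ϑ N z.1 z.2).mono fun ω hω => by simp only [hω])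

/-- Jointly measurable modifications of independent Gaussian variables. -/
theorem exists_gaussianFamily (hX : ∀ k, HasLaw (X k) stdComplexGaussian P)
    (hXi : iIndepFun X P) : ∃ X' : (Fin 2 → ℤ) → Ω → ℂ, GaussianFamily P X' ∧
      ∀ᵐ ω ∂P, ∀ k, X k ω = X' k ω := by
  refine ⟨fun k => (hX k).aemeasurable.mk, ⟨fun k => (hX k).aemeasurable.measurable_mk,
    fun k => (hX k).congr (hX k).aemeasurable.ae_eq_mk.symm,
    hXi.congr fun k => (hX k).aemeasurable.ae_eq_mk⟩,
    ae_all_iff.2 fun k => (hX k).aemeasurable.ae_eq_mk⟩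

end Modification

end Phi42

end

/-! ### The limit theorem -/

theorem proposition3p2
    {Ω : Type*} [MeasurableSpace Ω] (P : Measure Ω) [IsProbabilityMeasure P]
    (κ : ℝ) (hκ : 0 < κ)
    (v : EuclideanSpace ℝ (Fin 2) → ℝ) (hv : Phi42.IsPotential v)
    (X : (Fin 2 → ℤ) → Ω → ℂ) (hX : ∀ k, HasLaw (X k) Phi42.stdComplexGaussian P)
    (hXindep : iIndepFun X P) :
    ∃ (V : Ω → ℝ) (W : ℝ → Ω → ℝ),
      Phi42.IsInteractionLimit P (Phi42.localInteraction κ P X) V ∧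
      (∀ ε > 0, Phi42.IsInteractionLimit P (Phi42.nonlocalInteraction κ v P X ε) (W ε)) ∧
      Integrable (fun ω => Real.exp (-V ω)) P ∧
      (∀ ε > 0, Integrable (fun ω => Real.exp (-W ε ω)) P) ∧
      Tendsto (fun ε => Phi42.partitionFunction P (W ε)) (𝓝[>] 0)
        (𝓝 (Phi42.partitionFunction P V)) ∧
      ∀ p : ℕ, 1 ≤ p →
        ∃ (γV : C((Fin p → Phi42.Torus) × (Fin p → Phi42.Torus), ℂ))
          (γW : ℝ → C((Fin p → Phi42.Torus) × (Fin p → Phi42.Torus), ℂ)),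
          Phi42.IsCorrelation κ P X V γV ∧
          (∀ ε > 0, Phi42.IsCorrelation κ P X (W ε) (γW ε)) ∧
          Tendsto (fun ε => ‖γW ε - γV‖) (𝓝[>] 0) (𝓝 0) := by
  -- The given variables are only almost everywhere measurable, whereas the argument uses the
  -- σ-algebras they generate; a measurable modification is used throughout and the conclusions are
  -- carried back.
  obtain ⟨X', hX', hXX'⟩ := Phi42.exists_gaussianFamily hX hXindep
  obtain ⟨C, hC⟩ := hv.isWeight hκ
  -- The constant for the potentials is at least 1, so it also serves the constant weight of the
  -- local interaction, and the uniform estimates apply to the limit as well.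
  have h1 : Phi42.IsWeight κ C 1 := Phi42.isWeight_one hκ (hC 1 one_pos).one_le
  have hev : ∀ᶠ ε in 𝓝[>] (0 : ℝ), Phi42.IsWeight κ C (Phi42.potentialWeight v ε) :=
    eventually_mem_nhdsWithin.mono fun ε hε => hC ε hε
  have hlim : ∀ k, Tendsto (fun ε => Phi42.potentialWeight v ε k) (𝓝[>] 0)
      (𝓝 ((1 : (Fin 2 → ℤ) → ℝ) k)) := fun k =>
    (hv.tendsto_potentialWeight k).mono_left nhdsWithin_le_nhds
  refine ⟨Phi42.interaction κ X' 1, fun ε => Phi42.interaction κ X' (Phi42.potentialWeight v ε),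
    (hX'.isInteractionLimit_local hκ).congr (Phi42.localInteraction_congr hXX'),
    fun ε hε => (hX'.isInteractionLimit_nonlocal hκ hv hε).congr
      (Phi42.nonlocalInteraction_congr hXX' v ε),
    Phi42.integrable_exp_interaction hκ hX' h1,
    fun ε hε => Phi42.integrable_exp_interaction hκ hX' (hC ε hε),
    Phi42.tendsto_partitionFunction_weight hκ hX' hev h1 hlim, fun p _ => ?_⟩
  refine ⟨Phi42.correlation κ P X' p 1,
    fun ε => Phi42.correlation κ P X' p (Phi42.potentialWeight v ε),
    (Phi42.isCorrelation_correlation hκ hX' h1).congr hXX',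
    fun ε hε => (Phi42.isCorrelation_correlation hκ hX' (hC ε hε)).congr hXX', ?_⟩
  exact tendsto_iff_norm_sub_tendsto_zero.1 (Phi42.tendsto_correlation_weight hκ hX' hev h1 hlim p)
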